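/- **Setup.** Fix $H\ge 1$. Let $\mathbb{GT}_N$ be the set of $N$-tuples of integers $\lambda_1\ge\dots\ge\lambda_N$ and let $s_\lambda(x_1,\dots,x_N)$ be the Schur (Laurent) polynomial of $\lambda\in\mathbb{GT}_N$. For a probability measure $\tau$ on $\prod_{h=1}^H\mathbb{GT}_{N_h}$ its $H$-dimensional Schur generating function, in the variables $x_i^h$, $1\le h\le H$, $1\le i\le N_h$, is $$S_\tau=\sum_{\lambda^1,\dots,\lambda^H}\tau(\lambda^1,\dots,\lambda^H)\prod_{h=1}^H\frac{s_{\lambda^h}(x^h_1,\dots,x^h_{N_h})}{s_{\lambda^h}(1^{N_h})}.$$ The measure $\tau$ is *smooth* if $\sum\tau(\lambda^1,\dots,\lambda^H)\,r^{\sum_{h}\sum_{i}|\lambda^h_i|}<\infty$ for some $r>1$; then $S_\tau$ is analytic in a neighborhood of the point $\mathbf 1$ with all coordinates $1$, and $S_\tau(\mathbf 1)=1$. Let $N_h=N_h(L)$ satisfy $\lim_{L\to\infty}N_h/L=\mathcal N_h>0$ for $h=1,\dots,H$, and for each $L$ let $\rho_L$ be a smooth probability measure on $\prod_{h=1}^H\mathbb{GT}_{N_h}$.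 For a $\rho_L$-random $(\lambda^1,\dots,\lambda^H)$ and $k\ge1$ put $$p^L_{k,h}=\sum_{i=1}^{N_h}\Bigl(\frac{\lambda^h_i+N_h-i}{N_h}\Bigr)^k .$$ The measures $\rho_L$ *satisfy a CLT* if there are numbers $\mathfrak p(k,h)$, $\mathfrak{cov}(k,h;m,f)$ ($k,m\ge1$; $1\le h,f\le H$) such that, as $L\to\infty$, for all such indices - (A) $\frac1{N_h}\mathbb E[p^L_{k,h}]\to\mathfrak p(k,h)$; - (B) $\mathbb E[p^L_{k,h}p^L_{m,f}]-\mathbb E[p^L_{k,h}]\,\mathbb E[p^L_{m,f}]\to\mathfrak{cov}(k,h;m,f)$; - (C) for every $r>2$ and all pairs $(k_1,h_1),\dots,(k_r,h_r)$, the joint cumulant of $p^L_{k_1,h_1},\dots,p^L_{k_r,h_r}$ tends to $0$. They are *CLT-appropriate* if there are numbers $\mathfrak c_{k,h}$, $\mathfrak d_{k,h;m,f}$ ($k,m\ge1$; $1\le h,f\le H$) such that, as $L\to\infty$ with the indices of the variables fixed, 1. $\frac1{N_h}\bigl(\frac{\partial}{\partial x_i^h}\bigr)^k\ln S_{\rho_L}\big|_{\mathbf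 1}\to\mathfrak c_{k,h}$ for all $k,h,i$; 2. $\bigl(\frac{\partial}{\partial x_i^h}\bigr)^k\bigl(\frac{\partial}{\partial x_j^f}\bigr)^m\ln S_{\rho_L}\big|_{\mathbf 1}\to\mathfrak d_{k,h;m,f}$ for all $k,m$ and all $(i,h)\ne(j,f)$; 3. $\frac{\partial}{\partial x_{i_1}^{h_1}}\cdots\frac{\partial}{\partial x_{i_s}^{h_s}}\ln S_{\rho_L}\big|_{\mathbf 1}\to0$ whenever there are at least three distinct pairs among $(i_1,h_1),\dots,(i_s,h_s)$. **Theorem.** The smooth measures $\rho_L$ satisfy a CLT as $L\to\infty$ if and only if they are CLT-appropriate. In this case the numbers $\mathfrak p(k,h)$, $\mathfrak{cov}(k,h;m,f)$ are polynomials in the numbers $\mathfrak c_{k,h}$, $\mathfrak d_{k,h;m,f}$ (the polynomials, with rational coefficients, depend only on $H$ and on the indices), and, with $$f_h(z)=(1+z)\Bigl(\frac1z+\sum_{a=1}^\infty\frac{\mathfrak c_{a,h}z^{a-1}}{(a-1)!}\Bigr),$$ they are given by $$\mathfrak p(k,h)=[z^{-1}]\,\frac{1}{(k+1)(1+z)}\,f_h(z)^{k+1},$$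 $$\mathfrak{cov}(k_1,h_1;k_2,h_2)=[z^{-1}w^{-1}]\;f_{h_1}(z)^{k_1}f_{h_2}(w)^{k_2}\Bigl(\delta_{h_1=h_2}\Bigl(\sum_{a=0}^\infty\frac{z^a}{w^{1+a}}\Bigr)^2+\sum_{a,b=1}^\infty\frac{\mathfrak d_{a,h_1;b,h_2}}{(a-1)!\,(b-1)!}z^{a-1}w^{b-1}\Bigr),$$ where $[z^{-1}]$ and $[z^{-1}w^{-1}]$ denote the coefficients of $z^{-1}$ and $z^{-1}w^{-1}$ in the formal Laurent series that follow (the second one is expanded in powers of $z$, with coefficients that are Laurent series in $w$). -/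

import Mathlib

open Filter Topology

noncomputable section

namespace SchurCLT

/-- Signatures of length `N`: weakly decreasing `N`-tuples of integers
(coordinates are numbered from `0`). -/
abbrev GT (N : ℕ) : Type := {lam : Fin N → ℤ // Antitone lam}

/-- The Schur (Laurent) polynomial `s_λ(x_1, …, x_N)` of a signature `λ`, through the combinatorial
formula (sum over Gelfand--Tsetlin patterns), organised by the branching rule
`s_λ(x_1, …, x_{N+1}) = ∑_{μ ≺ λ} s_μ(x_1, …, x_N) x_{N+1}^{|λ| - |μ|}`, where `μ ≺ λ` means
`λ_1 ≥ μ_1 ≥ λ_2 ≥ … ≥ μ_N ≥ λ_{N+1}`. -/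
def schur : (N : ℕ) → (Fin N → ℤ) → (Fin N → ℂ) → ℂ
  | 0, _, _ => 1
  | N + 1, lam, x =>
      ∑ mu ∈ Finset.Icc (fun i : Fin N => lam i.succ) (fun i : Fin N => lam i.castSucc),
        schur N mu (fun i => x i.castSucc) * x (Fin.last N) ^ (∑ i, lam i - ∑ i, mu i)

section Measures

variable {H : ℕ} {N : Fin H → ℕ}

/-- The weight of a point under a probability measure on the countable set `∏_h GT_{N_h}`. -/
def weight (τ : PMF (∀ h, GT (N h))) (lam : ∀ h, GT (N h)) : ℝ := (τ lam).toReal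

/-- Smooth probability measures on `∏_h GT_{N_h}`. -/
def IsSmooth (τ : PMF (∀ h, GT (N h))) : Prop :=
  ∃ r : ℝ, 1 < r ∧
    Summable fun lam : ∀ h, GT (N h) => weight τ lam * r ^ (∑ h, ∑ i, ((lam h).1 i).natAbs)

/-- The `H`-dimensional Schur generating function; `x h i` is the variable `x_{i+1}^h`. -/
def sgf (τ : PMF (∀ h, GT (N h))) (x : ∀ h, Fin (N h) → ℂ) : ℂ :=
  ∑' lam : ∀ h, GT (N h), (weight τ lam : ℂ) *
    ∏ h, schur (N h) (lam h).1 (x h) / schur (N h) (lam h).1 1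

/-- Expectation of a random variable on `∏_h GT_{N_h}`. -/
def expect (τ : PMF (∀ h, GT (N h))) (ξ : (∀ h, GT (N h)) → ℝ) : ℝ :=
  ∑' lam : ∀ h, GT (N h), weight τ lam * ξ lam

/-- The random power sum
`p_{k,h} = ∑_{i=1}^{N_h} ((λ_i^h + N_h - i) / N_h)^k` (here `i` runs from `0`). -/
def powerSum (k : ℕ+) (h : Fin H) (lam : ∀ h, GT (N h)) : ℝ :=
  ∑ i : Fin (N h), ((((lam h).1 i : ℝ) + (N h : ℝ) - ((i : ℕ) + 1 : ℝ)) / (N h : ℝ)) ^ (k : ℕ)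

/-- The joint cumulant of the random variables `ξ_1, …, ξ_r`: the sum over all set partitions
of `{1, …, r}`. -/
def cumulant (τ : PMF (∀ h, GT (N h))) {r : ℕ} (ξ : Fin r → (∀ h, GT (N h)) → ℝ) : ℝ :=
  ∑ π : Finpartition (Finset.univ : Finset (Fin r)),
    (-1 : ℝ) ^ (π.parts.card - 1) * ((π.parts.card - 1).factorial : ℝ) *
      ∏ U ∈ π.parts, expect τ (fun lam => ∏ j ∈ U, ξ j lam)

/-- The unit vector in the direction of the variable `x_{i+1}^h`, `a = (h, i)`
(the zero vector if there is no such variable, that is, if `N h ≤ i`). -/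
def unitVec (N : Fin H → ℕ) (a : Fin H × ℕ) : ∀ h, Fin (N h) → ℂ :=
  fun h i => if h = a.1 ∧ (i : ℕ) = a.2 then 1 else 0

/-- The partial derivative `∂/∂x_{i+1}^h`, `a = (h, i)`. -/
def partialDeriv (a : Fin H × ℕ) (F : (∀ h, Fin (N h) → ℂ) → ℂ) : (∀ h, Fin (N h) → ℂ) → ℂ :=
  fun x => lineDeriv ℂ F x (unitVec N a)

/-- The successive partial derivatives, in the variables listed in `l`, of the logarithm of the
Schur generating function of `τ`, evaluated at the point all of whose coordinates are `1`. -/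
def logSGFDeriv (τ : PMF (∀ h, GT (N h))) (l : List (Fin H × ℕ)) : ℂ :=
  l.foldr partialDeriv (fun x => Complex.log (sgf τ x)) (fun _ _ => 1)

end Measures

section Limits

variable {H : ℕ} {N : ℕ → Fin H → ℕ}

/-- The measures `ρ_L` satisfy a CLT with limits `p(k,h)` and `cov(k,h;m,f)`. -/
structure HasCLTLimits (ρ : ∀ L, PMF (∀ h, GT (N L h)))
    (p : ℕ+ → Fin H → ℝ) (cov : ℕ+ → Fin H → ℕ+ → Fin H → ℝ) : Prop where
  mean : ∀ (k : ℕ+) (h : Fin H),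
    Tendsto (fun L => 1 / (N L h : ℝ) * expect (ρ L) (powerSum k h)) atTop (𝓝 (p k h))
  covariance : ∀ (k : ℕ+) (h : Fin H) (m : ℕ+) (f : Fin H),
    Tendsto (fun L => expect (ρ L) (fun lam => powerSum k h lam * powerSum m f lam)
      - expect (ρ L) (powerSum k h) * expect (ρ L) (powerSum m f)) atTop (𝓝 (cov k h m f))
  higher : ∀ (r : ℕ), 2 < r → ∀ (k : Fin r → ℕ+) (h : Fin r → Fin H),
    Tendsto (fun L => cumulant (ρ L) (fun j => powerSum (k j) (h j))) atTop (𝓝 0)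

/-- The measures `ρ_L` satisfy a CLT as `L → ∞`. -/
def SatisfiesCLT (ρ : ∀ L, PMF (∀ h, GT (N L h))) : Prop :=
  ∃ p cov, HasCLTLimits ρ p cov

/-- The measures `ρ_L` are CLT-appropriate with limits `c_{k,h}` and `d_{k,h;m,f}`. The indices of
the variables are fixed as `L → ∞`; a variable with a given index is present for all large `L`. -/
structure HasAppropriateLimits (ρ : ∀ L, PMF (∀ h, GT (N L h)))
    (c : ℕ+ → Fin H → ℂ) (d : ℕ+ → Fin H → ℕ+ → Fin H → ℂ) : Prop where
  one_variable : ∀ (k : ℕ+) (h : Fin H) (i : ℕ),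
    Tendsto (fun L => 1 / (N L h : ℂ) * logSGFDeriv (ρ L) (List.replicate k (h, i)))
      atTop (𝓝 (c k h))
  two_variables : ∀ (k : ℕ+) (h : Fin H) (m : ℕ+) (f : Fin H) (i j : ℕ), (h, i) ≠ (f, j) →
    Tendsto (fun L => logSGFDeriv (ρ L) (List.replicate k (h, i) ++ List.replicate m (f, j)))
      atTop (𝓝 (d k h m f))
  more_variables : ∀ l : List (Fin H × ℕ), 3 ≤ l.toFinset.card →
    Tendsto (fun L => logSGFDeriv (ρ L) l) atTop (𝓝 0)

/-- The measures `ρ_L` are CLT-appropriate as `L → ∞`. -/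
def IsCLTAppropriate (ρ : ∀ L, PMF (∀ h, GT (N L h))) : Prop :=
  ∃ c d, HasAppropriateLimits ρ c d

end Limits

section Formulas

/-- The variable of the field of formal Laurent series `K((T))`. -/
def lvar (K : Type) [Field K] : LaurentSeries K := HahnSeries.single 1 1

/-- The formal Laurent series `(1 + T) (1/T + ∑_{a ≥ 1} c_a T^{a-1} / (a-1)!)` in `K((T))`, where
the complex numbers are embedded into the field `K` by `ι`. -/
def fSeries {K : Type} [Field K] (ι : ℂ →+* K) (c : ℕ+ → ℂ) : LaurentSeries K :=
  (1 + lvar K) * ((lvar K)⁻¹ +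
    ((PowerSeries.mk fun a : ℕ => ι (c a.succPNat / (a.factorial : ℂ)) :
      PowerSeries K) : LaurentSeries K))

/-- `[z^{-1}] (1 / ((k+1)(1+z))) f(z)^{k+1}` with `f = fSeries c`. -/
def meanFormula (c : ℕ+ → ℂ) (k : ℕ+) : ℂ :=
  ((((k : ℕ) + 1 : LaurentSeries ℂ) * (1 + lvar ℂ))⁻¹ *
    fSeries (RingHom.id ℂ) c ^ ((k : ℕ) + 1)).coeff (-1)

/-- `∑_{a ≥ 0} z^a / w^{1+a}`, as an element of `ℂ((w))((z))`. -/
def geomSeries : LaurentSeries (LaurentSeries ℂ) :=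
  ((PowerSeries.mk fun a : ℕ => ((lvar ℂ) ^ (1 + a))⁻¹ : PowerSeries (LaurentSeries ℂ)) :
    LaurentSeries (LaurentSeries ℂ))

/-- `∑_{a,b ≥ 1} d_{a,b} / ((a-1)! (b-1)!) z^{a-1} w^{b-1}`, as an element of `ℂ((w))((z))`. -/
def dSeries (d : ℕ+ → ℕ+ → ℂ) : LaurentSeries (LaurentSeries ℂ) :=
  ((PowerSeries.mk fun a : ℕ =>
      ((PowerSeries.mk fun b : ℕ =>
        d a.succPNat b.succPNat / ((a.factorial : ℂ) * (b.factorial : ℂ)) : PowerSeries ℂ) :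
        LaurentSeries ℂ) : PowerSeries (LaurentSeries ℂ)) :
    LaurentSeries (LaurentSeries ℂ))

/-- `[z^{-1} w^{-1}] f₁(z)^{k₁} f₂(w)^{k₂} (δ (∑_{a ≥ 0} z^a / w^{1+a})^2 + ∑_{a,b} …)`, computed in
`ℂ((w))((z))` (Laurent series in `z` whose coefficients are Laurent series in `w`), with
`f₁ = fSeries c₁`, `f₂ = fSeries c₂`. -/
def covFormula (δ : Prop) [Decidable δ] (c₁ c₂ : ℕ+ → ℂ) (d : ℕ+ → ℕ+ → ℂ) (k₁ k₂ : ℕ+) : ℂ :=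
  ((fSeries (HahnSeries.C : ℂ →+* LaurentSeries ℂ) c₁ ^ (k₁ : ℕ) *
    HahnSeries.C (fSeries (RingHom.id ℂ) c₂ ^ (k₂ : ℕ)) *
    ((if δ then geomSeries ^ 2 else 0) + dSeries d)).coeff (-1)).coeff (-1)

/-- The variables `c_{k,h}` and `d_{k,h;m,f}` of the polynomials that express the limits. -/
abbrev LimitVar (H : ℕ) : Type := (ℕ+ × Fin H) ⊕ ((ℕ+ × Fin H) × (ℕ+ × Fin H))

/-- The values of these variables. -/
def limitVal {H : ℕ} (c : ℕ+ → Fin H → ℂ) (d : ℕ+ → Fin H → ℕ+ → Fin H → ℂ) : LimitVar H → ℂ :=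
  Sum.elim (fun a => c a.1 a.2) (fun a => d a.1.1 a.1.2 a.2.1 a.2.2)

end Formulas

end SchurCLT

end

/-! Write l_j = λ_j + N - j, w_j = ∏_{m ≠ j} (l_j - l_m)⁻¹ and D_i = (1+u_i) ∂/∂u_i. The normalized
Schur polynomial at (1+u, 1, …, 1) is φ(u) = (N-1)! u^{1-N} ∑_j w_j (1+u)^{l_j}. At r variables
1+u_i of one colour it becomes, after multiplication by the Vandermonde product in u and by ∏
u_i^{N-r}, a constant multiple of ∏_{i<j} (D_i - D_j) applied to ∏ u_i^{N-1} φ(u_i)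
(`exists_schurSeries_eq`). The constant and the operator do not depend on λ. So the Schur generating
function is obtained from the expectations E ∏ φ(u_i) by a fixed differential operator.

Divide both sides by the product of the one-variable expectations E φ, whose logarithms are of order
N. The conjugated operator, divided by N, is a first order operator in which ∂ carries the
coefficient 1/N. In the limit it multiplies by u_j g(u_i) - u_i g(u_j), where g(u) = (1+u)(1+u
c'(u)) and c = lim (1/N) log E φ. Its solutions are controlled coefficient by coefficient
(`CT.of_opB`), so the quotient for the Schur generating function converges if and only if the
quotient of the E ∏ φ(u_i) does, and the limits differ by the factors (u_j g(u_i) - u_i g(u_j)) /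
(u_j - u_i) (`schur_pair_iff_phi_pair`). CLT-appropriateness (`appropriate_iff`) thus says that
(1/N) log E φ converges and that log (E ∏ φ(u_x) / ∏ E φ(u_x)) tends to a sum of functions of two
variables. The latter means that φ / E φ behaves in moments like the exponential of a Gaussian
random series.

It remains to compare log φ with the power sums. Newton's identities for the moments ∑ w_j l_j^m
give a triangular algebraic system (`PowerSumSystem`) between the coefficients of (1/N) log φ and
the numbers p_k / N. Either family therefore lies in a suitable subalgebra as soon as the other
does. The subalgebra used consists of the sequences z_L + W_L / N with z_L deterministic and
convergent and W_L fluctuating, each paired with the dual number z + εw of its limits. Gaussian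
fluctuations of log φ and of the power sums are hence equivalent (`exists_phi_limits`,
`exists_gaussian_limits`). For 1/N = 0 the system is solved by Lagrange inversion; the part without
ε gives the means, and the ε-part gives the limiting fluctuation [u^{k+1}] g^{k+1} u w' of p_{k+1}
(`exists_powerSumSystem_dual`).

Gaussian behaviour is expressed by an abstract functional that satisfies integration by parts, and
moments are exchanged for cumulants by the recursion `moment_eq_sum_kap`. In the covariance, the
logarithm of (w g(z) - z g(w)) / (w - z) contributes the term with (∑ z^a / w^{1+a})², by
`coeff_ellSeries_mul_pow`. -/

open PowerSeries (X_ne_zero X_pow_dvd_iff coeff_X_pow_mul' coeff_derivative coeff_mk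
  coeff_succ_X_mul coeff_zero_X_mul derivative derivative_C derivative_X)
open Finset (add_sum_erase card_eq_one card_insert_of_notMem card_pair card_univ insert_erase
  mem_Icc mem_Ioi mem_erase mem_filter mem_insert mem_insert_self mem_powerset mem_range mem_sigma
  mem_singleton mem_univ mul_prod_erase mul_sum ne_of_mem_erase notMem_empty prod_congr prod_const
  prod_eq_single prod_filter prod_insert prod_map prod_mul_distrib prod_ne_zero_iff prod_pair
  range single_le_sum sum_add_distrib sum_congr sum_const sum_eq_single sum_eq_zero sum_insert
  sum_map sum_mul sum_mul_sum sum_nbij' sum_range_succ sum_singleton sum_sub_distrib sum_subset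
  univ)
open MvPolynomial (aeval basisMonomials coe_basisMonomials derivation_C lcoeff monomial)
open TrivSqZeroExt (algebraMap_eq_inl' fst_add fst_inl fst_inr inl inl_zero inr inr_smul inr_sum
  snd_add snd_inl snd_inr)
open Algebra (algebraMap_eq_smul_one smul_def)
open Finset.HasAntidiagonal (antidiagonal mem_antidiagonal)
open Metric (ball isOpen_ball mem_ball mem_ball_self)
open Fintype (card_fin prod_prod_type)
open Polynomial (coeToPowerSeries coe_X eval eval_C eval_X eval_finsetSum eval_mul eval_one
  eval_prod eval_sub)
open MvPowerSeries (coeff_index_single_X constantCoeff_rename killCompl pderiv_C pderiv_X_of_ne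
  pderiv_X_self rename_X)
open Derivation (commutator_apply leibniz leibniz_pow)
open AlgHom (commutes)
open Complex (continuous_ofReal norm_real ofReal_mul ofReal_prod ofReal_sum slitPlane)
open Finsupp (degree_eq_zero_iff degree_single embDomain_add embDomain_single erase_ne mapDomain
  mem_support_iff single_add single_le_iff single_zero toMultiset tsub_apply)
open Matrix (det_mul_column det_permute' of_apply submatrix_apply vandermonde)
open Nat (factorial_ne_zero factorial_succ succ_ne_zero)
open Function (iterate_succ_apply update_of_ne)
open LinearMap (mulLeft proj)
open HahnSeries (ofPowerSeries ofPowerSeries_X)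
open Multiset (singleton_add toFinsupp toFinsupp_support)
open Submodule (span span_induction subset_span)

noncomputable section

namespace SchurCLT

set_option linter.unusedSectionVars false

/-! ### Formal power series in several variables and their logarithms. -/

section

open MvPowerSeries (X coeff coeff_mul coeff_one constantCoeff)
open Finset (induction_on)

section ConstantCoeff

theorem coeff_zero_mv {σ R : Type*} [Semiring R] (φ : MvPowerSeries σ R) :
    coeff 0 φ = constantCoeff φ := MvPowerSeries.coeff_zero_eq_constantCoeff_apply φ

theorem coeff_zero_ps {R : Type*} [Semiring R] (φ : PowerSeries R) :
    PowerSeries.coeff 0 φ = PowerSeries.constantCoeff φ :=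
  PowerSeries.coeff_zero_eq_constantCoeff_apply φ

end ConstantCoeff

open MvPowerSeries Finsupp in
theorem pderiv_rename_apply {σ τ R : Type*} [CommRing R] [Finite σ] (e : σ ↪ τ) (i : σ)
    (p : MvPowerSeries σ R) : pderiv R (e i) (rename e p) = rename e (pderiv R i p) := by
  classical
  ext n
  rw [coeff_pderiv]
  by_cases hn : n ∈ Set.range (mapDomain e)
  · obtain ⟨m, rfl⟩ := hn
    rw [← embDomain_eq_mapDomain]
    have h1 : embDomain e m + single (e i) 1 = embDomain e (m + single i 1) := by
      simp [embDomain_eq_mapDomain, mapDomain_add, mapDomain_single]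
    rw [h1, coeff_embDomain_rename, coeff_embDomain_rename, coeff_pderiv, embDomain_apply_self]
  · rw [coeff_rename_eq_zero e (pderiv R i p) hn, coeff_rename_eq_zero, zero_mul]
    rintro ⟨m, hm⟩
    apply hn
    rw [← embDomain_eq_mapDomain] at hm
    have hmi : m i ≠ 0 := by
      have := DFunLike.congr_fun hm (e i)
      rw [embDomain_apply_self] at this
      simp at this
      omega
    refine ⟨m - single i 1, ?_⟩
    rw [← embDomain_eq_mapDomain]
    have h2 : m - single i 1 + single i 1 = m := tsub_add_cancel_of_le (by
        rw [single_le_iff]; omega)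
    have h3 : embDomain e (m - single i 1) + single (e i) 1 = n + single (e i) 1 := by
      rw [← hm, ← h2]
      simp [embDomain_eq_mapDomain, mapDomain_add, mapDomain_single]
    exact add_right_cancel h3

open MvPowerSeries Finsupp in
theorem pderiv_rename_of_notMem {σ τ R : Type*} [CommRing R] [Finite σ] (e : σ ↪ τ) (t : τ)
    (ht : t ∉ Set.range e) (p : MvPowerSeries σ R) : pderiv R t (rename e p) = 0 := by
  classical
  ext n
  rw [coeff_pderiv, coeff_rename_eq_zero, zero_mul, map_zero]
  rintro ⟨m, hm⟩
  rw [← embDomain_eq_mapDomain] at hm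
  have := DFunLike.congr_fun hm t
  rw [embDomain_of_notMem_range _ _ _ ht] at this
  simp at this

/-- The constant embedding of a one-element type. -/
def pt {σ : Type*} (i : σ) : Unit ↪ σ := ⟨fun _ => i, fun _ _ _ => rfl⟩

/-- A one-variable power series as a series in the variable `X i`. -/
def emb {σ R : Type*} [CommRing R] (i : σ) : PowerSeries R →ₐ[R] MvPowerSeries σ R :=
  MvPowerSeries.rename (pt i)

section emb

variable {σ R : Type*} [CommRing R]

theorem mapDomain_pt (i : σ) (m : Unit →₀ ℕ) : mapDomain (pt i) m = Finsupp.single i (m ()) := by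
  have : m = Finsupp.single () (m ()) := by ext; simp
  rw [this, Finsupp.mapDomain_single]
  simp only [Finsupp.single_eq_same]
  rfl

theorem coeff_emb_single (i : σ) (n : ℕ) (φ : PowerSeries R) :
    coeff (Finsupp.single i n) (emb i φ) = PowerSeries.coeff n φ := by
  have h := MvPowerSeries.coeff_embDomain_rename (pt i) φ (Finsupp.single () n)
  rw [Finsupp.embDomain_eq_mapDomain, mapDomain_pt] at h
  simp only [Finsupp.single_eq_same] at h
  exact h

theorem coeff_emb_of_ne (i : σ) (n : σ →₀ ℕ) (φ : PowerSeries R)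
    (hn : n ≠ Finsupp.single i (n i)) : coeff n (emb i φ) = 0 := by
  apply MvPowerSeries.coeff_rename_eq_zero
  rintro ⟨m, hm⟩
  rw [mapDomain_pt] at hm
  apply hn
  rw [← hm]
  simp

theorem coeff_emb [DecidableEq σ] (i : σ) (n : σ →₀ ℕ) (φ : PowerSeries R) : coeff n (emb i φ) =
      if n = Finsupp.single i (n i) then PowerSeries.coeff (n i) φ else 0 := by
  split_ifs with h
  · conv_lhs => rw [h]
    rw [coeff_emb_single]
  · exact coeff_emb_of_ne i n φ h

theorem constantCoeff_emb (i : σ) (φ : PowerSeries R) :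
    constantCoeff (emb i φ) = PowerSeries.constantCoeff φ := constantCoeff_rename _ _

theorem emb_X (i : σ) : emb i (PowerSeries.X : PowerSeries R) = X i := rename_X _ _

theorem pderiv_emb_self (i : σ) (φ : PowerSeries R) :
    MvPowerSeries.pderiv R i (emb i φ) = emb i (derivative R φ) := pderiv_rename_apply (pt i) () φ

theorem pderiv_emb_of_ne {i j : σ} (h : j ≠ i) (φ : PowerSeries R) :
    MvPowerSeries.pderiv R i (emb j φ) = 0 :=
  pderiv_rename_of_notMem (pt j) i (by rintro ⟨_, e⟩; exact h e) φ

/-- The product of one-variable series in the different variables. -/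
def tens [Fintype σ] (φ : σ → PowerSeries R) : MvPowerSeries σ R := ∏ i, emb i (φ i)

theorem coeff_prod_emb [DecidableEq σ] (φ : σ → PowerSeries R) (s : Finset σ) (n : σ →₀ ℕ) :
    coeff n (∏ i ∈ s, emb i (φ i)) =
      if n.support ⊆ s then ∏ i ∈ s, PowerSeries.coeff (n i) (φ i) else 0 := by
  induction s using induction_on generalizing n with
  | empty =>
    simp [coeff_one]
  | insert a s ha ih =>
    rw [prod_insert ha, coeff_mul]
    by_cases hn : n.support ⊆ insert a s
    · rw [if_pos hn, prod_insert ha]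
      rw [sum_eq_single (Finsupp.single a (n a), n.erase a)]
      · rw [coeff_emb_single, ih, if_pos]
        · congr 1
          apply prod_congr rfl
          intro i hi
          rw [erase_ne (by rintro rfl; exact ha hi)]
        · rw [Finsupp.support_erase]
          intro i hi
          rw [mem_erase] at hi
          exact (mem_insert.mp (hn hi.2)).resolve_left hi.1
      · rintro ⟨p, q⟩ hpq hne
        rw [mem_antidiagonal] at hpq
        simp only at hpq ⊢
        by_cases hp : p = Finsupp.single a (p a)
        · by_cases hq : q.support ⊆ s
          · exfalso
            apply hne
            have hqa : q a = 0 := by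
              by_contra h
              exact ha (hq (mem_support_iff.mpr h))
            have hpa : p a = n a := by rw [← hpq]; simp [hqa]
            have hq' : q = n.erase a := by
              ext i
              by_cases hi : i = a
              · subst hi; simp [hqa]
              · rw [erase_ne hi, ← hpq, Finsupp.add_apply, hp, Finsupp.single_eq_of_ne hi, zero_add]
            rw [← hq', ← hpa, ← hp]
          · rw [ih, if_neg hq, mul_zero]
        · rw [coeff_emb_of_ne _ _ _ hp, zero_mul]
      · intro h
        exfalso
        apply h
        rw [mem_antidiagonal]
        exact Finsupp.single_add_erase a n
    · rw [if_neg hn]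
      apply sum_eq_zero
      rintro ⟨p, q⟩ hpq
      rw [mem_antidiagonal] at hpq
      simp only at hpq ⊢
      by_cases hp : p = Finsupp.single a (p a)
      · have hq : ¬ q.support ⊆ s := by
          intro hq
          apply hn
          intro i hi
          rw [mem_insert]
          by_contra hcon
          push Not at hcon
          rw [mem_support_iff, ← hpq, Finsupp.add_apply, hp,
            Finsupp.single_eq_of_ne hcon.1, zero_add] at hi
          exact hcon.2 (hq (mem_support_iff.mpr hi))
        rw [ih, if_neg hq, mul_zero]
      · rw [coeff_emb_of_ne _ _ _ hp, zero_mul]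

theorem coeff_tens [Fintype σ] (φ : σ → PowerSeries R) (n : σ →₀ ℕ) :
    coeff n (tens φ) = ∏ i, PowerSeries.coeff (n i) (φ i) := by
  classical
  rw [tens, coeff_prod_emb, if_pos (Finset.subset_univ _)]

theorem tens_mul [Fintype σ] (φ ψ : σ → PowerSeries R) :
    tens (fun i => φ i * ψ i) = tens φ * tens ψ := by
  simp [tens, prod_mul_distrib]

theorem constantCoeff_tens [Fintype σ] (φ : σ → PowerSeries R)
    (h : ∀ i, PowerSeries.constantCoeff (φ i) = 1) : constantCoeff (tens φ) = 1 := by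
  simp [tens, map_prod, constantCoeff_emb, h]

theorem pderiv_tens [Fintype σ] (φ τ : σ → PowerSeries R)
    (h : ∀ i, derivative R (φ i) = τ i * φ i) (i : σ) :
    MvPowerSeries.pderiv R i (tens φ) = emb i (τ i) * tens φ := by
  classical
  rw [tens, ← mul_prod_erase univ _ (mem_univ i), leibniz, pderiv_emb_self, h]
  have : MvPowerSeries.pderiv R i (∏ j ∈ univ.erase i, emb j (φ j)) = 0 := by
    have h0 : ∀ s : Finset σ, i ∉ s → MvPowerSeries.pderiv R i (∏ j ∈ s, emb j (φ j)) = 0 := by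
      intro s
      induction s using induction_on with
      | empty => intro _; simp
      | insert a s ha ih =>
        intro hi
        rw [mem_insert, not_or] at hi
        rw [prod_insert ha, leibniz, ih hi.2, pderiv_emb_of_ne (Ne.symm hi.1)]
        simp
    exact h0 _ (Finset.notMem_erase i _)
  rw [this]
  simp only [smul_eq_mul, map_mul]
  ring

end emb

section IsLog

variable {σ R : Type*} [CommRing R]

/-- `Λ` is the logarithm of the power series `K`. -/
structure IsLog (Λ K : MvPowerSeries σ R) : Prop where
  left : constantCoeff Λ = 0
  right : constantCoeff K = 1
  deriv : ∀ i, MvPowerSeries.pderiv R i K = MvPowerSeries.pderiv R i Λ * K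

theorem IsLog.zero_one : IsLog (0 : MvPowerSeries σ R) 1 :=
  ⟨map_zero _, map_one _, fun i => by simp⟩

theorem IsLog.add_mul {Λ K Λ' K' : MvPowerSeries σ R} (h : IsLog Λ K) (h' : IsLog Λ' K') :
    IsLog (Λ + Λ') (K * K') := ⟨by simp [h.left, h'.left], by simp [h.right, h'.right], fun i => by
    rw [leibniz, h.deriv, h'.deriv, map_add]; simp only [smul_eq_mul]; ring⟩

theorem IsLog.sum_prod {ι : Type*} (s : Finset ι) {Λ K : ι → MvPowerSeries σ R}
    (h : ∀ i ∈ s, IsLog (Λ i) (K i)) : IsLog (∑ i ∈ s, Λ i) (∏ i ∈ s, K i) := by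
  classical
  induction s using induction_on with
  | empty => simpa using IsLog.zero_one
  | insert a s ha ih =>
    rw [sum_insert ha, prod_insert ha]
    exact (h a (by simp)).add_mul (ih fun i hi => h i (by simp [hi]))

theorem isUnit_of_constantCoeff_eq_one {K : MvPowerSeries σ R}
    (h : constantCoeff K = 1) : IsUnit K :=
  MvPowerSeries.isUnit_iff_constantCoeff.mpr (by rw [h]; exact isUnit_one)

/-- The logarithm is characterized by a differential equation rather than by substitution into a
series. The equation fixes all partial derivatives of `Λ`, because `K` is a unit; over a
torsion-free ring these and the constant term determine a series. -/
theorem IsLog.unique_left [IsAddTorsionFree R] {Λ Λ' K : MvPowerSeries σ R} (h : IsLog Λ K)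
    (h' : IsLog Λ' K) : Λ = Λ' := by
  apply MvPowerSeries.pderiv.ext
  · intro i
    have := (h.deriv i).symm.trans (h'.deriv i)
    exact (isUnit_of_constantCoeff_eq_one h.right).mul_right_cancel this
  · rw [h.left, h'.left]

theorem IsLog.sub_div {Λ K Λ' K' J : MvPowerSeries σ R} (h : IsLog Λ K) (h' : IsLog Λ' K')
    (hJ : K' * J = K) : IsLog (Λ - Λ') J := by
  have hu := isUnit_of_constantCoeff_eq_one h'.right
  refine ⟨by simp [h.left, h'.left], ?_, fun i => ?_⟩
  · have := congrArg constantCoeff hJ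
    rw [map_mul, h.right, h'.right, one_mul] at this
    exact this
  · apply hu.mul_left_cancel
    have h1 := h.deriv i
    rw [← hJ, leibniz, h'.deriv] at h1
    simp only [smul_eq_mul] at h1
    rw [map_sub]
    linear_combination h1

/-- The quotient of the two candidates has logarithm 0, hence vanishing derivatives and constant
term 1. -/
theorem IsLog.unique_right [IsAddTorsionFree R] {Λ K K' : MvPowerSeries σ R} (h : IsLog Λ K)
    (h' : IsLog Λ K') : K = K' := by
  obtain ⟨u, hu⟩ := isUnit_of_constantCoeff_eq_one h'.right
  have hJ : K' * (↑u⁻¹ * K) = K := by rw [← mul_assoc, ← hu]; simp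
  have h1 := h.sub_div h' hJ
  have h2 : (↑u⁻¹ * K) = 1 := by
    apply MvPowerSeries.pderiv.ext
    · intro i; rw [h1.deriv i]; simp
    · rw [h1.right]; simp
  rw [← hJ, h2, mul_one]

theorem IsLog.rename {τ : Type*} [Finite σ] (e : σ ↪ τ) {Λ K : MvPowerSeries σ R}
    (h : IsLog Λ K) : IsLog (MvPowerSeries.rename e Λ) (MvPowerSeries.rename e K) := by
  refine ⟨?_, ?_, fun t => ?_⟩
  · rw [constantCoeff_rename, h.left]
  · rw [constantCoeff_rename, h.right]
  · by_cases ht : t ∈ Set.range e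
    · obtain ⟨i, rfl⟩ := ht
      rw [pderiv_rename_apply, pderiv_rename_apply, h.deriv, map_mul]
    · rw [pderiv_rename_of_notMem e t ht, pderiv_rename_of_notMem e t ht, zero_mul]

theorem IsLog.emb {Λ K : PowerSeries R} (h : IsLog Λ K) (i : σ) :
    IsLog (emb i Λ) (SchurCLT.emb i K) := h.rename (pt i)

/-- The Euler operator multiplies every monomial by its degree. -/
def euler (K : MvPowerSeries σ R) : MvPowerSeries σ R :=
  fun n => (n.degree : R) * coeff n K

theorem coeff_euler (K : MvPowerSeries σ R) (n : σ →₀ ℕ) :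
    coeff n (euler K) = (n.degree : R) * coeff n K := rfl

theorem euler_mul (K J : MvPowerSeries σ R) : euler (K * J) = euler K * J + K * euler J := by
  classical
  ext n
  rw [coeff_euler, map_add, coeff_mul, coeff_mul, coeff_mul, mul_sum, ← sum_add_distrib]
  apply sum_congr rfl
  intro p hp
  rw [mem_antidiagonal] at hp
  rw [coeff_euler, coeff_euler, ← hp, map_add]
  push_cast
  ring

theorem pderiv_euler (K : MvPowerSeries σ R) (i : σ) : MvPowerSeries.pderiv R i (euler K) =
      euler (MvPowerSeries.pderiv R i K) + MvPowerSeries.pderiv R i K := by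
  ext n
  rw [MvPowerSeries.coeff_pderiv, map_add, coeff_euler, coeff_euler, MvPowerSeries.coeff_pderiv,
    map_add, degree_single]
  push_cast
  ring

/-- The Euler operator turns the equation into euler Λ = euler K / K, which is solved by dividing
each coefficient by its degree. That the partial derivatives of this Λ are correct follows from the
commutation of ∂_i with the Euler operator. -/
theorem IsLog.exists_left [Algebra ℚ R] {K : MvPowerSeries σ R}
    (h : constantCoeff K = 1) : ∃ Λ, IsLog Λ K := by
  obtain ⟨u, hu⟩ := isUnit_of_constantCoeff_eq_one h
  let Q : MvPowerSeries σ R := euler K * ↑u⁻¹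
  let Λ : MvPowerSeries σ R := fun n => algebraMap ℚ R (n.degree : ℚ)⁻¹ * coeff n Q
  have hΛc : ∀ n, coeff n Λ = algebraMap ℚ R (n.degree : ℚ)⁻¹ * coeff n Q := fun _ => rfl
  have huK : K * ↑u⁻¹ = 1 := by rw [← hu]; simp
  have hQ0 : constantCoeff Q = 0 := by
    rw [map_mul, ← coeff_zero_mv, coeff_euler]
    simp
  have hinv : ∀ m : ℕ, m ≠ 0 → (m : R) * algebraMap ℚ R (m : ℚ)⁻¹ = 1 := by
    intro m hm
    have : (m : R) = algebraMap ℚ R (m : ℚ) := by simp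
    rw [this, ← map_mul, mul_inv_cancel₀ (by exact_mod_cast hm), map_one]
  have hE : euler Λ = Q := by
    ext n
    rw [coeff_euler, hΛc, ← mul_assoc]
    by_cases hn : n = 0
    · subst hn
      rw [coeff_zero_mv, hQ0, mul_zero]
    · rw [hinv _ (by rwa [Ne, degree_eq_zero_iff]), one_mul]
  have hEK : euler K = Q * K := by
    rw [show Q * K = euler K * (K * ↑u⁻¹) by ring, huK, mul_one]
  refine ⟨Λ, ?_, h, fun i => ?_⟩
  · rw [← coeff_zero_mv, hΛc]
    simp
  -- On degree n the operator euler + 1 is multiplication by n + 1, which is invertible. It is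
  -- applied to the error ∂_i Λ - ∂_i K / K.
  have key : ∀ d : MvPowerSeries σ R, euler d + d = 0 → d = 0 := by
    intro d hd
    ext n
    have := congrArg (coeff n) hd
    rw [map_add, coeff_euler, map_zero] at this
    have h2 : ((n.degree + 1 : ℕ) : R) * coeff n d = 0 := by
      push_cast; linear_combination this
    have h3 := hinv (n.degree + 1) (by omega)
    calc coeff n d
        = (((n.degree + 1 : ℕ) : R) * algebraMap ℚ R ((n.degree + 1 : ℕ) : ℚ)⁻¹) *
            coeff n d := by rw [h3, one_mul]
      _ = algebraMap ℚ R ((n.degree + 1 : ℕ) : ℚ)⁻¹ *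
            (((n.degree + 1 : ℕ) : R) * coeff n d) := by ring
      _ = 0 := by rw [h2, mul_zero]
  set P := MvPowerSeries.pderiv R i K * ↑u⁻¹ with hP
  have hPK : MvPowerSeries.pderiv R i K = P * K := by
    rw [show P * K = MvPowerSeries.pderiv R i K * (K * ↑u⁻¹) by rw [hP]; ring, huK, mul_one]
  have e1 := pderiv_euler Λ i
  rw [hE] at e1
  have e2 := pderiv_euler K i
  rw [hEK, hPK, euler_mul, leibniz, hEK, hPK] at e2
  simp only [smul_eq_mul] at e2
  have e3 : MvPowerSeries.pderiv R i Q = euler P + P := by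
    apply (isUnit_of_constantCoeff_eq_one h).mul_right_cancel
    linear_combination e2
  have e4 : euler (MvPowerSeries.pderiv R i Λ - P) + (MvPowerSeries.pderiv R i Λ - P) = 0 := by
    have : euler (MvPowerSeries.pderiv R i Λ - P) =
        euler (MvPowerSeries.pderiv R i Λ) - euler P := by
      ext n; simp only [coeff_euler, map_sub]; ring
    rw [this]
    linear_combination e3 - e1
  rw [hPK, sub_eq_zero.mp (key _ e4)]

/-- Existence of the exponential in one variable. -/
theorem IsLog.exists_right [Algebra ℚ R] {Λ : PowerSeries R}
    (h : PowerSeries.constantCoeff Λ = 0) : ∃ K : PowerSeries R, IsLog Λ K := by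
  have hs : PowerSeries.HasSubst Λ := PowerSeries.HasSubst.of_constantCoeff_zero' h
  refine ⟨(PowerSeries.exp R).subst Λ, h, ?_, fun i => ?_⟩
  · have := PowerSeries.constantCoeff_subst_eq_zero h (PowerSeries.exp R - 1) (by simp)
    rw [PowerSeries.subst_sub hs] at this
    have h1 : PowerSeries.subst Λ (1 : PowerSeries R) = 1 := by
      rw [← PowerSeries.coe_substAlgHom hs, map_one]
    rw [h1, map_sub, map_one, sub_eq_zero] at this
    exact this
  · have := PowerSeries.derivative_subst (f := PowerSeries.exp R) hs
    rw [PowerSeries.derivative_exp] at this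
    rw [mul_comm]
    exact this

end IsLog

end

/-! ### Coefficientwise convergence and first order operators with small derivative part. -/

section

open MvPowerSeries (C X coeff coeff_C coeff_C_mul coeff_mul coeff_pderiv constantCoeff pderiv
  rename)
open Finsupp (single)

section CT

variable {σ : Type*}

/-- Coefficientwise convergence of a sequence of power series. -/
def CT (K : ℕ → MvPowerSeries σ ℂ) (k : MvPowerSeries σ ℂ) : Prop :=
  ∀ n, Tendsto (fun L => coeff n (K L)) atTop (𝓝 (coeff n k))

theorem CT.const (k : MvPowerSeries σ ℂ) : CT (fun _ => k) k := fun _ => tendsto_const_nhds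

theorem CT.add {K J : ℕ → MvPowerSeries σ ℂ} {k j : MvPowerSeries σ ℂ} (hK : CT K k)
    (hJ : CT J j) : CT (fun L => K L + J L) (k + j) := fun n => by
  simpa using (hK n).add (hJ n)

theorem CT.sub {K J : ℕ → MvPowerSeries σ ℂ} {k j : MvPowerSeries σ ℂ} (hK : CT K k)
    (hJ : CT J j) : CT (fun L => K L - J L) (k - j) := fun n => by
  simpa using (hK n).sub (hJ n)

theorem CT.mul {K J : ℕ → MvPowerSeries σ ℂ} {k j : MvPowerSeries σ ℂ} (hK : CT K k)
    (hJ : CT J j) : CT (fun L => K L * J L) (k * j) := fun n => by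
  classical
  simp only [coeff_mul]
  exact tendsto_finsetSum _ fun p _ => (hK p.1).mul (hJ p.2)

theorem CT.sum {ι : Type*} (s : Finset ι) {K : ι → ℕ → MvPowerSeries σ ℂ}
    {k : ι → MvPowerSeries σ ℂ} (h : ∀ i ∈ s, CT (K i) (k i)) :
    CT (fun L => ∑ i ∈ s, K i L) (∑ i ∈ s, k i) := by
  intro n
  simp only [map_sum]
  exact tendsto_finsetSum _ fun i hi => h i hi n

theorem CT.pderiv {K : ℕ → MvPowerSeries σ ℂ} {k : MvPowerSeries σ ℂ} (hK : CT K k) (i : σ) :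
    CT (fun L => MvPowerSeries.pderiv ℂ i (K L)) (MvPowerSeries.pderiv ℂ i k) := fun n => by
  simp only [coeff_pderiv]
  exact (hK _).mul_const _

theorem CT.C {a : ℕ → ℂ} {x : ℂ} (h : Tendsto a atTop (𝓝 x)) :
    CT (fun L => (MvPowerSeries.C (a L) : MvPowerSeries σ ℂ)) (MvPowerSeries.C x) := fun n => by
  classical
  simp only [coeff_C]
  split_ifs
  · exact h
  · exact tendsto_const_nhds

theorem CT.rename {τ : Type*} [Finite σ] (e : σ ↪ τ) {K : ℕ → MvPowerSeries σ ℂ}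
    {k : MvPowerSeries σ ℂ} (hK : CT K k) :
    CT (fun L => MvPowerSeries.rename e (K L)) (MvPowerSeries.rename e k) := fun n => by
  simp only [MvPowerSeries.coeff_rename]
  exact tendsto_finsetSum _ fun p _ => hK p

theorem CT.emb {K : ℕ → PowerSeries ℂ} {k : PowerSeries ℂ} (hK : CT K k) (i : σ) :
    CT (fun L => emb i (K L)) (SchurCLT.emb i k) := hK.rename (pt i)

theorem CT.unique {K : ℕ → MvPowerSeries σ ℂ} {k k' : MvPowerSeries σ ℂ} (h : CT K k)
    (h' : CT K k') : k = k' := by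
  ext n
  exact tendsto_nhds_unique (h n) (h' n)

theorem CT.congr' {K J : ℕ → MvPowerSeries σ ℂ} {k : MvPowerSeries σ ℂ} (h : CT K k)
    (hKJ : ∀ᶠ L in atTop, K L = J L) : CT J k := fun n =>
  (h n).congr' (hKJ.mono fun L hL => by rw [hL])

theorem CT.of_coeff {K : ℕ → MvPowerSeries σ ℂ}
    (h : ∀ n, ∃ x, Tendsto (fun L => coeff n (K L)) atTop (𝓝 x)) : ∃ k, CT K k := by
  choose x hx using h
  exact ⟨x, hx⟩

/-- A proof by induction on the degree. -/
theorem CT.of_degree {K : ℕ → MvPowerSeries σ ℂ}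
    (h : ∀ n : σ →₀ ℕ, (∀ m : σ →₀ ℕ, m.degree < n.degree →
        ∃ x, Tendsto (fun L => coeff m (K L)) atTop (𝓝 x)) →
      ∃ x, Tendsto (fun L => coeff n (K L)) atTop (𝓝 x)) : ∃ k, CT K k := by
  apply CT.of_coeff
  intro n
  induction hd : n.degree using Nat.strong_induction_on generalizing n with
  | _ d ih =>
    subst hd
    exact h n fun m hm => ih _ hm m rfl

/-- In a product, the terms other than the one with the constant coefficient of the first factor
converge as soon as the coefficients of smaller degree of the second factor converge. -/
theorem tendsto_coeff_mul_sub {K J : ℕ → MvPowerSeries σ ℂ} {k : MvPowerSeries σ ℂ} (hK : CT K k)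
    (n : σ →₀ ℕ) (hJ : ∀ m : σ →₀ ℕ, m.degree < n.degree →
        ∃ x, Tendsto (fun L => coeff m (J L)) atTop (𝓝 x)) :
    ∃ x, Tendsto (fun L => coeff n (K L * J L) -
      constantCoeff (K L) * coeff n (J L)) atTop (𝓝 x) := by
  classical
  have hmem : ((0 : σ →₀ ℕ), n) ∈ antidiagonal n := by
    rw [mem_antidiagonal]; simp
  have h1 : ∀ L, coeff n (K L * J L) - constantCoeff (K L) * coeff n (J L) =
      ∑ p ∈ (antidiagonal n).erase (0, n), coeff p.1 (K L) * coeff p.2 (J L) := by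
    intro L
    rw [coeff_mul, ← add_sum_erase _ _ hmem]
    simp
  simp only [h1]
  have h2 : ∀ p ∈ (antidiagonal n).erase (0, n),
      ∃ x, Tendsto (fun L => coeff p.1 (K L) * coeff p.2 (J L))
        atTop (𝓝 x) := by
    rintro ⟨p, q⟩ hpq
    rw [mem_erase, mem_antidiagonal] at hpq
    have hp : p ≠ 0 := by
      rintro rfl
      apply hpq.1
      rw [← hpq.2]; simp
    have hq : q.degree < n.degree := by
      rw [← hpq.2, map_add]
      have : p.degree ≠ 0 := by rwa [Ne, degree_eq_zero_iff]
      simp only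
      omega
    obtain ⟨x, hx⟩ := hJ q hq
    exact ⟨_, (hK p).mul hx⟩
  choose! x hx using h2
  exact ⟨_, tendsto_finsetSum _ hx⟩

/-- The coefficient of degree n of the product is the constant coefficient of `K` times that of `J`,
plus terms with coefficients of `J` of smaller degree; so the coefficients of `J` converge one
degree after another. -/
theorem CT.of_mul {K J : ℕ → MvPowerSeries σ ℂ} {k r : MvPowerSeries σ ℂ} (hK : CT K k)
    (hk : constantCoeff k ≠ 0) (h : CT (fun L => K L * J L) r) : ∃ j, CT J j ∧ k * j = r := by
  have h0 : Tendsto (fun L => constantCoeff (K L)) atTop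
      (𝓝 (constantCoeff k)) := hK 0
  obtain ⟨j, hj⟩ : ∃ j, CT J j := by
    apply CT.of_degree
    intro n hn
    obtain ⟨x, hx⟩ := tendsto_coeff_mul_sub hK n hn
    refine ⟨_, (((h n).sub hx).div h0 hk).congr' ?_⟩
    filter_upwards [h0.eventually_ne hk] with L hL
    rw [Pi.div_apply, div_eq_iff hL]
    ring
  exact ⟨j, hj, (hK.mul hj).unique h⟩

theorem IsLog.of_CT {Λ K : ℕ → MvPowerSeries σ ℂ} {l k : MvPowerSeries σ ℂ}
    (h : ∀ᶠ L in atTop, IsLog (Λ L) (K L)) (hΛ : CT Λ l) (hK : CT K k) : IsLog l k := by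
  refine ⟨?_, ?_, fun i => ?_⟩
  · exact tendsto_nhds_unique (hΛ 0) ((tendsto_const_nhds (x := (0 : ℂ))).congr'
      (h.mono fun L hL => hL.left.symm))
  · exact tendsto_nhds_unique (hK 0) ((tendsto_const_nhds (x := (1 : ℂ))).congr'
      (h.mono fun L hL => hL.right.symm))
  · exact ((hK.pderiv i).congr' (h.mono fun L hL => hL.deriv i)).unique ((hΛ.pderiv i).mul hK)

theorem exists_pos_of_ne_zero {n : σ →₀ ℕ} (hn : n ≠ 0) : ∃ i m, n = m + single i 1 := by
  obtain ⟨i, hi⟩ := Finsupp.ne_iff.mp hn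
  refine ⟨i, n - single i 1, (tsub_add_cancel_of_le ?_).symm⟩
  rw [single_le_iff]
  simp at hi
  omega

/-- Convergence of the logarithms implies convergence of the series. -/
theorem CT.of_log {Λ K : ℕ → MvPowerSeries σ ℂ} {l : MvPowerSeries σ ℂ}
    (h : ∀ᶠ L in atTop, IsLog (Λ L) (K L)) (hΛ : CT Λ l) : ∃ k, CT K k ∧ IsLog l k := by
  classical
  obtain ⟨k, hk⟩ : ∃ k, CT K k := by
    apply CT.of_degree
    intro n hn
    by_cases h0 : n = 0
    · subst h0
      exact ⟨1, (tendsto_const_nhds (x := (1 : ℂ))).congr' (h.mono fun L hL => hL.right.symm)⟩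
    · obtain ⟨i, m, rfl⟩ := exists_pos_of_ne_zero h0
      have h2 : ∀ p ∈ antidiagonal m,
          ∃ x, Tendsto (fun L => coeff p.1 (MvPowerSeries.pderiv ℂ i (Λ L)) *
            coeff p.2 (K L)) atTop (𝓝 x) := by
        rintro ⟨p, q⟩ hpq
        rw [mem_antidiagonal] at hpq
        obtain ⟨x, hx⟩ := hn q (by
          rw [← hpq, map_add, map_add, degree_single]
          simp only
          omega)
        exact ⟨_, ((hΛ.pderiv i) p).mul hx⟩
      choose! x hx using h2
      refine ⟨_, ((tendsto_finsetSum _ hx).div_const ((m i : ℂ) + 1)).congr' ?_⟩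
      filter_upwards [h] with L hL
      rw [← coeff_mul, ← hL.deriv i, coeff_pderiv]
      have : (m i : ℂ) + 1 ≠ 0 := by exact_mod_cast succ_ne_zero (m i)
      field_simp
  exact ⟨k, hk, IsLog.of_CT h hΛ hk⟩

/-- Convergence of the series implies convergence of the logarithms. -/
theorem CT.log {Λ K : ℕ → MvPowerSeries σ ℂ} {k : MvPowerSeries σ ℂ}
    (h : ∀ᶠ L in atTop, IsLog (Λ L) (K L)) (hK : CT K k) : ∃ l, CT Λ l ∧ IsLog l k := by
  have hk1 : constantCoeff k = 1 :=
    tendsto_nhds_unique (hK 0) ((tendsto_const_nhds (x := (1 : ℂ))).congr'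
      (h.mono fun L hL => hL.right.symm))
  obtain ⟨l, hl⟩ : ∃ l, CT Λ l := by
    apply CT.of_coeff
    intro n
    by_cases h0 : n = 0
    · subst h0
      exact ⟨0, (tendsto_const_nhds (x := (0 : ℂ))).congr' (h.mono fun L hL => hL.left.symm)⟩
    · obtain ⟨i, m, rfl⟩ := exists_pos_of_ne_zero h0
      obtain ⟨j, hj, -⟩ := hK.of_mul (J := fun L => MvPowerSeries.pderiv ℂ i (Λ L))
        (by rw [hk1]; exact one_ne_zero)
        ((hK.pderiv i).congr' (h.mono fun L hL => by rw [hL.deriv i, mul_comm]))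
      refine ⟨_, ((hj m).div_const ((m i : ℂ) + 1)).congr fun L => ?_⟩
      rw [coeff_pderiv]
      have : (m i : ℂ) + 1 ≠ 0 := by exact_mod_cast succ_ne_zero (m i)
      field_simp
  exact ⟨l, hl, IsLog.of_CT h hl hK⟩

end CT

section Operators

variable {σ : Type*}

/-- The operator `(1 + u_i) (α + s(u_i) + ε u_i ∂_i)`. -/
def opP (i : σ) (α ε : ℂ) (s : PowerSeries ℂ) (K : MvPowerSeries σ ℂ) : MvPowerSeries σ ℂ :=
  (1 + X i) * ((C α + emb i s) * K + C ε * (X i * pderiv ℂ i K))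

/-- The operator `u_j (1 + u_i) (α + s(u_i) + ε u_i ∂_i) - u_i (1 + u_j) (β + s(u_j) + ε u_j ∂_j)`. -/
def opB (i j : σ) (α β ε : ℂ) (s : PowerSeries ℂ) (K : MvPowerSeries σ ℂ) : MvPowerSeries σ ℂ :=
  X j * opP i α ε s K - X i * opP j β ε s K

theorem coeff_single_add_X_mul (i : σ) (J : MvPowerSeries σ ℂ) (m : σ →₀ ℕ) :
    coeff (single i 1 + m) (X i * J) =
      coeff m J := by
  rw [X, MvPowerSeries.coeff_add_monomial_mul, one_mul]

theorem coeff_X_mul_of_eq_zero {i : σ} (J : MvPowerSeries σ ℂ) {n : σ →₀ ℕ} (hn : n i = 0) :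
    coeff n (X i * J) = 0 := by
  classical
  rw [X, MvPowerSeries.coeff_monomial_mul, if_neg]
  rw [single_le_iff]
  omega

theorem coeff_X_mul_pderiv (i : σ) (K : MvPowerSeries σ ℂ) (n : σ →₀ ℕ) :
    coeff n (X i * pderiv ℂ i K) = (n i : ℂ) * coeff n K := by
  classical
  by_cases hn : n i = 0
  · rw [hn, Nat.cast_zero, zero_mul]
    exact coeff_X_mul_of_eq_zero _ hn
  · obtain ⟨m, rfl⟩ : ∃ m, n = single i 1 + m := ⟨n - single i 1, (add_tsub_cancel_of_le (by
        rw [single_le_iff]; omega)).symm⟩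
    rw [coeff_single_add_X_mul, coeff_pderiv, add_comm m]
    simp only [Finsupp.add_apply, Finsupp.single_eq_same]
    push_cast
    ring

theorem CT.opP {i : σ} {α ε : ℕ → ℂ} {s : ℕ → PowerSeries ℂ} {K : ℕ → MvPowerSeries σ ℂ}
    {a : ℂ} {t : PowerSeries ℂ} {k : MvPowerSeries σ ℂ}
    (hα : Tendsto α atTop (𝓝 a)) (hε : Tendsto ε atTop (𝓝 0)) (hs : CT s t) (hK : CT K k) :
    CT (fun L => opP i (α L) (ε L) (s L) (K L))
      ((1 + X i) * ((MvPowerSeries.C a + SchurCLT.emb i t) * k)) := by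
  have := (CT.const (1 + X i)).mul (((((CT.C hα).add (hs.emb i)).mul hK)).add
    ((CT.C hε).mul ((CT.const (X i)).mul (hK.pderiv i))))
  simpa using! this

/-- The limit of the operators `opB`: multiplication by `u_j g(u_i) - u_i g(u_j)`. -/
def mulB (i j : σ) (g : PowerSeries ℂ) : MvPowerSeries σ ℂ := X j * emb i g - X i * emb j g

/-- The derivative carries the coefficient ε → 0, so only multiplication survives in the limit. -/
theorem CT.opB {i j : σ} {α β ε : ℕ → ℂ} {s : ℕ → PowerSeries ℂ} {K : ℕ → MvPowerSeries σ ℂ}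
    {t : PowerSeries ℂ} {k : MvPowerSeries σ ℂ}
    (hα : Tendsto α atTop (𝓝 1)) (hβ : Tendsto β atTop (𝓝 1)) (hε : Tendsto ε atTop (𝓝 0))
    (hs : CT s t) (hK : CT K k) : CT (fun L => SchurCLT.opB i j (α L) (β L) (ε L) (s L) (K L))
      (mulB i j ((1 + PowerSeries.X) * (1 + t)) * k) := by
  have := ((CT.const (X j)).mul (CT.opP (i := i) hα hε hs hK)).sub
    ((CT.const (X i)).mul (CT.opP (i := j) hβ hε hs hK))
  convert! this using 1
  simp only [mulB, map_mul, map_add, map_one, emb_X]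
  ring

/-- The coefficients of `opP i K` and of `K` converge simultaneously. -/
theorem tendsto_coeff_opP {i : σ} {α ε : ℕ → ℂ} {s : ℕ → PowerSeries ℂ}
    {K : ℕ → MvPowerSeries σ ℂ} {t : PowerSeries ℂ}
    (hα : Tendsto α atTop (𝓝 1)) (hε : Tendsto ε atTop (𝓝 0)) (hs : CT s t)
    (hs0 : ∀ L, PowerSeries.constantCoeff (s L) = 0)
    (n : σ →₀ ℕ) (hK : ∀ m : σ →₀ ℕ, m.degree < n.degree →
        ∃ x, Tendsto (fun L => coeff m (K L)) atTop (𝓝 x)) :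
    ∃ x, Tendsto (fun L => coeff n (opP i (α L) (ε L) (s L) (K L)) -
      (α L + ε L * n i) * coeff n (K L)) atTop (𝓝 x) := by
  obtain ⟨x, hx⟩ := tendsto_coeff_mul_sub (J := K)
    ((CT.const (1 + X i)).mul ((CT.C hα).add (hs.emb i))) n hK
  have hJ : ∀ m : σ →₀ ℕ, m.degree < n.degree → ∃ x, Tendsto (fun L => coeff m
        (C (ε L) * (X i * pderiv ℂ i (K L)))) atTop
          (𝓝 x) := by
    intro m hm
    obtain ⟨x, hx⟩ := hK m hm
    simp only [coeff_C_mul, coeff_X_mul_pderiv]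
    exact ⟨_, hε.mul (hx.const_mul _)⟩
  obtain ⟨y, hy⟩ := tendsto_coeff_mul_sub (CT.const (1 + X i)) n hJ
  refine ⟨_, (hx.add hy).congr fun L => ?_⟩
  simp only [opP, mul_add, map_add, coeff_C_mul, coeff_X_mul_pderiv, map_mul, map_one,
    MvPowerSeries.constantCoeff_X, MvPowerSeries.constantCoeff_C, constantCoeff_emb, hs0]
  ring_nf

/-- The limit is multiplication by a series with leading form u_j - u_i, which is not a unit, so
division as in `CT.of_mul` is impossible. Instead the coefficients of `K` are found by induction on
the degree and, within one degree, on the exponent of u_i: the coefficient of u_j u^n in the image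
expresses K_n through coefficients of smaller degree and the one at n with a factor u_i replaced by
u_j. -/
theorem CT.of_opB {i j : σ} (hij : i ≠ j) {α β ε : ℕ → ℂ} {s : ℕ → PowerSeries ℂ}
    {K : ℕ → MvPowerSeries σ ℂ} {t : PowerSeries ℂ} {r : MvPowerSeries σ ℂ}
    (hα : Tendsto α atTop (𝓝 1)) (hβ : Tendsto β atTop (𝓝 1)) (hε : Tendsto ε atTop (𝓝 0))
    (hs : CT s t) (hs0 : ∀ L, PowerSeries.constantCoeff (s L) = 0)
    (h : CT (fun L => SchurCLT.opB i j (α L) (β L) (ε L) (s L) (K L)) r) :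
    ∃ k, CT K k ∧ mulB i j ((1 + PowerSeries.X) * (1 + t)) * k = r := by
  classical
  obtain ⟨k, hk⟩ : ∃ k, CT K k := by
    apply CT.of_degree
    intro n hn
    induction hd : n i generalizing n with
    | zero =>
      -- Without u_i in the monomial the second summand u_i (…) does not contribute, and the
      -- coefficient is (α + ε n_i) K_n up to smaller degrees.
      have h1 := h (single j 1 + n)
      simp only [SchurCLT.opB, map_sub, coeff_single_add_X_mul] at h1
      have h2 : ∀ J : MvPowerSeries σ ℂ, coeff (single j 1 + n)
          (X i * J) = 0 := fun J =>
        coeff_X_mul_of_eq_zero _ (by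
          rw [Finsupp.add_apply, hd, Finsupp.single_eq_of_ne hij])
      simp only [h2, sub_zero] at h1
      obtain ⟨x, hx⟩ := tendsto_coeff_opP (i := i) hα hε hs hs0 n hn
      have h3 : Tendsto (fun L => α L + ε L * n i) atTop (𝓝 1) := by
        simpa using hα.add (hε.mul_const (n i : ℂ))
      refine ⟨_, ((h1.sub hx).div h3 one_ne_zero).congr' ?_⟩
      filter_upwards [h3.eventually_ne one_ne_zero] with L hL
      rw [Pi.div_apply, div_eq_iff hL]
      ring
    | succ e ih =>
      obtain ⟨m, rfl⟩ : ∃ m, n = single i 1 + m := ⟨n - single i 1, (add_tsub_cancel_of_le (by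
          rw [single_le_iff]; omega)).symm⟩
      have hdeg : (single j 1 + m).degree = (single i 1 + m).degree := by
        simp [map_add, degree_single]
      obtain ⟨y, hy⟩ := ih (single j 1 + m) (fun p hp => hn p (by rwa [← hdeg])) (by
        rw [Finsupp.add_apply, Finsupp.single_eq_same] at hd
        rw [Finsupp.add_apply, Finsupp.single_eq_of_ne hij]
        omega)
      -- Now both summands contribute; the second one involves the exponent u_j u^m, of the same
      -- degree but with one u_i less, which is covered by `ih`.
      have h1 := h (single j 1 + (single i 1 + m))
      simp only [SchurCLT.opB, map_sub, coeff_single_add_X_mul] at h1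
      simp only [add_left_comm (single j 1) (single i 1) m, coeff_single_add_X_mul] at h1
      obtain ⟨x, hx⟩ := tendsto_coeff_opP (i := i) hα hε hs hs0 (single i 1 + m) hn
      obtain ⟨z, hz⟩ := tendsto_coeff_opP (i := j) hβ hε hs hs0 (single j 1 + m)
        (fun p hp => hn p (by rwa [← hdeg]))
      have h3 : ∀ e : ℕ, Tendsto (fun L => α L + ε L * e) atTop (𝓝 1) := fun e => by
        simpa using hα.add (hε.mul_const (e : ℂ))
      have h4 : ∀ e : ℕ, Tendsto (fun L => β L + ε L * e) atTop (𝓝 1) := fun e => by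
        simpa using hβ.add (hε.mul_const (e : ℂ))
      refine ⟨_, (((h1.sub hx).add (hz.add ((h4 ((single j 1 + m : σ →₀ ℕ) j)).mul hy))).div
        (h3 ((single i 1 + m : σ →₀ ℕ) i)) one_ne_zero).congr' ?_⟩
      filter_upwards [(h3 ((single i 1 + m : σ →₀ ℕ) i)).eventually_ne one_ne_zero] with L hL
      rw [Pi.div_apply, div_eq_iff hL]
      ring
  exact ⟨k, hk, (CT.opB hα hβ hε hs hk).unique h⟩

end Operators

end

/-! ### The bialternant formula for Schur polynomials. -/

/-- The shifted coordinates `λ_i + N - i` of a signature. -/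
def shifted {N : ℕ} (lam : Fin N → ℤ) (j : Fin N) : ℤ := lam j + N - (j + 1)

/-- The Vandermonde product `∏_{i < j} (x_i - x_j)`. -/
def vdm {N : ℕ} (x : Fin N → ℂ) : ℂ := ∏ i, ∏ j ∈ Finset.Ioi i, (x i - x j)

theorem prod_zpow_eq {ι : Type*} (s : Finset ι) {y : ℂ} (hy : y ≠ 0) (f : ι → ℤ) :
    y ^ ∑ i ∈ s, f i = ∏ i ∈ s, y ^ f i := by
  classical
  induction s using Finset.induction_on with
  | empty => simp
  | insert a s ha ih => rw [sum_insert ha, prod_insert ha, zpow_add₀ hy, ih]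

theorem zpow_sub_zpow {x y : ℂ} (hx : x ≠ 0) (hy : y ≠ 0) (a : ℤ) (n : ℕ) :
    x ^ (a + n) - y ^ n * x ^ a =
      (x - y) * ∑ m ∈ Finset.Icc a (a + n - 1), x ^ m * y ^ (a + n - 1 - m) := by
  induction n with
  | zero => simp
  | succ n ih =>
    have h1 : Finset.Icc a (a + (n + 1 : ℕ) - 1) = insert (a + n) (Finset.Icc a (a + n - 1)) := by
      ext m
      simp only [mem_Icc, mem_insert]
      push_cast
      omega
    rw [h1, sum_insert (by simp)]
    have h2 : ∀ m : ℤ, x ^ m * y ^ (a + (n + 1 : ℕ) - 1 - m) =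
        y * (x ^ m * y ^ (a + n - 1 - m)) := by
      intro m
      rw [show a + (n + 1 : ℕ) - 1 - m = (a + n - 1 - m) + 1 by push_cast; ring, zpow_add_one₀ hy]
      ring
    simp only [h2]
    rw [← mul_sum, mul_add]
    have h3 : y * (x ^ (a + (n : ℤ)) * y ^ (a + n - 1 - (a + n))) = x ^ (a + (n : ℤ)) := by
      rw [show a + n - 1 - (a + n) = (-1 : ℤ) by ring, zpow_neg_one]
      field_simp
    rw [h3, show a + ((n + 1 : ℕ) : ℤ) = (a + n) + 1 by push_cast; ring, zpow_add_one₀ hx]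
    linear_combination y * ih

/-- Reversing the order of the columns turns this into the statement about subtracting the preceding
column; the sign of the reversal appears on both sides and cancels. -/
theorem det_eq_of_forall_col_eq_add_smul_succ {n : ℕ} {A B : Matrix (Fin (n + 1)) (Fin (n + 1)) ℂ}
    (c : Fin n → ℂ) (hl : ∀ i, A i (Fin.last n) = B i (Fin.last n))
    (hs : ∀ i (j : Fin n), A i j.castSucc = B i j.castSucc + c j * A i j.succ) : A.det = B.det := by
  have h := Matrix.det_eq_of_forall_col_eq_smul_add_pred (A := A.submatrix id Fin.revPerm)
    (B := B.submatrix id Fin.revPerm) (fun j => c (Fin.rev j))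
    (fun i => by simp [Fin.rev_zero, hl])
    (fun i j => by
      simp only [submatrix_apply, id, Fin.revPerm_apply, Fin.rev_succ, Fin.rev_castSucc]
      exact hs i (Fin.rev j))
  rw [det_permute', det_permute'] at h
  have hu : ((Equiv.Perm.sign (Fin.revPerm (n := n + 1)) : ℤ) : ℂ) ≠ 0 := by
    exact_mod_cast Units.ne_zero _
  exact mul_left_cancel₀ hu h

theorem det_of_sum_col {n : ℕ} {κ : Type*} [DecidableEq κ] (S : Fin n → Finset κ)
    (a : Fin n → Fin n → κ → ℂ) : Matrix.det (Matrix.of fun i j => ∑ m ∈ S j, a i j m) =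
      ∑ μ ∈ Fintype.piFinset S, Matrix.det (Matrix.of fun i j => a i j (μ j)) := by
  rw [← Matrix.det_transpose]
  have h := (Matrix.detRowAlternating (n := Fin n) (R := ℂ)).toMultilinearMap.map_sum_finset
    (fun j m => fun i => a i j m) S
  have h1 : Matrix.transpose (Matrix.of fun i j => ∑ m ∈ S j, a i j m) =
      (fun j => ∑ m ∈ S j, (fun i => a i j m)) := by
    ext j i
    simp [Finset.sum_apply]
  rw [h1]
  refine h.trans ?_
  apply sum_congr rfl
  intro μ _
  rw [← Matrix.det_transpose]
  rfl

theorem vdm_castSucc {N : ℕ} (x : Fin (N + 1) → ℂ) :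
    vdm x = vdm (fun i => x i.castSucc) * ∏ i : Fin N, (x i.castSucc - x (Fin.last N)) := by
  simp only [vdm]
  rw [Fin.prod_univ_castSucc]
  have h1 : Finset.Ioi (Fin.last N) = ∅ := by ext i; simp [Fin.le_last]
  rw [h1, Finset.prod_empty, mul_one, ← prod_mul_distrib]
  apply prod_congr rfl
  intro i _
  have h2 : Finset.Ioi i.castSucc = insert (Fin.last N) ((Finset.Ioi i).map Fin.castSuccEmb) := by
    ext j
    refine Fin.lastCases ?_ (fun j => ?_) j
    · simp [Fin.castSucc_lt_last]
    · simp only [mem_Ioi, Fin.castSucc_lt_castSucc_iff, mem_insert,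
        (Fin.castSucc_lt_last j).ne, Finset.mem_map, Fin.coe_castSuccEmb, Fin.castSucc_inj,
        exists_eq_right, false_or]
  rw [h2, prod_insert (by
    simp only [Finset.mem_map, not_exists, not_and]
    intro j _ hj
    exact (Fin.castSucc_lt_last j).ne hj), prod_map, mul_comm]
  rfl

/-- The bialternant formula for Schur polynomials. -/
theorem schur_mul_vdm : ∀ (N : ℕ) (lam : Fin N → ℤ), Antitone lam → ∀ x : Fin N → ℂ,
    (∀ i, x i ≠ 0) → schur N lam x * vdm x = Matrix.det (Matrix.of fun i j => x i ^ shifted lam j)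
  | 0, lam, _, x, _ => by simp [schur, vdm]
  | N + 1, lam, hlam, x, hx => by
    set y := x (Fin.last N) with hy
    have hy0 : y ≠ 0 := hx _
    let z : Fin N → ℂ := fun i => x i.castSucc
    have hz : ∀ i, z i ≠ 0 := fun i => hx _
    have hmono : ∀ j : Fin N, lam j.succ ≤ lam j.castSucc := fun j =>
      hlam (Fin.castSucc_lt_succ).le
    -- The gap between consecutive shifted coordinates; it is also the number of values that μ_j can
    -- take between λ_{j+1} and λ_j.
    let d : Fin N → ℕ := fun j => (lam j.castSucc - lam j.succ + 1).toNat
    have hd : ∀ j, (d j : ℤ) = lam j.castSucc - lam j.succ + 1 := fun j =>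
      Int.toNat_of_nonneg (by have := hmono j; omega)
    have hsh : ∀ j : Fin N, shifted lam j.castSucc = shifted lam j.succ + d j := by
      intro j
      simp only [shifted, hd, Fin.val_castSucc, Fin.val_succ]
      push_cast
      ring
    -- Subtracting y^{d_j} times the next column kills the last row except for its last entry. Each
    -- remaining entry is z_i - y times a geometric sum over the interlacing interval, so expanding
    -- the minor over these sums reproduces the branching rule.
    let B : Matrix (Fin (N + 1)) (Fin (N + 1)) ℂ := Matrix.of fun i j =>
      Fin.lastCases (x i ^ shifted lam (Fin.last N))
        (fun j : Fin N => x i ^ shifted lam j.castSucc - y ^ d j * x i ^ shifted lam j.succ) j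
    have hdet : Matrix.det (Matrix.of fun i j => x i ^ shifted lam j) = B.det := by
      apply det_eq_of_forall_col_eq_add_smul_succ (fun j => y ^ d j)
      · intro i; simp [B]
      · intro i j; simp [B]
    have hBlast : ∀ j : Fin N, B (Fin.last N) j.castSucc = 0 := by
      intro j
      simp only [B, of_apply, Fin.lastCases_castSucc]
      rw [hsh, zpow_add₀ hy0, ← hy, zpow_natCast]
      ring
    have hexp : B.det = y ^ lam (Fin.last N) *
        Matrix.det (Matrix.of fun i j : Fin N => B i.castSucc j.castSucc) := by
      rw [Matrix.det_succ_row B (Fin.last N), Fin.sum_univ_castSucc]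
      rw [sum_eq_zero (fun j _ => by rw [hBlast]; ring), zero_add]
      have h1 : B (Fin.last N) (Fin.last N) = y ^ lam (Fin.last N) := by
        simp only [B, of_apply, Fin.lastCases_last, ← hy]
        congr 1
        simp [shifted]
      rw [h1, Even.neg_one_pow ⟨_, rfl⟩, one_mul]
      congr 2
      ext i j
      simp [submatrix_apply, Fin.succAbove_last]
    have hent : ∀ i j : Fin N, B i.castSucc j.castSucc =
        (z i - y) * ∑ m ∈ Finset.Icc (lam j.succ) (lam j.castSucc),
          z i ^ (m + N - (j + 1)) * y ^ (lam j.castSucc - m) := by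
      intro i j
      simp only [B, of_apply, Fin.lastCases_castSucc]
      rw [hsh, zpow_sub_zpow (hx _) hy0]
      congr 1
      have hmap : Finset.Icc (shifted lam j.succ) (shifted lam j.succ + d j - 1) =
          (Finset.Icc (lam j.succ) (lam j.castSucc)).map
            (addRightEmbedding ((N : ℤ) - (j + 1))) := by
        rw [Finset.map_add_right_Icc]
        congr 1
        · simp only [shifted, Fin.val_succ]; push_cast; ring
        · simp only [shifted, hd, Fin.val_succ]; push_cast; ring
      rw [hmap, sum_map]
      apply sum_congr rfl
      intro m _
      simp only [addRightEmbedding_apply, z]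
      congr 2
      · ring
      · simp only [shifted, hd, Fin.val_succ]; push_cast; ring
    have hminor : Matrix.det (Matrix.of fun i j : Fin N => B i.castSucc j.castSucc) =
        (∏ i, (z i - y)) * ∑ μ ∈ Finset.Icc (fun i : Fin N => lam i.succ)
            (fun i : Fin N => lam i.castSucc), y ^ (∑ j : Fin N, lam j.castSucc - ∑ j, μ j) *
            Matrix.det (Matrix.of fun i j => z i ^ shifted μ j) := by
      simp only [hent]
      have h1 := det_mul_column (fun i => z i - y)
        (Matrix.of fun i j : Fin N => ∑ m ∈ Finset.Icc (lam j.succ) (lam j.castSucc),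
          z i ^ (m + N - (j + 1)) * y ^ (lam j.castSucc - m))
      refine h1.trans ?_
      congr 1
      rw [det_of_sum_col (fun j => Finset.Icc (lam j.succ) (lam j.castSucc))
        (fun i j m => z i ^ (m + N - (j + 1)) * y ^ (lam j.castSucc - m))]
      rw [Pi.Icc_eq]
      apply sum_congr rfl
      intro μ _
      have h2 := Matrix.det_mul_row (fun j : Fin N => y ^ (lam j.castSucc - μ j))
        (Matrix.of fun i j : Fin N => z i ^ shifted μ j)
      rw [← sum_sub_distrib, prod_zpow_eq _ hy0, ← h2]
      congr 1
      ext i j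
      simp only [of_apply, shifted]
      ring
    rw [hdet, hexp, hminor, vdm_castSucc, schur, sum_mul, mul_sum, mul_sum]
    apply sum_congr rfl
    intro μ hμ
    rw [mem_Icc] at hμ
    have hμa : Antitone μ := by
      intro i j hij
      rcases eq_or_lt_of_le hij with rfl | hlt
      · exact le_rfl
      · refine (hμ.2 j).trans (le_trans (hlam ?_) (hμ.1 i))
        rw [Fin.le_def, Fin.val_succ, Fin.val_castSucc]
        exact hlt
    rw [← schur_mul_vdm N μ hμa z hz, Fin.sum_univ_castSucc,
      show ∑ i : Fin N, lam i.castSucc + lam (Fin.last N) - ∑ i, μ i =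
        lam (Fin.last N) + (∑ j : Fin N, lam j.castSucc - ∑ j, μ j) by ring, zpow_add₀ hy0]
    ring

/-! ### Interpolation weights, and Schur polynomials with most variables equal to 1. -/

section

open PowerSeries (C coeff)

theorem continuousAt_schur : ∀ (N : ℕ) (lam : Fin N → ℤ) (x : Fin N → ℂ), (∀ i, x i ≠ 0) →
    ContinuousAt (schur N lam) x
  | 0, _, _, _ => continuousAt_const
  | N + 1, lam, x, hx => by
    have h : schur (N + 1) lam = fun x => ∑ mu ∈ Finset.Icc (fun i : Fin N => lam i.succ)
        (fun i : Fin N => lam i.castSucc), schur N mu (fun i => x i.castSucc) *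
          x (Fin.last N) ^ (∑ i, lam i - ∑ i, mu i) := by
      funext x; rw [schur]
    rw [h]
    apply tendsto_finsetSum
    intro mu _
    refine Tendsto.mul ?_ ?_
    · have h1 := continuousAt_schur N mu (fun i => x i.castSucc) (fun i => hx _)
      exact ContinuousAt.comp (f := fun x : Fin (N + 1) → ℂ => fun i : Fin N => x i.castSucc)
        h1 (continuous_pi fun i => continuous_apply _).continuousAt
    · exact (continuousAt_zpow₀ _ _ (Or.inl (hx _))).comp
        (f := fun x : Fin (N + 1) → ℂ => x (Fin.last N)) (continuous_apply _).continuousAt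

section Weights

variable {N : ℕ}

/-- The weights `1 / ∏_{m ≠ j} (a_j - a_m)`. -/
def wt (a : Fin N → ℂ) (j : Fin N) : ℂ := (∏ m ∈ univ.erase j, (a j - a m))⁻¹

/-- This is Lagrange interpolation of the constant 1 at the nodes a_j, evaluated at 1/t and
multiplied by t^{N-1}. -/
theorem sum_wt_mul_prod [NeZero N] {a : Fin N → ℂ} (ha : Function.Injective a) :
    ∑ j, Polynomial.C (wt a j) * ∏ m ∈ univ.erase j, (1 - Polynomial.C (a m) * Polynomial.X) =
      Polynomial.X ^ (N - 1) := by
  apply Polynomial.eq_of_infinite_eval_eq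
  -- The evaluation at 1/t needs t ≠ 0; a polynomial identity on this infinite set suffices.
  apply Set.Infinite.mono (s := {0}ᶜ)
  · intro t (ht : t ≠ 0)
    simp only [Set.mem_ofPred_eq, eval_finsetSum, eval_mul, eval_C,
      eval_prod, eval_sub, eval_one, eval_X, Polynomial.eval_pow]
    have h1 := Lagrange.sum_basis (s := univ) (v := a) ha.injOn
      ⟨(0 : Fin N), mem_univ _⟩
    have h2 := congrArg (eval t⁻¹) h1
    simp only [eval_finsetSum, eval_one, Lagrange.basis, Lagrange.basisDivisor,
      eval_prod, eval_mul, eval_C, eval_sub, eval_X] at h2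
    refine Eq.trans ?_ ((congrArg (t ^ (N - 1) * ·) h2).trans (mul_one _))
    rw [mul_sum]
    clear h1 h2
    apply sum_congr rfl
    intro j _
    rw [prod_mul_distrib, wt, Finset.prod_inv_distrib, mul_left_comm]
    congr 1
    have h3 : t ^ (N - 1) = ∏ m ∈ univ.erase j, t := by
      rw [prod_const, Finset.card_erase_of_mem (mem_univ _), card_univ, card_fin]
    rw [h3, ← prod_mul_distrib]
    apply prod_congr rfl
    intro m _
    field_simp
  · exact (Set.finite_singleton _).infinite_compl

/-- The generating function of the moments `∑_j w_j a_j^n`. -/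
def momentSeries (a : Fin N → ℂ) : PowerSeries ℂ := PowerSeries.mk fun n => ∑ j, wt a j * a j ^ n

/-- The polynomial `∏_j (1 - a_j t)`. -/
def denomSeries (a : Fin N → ℂ) : PowerSeries ℂ := ∏ j, (1 - C (a j) * PowerSeries.X)

theorem geom_mul (b : ℂ) : (PowerSeries.mk fun n => b ^ n) * (1 - C b * PowerSeries.X) = 1 := by
  ext n
  rw [mul_sub, mul_one, ← mul_assoc, map_sub]
  rcases n with _ | n
  · simp
  · rw [PowerSeries.coeff_succ_mul_X, PowerSeries.coeff_mul_C, coeff_mk,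
      coeff_mk, PowerSeries.coeff_one, if_neg (succ_ne_zero n), pow_succ, sub_self]

theorem momentSeries_eq (a : Fin N → ℂ) :
    momentSeries a = ∑ j, C (wt a j) * PowerSeries.mk fun n => a j ^ n := by
  ext n
  simp [momentSeries]

theorem momentSeries_mul_denomSeries [NeZero N] {a : Fin N → ℂ} (ha : Function.Injective a) :
    momentSeries a * denomSeries a = PowerSeries.X ^ (N - 1) := by
  have h := congrArg (fun p : Polynomial ℂ => (p : PowerSeries ℂ)) (sum_wt_mul_prod ha)
  simp only [Polynomial.coe_pow, coe_X] at h
  rw [← h, momentSeries_eq, sum_mul]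
  have hs : ((∑ j, Polynomial.C (wt a j) * ∏ m ∈ univ.erase j,
      (1 - Polynomial.C (a m) * Polynomial.X) : Polynomial ℂ) : PowerSeries ℂ) =
      ∑ j, C (wt a j) * ∏ m ∈ univ.erase j, (1 - C (a m) * PowerSeries.X) := by
    rw [← coeToPowerSeries.ringHom_apply, map_sum]
    apply sum_congr rfl
    intro j _
    rw [map_mul, map_prod]
    simp [coeToPowerSeries.ringHom_apply]
  rw [hs]
  apply sum_congr rfl
  intro j _
  rw [denomSeries, ← mul_prod_erase univ _ (mem_univ j), mul_assoc,
    ← mul_assoc (PowerSeries.mk fun n => a j ^ n), geom_mul, one_mul]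

theorem constantCoeff_denomSeries (a : Fin N → ℂ) :
    PowerSeries.constantCoeff (denomSeries a) = 1 := by
  simp [denomSeries, map_prod]

theorem momentSeries_eq_X_pow_mul [NeZero N] {a : Fin N → ℂ} (ha : Function.Injective a) :
    momentSeries a = PowerSeries.X ^ (N - 1) * (denomSeries a)⁻¹ := by
  rw [← momentSeries_mul_denomSeries ha, mul_assoc, PowerSeries.mul_inv_cancel _ (by
    rw [constantCoeff_denomSeries]; exact one_ne_zero), mul_one]

/-- The generating series of the moments is t^{N-1} / ∏ (1 - a_j t): the n-th moment is the complete
homogeneous polynomial of degree n - N + 1 in the nodes. -/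
theorem sum_wt_mul_pow_of_lt {a : Fin N → ℂ} (ha : Function.Injective a) {n : ℕ}
    (hn : n + 1 < N) : ∑ j, wt a j * a j ^ n = 0 := by
  have : NeZero N := ⟨by omega⟩
  have h := congrArg (coeff n) (momentSeries_eq_X_pow_mul ha)
  rw [momentSeries, coeff_mk, coeff_X_pow_mul', if_neg (by omega)] at h
  exact h

theorem sum_wt_mul_pow_of_eq {a : Fin N → ℂ} (ha : Function.Injective a) {n : ℕ}
    (hn : n + 1 = N) : ∑ j, wt a j * a j ^ n = 1 := by
  have : NeZero N := ⟨by omega⟩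
  have h := congrArg (coeff n) (momentSeries_eq_X_pow_mul ha)
  rw [momentSeries, coeff_mk, coeff_X_pow_mul', if_pos (by omega),
    show n - (N - 1) = 0 by omega, coeff_zero_ps,
    PowerSeries.constantCoeff_inv, constantCoeff_denomSeries, inv_one] at h
  exact h

/-- Newton's identities for the moments. -/
theorem momentSeries_newton [NeZero N] {a : Fin N → ℂ} (ha : Function.Injective a) :
    PowerSeries.X * derivative ℂ (momentSeries a) - C ((N - 1 : ℕ) : ℂ) * momentSeries a =
      (∑ j, ((PowerSeries.mk fun n => a j ^ n) - 1)) * momentSeries a := by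
  have hQ0 : denomSeries a ≠ 0 := by
    intro h
    have := constantCoeff_denomSeries a
    rw [h, map_zero] at this
    exact zero_ne_one this
  have h1 := congrArg (derivative ℂ) (momentSeries_mul_denomSeries ha)
  rw [leibniz, leibniz_pow, derivative_X] at h1
  simp only [smul_eq_mul, nsmul_eq_mul, mul_one] at h1
  -- The logarithmic derivative of ∏ (1 - a_j t) produces the power sums of the nodes.
  have h2 : PowerSeries.X * derivative ℂ (denomSeries a) =
      -denomSeries a * ∑ j, ((PowerSeries.mk fun n => a j ^ n) - 1) := by
    rw [denomSeries]
    induction (univ : Finset (Fin N)) using Finset.induction_on with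
    | empty => simp
    | insert j s hj ih =>
      rw [prod_insert hj, sum_insert hj, leibniz, map_sub, leibniz, derivative_X, derivative_C,
        Derivation.map_one_eq_zero]
      simp only [smul_eq_mul, mul_one, mul_zero, add_zero, zero_sub]
      have h3 := geom_mul (a j)
      linear_combination (1 - C (a j) * PowerSeries.X) * ih +
        (∏ x ∈ s, (1 - C (a x) * PowerSeries.X)) * h3
  have h4 : (PowerSeries.X : PowerSeries ℂ) * (((N - 1 : ℕ) : PowerSeries ℂ) *
      PowerSeries.X ^ (N - 1 - 1)) =
      ((N - 1 : ℕ) : PowerSeries ℂ) * (momentSeries a * denomSeries a) := by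
    rw [momentSeries_mul_denomSeries ha]
    rcases Nat.eq_zero_or_pos (N - 1) with h0 | h0
    · rw [h0]; simp
    · rw [mul_left_comm, ← pow_succ', Nat.sub_add_cancel h0]
  apply mul_right_cancel₀ hQ0
  rw [map_natCast]
  linear_combination PowerSeries.X * h1 - momentSeries a * h2 + h4

/-- In the binomial expansion of (1 + η a_j)^t only moments up to the order t + b occur, and all
moments below N - 1 vanish. -/
theorem sum_wt_one_add_pow {a : Fin N → ℂ} (ha : Function.Injective a) (η : ℂ) (t b : ℕ) :
    (t + b + 1 < N → ∑ j, (1 + η * a j) ^ t * (a j ^ b * wt a j) = 0) ∧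
    (t + b + 1 = N → ∑ j, (1 + η * a j) ^ t * (a j ^ b * wt a j) = η ^ t) := by
  have h : ∑ j, (1 + η * a j) ^ t * (a j ^ b * wt a j) =
      ∑ s ∈ range (t + 1), (t.choose s : ℂ) * η ^ s * ∑ j, wt a j * a j ^ (s + b) := by
    simp only [mul_sum]
    rw [Finset.sum_comm]
    apply sum_congr rfl
    intro j _
    rw [add_comm, add_pow, sum_mul]
    apply sum_congr rfl
    intro s _
    rw [mul_pow, pow_add]
    ring
  rw [h]
  constructor
  · intro hlt
    apply sum_eq_zero
    intro s hs
    rw [mem_range] at hs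
    rw [sum_wt_mul_pow_of_lt ha (by omega), mul_zero]
  · intro heq
    rw [sum_range_succ, sum_eq_zero, zero_add, sum_wt_mul_pow_of_eq ha (by omega)]
    · simp
    · intro s hs
      rw [mem_range] at hs
      rw [sum_wt_mul_pow_of_lt ha (by omega), mul_zero]

end Weights

theorem vdm_append {r M : ℕ} (x : Fin r → ℂ) (y : Fin M → ℂ) :
    vdm (Fin.append x y) = vdm x * (∏ i, ∏ t, (x i - y t)) * vdm y := by
  have h : ∀ {n : ℕ} (z : Fin n → ℂ), vdm z = ∏ i, ∏ j, if i < j then z i - z j else 1 := by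
    intro n z
    simp only [vdm]
    apply prod_congr rfl
    intro i _
    rw [← prod_filter]
    apply prod_congr _ fun _ _ => rfl
    ext j; simp
  have h1 : ∀ (i : Fin r) (j : Fin M), Fin.castAdd M i < Fin.natAdd r j := by
    intro i j; rw [Fin.lt_def]; simp only [Fin.val_castAdd, Fin.val_natAdd]; omega
  have h2 : ∀ (i : Fin r) (j : Fin M), ¬ Fin.natAdd r j < Fin.castAdd M i := by
    intro i j; rw [Fin.lt_def]; simp only [Fin.val_castAdd, Fin.val_natAdd]; omega
  have h3 : ∀ (i j : Fin r), Fin.castAdd M i < Fin.castAdd M j ↔ i < j := by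
    intro i j; rw [Fin.lt_def, Fin.lt_def]; simp
  have h4 : ∀ (i j : Fin M), Fin.natAdd r i < Fin.natAdd r j ↔ i < j := by
    intro i j; rw [Fin.lt_def, Fin.lt_def]; simp
  rw [h, h x, h y]
  simp only [Fin.prod_univ_add, Fin.append_left, Fin.append_right, h1, h2, h3, h4, if_true,
    if_false, Finset.prod_const_one, prod_mul_distrib]
  ring

/-- The sign of the order reversal. -/
def revSign (M : ℕ) : ℂ := ((Equiv.Perm.sign (Fin.revPerm (n := M)) : ℤ) : ℂ)

theorem revSign_ne_zero (M : ℕ) : revSign M ≠ 0 := by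
  rw [revSign]; exact_mod_cast Units.ne_zero _

theorem revSign_mul_self (M : ℕ) : revSign M * revSign M = 1 := by
  rw [revSign, ← Int.cast_mul, ← Units.val_mul, Int.units_mul_self]; simp

/-- The matrix `∑_j x_i^{l_j} a_j^b w_j`. -/
def pairMatrix {r N : ℕ} (x : Fin r → ℂ) (l : Fin N → ℤ) (a : Fin N → ℂ) :
    Matrix (Fin r) (Fin r) ℂ := Matrix.of fun i b => ∑ j, x i ^ l j * (a j ^ (b : ℕ) * wt a j)

/-- The determinant of a matrix whose last rows are `(1 + η a_j)^t`. -/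
theorem det_append_eq {r M : ℕ} (x : Fin r → ℂ) (y : Fin M → ℂ) (l : Fin (r + M) → ℤ)
    {a : Fin (r + M) → ℂ} (ha : Function.Injective a) (η : ℂ)
    (hy : ∀ t j, y t ^ l j = (1 + η * a j) ^ (t : ℕ)) :
    Matrix.det (Matrix.of fun i j => Fin.append x y i ^ l j) * ((vandermonde a).det * ∏ j, wt a j) =
      revSign M * (∏ t : Fin M, η ^ (t : ℕ)) * (pairMatrix x l a).det := by
  set W : Matrix (Fin (r + M)) (Fin (r + M)) ℂ := Matrix.of fun j c => wt a j * a j ^ (c : ℕ)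
    with hW
  have hWdet : W.det = (vandermonde a).det * ∏ j, wt a j := by
    have := det_mul_column (fun j => wt a j) (vandermonde a)
    rw [mul_comm, ← this]
    congr 1
  set X : Matrix (Fin (r + M)) (Fin (r + M)) ℂ := Matrix.of fun i j => Fin.append x y i ^ l j
    with hX
  set J : Matrix (Fin M) (Fin M) ℂ := Matrix.of fun t t' =>
    ∑ j, (1 + η * a j) ^ (t : ℕ) * (a j ^ (r + t' : ℕ) * wt a j) with hJ
  rw [← hWdet, ← Matrix.det_mul, ← Matrix.det_submatrix_equiv_self finSumFinEquiv]
  -- Multiplication by the weighted Vandermonde matrix replaces each row by its moments. The last M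
  -- rows are polynomials of degree below M in the nodes, so their moments against the first r
  -- powers vanish and the product is block triangular.
  have hblock : (X * W).submatrix finSumFinEquiv finSumFinEquiv = Matrix.fromBlocks
      (pairMatrix x l a) (Matrix.of fun i (t : Fin M) => ∑ j, x i ^ l j * (a j ^ (r + t : ℕ) * wt a j)) 0 J := by
    ext (i | i) (j | j)
    · simp only [submatrix_apply, finSumFinEquiv_apply_left, Matrix.mul_apply, hX, hW,
        of_apply, Fin.append_left, Matrix.fromBlocks_apply₁₁, pairMatrix, Fin.val_castAdd]
      exact sum_congr rfl fun _ _ => by ring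
    · simp only [submatrix_apply, finSumFinEquiv_apply_left, finSumFinEquiv_apply_right,
        Matrix.mul_apply, hX, hW,
        of_apply, Fin.append_left, Matrix.fromBlocks_apply₁₂, Fin.val_natAdd]
      exact sum_congr rfl fun _ _ => by ring
    · simp only [submatrix_apply, finSumFinEquiv_apply_left, finSumFinEquiv_apply_right,
        Matrix.mul_apply, hX, hW,
        of_apply, Fin.append_right, Matrix.fromBlocks_apply₂₁, Fin.val_castAdd, hy,
        Matrix.zero_apply]
      rw [← (sum_wt_one_add_pow ha η i j).1 (by omega)]
      exact sum_congr rfl fun _ _ => by ring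
    · simp only [submatrix_apply, finSumFinEquiv_apply_right, Matrix.mul_apply, hX, hW, hJ,
        of_apply, Fin.append_right, Matrix.fromBlocks_apply₂₂, Fin.val_natAdd, hy]
      exact sum_congr rfl fun _ _ => by ring
  rw [hblock, Matrix.det_fromBlocks_zero₂₁, mul_comm]
  congr 1
  -- After reversing the columns the order t + r + rev t' + 1 equals N exactly on the diagonal and
  -- is smaller above it.
  have hJ1 : (J.submatrix id Fin.revPerm).det = ∏ t : Fin M, η ^ (t : ℕ) := by
    rw [Matrix.det_of_isLowerTriangular]
    · apply prod_congr rfl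
      intro t _
      simp only [submatrix_apply, id, hJ, of_apply, Fin.revPerm_apply]
      rw [← (sum_wt_one_add_pow ha η t (r + (Fin.rev t : ℕ))).2 (by rw [Fin.val_rev]; omega)]
    · intro t t' htt'
      have htt : t < t' := htt'
      simp only [submatrix_apply, id, hJ, of_apply, Fin.revPerm_apply]
      rw [← (sum_wt_one_add_pow ha η t (r + (Fin.rev t' : ℕ))).1 (by
        rw [Fin.val_rev]; rw [Fin.lt_def] at htt; omega)]
  rw [det_permute'] at hJ1
  rw [← hJ1, ← mul_assoc]
  change _ = revSign M * revSign M * _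
  rw [revSign_mul_self, one_mul]

theorem shifted_strictAnti {N : ℕ} {lam : Fin N → ℤ} (h : Antitone lam) :
    StrictAnti (shifted lam) := by
  intro i j hij
  have h1 := h hij.le
  have h2 : (i : ℤ) < j := by exact_mod_cast hij
  simp only [shifted]
  omega

theorem shifted_cast_injective {N : ℕ} {lam : Fin N → ℤ} (h : Antitone lam) :
    Function.Injective fun j => (shifted lam j : ℂ) := fun i j hij => by
  apply (shifted_strictAnti h).injective
  simp only at hij
  exact_mod_cast hij

theorem tendsto_zpow_slope (l : ℤ) :
    Tendsto (fun η : ℂ => ((1 + η) ^ l - 1) / η) (𝓝[≠] 0) (𝓝 (l : ℂ)) := by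
  have h := hasDerivAt_zpow l (1 : ℂ) (Or.inl one_ne_zero)
  rw [hasDerivAt_iff_tendsto_slope_zero] at h
  simp only [one_zpow, mul_one, smul_eq_mul] at h
  refine h.congr fun η => ?_
  rw [div_eq_inv_mul]

/-- The constants `∏_{t < t' < M} (t - t')`. -/
def vdmConst (M : ℕ) : ℂ := vdm fun t : Fin M => ((t : ℕ) : ℂ)

theorem vdmConst_ne_zero (M : ℕ) : vdmConst M ≠ 0 := by
  rw [vdmConst, vdm, prod_ne_zero_iff]
  intro i _
  rw [prod_ne_zero_iff]
  intro j hj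
  rw [mem_Ioi] at hj
  rw [sub_ne_zero]
  intro h
  exact hj.ne (Fin.ext (by exact_mod_cast h))

theorem vdm_pow (M : ℕ) (η : ℂ) : vdm (fun t : Fin M => (1 + η) ^ (t : ℕ)) =
      (∏ t : Fin M, η ^ (t : ℕ)) * vdm fun t : Fin M => ∑ s ∈ range t, (1 + η) ^ s := by
  have h1 : ∏ t : Fin M, η ^ (t : ℕ) = ∏ t : Fin M, ∏ _j ∈ Finset.Ioi t, η := by
    rw [← Equiv.prod_comp Fin.revPerm]
    apply prod_congr rfl
    intro t _
    rw [prod_const, Fin.card_Ioi, Fin.revPerm_apply, Fin.val_rev]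
    congr 1
    omega
  rw [h1, vdm, vdm, ← prod_mul_distrib]
  apply prod_congr rfl
  intro t _
  rw [← prod_mul_distrib]
  apply prod_congr rfl
  intro t' _
  have h2 : ∀ n : ℕ, (1 + η) ^ n = 1 + η * ∑ s ∈ range n, (1 + η) ^ s := by
    intro n
    have := geom_sum_mul (1 + η) n
    linear_combination -this
  linear_combination h2 t - h2 t'

theorem tendsto_det {ι κ : Type*} [Fintype κ] [DecidableEq κ] {f : Filter ι}
    {A : ι → Matrix κ κ ℂ} {B : Matrix κ κ ℂ}
    (h : ∀ i j, Tendsto (fun η => A η i j) f (𝓝 (B i j))) :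
    Tendsto (fun η => (A η).det) f (𝓝 B.det) := by
  have h1 : Tendsto A f (𝓝 B) := by
    apply tendsto_pi_nhds.mpr
    intro i
    apply tendsto_pi_nhds.mpr
    exact h i
  exact ((continuous_id.matrix_det).tendsto B).comp h1

/-- The Schur polynomial with all but `r` variables equal to `1`. -/
theorem schur_append_one {r M : ℕ} (lam : Fin (r + M) → ℤ) (hlam : Antitone lam) (x : Fin r → ℂ)
    (hx : ∀ i, x i ≠ 0) :
    schur (r + M) lam (Fin.append x 1) * (vdm x * (∏ i, (x i - 1) ^ M) * vdmConst M) *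
      ((vandermonde fun j => (shifted lam j : ℂ)).det * ∏ j, wt (fun j => (shifted lam j : ℂ)) j) =
    revSign M * (pairMatrix x (shifted lam) fun j => (shifted lam j : ℂ)).det := by
  set l := shifted lam with hl
  -- The last M variables are set to (1+η)^t, a deformation of 1. With this choice of nodes (1+η)^{t
  -- l_j} = (1 + η α_j)^t is polynomial in α_j, and α_j → l_j as η → 0.
  set α : ℂ → Fin (r + M) → ℂ := fun η j => ((1 + η) ^ l j - 1) / η with hα
  set y : ℂ → Fin M → ℂ := fun η t => (1 + η) ^ (t : ℕ) with hy
  have hαt : ∀ j, Tendsto (fun η => α η j) (𝓝[≠] 0) (𝓝 (l j : ℂ)) := fun j =>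
    tendsto_zpow_slope (l j)
  have hinj : ∀ i j, i ≠ j → (l i : ℂ) - l j ≠ 0 := fun i j hij =>
    sub_ne_zero.mpr fun h => hij (shifted_cast_injective hlam h)
  have hwt : ∀ j, Tendsto (fun η => wt (α η) j) (𝓝[≠] 0) (𝓝 (wt (fun j => (l j : ℂ)) j)) := by
    intro j
    refine Tendsto.inv₀ (tendsto_finsetProd _ fun m _ => (hαt j).sub (hαt m)) ?_
    rw [prod_ne_zero_iff]
    intro m hm
    exact hinj _ _ (ne_of_mem_erase hm).symm
  have hη0 : Tendsto (fun η : ℂ => 1 + η) (𝓝[≠] 0) (𝓝 1) := by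
    have : Tendsto (fun η : ℂ => 1 + η) (𝓝 0) (𝓝 (1 + 0)) := tendsto_const_nhds.add tendsto_id
    rw [add_zero] at this
    exact this.mono_left nhdsWithin_le_nhds
  have hev : ∀ᶠ η in 𝓝[≠] (0 : ℂ),
      schur (r + M) lam (Fin.append x (y η)) * (vdm x * (∏ i, ∏ t, (x i - y η t)) *
        vdm fun t : Fin M => ∑ s ∈ range t, (1 + η) ^ s) *
        ((vandermonde (α η)).det * ∏ j, wt (α η) j) = revSign M * (pairMatrix x l (α η)).det := by
    have hne : ∀ᶠ η in 𝓝[≠] (0 : ℂ), η ≠ 0 := self_mem_nhdsWithin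
    have hinj' : ∀ᶠ η in 𝓝[≠] (0 : ℂ), ∀ i j, i ≠ j → α η i - α η j ≠ 0 := by
      rw [eventually_all]; intro i
      rw [eventually_all]; intro j
      by_cases hij : i = j
      · simp [hij]
      · filter_upwards [((hαt i).sub (hαt j)).eventually_ne (hinj i j hij)] with η h _
        exact h
    filter_upwards [hne, hinj', hη0.eventually_ne one_ne_zero] with η h0 h1 h2
    have hai : Function.Injective (α η) := by
      intro i j hij
      by_contra hne
      exact h1 i j hne (sub_eq_zero.mpr hij)
    have hrow : ∀ t j, y η t ^ l j = (1 + η * α η j) ^ (t : ℕ) := by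
      intro t j
      have : 1 + η * α η j = (1 + η) ^ l j := by
        simp only [hα]; field_simp; ring
      rw [this]
      simp only [hy]
      rw [← zpow_natCast, ← zpow_natCast, ← zpow_mul, ← zpow_mul, mul_comm]
    have hd := det_append_eq x (y η) l hai η hrow
    rw [← schur_mul_vdm _ lam hlam, vdm_append] at hd
    · have hp : (∏ t : Fin M, η ^ (t : ℕ)) ≠ 0 := prod_ne_zero_iff.mpr fun t _ => pow_ne_zero _ h0
      have hv : vdm (y η) = _ := vdm_pow M η
      rw [hv] at hd
      apply mul_left_cancel₀ hp
      linear_combination hd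
    · intro i
      refine Fin.addCases (fun i => ?_) (fun i => ?_) i
      · rw [Fin.append_left]; exact hx i
      · rw [Fin.append_right]; exact pow_ne_zero _ h2
  have hyt : ∀ t, Tendsto (fun η => y η t) (𝓝[≠] 0) (𝓝 1) := fun t => by
    simpa using hη0.pow (t : ℕ)
  have hL : Tendsto (fun η => schur (r + M) lam (Fin.append x (y η)) *
      (vdm x * (∏ i, ∏ t, (x i - y η t)) * vdm fun t : Fin M => ∑ s ∈ range t, (1 + η) ^ s) *
        ((vandermonde (α η)).det * ∏ j, wt (α η) j)) (𝓝[≠] 0)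
      (𝓝 (schur (r + M) lam (Fin.append x 1) * (vdm x * (∏ i, (x i - 1) ^ M) * vdmConst M) *
      ((vandermonde fun j => (l j : ℂ)).det * ∏ j, wt (fun j => (l j : ℂ)) j))) := by
    refine Tendsto.mul (Tendsto.mul ?_ (Tendsto.mul (Tendsto.mul tendsto_const_nhds ?_) ?_))
      (Tendsto.mul ?_ ?_)
    · refine (continuousAt_schur (r + M) lam (Fin.append x 1) ?_).tendsto.comp ?_
      · intro i
        refine Fin.addCases (fun i => ?_) (fun i => ?_) i
        · rw [Fin.append_left]; exact hx i
        · rw [Fin.append_right]; exact one_ne_zero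
      · rw [tendsto_pi_nhds]
        intro i
        refine Fin.addCases (fun i => ?_) (fun i => ?_) i
        · simp only [Fin.append_left]; exact tendsto_const_nhds
        · simp only [Fin.append_right]; exact hyt i
    · have : ∀ i, (x i - 1) ^ M = ∏ _t : Fin M, (x i - 1) := by intro i; simp
      simp only [this]
      exact tendsto_finsetProd _ fun i _ => tendsto_finsetProd _ fun t _ =>
        tendsto_const_nhds.sub (hyt t)
    · have hs : ∀ t : Fin M, Tendsto (fun η : ℂ => ∑ s ∈ range t, (1 + η) ^ s) (𝓝[≠] 0)
          (𝓝 ((t : ℕ) : ℂ)) := by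
        intro t
        have := tendsto_finsetSum (range t) fun s _ => hη0.pow s
        simpa using this
      exact tendsto_finsetProd _ fun i _ => tendsto_finsetProd _ fun j _ => (hs i).sub (hs j)
    · apply tendsto_det
      intro i j
      exact (hαt i).pow _
    · exact tendsto_finsetProd _ fun j _ => hwt j
  have hR : Tendsto (fun η => revSign M * (pairMatrix x l (α η)).det) (𝓝[≠] 0)
      (𝓝 (revSign M * (pairMatrix x l fun j => (l j : ℂ)).det)) := by
    refine Tendsto.const_mul _ (tendsto_det fun i b => ?_)
    simp only [pairMatrix, of_apply]
    exact tendsto_finsetSum _ fun j _ => tendsto_const_nhds.mul (((hαt j).pow _).mul (hwt j))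
  exact tendsto_nhds_unique (hL.congr' hev) hR

end

/-- Expansion by multilinearity in the rows: choosing the summand f(i) in row i leaves a Vandermonde
matrix in the chosen nodes. -/
theorem det_pairMatrix {r N : ℕ} (x : Fin r → ℂ) (l : Fin N → ℤ) (a : Fin N → ℂ) :
    (pairMatrix x l a).det = ∑ f : Fin r → Fin N,
      (∏ i, x i ^ l (f i) * wt a (f i)) * (vandermonde (a ∘ f)).det := by
  have h := (Matrix.detRowAlternating (n := Fin r) (R := ℂ)).toMultilinearMap.map_sum
    (fun (i : Fin r) (j : Fin N) => fun b : Fin r => x i ^ l j * (a j ^ (b : ℕ) * wt a j))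
  have h1 : pairMatrix x l a =
      fun i => ∑ j, (fun b : Fin r => x i ^ l j * (a j ^ (b : ℕ) * wt a j)) := by
    ext i b
    simp [pairMatrix, Finset.sum_apply]
  rw [h1]
  refine h.trans (sum_congr rfl fun f _ => ?_)
  rw [← det_mul_column (fun i => x i ^ l (f i) * wt a (f i))]
  change Matrix.det _ = _
  congr 1
  ext i b
  simp only [Matrix.vandermonde_apply, Function.comp, of_apply]
  ring

/-- The sign `(-1)^{r(r-1)/2}`. -/
def vdmSign (r : ℕ) : ℂ := ∏ i : Fin r, ∏ _j ∈ Finset.Ioi i, (-1)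

theorem vdmSign_ne_zero (r : ℕ) : vdmSign r ≠ 0 :=
  prod_ne_zero_iff.mpr fun _ _ => prod_ne_zero_iff.mpr fun _ _ => by norm_num

theorem det_vandermonde_eq {r : ℕ} (v : Fin r → ℂ) : (vandermonde v).det = vdmSign r * vdm v := by
  rw [Matrix.det_vandermonde, vdmSign, vdm, ← prod_mul_distrib]
  refine prod_congr rfl fun i _ => ?_
  rw [← prod_mul_distrib]
  exact prod_congr rfl fun j _ => by ring

/-- The point whose first `r` coordinates are given and whose other coordinates are `1`. -/
def pad {r : ℕ} (N : ℕ) (x : Fin r → ℂ) (i : Fin N) : ℂ := if h : (i : ℕ) < r then x ⟨i, h⟩ else 1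

theorem pad_ne_zero {r : ℕ} (N : ℕ) {x : Fin r → ℂ} (hx : ∀ i, x i ≠ 0) (i : Fin N) :
    pad N x i ≠ 0 := by
  rw [pad]; split_ifs
  · exact hx _
  · exact one_ne_zero

theorem pad_eq_append {r M : ℕ} (x : Fin r → ℂ) : pad (r + M) x = Fin.append x 1 := by
  ext i
  refine Fin.addCases (fun i => ?_) (fun i => ?_) i
  · rw [Fin.append_left, pad, dif_pos (by simp)]; rfl
  · rw [Fin.append_right, pad, dif_neg (by simp)]; rfl

/-- The case of no free variables in `schur_append_one`. It gives the normalizing value at 1 in the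
same terms, so that the factors depending on λ cancel in the quotient. -/
theorem schur_one_mul_vdmConst {N : ℕ} (lam : Fin N → ℤ) (hlam : Antitone lam) :
    schur N lam 1 * vdmConst N * ((vandermonde fun j => (shifted lam j : ℂ)).det *
        ∏ j, wt (fun j => (shifted lam j : ℂ)) j) = revSign N := by
  -- The detour through K avoids transporting signatures along 0 + N = N.
  have key : ∀ (K : ℕ) (_ : K = 0 + N) (lam : Fin K → ℤ), Antitone lam →
      schur K lam 1 * vdmConst K * ((vandermonde fun j => (shifted lam j : ℂ)).det *
      ∏ j, wt (fun j => (shifted lam j : ℂ)) j) = revSign K := by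
    rintro K rfl lam hlam
    have h := schur_append_one (r := 0) (M := N) lam hlam Fin.elim0 (fun i => i.elim0)
    rw [← pad_eq_append] at h
    have h1 : pad (0 + N) (Fin.elim0 : Fin 0 → ℂ) = 1 := by
      ext i; rw [pad, dif_neg (by omega)]; rfl
    have h2 : vdm (Fin.elim0 : Fin 0 → ℂ) = 1 := by simp [vdm]
    have h3 : ∀ A : Matrix (Fin 0) (Fin 0) ℂ, A.det = 1 := fun A => Matrix.det_isEmpty
    have h4 : ∀ A B : ℕ, A = B → vdmConst A = vdmConst B ∧ revSign A = revSign B := by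
      rintro A B rfl; exact ⟨rfl, rfl⟩
    rw [h1, h2, h3 (pairMatrix _ _ _)] at h
    rw [(h4 (0 + N) N (by omega)).1, (h4 (0 + N) N (by omega)).2]
    simpa using h
  exact key N (by omega) lam hlam

theorem schur_one_ne_zero {N : ℕ} {lam : Fin N → ℤ} (hlam : Antitone lam) : schur N lam 1 ≠ 0 := by
  intro h
  have := schur_one_mul_vdmConst lam hlam
  rw [h, zero_mul, zero_mul] at this
  exact revSign_ne_zero N this.symm

/-- The normalized Schur polynomial with all but `r` variables equal to `1`, up to a constant that
does not depend on the signature. -/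
theorem exists_schur_pad (N r : ℕ) (hr : r ≤ N) : ∃ C : ℂ, ∀ lam : Fin N → ℤ, Antitone lam →
    ∀ x : Fin r → ℂ, (∀ i, x i ≠ 0) →
    C * (vdm x * (∏ i, (x i - 1) ^ (N - r))) * (schur N lam (pad N x) / schur N lam 1) =
    ∑ f : Fin r → Fin N, vdm (fun i => (shifted lam (f i) : ℂ)) *
      ∏ i, x i ^ shifted lam (f i) * wt (fun j => (shifted lam j : ℂ)) (f i) := by
  obtain ⟨M, rfl⟩ := Nat.exists_eq_add_of_le hr
  refine ⟨vdmConst M * revSign (r + M) / (revSign M * vdmConst (r + M) * vdmSign r), ?_⟩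
  intro lam hlam x hx
  have h1 := schur_append_one lam hlam x hx
  have h2 := schur_one_mul_vdmConst lam hlam
  have h3 := schur_one_ne_zero hlam
  rw [← pad_eq_append, det_pairMatrix] at h1
  simp only [det_vandermonde_eq, Function.comp_def] at h1
  set D := (vandermonde fun j => (shifted lam j : ℂ)).det *
        ∏ j, wt (fun j => (shifted lam j : ℂ)) j with hD
  set S := ∑ f : Fin r → Fin (r + M), vdm (fun i => (shifted lam (f i) : ℂ)) *
      ∏ i, x i ^ shifted lam (f i) * wt (fun j => (shifted lam j : ℂ)) (f i) with hS
  have h4 : ∑ f : Fin r → Fin (r + M),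
      (∏ i, x i ^ shifted lam (f i) * wt (fun j => (shifted lam j : ℂ)) (f i)) *
        (vdmSign r * vdm fun i => (shifted lam (f i) : ℂ)) = vdmSign r * S := by
    rw [hS, mul_sum]
    exact sum_congr rfl fun f _ => by ring
  have h4' := h4
  rw [det_vandermonde_eq] at hD
  rw [← hD, h4] at h1
  have hM := revSign_ne_zero M
  have hv := vdmConst_ne_zero (r + M)
  have hs := vdmSign_ne_zero r
  rw [← h2, Nat.add_sub_cancel_left]
  field_simp
  linear_combination h1

/-- For distinct coordinates the numerator and the denominator of the bialternant formula both
change by the sign of the permutation. The general case follows by continuity. -/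
theorem schur_comp_perm {N : ℕ} {lam : Fin N → ℤ} (hlam : Antitone lam) (τ : Equiv.Perm (Fin N))
    (x : Fin N → ℂ) (hx : ∀ i, x i ≠ 0) : schur N lam (x ∘ τ) = schur N lam x := by
  have hinj : ∀ y : Fin N → ℂ, (∀ i, y i ≠ 0) → Function.Injective y →
      schur N lam (y ∘ τ) = schur N lam y := by
    intro y hy hyi
    have h1 := schur_mul_vdm N lam hlam y hy
    have h2 := schur_mul_vdm N lam hlam (y ∘ τ) (fun i => hy _)
    have h3 : Matrix.det (Matrix.of fun i j => (y ∘ τ) i ^ shifted lam j) =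
        Equiv.Perm.sign τ * Matrix.det (Matrix.of fun i j => y i ^ shifted lam j) := by
      rw [← Matrix.det_permute]; rfl
    have h4 : vdm (y ∘ τ) = Equiv.Perm.sign τ * vdm y := by
      have h5 : (vandermonde (y ∘ τ)).det = Equiv.Perm.sign τ * (vandermonde y).det := by
        rw [← Matrix.det_permute]; rfl
      rw [det_vandermonde_eq, det_vandermonde_eq] at h5
      apply mul_left_cancel₀ (vdmSign_ne_zero N)
      linear_combination h5
    have h6 : vdm y ≠ 0 := by
      rw [vdm, prod_ne_zero_iff]
      intro i _
      rw [prod_ne_zero_iff]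
      intro j hj
      rw [mem_Ioi] at hj
      exact sub_ne_zero.mpr fun h => hj.ne (hyi h)
    have h7 : ((Equiv.Perm.sign τ : ℤ) : ℂ) ≠ 0 := by exact_mod_cast Units.ne_zero _
    rw [h3, ← h1, h4] at h2
    apply mul_right_cancel₀ (mul_ne_zero h7 h6)
    linear_combination h2
  -- For small η ≠ 0 the coordinates become distinct and stay nonzero.
  set y : ℂ → Fin N → ℂ := fun η i => x i + η * (i : ℕ) with hy
  have hyt : Tendsto y (𝓝[≠] 0) (𝓝 x) := by
    have : Tendsto y (𝓝 0) (𝓝 (y 0)) := by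
      apply Continuous.tendsto
      exact continuous_pi fun i => continuous_const.add (continuous_id.mul continuous_const)
    have h0 : y 0 = x := by ext i; simp [hy]
    rw [h0] at this
    exact this.mono_left nhdsWithin_le_nhds
  have hyc : ∀ i, Tendsto (fun η => y η i) (𝓝[≠] 0) (𝓝 (x i)) := fun i =>
    (tendsto_pi_nhds.mp hyt) i
  have hev : ∀ᶠ η in 𝓝[≠] (0 : ℂ), schur N lam (y η ∘ τ) = schur N lam (y η) := by
    have h1 : ∀ᶠ η in 𝓝[≠] (0 : ℂ), ∀ i, y η i ≠ 0 := by
      rw [eventually_all]; exact fun i => (hyc i).eventually_ne (hx i)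
    have h2 : ∀ᶠ η in 𝓝[≠] (0 : ℂ), ∀ i j, i ≠ j → y η i ≠ y η j := by
      rw [eventually_all]; intro i
      rw [eventually_all]; intro j
      by_cases hxx : x i = x j
      · have hne : ∀ᶠ η in 𝓝[≠] (0 : ℂ), η ≠ 0 := self_mem_nhdsWithin
        filter_upwards [hne] with η hη hij h
        simp only [hy, hxx] at h
        have h' := mul_left_cancel₀ hη (add_left_cancel h)
        exact hij (Fin.ext (by exact_mod_cast h'))
      · have := ((hyc i).sub (hyc j)).eventually_ne (sub_ne_zero.mpr hxx)
        filter_upwards [this] with η hη _ h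
        exact hη (sub_eq_zero.mpr h)
    filter_upwards [h1, h2] with η h1 h2
    apply hinj _ h1
    intro i j hij
    by_contra hne
    exact h2 i j hne hij
  have hl : Tendsto (fun η => schur N lam (y η ∘ τ)) (𝓝[≠] 0) (𝓝 (schur N lam (x ∘ τ))) := by
    refine (continuousAt_schur N lam (x ∘ τ) fun i => hx _).tendsto.comp ?_
    rw [tendsto_pi_nhds]
    exact fun i => hyc (τ i)
  have hr := (continuousAt_schur N lam x hx).tendsto.comp hyt
  exact tendsto_nhds_unique (hl.congr' hev) hr

theorem norm_zpow_le {y : ℂ} {R : ℝ} (hR : 1 ≤ R) (h1 : ‖y‖ ≤ R) (h2 : ‖y⁻¹‖ ≤ R) (k : ℤ)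
    {n : ℕ} (hk : k.natAbs ≤ n) : ‖y ^ k‖ ≤ R ^ n := by
  refine le_trans ?_ (pow_le_pow_right₀ hR hk)
  rcases k.natAbs_eq with h | h
  · rw [h, zpow_natCast, norm_pow, Int.natAbs_natCast]
    exact pow_le_pow_left₀ (norm_nonneg _) h1 _
  · rw [h, zpow_neg, zpow_natCast, ← inv_pow, norm_pow, Int.natAbs_neg, Int.natAbs_natCast]
    exact pow_le_pow_left₀ (norm_nonneg _) h2 _

/-- The values of a Schur polynomial near the torus are controlled by its value at `1`. -/
theorem exists_norm_schur_le : ∀ (N : ℕ) (lam : Fin N → ℤ), ∃ n : ℕ, schur N lam 1 = n ∧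
    ∀ (R : ℝ) (B : ℕ) (x : Fin N → ℂ), 1 ≤ R → (∀ i, (lam i).natAbs ≤ B) →
      (∀ i, ‖x i‖ ≤ R) → (∀ i, ‖(x i)⁻¹‖ ≤ R) → ‖schur N lam x‖ ≤ n * R ^ (N ^ 2 * B)
  | 0, lam => ⟨1, by simp [schur], fun R B x _ _ _ _ => by simp [schur]⟩
  | N + 1, lam => by
    choose n hn hb using exists_norm_schur_le N
    refine ⟨∑ mu ∈ Finset.Icc (fun i : Fin N => lam i.succ) (fun i : Fin N => lam i.castSucc),
      n mu, ?_, ?_⟩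
    · rw [schur]
      push_cast
      refine sum_congr rfl fun mu _ => ?_
      rw [Pi.one_apply, one_zpow, mul_one, ← hn]
      rfl
    · intro R B x hR hB hx1 hx2
      rw [schur]
      push_cast
      rw [sum_mul]
      refine norm_sum_le_of_le _ fun mu hmu => ?_
      rw [mem_Icc] at hmu
      have hmuB : ∀ i, (mu i).natAbs ≤ B := by
        intro i
        have h1 := hmu.1 i
        have h2 := hmu.2 i
        have h3 := hB i.succ
        have h4 := hB i.castSucc
        simp only at h1 h2
        omega
      have h1 := hb mu R B (fun i => x i.castSucc) hR hmuB (fun i => hx1 _) (fun i => hx2 _)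
      have h2 : (∑ i, lam i - ∑ i, mu i).natAbs ≤ (2 * N + 1) * B := by
        have h3 : (∑ i, lam i).natAbs ≤ (N + 1) * B := by
          refine (Int.natAbs_sum_le _ _).trans ?_
          refine (Finset.sum_le_sum fun i _ => hB i).trans ?_
          simp
        have h4 : (∑ i, mu i).natAbs ≤ N * B := by
          refine (Int.natAbs_sum_le _ _).trans ?_
          refine (Finset.sum_le_sum fun i _ => hmuB i).trans ?_
          simp
        have h5 : (2 * N + 1) * B = (N + 1) * B + N * B := by ring
        omega
      have h3 := norm_zpow_le hR (hx1 (Fin.last N)) (hx2 (Fin.last N)) _ h2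
      -- The exponent N² B is built for this recursion: the exponent of the last variable is a
      -- difference of sums of N + 1 and N entries of size at most B.
      rw [norm_mul, show (N + 1) ^ 2 * B = N ^ 2 * B + (2 * N + 1) * B by ring, pow_add, ← mul_assoc]
      exact mul_le_mul h1 h3 (norm_nonneg _) (by positivity)

/-! ### Taylor series of smooth functions and of normally convergent sums. -/

section

open MvPowerSeries (X coeff coeff_pderiv constantCoeff constantCoeff_C pderiv)
open Pi (single)

open scoped ContDiff




section Taylor

variable {σ : Type} [Fintype σ] [DecidableEq σ]

/-- The partial derivative in a coordinate direction. -/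
def pd (i : σ) (f : (σ → ℂ) → ℂ) : (σ → ℂ) → ℂ := fun x => lineDeriv ℂ f x (single i 1)

/-- The Taylor coefficients at `0` of the function `f`, up to the order `n`, are those of the
formal power series `K`. -/
def TaylorTo : ℕ → ((σ → ℂ) → ℂ) → MvPowerSeries σ ℂ → Prop
  | 0, f, K => f 0 = constantCoeff K
  | n + 1, f, K => f 0 = constantCoeff K ∧ ∀ i, TaylorTo n (pd i f) (pderiv ℂ i K)

/-- `K` is the Taylor series of `f` at `0`. -/
def IsTaylor (f : (σ → ℂ) → ℂ) (K : MvPowerSeries σ ℂ) : Prop := ∀ n, TaylorTo n f K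

theorem TaylorTo.zero {n : ℕ} {f : (σ → ℂ) → ℂ} {K : MvPowerSeries σ ℂ} (h : TaylorTo n f K) :
    f 0 = constantCoeff K := by
  cases n with
  | zero => exact h
  | succ n => exact h.1

theorem TaylorTo.pred {n : ℕ} {f : (σ → ℂ) → ℂ} {K : MvPowerSeries σ ℂ}
    (h : TaylorTo (n + 1) f K) : TaylorTo n f K := by
  induction n generalizing f K with
  | zero => exact h.1
  | succ n ih => exact ⟨h.1, fun i => ih (h.2 i)⟩

theorem pd_congr {f g : (σ → ℂ) → ℂ} {x : σ → ℂ} (h : f =ᶠ[𝓝 x] g) (i : σ) :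
    pd i f =ᶠ[𝓝 x] pd i g := by
  filter_upwards [eventually_eventually_nhds.mpr h] with y hy
  exact Filter.EventuallyEq.lineDeriv_eq hy

theorem TaylorTo.congr {n : ℕ} {f g : (σ → ℂ) → ℂ} {K : MvPowerSeries σ ℂ}
    (h : TaylorTo n f K) (hfg : f =ᶠ[𝓝 0] g) : TaylorTo n g K := by
  induction n generalizing f g K with
  | zero => exact hfg.self_of_nhds.symm.trans h
  | succ n ih => exact ⟨hfg.self_of_nhds.symm.trans h.1, fun i => ih (h.2 i) (pd_congr hfg i)⟩

theorem IsTaylor.congr {f g : (σ → ℂ) → ℂ} {K : MvPowerSeries σ ℂ}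
    (h : IsTaylor f K) (hfg : f =ᶠ[𝓝 0] g) : IsTaylor g K := fun n => (h n).congr hfg

theorem pd_eq_fderiv {U : Set (σ → ℂ)} (hU : IsOpen U) {f : (σ → ℂ) → ℂ}
    (hf : ContDiffOn ℂ ∞ f U) (i : σ) :
    Set.EqOn (pd i f) (fun x => fderiv ℂ f x (single i 1)) U := by
  intro x hx
  have hd : DifferentiableAt ℂ f x :=
    (hf.differentiableOn (by simp)).differentiableAt (hU.mem_nhds hx)
  exact hd.lineDeriv_eq_fderiv

theorem contDiffOn_pd {U : Set (σ → ℂ)} (hU : IsOpen U) {f : (σ → ℂ) → ℂ}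
    (hf : ContDiffOn ℂ ∞ f U) (i : σ) : ContDiffOn ℂ ∞ (pd i f) U := by
  refine ContDiffOn.congr ?_ (pd_eq_fderiv hU hf i)
  exact (hf.fderiv_of_isOpen hU (by simp)).clm_apply contDiffOn_const

theorem differentiableAt_of_mem {U : Set (σ → ℂ)} (hU : IsOpen U) {f : (σ → ℂ) → ℂ}
    (hf : ContDiffOn ℂ ∞ f U) {x : σ → ℂ} (hx : x ∈ U) : DifferentiableAt ℂ f x :=
  (hf.differentiableOn (by simp)).differentiableAt (hU.mem_nhds hx)

theorem TaylorTo.add {U : Set (σ → ℂ)} (hU : IsOpen U) (h0 : (0 : σ → ℂ) ∈ U) {n : ℕ}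
    {f g : (σ → ℂ) → ℂ} {K J : MvPowerSeries σ ℂ} (hf : ContDiffOn ℂ ∞ f U)
    (hg : ContDiffOn ℂ ∞ g U) (h : TaylorTo n f K) (h' : TaylorTo n g J) :
    TaylorTo n (fun x => f x + g x) (K + J) := by
  induction n generalizing f g K J with
  | zero =>
    change f 0 + g 0 = _
    rw [h.zero, h'.zero, map_add]
  | succ n ih =>
    refine ⟨by change f 0 + g 0 = _; rw [h.zero, h'.zero, map_add], fun i => ?_⟩
    rw [map_add]
    refine (ih (contDiffOn_pd hU hf i) (contDiffOn_pd hU hg i) (h.2 i) (h'.2 i)).congr ?_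
    filter_upwards [hU.mem_nhds h0] with x hx
    have h1 := differentiableAt_of_mem hU hf hx
    have h2 := differentiableAt_of_mem hU hg hx
    rw [pd_eq_fderiv hU hf i hx, pd_eq_fderiv hU hg i hx, pd_eq_fderiv hU (hf.add hg) i hx]
    simp only
    rw [show (fun x => f x + g x) = f + g from rfl, fderiv_add h1 h2]
    rfl

theorem TaylorTo.mul {U : Set (σ → ℂ)} (hU : IsOpen U) (h0 : (0 : σ → ℂ) ∈ U) {n : ℕ}
    {f g : (σ → ℂ) → ℂ} {K J : MvPowerSeries σ ℂ} (hf : ContDiffOn ℂ ∞ f U)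
    (hg : ContDiffOn ℂ ∞ g U) (h : TaylorTo n f K) (h' : TaylorTo n g J) :
    TaylorTo n (fun x => f x * g x) (K * J) := by
  induction n generalizing f g K J with
  | zero =>
    change f 0 * g 0 = _
    rw [h.zero, h'.zero, map_mul]
  | succ n ih =>
    refine ⟨by change f 0 * g 0 = _; rw [h.zero, h'.zero, map_mul], fun i => ?_⟩
    rw [leibniz]
    refine (TaylorTo.add hU h0 (hf.mul (contDiffOn_pd hU hg i)) (hg.mul (contDiffOn_pd hU hf i))
      (ih hf (contDiffOn_pd hU hg i) h.pred (h'.2 i))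
      (ih hg (contDiffOn_pd hU hf i) h'.pred (h.2 i))).congr ?_
    filter_upwards [hU.mem_nhds h0] with x hx
    have h1 := differentiableAt_of_mem hU hf hx
    have h2 := differentiableAt_of_mem hU hg hx
    rw [pd_eq_fderiv hU hf i hx, pd_eq_fderiv hU hg i hx, pd_eq_fderiv hU (hf.mul hg) i hx]
    simp only
    rw [show (fun x => f x * g x) = f * g from rfl, fderiv_mul h1 h2]
    rfl

theorem TaylorTo.const (n : ℕ) (c : ℂ) : TaylorTo n (fun _ : σ → ℂ => c) (MvPowerSeries.C c) := by
  induction n generalizing c with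
  | zero => exact (constantCoeff_C c).symm
  | succ n ih =>
    refine ⟨(constantCoeff_C c).symm, fun i => ?_⟩
    have h1 : pd i (fun _ : σ → ℂ => c) = fun _ => 0 := by
      funext x; simp [pd, lineDeriv]
    rw [h1, pderiv_C, ← map_zero (MvPowerSeries.C (R := ℂ) (σ := σ))]
    exact ih 0

theorem TaylorTo.coord (n : ℕ) (j : σ) : TaylorTo n (fun x : σ → ℂ => x j) (X j) := by
  cases n with
  | zero => simp [TaylorTo]
  | succ n =>
    refine ⟨by simp, fun i => ?_⟩
    have h1 : pd i (fun x : σ → ℂ => x j) = fun _ => if j = i then 1 else 0 := by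
      funext x
      have h := ((ContinuousLinearMap.proj (R := ℂ) (φ := fun _ : σ => ℂ) j).hasFDerivAt
        (x := x)).hasLineDerivAt (single i 1)
      have h2 := h.lineDeriv
      simp only [ContinuousLinearMap.proj_apply, Pi.single_apply] at h2
      exact h2
    rw [h1]
    have h2 : pderiv ℂ i (X j) = MvPowerSeries.C (if j = i then (1 : ℂ) else 0) := by
      by_cases hij : j = i
      · subst hij; simp
      · simp [hij, pderiv_X_of_ne hij]
    rw [h2]
    exact TaylorTo.const n _

theorem TaylorTo.inv {U : Set (σ → ℂ)} (hU : IsOpen U) (h0 : (0 : σ → ℂ) ∈ U) {n : ℕ}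
    {f : (σ → ℂ) → ℂ} {K : MvPowerSeries σ ℂ} (hf : ContDiffOn ℂ ∞ f U)
    (hne : ∀ x ∈ U, f x ≠ 0) (h : TaylorTo n f K) : TaylorTo n (fun x => (f x)⁻¹) K⁻¹ := by
  have hc : ∀ {m : ℕ}, TaylorTo m f K → (f 0)⁻¹ = constantCoeff K⁻¹ := by
    intro m h
    rw [MvPowerSeries.constantCoeff_inv, h.zero]
  have hinv : ContDiffOn ℂ ∞ (fun x => (f x)⁻¹) U := hf.inv hne
  induction n with
  | zero => exact hc h
  | succ n ih =>
    refine ⟨hc h, fun i => ?_⟩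
    rw [MvPowerSeries.pderiv_inv']
    have h1 := ih h.pred
    have h2 := TaylorTo.mul hU h0 (contDiffOn_const.mul (hinv.mul hinv)) (contDiffOn_pd hU hf i)
      (TaylorTo.mul hU h0 contDiffOn_const (hinv.mul hinv) (TaylorTo.const n (-1))
        (TaylorTo.mul hU h0 hinv hinv h1 h1)) (h.2 i)
    have h3 : MvPowerSeries.C (-1 : ℂ) * (K⁻¹ * K⁻¹) * pderiv ℂ i K = -K⁻¹ ^ 2 * pderiv ℂ i K := by
      rw [map_neg, map_one]; ring
    rw [← h3]
    refine h2.congr ?_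
    filter_upwards [hU.mem_nhds h0] with x hx
    rw [pd_eq_fderiv hU hf i hx, pd_eq_fderiv hU hinv i hx]
    have hd := differentiableAt_of_mem hU hf hx
    have hd2 : HasFDerivAt (fun x => (f x)⁻¹) _ x :=
      (hasDerivAt_inv (hne x hx)).comp_hasFDerivAt x hd.hasFDerivAt
    simp only
    rw [hd2.fderiv]
    simp only [smul_apply, smul_eq_mul]
    field_simp

/-- The derivative of log f is f⁻¹ f', whose Taylor series is known from the rules for inverses and
products; the defining equation of `IsLog` gives the same expression. -/
theorem IsTaylor.log {U : Set (σ → ℂ)} (hU : IsOpen U) (h0 : (0 : σ → ℂ) ∈ U)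
    {f : (σ → ℂ) → ℂ} {Λ K : MvPowerSeries σ ℂ} (hf : ContDiffOn ℂ ∞ f U)
    (hne : ∀ x ∈ U, f x ∈ slitPlane) (h : IsTaylor f K) (hΛ : IsLog Λ K) :
    IsTaylor (fun x => Complex.log (f x)) Λ := by
  have hc : Complex.log (f 0) = constantCoeff Λ := by
    rw [(h 0).zero, hΛ.right, hΛ.left, Complex.log_one]
  have hne' : ∀ x ∈ U, f x ≠ 0 := fun x hx => Complex.slitPlane_ne_zero (hne x hx)
  have hinv : ContDiffOn ℂ ∞ (fun x => (f x)⁻¹) U := hf.inv hne'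
  have hlog : ContDiffOn ℂ ∞ (fun x => Complex.log (f x)) U :=
    fun x hx => (Complex.contDiffAt_log (hne x hx)).comp_contDiffWithinAt x (hf x hx)
  intro n
  cases n with
  | zero => exact hc
  | succ n =>
    refine ⟨hc, fun i => ?_⟩
    have h1 : pderiv ℂ i Λ = K⁻¹ * pderiv ℂ i K := by
      rw [hΛ.deriv, mul_left_comm, MvPowerSeries.inv_mul_cancel _ (by
        rw [hΛ.right]; exact one_ne_zero), mul_one]
    rw [h1]
    refine (TaylorTo.mul hU h0 hinv (contDiffOn_pd hU hf i)
      (TaylorTo.inv hU h0 hf hne' (h n)) ((h (n + 1)).2 i)).congr ?_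
    filter_upwards [hU.mem_nhds h0] with x hx
    rw [pd_eq_fderiv hU hf i hx, pd_eq_fderiv hU hlog i hx]
    have hd := differentiableAt_of_mem hU hf hx
    have hd2 : HasFDerivAt (fun x => Complex.log (f x)) _ x := hd.hasFDerivAt.clog (hne x hx)
    simp only
    rw [hd2.fderiv]
    simp

theorem TaylorTo.coeff_eq {n : ℕ} {f : (σ → ℂ) → ℂ} {K J : MvPowerSeries σ ℂ}
    (h : TaylorTo n f K) (h' : TaylorTo n f J) (m : σ →₀ ℕ) (hm : m.degree ≤ n) :
    coeff m K = coeff m J := by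
  induction n generalizing f K J m with
  | zero =>
    have : m = 0 := by
      rw [← degree_eq_zero_iff]; omega
    subst this
    exact h.symm.trans h'
  | succ n ih =>
    by_cases h0 : m = 0
    · subst h0
      exact h.zero.symm.trans h'.zero
    · obtain ⟨i, p, rfl⟩ := exists_pos_of_ne_zero h0
      have h1 := ih (h.2 i) (h'.2 i) p (by
        rw [map_add, degree_single] at hm; omega)
      rw [coeff_pderiv, coeff_pderiv] at h1
      exact mul_right_cancel₀ (by exact_mod_cast succ_ne_zero (p i)) h1

theorem IsTaylor.unique {f : (σ → ℂ) → ℂ} {K J : MvPowerSeries σ ℂ}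
    (h : IsTaylor f K) (h' : IsTaylor f J) : K = J := by
  ext m
  exact (h m.degree).coeff_eq (h' m.degree) m le_rfl

theorem TaylorTo.foldr {f : (σ → ℂ) → ℂ} {K : MvPowerSeries σ ℂ} (l : List σ)
    (h : TaylorTo l.length f K) : l.foldr pd f 0 = constantCoeff
      (l.foldr (fun i J => pderiv ℂ i J) K) := by
  induction l using List.reverseRecOn generalizing f K with
  | nil => exact h
  | append_singleton l i ih =>
    rw [List.length_append, List.length_singleton] at h
    simp only [List.foldr_append, List.foldr_cons, List.foldr_nil]
    exact ih (h.2 i)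

end Taylor

section Sums

variable {E F : Type} [NormedAddCommGroup E] [NormedSpace ℂ E] [NormedAddCommGroup F]
  [NormedSpace ℂ F]

/-- Local normal convergence of a series of functions. -/
def NormalOn {ι : Type} (f : ι → E → F) (U : Set E) : Prop :=
  ∀ x ∈ U, ∃ δ > 0, ∃ u : ι → ℝ, Summable u ∧ ball x δ ⊆ U ∧ ∀ i, ∀ y ∈ ball x δ, ‖f i y‖ ≤ u i

/-- Cauchy's estimate for the Fréchet derivative. -/
theorem norm_fderiv_le_of_ball {f : E → F} {x : E} {δ C : ℝ} (hδ : 0 < δ)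
    (hd : DifferentiableOn ℂ f (ball x δ)) (hC : ∀ y ∈ ball x δ, ‖f y‖ ≤ C) :
    ‖fderiv ℂ f x‖ ≤ C / (δ / 2) := by
  have hC0 : 0 ≤ C := (norm_nonneg _).trans (hC x (mem_ball_self hδ))
  apply ContinuousLinearMap.opNorm_le_bound _ (by positivity)
  intro v
  by_cases hv : v = 0
  · simp [hv]
  have hvn : 0 < ‖v‖ := norm_pos_iff.mpr hv
  have hR : 0 < δ / 2 / ‖v‖ := by positivity
  set g : ℂ → F := fun t => f (x + t • v) with hg
  have hmem : ∀ t : ℂ, ‖t‖ ≤ δ / 2 / ‖v‖ → x + t • v ∈ ball x δ := by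
    intro t ht
    rw [mem_ball, dist_eq_norm, add_sub_cancel_left, norm_smul]
    have : ‖t‖ * ‖v‖ ≤ δ / 2 := by
      rw [le_div_iff₀ hvn] at ht; exact ht
    linarith
  have hdg : ∀ t : ℂ, ‖t‖ ≤ δ / 2 / ‖v‖ → DifferentiableAt ℂ g t := by
    intro t ht
    have h1 : DifferentiableAt ℂ f (x + t • v) :=
      hd.differentiableAt (isOpen_ball.mem_nhds (hmem t ht))
    have h2 : DifferentiableAt ℂ (fun t : ℂ => x + t • v) t := by fun_prop
    exact h1.comp t h2
  have hcl : DiffContOnCl ℂ g (ball 0 (δ / 2 / ‖v‖)) := by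
    apply DifferentiableOn.diffContOnCl
    intro t ht
    apply (hdg t _).differentiableWithinAt
    have := Metric.closure_ball_subset_closedBall ht
    rwa [mem_closedBall_zero_iff] at this
  have h1 := Complex.norm_deriv_le_of_forall_mem_sphere_norm_le hR hcl (C := C) (fun t ht => by
    apply hC
    apply hmem
    rw [mem_sphere_zero_iff_norm] at ht
    exact ht.le)
  have h2 : deriv g 0 = fderiv ℂ f x v := by
    have h3 : DifferentiableAt ℂ f x := hd.differentiableAt (Metric.ball_mem_nhds x hδ)
    exact h3.lineDeriv_eq_fderiv
  rw [h2] at h1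
  refine h1.trans (le_of_eq ?_)
  field_simp

/-- Cauchy's estimate on balls of half the radius bounds the derivatives by the same summable
sequence, up to a constant. -/
theorem NormalOn.fderiv {ι : Type} {f : ι → E → F} {U : Set E} (h : NormalOn f U)
    (hd : ∀ i, DifferentiableOn ℂ (f i) U) : NormalOn (fun i => _root_.fderiv ℂ (f i)) U := by
  intro x hx
  obtain ⟨δ, hδ, u, hu, hsub, hb⟩ := h x hx
  refine ⟨δ / 2, by positivity, fun i => u i / (δ / 2 / 2), hu.div_const _, ?_, ?_⟩
  · exact (Metric.ball_subset_ball (by linarith)).trans hsub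
  · intro i y hy
    have hyb : ball y (δ / 2) ⊆ ball x δ := by
      apply Metric.ball_subset_ball'
      rw [mem_ball] at hy
      linarith
    exact norm_fderiv_le_of_ball (by positivity) ((hd i).mono (hyb.trans hsub))
      fun z hz => hb i z (hyb hz)

theorem NormalOn.summable [CompleteSpace F] {ι : Type} {f : ι → E → F} {U : Set E}
    (h : NormalOn f U) {x : E} (hx : x ∈ U) : Summable fun i => f i x := by
  obtain ⟨δ, hδ, u, hu, hsub, hb⟩ := h x hx
  exact Summable.of_norm_bounded hu fun i => hb i x (mem_ball_self hδ)

theorem NormalOn.hasFDerivAt [CompleteSpace F] {ι : Type} {f : ι → E → F} {U : Set E}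
    (h : NormalOn f U) (hU : IsOpen U)
    (hd : ∀ i, DifferentiableOn ℂ (f i) U) {x : E} (hx : x ∈ U) :
    HasFDerivAt (fun x => ∑' i, f i x) (∑' i, _root_.fderiv ℂ (f i) x) x := by
  obtain ⟨δ, hδ, u, hu, hsub, hb⟩ := (h.fderiv hd) x hx
  exact hasFDerivAt_tsum_of_isPreconnected hu isOpen_ball
    (convex_ball x δ).isPreconnected
    (fun i y hy => ((hd i).differentiableAt (hU.mem_nhds (hsub hy))).hasFDerivAt)
    (fun i y hy => hb i y hy) (mem_ball_self hδ) (h.summable hx) (mem_ball_self hδ)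

/-- Normal convergence passes to the derivatives, so the order of smoothness increases by induction.
The target space must vary, as the derivatives take values in spaces of linear maps. -/
theorem contDiffOn_tsum_of_normalOn {ι : Type} (n : ℕ) :
    ∀ {F : Type} [NormedAddCommGroup F] [NormedSpace ℂ F] [CompleteSpace F] {f : ι → E → F}
      {U : Set E}, IsOpen U → NormalOn f U → (∀ i, ContDiffOn ℂ ∞ (f i) U) →
      ContDiffOn ℂ n (fun x => ∑' i, f i x) U := by
  induction n with
  | zero =>
    intro F _ _ _ f U hU h hf
    rw [Nat.cast_zero, contDiffOn_zero]
    intro x hx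
    exact (h.hasFDerivAt hU (fun i => (hf i).differentiableOn (by simp))
      hx).continuousAt.continuousWithinAt
  | succ n ih =>
    intro F _ _ _ f U hU h hf
    have hd : ∀ i, DifferentiableOn ℂ (f i) U := fun i => (hf i).differentiableOn (by simp)
    rw [Nat.cast_add, Nat.cast_one, contDiffOn_succ_iff_fderiv_of_isOpen hU]
    refine ⟨fun x hx => (h.hasFDerivAt hU hd hx).differentiableAt.differentiableWithinAt,
      by simp, ?_⟩
    refine (ih hU (h.fderiv hd) fun i => (hf i).fderiv_of_isOpen hU (by simp)).congr ?_
    intro x hx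
    exact (h.hasFDerivAt hU hd hx).fderiv

theorem contDiffOn_infty_tsum [CompleteSpace F] {ι : Type} {f : ι → E → F} {U : Set E}
    (hU : IsOpen U) (h : NormalOn f U) (hf : ∀ i, ContDiffOn ℂ ∞ (f i) U) :
    ContDiffOn ℂ ∞ (fun x => ∑' i, f i x) U := by
  rw [contDiffOn_infty]
  exact fun n => contDiffOn_tsum_of_normalOn n hU h hf

end Sums

section TaylorSum

variable {σ : Type} [Fintype σ] [DecidableEq σ]

/-- The sum of a family of power series, coefficient by coefficient. -/
def tsumCoeff {ι : Type} (K : ι → MvPowerSeries σ ℂ) : MvPowerSeries σ ℂ :=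
  fun m => ∑' i, coeff m (K i)

theorem coeff_tsumCoeff {ι : Type} (K : ι → MvPowerSeries σ ℂ) (m : σ →₀ ℕ) :
    coeff m (tsumCoeff K) = ∑' i, coeff m (K i) := rfl

theorem pderiv_tsumCoeff {ι : Type} (K : ι → MvPowerSeries σ ℂ) (i : σ) : pderiv ℂ i (tsumCoeff K) =
      tsumCoeff fun j => pderiv ℂ i (K j) := by
  ext m
  simp only [coeff_pderiv, coeff_tsumCoeff, tsum_mul_right]

theorem NormalOn.pd {ι : Type} {f : ι → (σ → ℂ) → ℂ} {U : Set (σ → ℂ)} (hU : IsOpen U)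
    (h : NormalOn f U) (hf : ∀ i, ContDiffOn ℂ ∞ (f i) U) (j : σ) :
    NormalOn (fun i => SchurCLT.pd j (f i)) U := by
  intro x hx
  obtain ⟨δ, hδ, u, hu, hsub, hb⟩ := h.fderiv (fun i => (hf i).differentiableOn (by simp)) x hx
  refine ⟨δ, hδ, fun i => u i * ‖(single j 1 : σ → ℂ)‖, hu.mul_right _, hsub, ?_⟩
  intro i y hy
  simp only
  rw [pd_eq_fderiv hU (hf i) j (hsub hy)]
  exact (ContinuousLinearMap.le_opNorm _ _).trans
    (mul_le_mul_of_nonneg_right (hb i y hy) (norm_nonneg _))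

/-- Differentiation commutes with the sum, and the differentiated family is again normally
convergent. -/
theorem TaylorTo.tsum {ι : Type} {n : ℕ} {f : ι → (σ → ℂ) → ℂ} {K : ι → MvPowerSeries σ ℂ}
    {U : Set (σ → ℂ)} (hU : IsOpen U) (h0 : (0 : σ → ℂ) ∈ U) (h : NormalOn f U)
    (hf : ∀ i, ContDiffOn ℂ ∞ (f i) U) (hK : ∀ i, TaylorTo n (f i) (K i)) :
    TaylorTo n (fun x => ∑' i, f i x) (tsumCoeff K) := by
  have hc : ∀ {f : ι → (σ → ℂ) → ℂ} {K : ι → MvPowerSeries σ ℂ} {m : ℕ},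
      (∀ i, TaylorTo m (f i) (K i)) → ∑' i, f i 0 = constantCoeff (tsumCoeff K) := by
    intro f K m hK
    rw [← coeff_zero_mv, coeff_tsumCoeff]
    exact tsum_congr fun i => (hK i).zero
  induction n generalizing f K with
  | zero => exact hc hK
  | succ n ih =>
    refine ⟨hc hK, fun j => ?_⟩
    rw [pderiv_tsumCoeff]
    refine (ih (h.pd hU hf j) (fun i => contDiffOn_pd hU (hf i) j) fun i => (hK i).2 j).congr ?_
    filter_upwards [hU.mem_nhds h0] with x hx
    have hd : ∀ i, DifferentiableOn ℂ (f i) U := fun i => (hf i).differentiableOn (by simp)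
    have h1 := h.hasFDerivAt hU hd hx
    have h2 : SchurCLT.pd j (fun x => ∑' i, f i x) x = (∑' i, fderiv ℂ (f i) x) (single j 1) := by
      rw [← h1.fderiv]
      exact h1.differentiableAt.lineDeriv_eq_fderiv
    rw [h2]
    have h3 := ((h.fderiv hd).summable hx).hasSum.mapL
      (ContinuousLinearMap.apply ℂ ℂ (single j 1 : σ → ℂ))
    simp only [ContinuousLinearMap.apply_apply] at h3
    rw [← h3.tsum_eq]
    exact tsum_congr fun i => pd_eq_fderiv hU (hf i) j hx

end TaylorSum

end

/-! ### Series in powers of log(1+u), binomial series, and Taylor series of Schur polynomials. -/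

section

open PowerSeries (C X coeff coeff_C_mul constantCoeff)
open Finset (induction_on)
open Pi (single)

open scoped ContDiff




section Beta

/-- The coefficients of the power series `∑ a_m log(1+u)^m / m!`. -/
def betaCoeff : ℕ → (ℕ → ℂ) → ℂ
  | 0, a => a 0
  | n + 1, a => (betaCoeff n (fun m => a (m + 1)) - n * betaCoeff n a) / (n + 1)

/-- The power series `∑ a_m log(1+u)^m / m!`. -/
def beta (a : ℕ → ℂ) : PowerSeries ℂ := PowerSeries.mk fun n => betaCoeff n a

theorem coeff_one_add_X_mul_derivative (Z : PowerSeries ℂ) (n : ℕ) :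
    coeff n ((1 + X) * derivative ℂ Z) = (n + 1) * coeff (n + 1) Z + n * coeff n Z := by
  rw [add_mul, one_mul, map_add, coeff_derivative]
  cases n with
  | zero => simp
  | succ n =>
    rw [coeff_succ_X_mul, coeff_derivative]
    push_cast
    ring

/-- The operator (1+u) d/du sends log(1+u)^m / m! to log(1+u)^{m-1} / (m-1)!, so it shifts the
sequence. This is what the recursion for `betaCoeff` encodes. -/
theorem one_add_X_mul_derivative_beta (a : ℕ → ℂ) :
    (1 + X) * derivative ℂ (beta a) = beta fun m => a (m + 1) := by
  ext n
  have hn : (n + 1 : ℂ) ≠ 0 := by exact_mod_cast succ_ne_zero n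
  rw [coeff_one_add_X_mul_derivative, beta, beta, coeff_mk, coeff_mk, coeff_mk, betaCoeff]
  field_simp
  ring

theorem constantCoeff_beta (a : ℕ → ℂ) : constantCoeff (beta a) = a 0 := by
  rw [← coeff_zero_ps, beta, coeff_mk, betaCoeff]

theorem betaCoeff_linear (n : ℕ) (s t : ℂ) (a b : ℕ → ℂ) :
    betaCoeff n (fun m => s * a m + t * b m) = s * betaCoeff n a + t * betaCoeff n b := by
  induction n generalizing a b with
  | zero => rfl
  | succ n ih =>
    rw [betaCoeff, betaCoeff, betaCoeff, ih, ih a b]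
    ring

theorem betaCoeff_zero_fun (n : ℕ) : betaCoeff n (fun _ => 0) = 0 := by
  have := betaCoeff_linear n 0 0 (fun _ => 0) (fun _ => 0)
  simpa using this

theorem betaCoeff_sum {ι : Type} (n : ℕ) (s : Finset ι) (a : ι → ℕ → ℂ) :
    betaCoeff n (fun m => ∑ i ∈ s, a i m) = ∑ i ∈ s, betaCoeff n (a i) := by
  classical
  induction s using induction_on with
  | empty => simpa using betaCoeff_zero_fun n
  | insert i s hi ih =>
    have h := betaCoeff_linear n 1 1 (a i) (fun m => ∑ i ∈ s, a i m)
    simp only [one_mul] at h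
    simp only [sum_insert hi]
    rw [h, ih]

theorem betaCoeff_congr {n : ℕ} {a b : ℕ → ℂ} (h : ∀ m ≤ n, a m = b m) :
    betaCoeff n a = betaCoeff n b := by
  induction n generalizing a b with
  | zero => exact h 0 le_rfl
  | succ n ih =>
    rw [betaCoeff, betaCoeff, ih (fun m hm => h m (by omega)),
      ih (a := fun m => a (m + 1)) (fun m hm => h (m + 1) (by omega))]

/-- The binomial series `(1+u)^l`. -/
def binSeries (l : ℂ) : PowerSeries ℂ := beta fun m => l ^ m

theorem one_add_X_mul_derivative_binSeries (l : ℂ) : (1 + X) * derivative ℂ (binSeries l) =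
      C l * binSeries l := by
  rw [binSeries, one_add_X_mul_derivative_beta]
  ext n
  rw [beta, beta, coeff_mk, coeff_C_mul, coeff_mk]
  have := betaCoeff_linear n l 0 (fun m => l ^ m) (fun _ => 0)
  simp only [mul_zero, add_zero, zero_mul] at this
  rw [← this]
  congr 1
  funext m
  ring

theorem constantCoeff_binSeries (l : ℂ) : constantCoeff (binSeries l) = 1 := by
  rw [binSeries, constantCoeff_beta, pow_zero]

theorem eq_binSeries {l : ℂ} {Z : PowerSeries ℂ} (h0 : constantCoeff Z = 1)
    (h : (1 + X) * derivative ℂ Z = C l * Z) : Z = binSeries l := by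
  ext n
  induction n with
  | zero =>
    rw [coeff_zero_ps, coeff_zero_ps, constantCoeff_binSeries, h0]
  | succ n ih =>
    have h1 := congrArg (coeff n) h
    have h2 := congrArg (coeff n) (one_add_X_mul_derivative_binSeries l)
    rw [coeff_one_add_X_mul_derivative, coeff_C_mul] at h1 h2
    rw [ih] at h1
    have hn : (n + 1 : ℂ) ≠ 0 := by exact_mod_cast succ_ne_zero n
    exact mul_left_cancel₀ hn (by linear_combination h1 - h2)

theorem one_add_X_mul_binSeries (l : ℂ) : (1 + X) * binSeries (l - 1) = binSeries l := by
  apply eq_binSeries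
  · rw [map_mul, constantCoeff_binSeries]; simp
  · have h := one_add_X_mul_derivative_binSeries (l - 1)
    have h1 : derivative ℂ ((1 + X) * binSeries (l - 1)) =
        (1 + X) * derivative ℂ (binSeries (l - 1)) + binSeries (l - 1) := by
      rw [leibniz]
      simp
    rw [h1, h, map_sub, map_one]
    ring

theorem derivative_binSeries (l : ℂ) : derivative ℂ (binSeries l) = C l * binSeries (l - 1) := by
  have h1 : (1 + X : PowerSeries ℂ) ≠ 0 := by
    intro hx
    have := congrArg constantCoeff hx
    simp at this
  apply mul_left_cancel₀ h1
  rw [one_add_X_mul_derivative_binSeries, mul_left_comm, one_add_X_mul_binSeries]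

end Beta

section Reg

variable {σ : Type} [Fintype σ] [DecidableEq σ]

/-- The points at which all functions `1 + u_i` are invertible. -/
def invSet (σ : Type) : Set (σ → ℂ) := {u | ∀ i, 1 + u i ≠ 0}

theorem isOpen_invSet : IsOpen (invSet σ) := by
  have : invSet σ = ⋂ i, {u : σ → ℂ | 1 + u i ≠ 0} := by
    ext u; simp [invSet]
  rw [this]
  exact isOpen_iInter_of_finite fun i =>
    isOpen_ne_fun (continuous_const.add (continuous_apply i)) continuous_const

theorem zero_mem_invSet : (0 : σ → ℂ) ∈ invSet σ := fun i => by simp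

/-- A function that is smooth where all `1 + u_i` are invertible, and its Taylor series. -/
structure Reg (f : (σ → ℂ) → ℂ) (K : MvPowerSeries σ ℂ) : Prop where
  smooth : ContDiffOn ℂ ∞ f (invSet σ)
  taylor : IsTaylor f K

theorem Reg.const (c : ℂ) : Reg (fun _ : σ → ℂ => c) (MvPowerSeries.C c) :=
  ⟨contDiffOn_const, fun n => TaylorTo.const n c⟩

theorem Reg.coord (j : σ) : Reg (fun x : σ → ℂ => x j) (MvPowerSeries.X j) :=
  ⟨(contDiff_apply ℂ ℂ j).contDiffOn, fun n => TaylorTo.coord n j⟩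

theorem Reg.add {f g : (σ → ℂ) → ℂ} {K J : MvPowerSeries σ ℂ} (h : Reg f K) (h' : Reg g J) :
    Reg (fun x => f x + g x) (K + J) := ⟨h.smooth.add h'.smooth, fun n =>
    TaylorTo.add isOpen_invSet zero_mem_invSet h.smooth h'.smooth (h.taylor n) (h'.taylor n)⟩

theorem Reg.mul {f g : (σ → ℂ) → ℂ} {K J : MvPowerSeries σ ℂ} (h : Reg f K) (h' : Reg g J) :
    Reg (fun x => f x * g x) (K * J) := ⟨h.smooth.mul h'.smooth, fun n =>
    TaylorTo.mul isOpen_invSet zero_mem_invSet h.smooth h'.smooth (h.taylor n) (h'.taylor n)⟩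

theorem Reg.sum {ι : Type} (s : Finset ι) {f : ι → (σ → ℂ) → ℂ} {K : ι → MvPowerSeries σ ℂ}
    (h : ∀ i ∈ s, Reg (f i) (K i)) : Reg (fun x => ∑ i ∈ s, f i x) (∑ i ∈ s, K i) := by
  classical
  induction s using induction_on with
  | empty => simpa using Reg.const (0 : ℂ)
  | insert i s hi ih =>
    simp only [sum_insert hi]
    exact (h i (mem_insert_self i s)).add
      (ih fun j hj => h j (Finset.mem_insert_of_mem hj))

theorem Reg.prod {ι : Type} (s : Finset ι) {f : ι → (σ → ℂ) → ℂ} {K : ι → MvPowerSeries σ ℂ}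
    (h : ∀ i ∈ s, Reg (f i) (K i)) : Reg (fun x => ∏ i ∈ s, f i x) (∏ i ∈ s, K i) := by
  classical
  induction s using induction_on with
  | empty => simpa using Reg.const (1 : ℂ)
  | insert i s hi ih =>
    simp only [prod_insert hi]
    exact (h i (mem_insert_self i s)).mul
      (ih fun j hj => h j (Finset.mem_insert_of_mem hj))

theorem Reg.pow {f : (σ → ℂ) → ℂ} {K : MvPowerSeries σ ℂ} (h : Reg f K) (n : ℕ) :
    Reg (fun x => f x ^ n) (K ^ n) := by
  have := Reg.prod (range n) (f := fun _ => f) (K := fun _ => K) fun _ _ => h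
  simpa using this

/-- This transfers identities between functions, valid where all 1 + u_i are invertible, to formal
power series. -/
theorem Reg.eq {f g : (σ → ℂ) → ℂ} {K J : MvPowerSeries σ ℂ} (h : Reg f K) (h' : Reg g J)
    (hfg : ∀ u ∈ invSet σ, f u = g u) : K = J :=
  (h.taylor.congr (Filter.eventuallyEq_of_mem (isOpen_invSet.mem_nhds zero_mem_invSet)
    hfg)).unique h'.taylor

theorem contDiffOn_zpow (i : σ) (l : ℤ) :
    ContDiffOn ℂ ∞ (fun u : σ → ℂ => (1 + u i) ^ l) (invSet σ) := by
  have h1 : ContDiffOn ℂ ∞ (fun u : σ → ℂ => 1 + u i) (invSet σ) :=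
    contDiffOn_const.add (contDiff_apply ℂ ℂ i).contDiffOn
  cases l with
  | ofNat n => simpa using h1.pow n
  | negSucc n =>
    simp only [zpow_negSucc]
    exact (h1.pow (n + 1)).inv fun u hu => pow_ne_zero _ (hu i)

theorem taylorTo_zpow (n : ℕ) (i : σ) (l : ℤ) :
    TaylorTo n (fun u : σ → ℂ => (1 + u i) ^ l) (emb i (binSeries l)) := by
  have hc : ∀ l : ℤ, (1 + (0 : σ → ℂ) i) ^ l =
      MvPowerSeries.constantCoeff (emb i (binSeries l)) := by
    intro l
    rw [constantCoeff_emb, constantCoeff_binSeries]; simp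
  induction n generalizing l with
  | zero => exact hc l
  | succ n ih =>
    refine ⟨hc l, fun j => ?_⟩
    by_cases hij : j = i
    · subst hij
      rw [pderiv_emb_self, derivative_binSeries, map_mul]
      have h1 : emb j (C (l : ℂ)) = (MvPowerSeries.C (l : ℂ) : MvPowerSeries σ ℂ) :=
        commutes (emb j) (l : ℂ)
      have h2 : (l : ℂ) - 1 = ((l - 1 : ℤ) : ℂ) := by push_cast; ring
      rw [h1, h2]
      refine (TaylorTo.mul isOpen_invSet zero_mem_invSet contDiffOn_const
        (contDiffOn_zpow j (l - 1)) (TaylorTo.const n (l : ℂ)) (ih (l - 1))).congr ?_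
      filter_upwards [isOpen_invSet.mem_nhds zero_mem_invSet] with u hu
      have h3 : HasDerivAt (fun t : ℂ => (1 + (u + t • (single j 1 : σ → ℂ)) j) ^ l)
          (l * (1 + u j) ^ (l - 1) * 1) 0 := by
        have h4 : HasDerivAt (fun t : ℂ => 1 + (u + t • (single j 1 : σ → ℂ)) j) 1 0 := by
          simp only [Pi.add_apply, Pi.smul_apply, Pi.single_eq_same, smul_eq_mul, mul_one]
          exact ((hasDerivAt_id (0 : ℂ)).const_add (u j)).const_add 1
        have h5 := hasDerivAt_zpow l (1 + u j) (Or.inl (hu j))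
        have h6 := HasDerivAt.comp (h := fun t : ℂ => 1 + (u + t • (single j 1 : σ → ℂ)) j)
          (h₂ := fun y : ℂ => y ^ l) (0 : ℂ) (by simpa using h5) h4
        exact h6
      rw [mul_one] at h3
      exact h3.deriv.symm
    · rw [pderiv_emb_of_ne (Ne.symm hij)]
      have h1 : pd j (fun u : σ → ℂ => (1 + u i) ^ l) = fun _ => 0 := by
        funext u
        rw [pd, lineDeriv]
        have : (fun t : ℂ => (1 + (u + t • (single j 1 : σ → ℂ)) i) ^ l) =
            fun _ => (1 + u i) ^ l := by
          funext t
          simp [Pi.single_eq_of_ne (Ne.symm hij)]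
        rw [this, deriv_const]
      rw [h1]
      simpa using TaylorTo.const (σ := σ) n 0

theorem Reg.zpow (i : σ) (l : ℤ) : Reg (fun u : σ → ℂ => (1 + u i) ^ l) (emb i (binSeries l)) :=
  ⟨contDiffOn_zpow i l, fun n => taylorTo_zpow n i l⟩

/-- The branching rule writes a Schur polynomial as a finite sum of products of integer powers of
the variables. Only the existence of the Taylor series matters here; it is identified later. -/
theorem exists_reg_schur (N : ℕ) (lam : Fin N → ℤ) (g : (σ → ℂ) → Fin N → ℂ)
    (hg : ∀ i, (∀ u, g u i = 1) ∨ ∃ s, ∀ u, g u i = 1 + u s) :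
    ∃ K, Reg (fun u => schur N lam (g u)) K := by
  induction N with
  | zero => exact ⟨_, Reg.const 1⟩
  | succ N ih =>
    have h1 := fun mu : Fin N → ℤ => ih mu (fun u i => g u i.castSucc) fun i => hg i.castSucc
    choose K hK using h1
    have h2 : ∀ k : ℤ, ∃ J, Reg (fun u => g u (Fin.last N) ^ k) J := by
      intro k
      rcases hg (Fin.last N) with h | ⟨s, h⟩
      · exact ⟨_, by simpa [h] using Reg.const (1 : ℂ)⟩
      · exact ⟨_, by simpa [h] using Reg.zpow s k⟩
    choose J hJ using h2
    exact ⟨_, Reg.sum _ fun mu _ => (hK mu).mul (hJ _)⟩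

end Reg

end

/-! ### Normalized Schur polynomials as images of products of one-variable series. -/

section

open MvPowerSeries (X pderiv smul_eq_C_mul)
open PowerSeries (coeff coeff_C_mul)

open scoped ContDiff




section Phi

theorem betaCoeff_of_lt {n M : ℕ} {a : ℕ → ℂ} (h : ∀ m < M, a m = 0) (hn : n < M) :
    betaCoeff n a = 0 := by
  rw [← betaCoeff_zero_fun n]
  exact betaCoeff_congr fun m hm => h m (by omega)

theorem betaCoeff_self {M : ℕ} {a : ℕ → ℂ} (h : ∀ m < M, a m = 0) :
    betaCoeff M a = a M / (M.factorial : ℂ) := by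
  induction M generalizing a with
  | zero => simp [betaCoeff]
  | succ M ih =>
    rw [betaCoeff, ih (a := fun m => a (m + 1)) (fun m hm => h (m + 1) (by omega)),
      betaCoeff_of_lt h (Nat.lt_succ_self M), factorial_succ]
    have hn : (M + 1 : ℂ) ≠ 0 := by exact_mod_cast succ_ne_zero M
    have hf : (M.factorial : ℂ) ≠ 0 := by exact_mod_cast factorial_ne_zero M
    push_cast
    field_simp
    ring

variable {N : ℕ}

/-- The power series `∑_j w_j (1+u)^{a_j}`, where `w_j = ∏_{m ≠ j} (a_j - a_m)⁻¹`. -/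
def wtSeries (a : Fin N → ℂ) : PowerSeries ℂ := beta fun m => ∑ j, wt a j * a j ^ m

theorem wtSeries_eq_sum (a : Fin N → ℂ) :
    wtSeries a = ∑ j, PowerSeries.C (wt a j) * binSeries (a j) := by
  ext n
  rw [wtSeries, beta, coeff_mk, betaCoeff_sum, map_sum]
  refine sum_congr rfl fun j _ => ?_
  rw [coeff_C_mul, binSeries, beta, coeff_mk]
  have := betaCoeff_linear n (wt a j) 0 (fun m => a j ^ m) (fun _ => 0)
  simpa using this

/-- The normalized power series `(N-1)! u^{1-N} ∑_j w_j (1+u)^{a_j}`. -/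
def phi (a : Fin N → ℂ) : PowerSeries ℂ :=
  PowerSeries.mk fun n => ((N - 1).factorial : ℂ) * coeff (n + (N - 1)) (wtSeries a)

/-- The moments of order below N - 1 vanish and log(1+u)^m is divisible by u^m, so u^{N-1} divides
the series. -/
theorem wtSeries_eq_mul_phi {a : Fin N → ℂ} (ha : Function.Injective a) :
    wtSeries a = PowerSeries.C ((N - 1).factorial : ℂ)⁻¹ * (PowerSeries.X ^ (N - 1) * phi a) := by
  have hf : ((N - 1).factorial : ℂ) ≠ 0 := by exact_mod_cast factorial_ne_zero _
  ext n
  rw [coeff_C_mul, coeff_X_pow_mul']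
  split_ifs with h
  · rw [phi, coeff_mk, Nat.sub_add_cancel h, inv_mul_cancel_left₀ hf]
  · rw [mul_zero, wtSeries, beta, coeff_mk]
    exact betaCoeff_of_lt (M := N - 1)
      (fun m hm => sum_wt_mul_pow_of_lt ha (by omega)) (by omega)

theorem constantCoeff_phi [NeZero N] {a : Fin N → ℂ} (ha : Function.Injective a) :
    PowerSeries.constantCoeff (phi a) = 1 := by
  have hf : ((N - 1).factorial : ℂ) ≠ 0 := by exact_mod_cast factorial_ne_zero _
  have hN : N ≠ 0 := NeZero.ne N
  rw [← coeff_zero_ps, phi, coeff_mk, zero_add, wtSeries, beta, coeff_mk,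
    betaCoeff_self (fun m hm => sum_wt_mul_pow_of_lt ha (by omega)),
    sum_wt_mul_pow_of_eq ha (by omega)]
  field_simp

end Phi

section Operators

variable {σ : Type} [Fintype σ] [DecidableEq σ]

/-- The operator `(1 + u_i) ∂/∂u_i`. -/
def opD (i : σ) : MvPowerSeries σ ℂ →ₗ[ℂ] MvPowerSeries σ ℂ :=
  mulLeft ℂ (1 + X i) ∘ₗ (pderiv ℂ i).toLinearMap

theorem opD_apply (i : σ) (K : MvPowerSeries σ ℂ) : opD i K = (1 + X i) * pderiv ℂ i K := rfl

/-- The product of the operators `D_i - D_j` over a list of pairs `(i, j)`. -/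
def bigD : List (σ × σ) → MvPowerSeries σ ℂ →ₗ[ℂ] MvPowerSeries σ ℂ
  | [] => LinearMap.id
  | p :: P => (opD p.1 - opD p.2) ∘ₗ bigD P

/-- The powers (1+u)^l are eigenfunctions of (1+u) d/du. A polynomial in the exponents is therefore
produced by a differential operator. -/
theorem opD_tens (τ : σ → PowerSeries ℂ) (l : σ → ℂ)
    (h : ∀ i, (1 + PowerSeries.X) * derivative ℂ (τ i) = PowerSeries.C (l i) * τ i)
    (i : σ) : opD i (tens τ) = l i • tens τ := by
  obtain ⟨v, hv⟩ : ∃ v : PowerSeries ℂ, v * (1 + PowerSeries.X) = 1 :=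
    ⟨(1 + PowerSeries.X)⁻¹, PowerSeries.inv_mul_cancel _ (by simp)⟩
  have h1 : ∀ i, derivative ℂ (τ i) = (PowerSeries.C (l i) * v) * τ i := by
    intro i
    calc derivative ℂ (τ i) = v * (1 + PowerSeries.X) * derivative ℂ (τ i) := by rw [hv, one_mul]
      _ = _ := by rw [mul_assoc, h]; ring
  rw [opD_apply, pderiv_tens τ _ h1 i]
  have h2 : (1 + X i : MvPowerSeries σ ℂ) = emb i (1 + PowerSeries.X) := by
    rw [map_add, map_one, emb_X]
  have h3 : emb i (PowerSeries.C (l i)) = (MvPowerSeries.C (l i) : MvPowerSeries σ ℂ) :=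
    commutes (emb i) (l i)
  rw [h2, ← mul_assoc, ← map_mul, mul_left_comm, mul_comm _ v, hv, mul_one, h3, smul_eq_C_mul]

theorem bigD_tens (τ : σ → PowerSeries ℂ) (l : σ → ℂ)
    (h : ∀ i, (1 + PowerSeries.X) * derivative ℂ (τ i) = PowerSeries.C (l i) * τ i)
    (P : List (σ × σ)) : bigD P (tens τ) = (P.map fun p => l p.1 - l p.2).prod • tens τ := by
  induction P with
  | nil => simp [bigD]
  | cons p P ih =>
    rw [bigD, LinearMap.comp_apply, ih, map_smul, LinearMap.sub_apply, opD_tens τ l h,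
      opD_tens τ l h, ← sub_smul, smul_smul, List.map_cons, List.prod_cons, mul_comm]

end Operators

section Pairs

variable {H r : ℕ}

/-- The pairs of variables of the same colour. -/
def pairList (H r : ℕ) : List ((Fin H × Fin r) × (Fin H × Fin r)) :=
  ((univ.filter fun q : Fin H × Fin r × Fin r => q.2.1 < q.2.2).toList).map
    fun q => ((q.1, q.2.1), (q.1, q.2.2))

theorem mem_pairList {p : (Fin H × Fin r) × (Fin H × Fin r)} (hp : p ∈ pairList H r) :
    p.1.1 = p.2.1 ∧ p.1.2 < p.2.2 := by
  simp only [pairList, List.mem_map, Finset.mem_toList, mem_filter] at hp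
  obtain ⟨q, hq, rfl⟩ := hp
  exact ⟨rfl, hq.2⟩

theorem prod_pairList {M : Type*} [CommMonoid M] (φ : Fin H × Fin r → Fin H × Fin r → M) :
    ((pairList H r).map fun p => φ p.1 p.2).prod =
      ∏ h, ∏ i, ∏ j ∈ Finset.Ioi i, φ (h, i) (h, j) := by
  rw [pairList, List.map_map, Finset.prod_map_toList, prod_filter, prod_prod_type]
  refine prod_congr rfl fun h _ => ?_
  rw [prod_prod_type]
  refine prod_congr rfl fun i _ => ?_
  rw [← prod_filter, ← Finset.filter_lt_eq_Ioi]
  rfl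

theorem sum_pairList {M : Type*} [AddCommMonoid M] (φ : Fin H × Fin r → Fin H × Fin r → M) :
    ((pairList H r).map fun p => φ p.1 p.2).sum =
      ∑ h, ∑ i, ∑ j ∈ Finset.Ioi i, φ (h, i) (h, j) := by
  rw [pairList, List.map_map, Finset.sum_map_toList, Finset.sum_filter, Fintype.sum_prod_type]
  refine sum_congr rfl fun h _ => ?_
  rw [Fintype.sum_prod_type]
  refine sum_congr rfl fun i _ => ?_
  rw [← Finset.sum_filter, ← Finset.filter_lt_eq_Ioi]
  rfl

/-- The number of pairs in the list that contain `x`. -/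
def incidence {σ : Type} [DecidableEq σ] (P : List (σ × σ)) (x : σ) : ℕ :=
  (P.map fun p => (if p.1 = x then 1 else 0) + (if p.2 = x then 1 else 0)).sum

/-- Each variable meets the r - 1 others of its colour. This is the difference between the exponent
N - 1 of u in the one-variable series and the exponent N - r in the Schur polynomial. -/
theorem incidence_pairList (x : Fin H × Fin r) : incidence (pairList H r) x = r - 1 := by
  obtain ⟨g, k⟩ := x
  rw [incidence, sum_pairList fun a b => (if a = (g, k) then 1 else 0) + if b = (g, k) then 1 else 0]
  simp only [sum_add_distrib, Prod.mk.injEq]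
  rw [sum_eq_single g (by intro h _ hne; simp [hne]) (by simp),
    sum_eq_single g (by intro h _ hne; simp [hne]) (by simp)]
  simp only [true_and, sum_const, smul_eq_mul, mul_ite, mul_one, mul_zero,
    Finset.sum_ite_eq', mem_univ, if_true, mem_Ioi, Fin.card_Ioi]
  rw [Finset.sum_ite, Finset.sum_const_zero, add_zero, sum_const, smul_eq_mul, mul_one]
  have : (univ.filter fun i : Fin r => i < k) = Finset.Iio k := by ext; simp
  rw [this, Fin.card_Iio]
  have := k.2
  omega

end Pairs

section SchurSeries

variable {H : ℕ} {N : Fin H → ℕ}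

/-- The product of the normalized Schur polynomials in the variables `1 + u_{h,i}`, `i < r`, all
other variables being equal to `1`. -/
def schurSlice (r : ℕ) (lam : ∀ h, GT (N h)) (u : Fin H × Fin r → ℂ) : ℂ :=
  ∏ h, schur (N h) (lam h).1 (pad (N h) fun i => 1 + u (h, i)) / schur (N h) (lam h).1 1

theorem exists_reg_schurSlice (r : ℕ) (lam : ∀ h, GT (N h)) : ∃ K, Reg (schurSlice r lam) K := by
  have h1 : ∀ h, ∃ K, Reg (fun u : Fin H × Fin r → ℂ =>
      schur (N h) (lam h).1 (pad (N h) fun i => 1 + u (h, i))) K := by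
    intro h
    apply exists_reg_schur
    intro i
    simp only [pad]
    by_cases hi : (i : ℕ) < r
    · right
      exact ⟨(h, ⟨i, hi⟩), fun u => by simp [hi]⟩
    · left
      intro u
      simp [hi]
  choose K hK using h1
  refine ⟨_, Reg.prod univ (K := fun h => K h *
    MvPowerSeries.C (schur (N h) (lam h).1 1)⁻¹) fun h _ => ?_⟩
  simp only [div_eq_mul_inv]
  exact (hK h).mul (Reg.const _)

/-- The Taylor series of `schurSlice`. -/
def schurSeries (r : ℕ) (lam : ∀ h, GT (N h)) : MvPowerSeries (Fin H × Fin r) ℂ :=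
  (exists_reg_schurSlice r lam).choose

theorem reg_schurSlice (r : ℕ) (lam : ∀ h, GT (N h)) : Reg (schurSlice r lam) (schurSeries r lam) :=
  (exists_reg_schurSlice r lam).choose_spec

/-- The shifted coordinates `λ_j + N - j` of a signature, as complex numbers. -/
def shiftedC {N : ℕ} (lam : GT N) (j : Fin N) : ℂ := (shifted lam.1 j : ℂ)

theorem shiftedC_injective {N : ℕ} (lam : GT N) : Function.Injective (shiftedC lam) :=
  shifted_cast_injective lam.2

/-- In the formula of `exists_schur_pad` the Vandermonde product of the chosen l_{f(i)} is the
eigenvalue of ∏ (D_i - D_j) on ∏ (1+u_i)^{l_{f(i)}}. Pulling the operator out of the sum over f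
leaves a product of one-variable sums. Since `C` does not depend on the signatures, expectations can
be taken afterwards. -/
theorem exists_schurSeries_eq (r : ℕ) (hr : ∀ h, r ≤ N h) : ∃ C : ℂ, ∀ lam : ∀ h, GT (N h),
    MvPowerSeries.C C * (((pairList H r).map fun p =>
        (X p.1 - X p.2 : MvPowerSeries (Fin H × Fin r) ℂ)).prod *
      ∏ x : Fin H × Fin r, X x ^ (N x.1 - r)) * schurSeries r lam =
    bigD (pairList H r) (tens fun x => wtSeries (shiftedC (lam x.1))) := by
  choose C hC using fun h => exists_schur_pad (N h) r (hr h)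
  refine ⟨∏ h, C h, fun lam => ?_⟩
  have hneg : ∀ i : Fin H × Fin r, Reg (fun u : Fin H × Fin r → ℂ => -u i)
      (-X i) := by
    intro i
    have := (Reg.const (-1 : ℂ)).mul (Reg.coord i)
    simpa using this
  have hL : Reg (fun u : Fin H × Fin r → ℂ => (∏ h, C h) *
      ((∏ h, ∏ i, ∏ j ∈ Finset.Ioi i, (u (h, i) + -u (h, j))) *
        ∏ x : Fin H × Fin r, u x ^ (N x.1 - r)) * schurSlice r lam u)
      (MvPowerSeries.C (∏ h, C h) * ((∏ h, ∏ i, ∏ j ∈ Finset.Ioi i, (X (h, i) + -X (h, j))) *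
        ∏ x : Fin H × Fin r, X x ^ (N x.1 - r)) * schurSeries r lam) := by
    refine ((Reg.const _).mul (Reg.mul ?_ ?_)).mul (reg_schurSlice r lam)
    · exact Reg.prod _ fun h _ => Reg.prod _ fun i _ => Reg.prod _ fun j _ =>
        (Reg.coord _).add (hneg _)
    · exact Reg.prod _ fun x _ => (Reg.coord x).pow _
  set l : (∀ h, Fin r → Fin (N h)) → Fin H × Fin r → ℤ :=
    fun f x => shifted (lam x.1).1 (f x.1 x.2) with hl
  have hR : Reg (fun u : Fin H × Fin r → ℂ => ∑ f : ∀ h, Fin r → Fin (N h),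
      ((∏ h, ∏ i, ∏ j ∈ Finset.Ioi i, ((l f (h, i) : ℂ) - l f (h, j))) *
        ∏ x : Fin H × Fin r, wt (shiftedC (lam x.1)) (f x.1 x.2)) *
        ∏ x : Fin H × Fin r, (1 + u x) ^ l f x)
      (∑ f : ∀ h, Fin r → Fin (N h),
      MvPowerSeries.C ((∏ h, ∏ i, ∏ j ∈ Finset.Ioi i, ((l f (h, i) : ℂ) - l f (h, j))) *
        ∏ x : Fin H × Fin r, wt (shiftedC (lam x.1)) (f x.1 x.2)) *
        tens fun x => binSeries (l f x)) :=
    Reg.sum _ fun f _ => (Reg.const _).mul (Reg.prod _ fun x _ => Reg.zpow x _)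
  -- The functional identity is the product over the colours of the identities for single Schur
  -- polynomials, with the product of sums expanded into one sum over the families f.
  have hE := hL.eq hR (fun u hu => by
    have h1 := fun h => hC h (lam h).1 (lam h).2 (fun i => 1 + u (h, i)) fun i => hu (h, i)
    have h2 := prod_congr (s₁ := univ) rfl fun h _ => h1 h
    rw [prod_mul_distrib, prod_mul_distrib, prod_mul_distrib, Finset.prod_univ_sum] at h2
    simp only [Fintype.piFinset_univ] at h2
    have h3 : (∏ h, vdm fun i : Fin r => 1 + u (h, i)) =
        ∏ h, ∏ i, ∏ j ∈ Finset.Ioi i, (u (h, i) + -u (h, j)) := by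
      refine prod_congr rfl fun h _ => prod_congr rfl fun i _ =>
        prod_congr rfl fun j _ => by ring
    rw [h3] at h2
    rw [schurSlice]
    simp only [prod_prod_type]
    simp only [add_sub_cancel_left] at h2
    refine h2.trans (sum_congr rfl fun f _ => ?_)
    rw [prod_mul_distrib, mul_assoc]
    congr 1
    rw [← prod_mul_distrib]
    refine prod_congr rfl fun h _ => ?_
    rw [prod_mul_distrib, mul_comm]
    rfl)
  rw [prod_pairList fun a b =>
    (X a - X b : MvPowerSeries (Fin H × Fin r) ℂ)]
  simp only [← sub_eq_add_neg] at hE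
  rw [hE]
  have h4 : (tens fun x : Fin H × Fin r => wtSeries (shiftedC (lam x.1))) =
      ∑ f : ∀ h, Fin r → Fin (N h), (∏ x : Fin H × Fin r, wt (shiftedC (lam x.1)) (f x.1 x.2)) •
          tens fun x => binSeries (l f x) := by
    have h5 : ∀ x : Fin H × Fin r, emb x (wtSeries (shiftedC (lam x.1))) =
        ∑ j, MvPowerSeries.C (wt (shiftedC (lam x.1)) j) *
          emb x (binSeries (shiftedC (lam x.1) j)) := by
      intro x
      rw [wtSeries_eq_sum, map_sum]
      refine sum_congr rfl fun j _ => ?_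
      rw [map_mul]
      congr 1
      exact commutes (emb x) _
    simp only [tens, h5]
    rw [prod_prod_type]
    simp only [Finset.prod_univ_sum, Fintype.piFinset_univ]
    refine sum_congr rfl fun f _ => ?_
    rw [smul_eq_C_mul, prod_prod_type, prod_prod_type, map_prod]
    simp only [map_prod]
    rw [← prod_mul_distrib]
    refine prod_congr rfl fun h _ => ?_
    rw [← prod_mul_distrib]
    rfl
  rw [h4, map_sum]
  refine sum_congr rfl fun f _ => ?_
  rw [map_smul, bigD_tens _ (fun x => (l f x : ℂ))
    (fun x => one_add_X_mul_derivative_binSeries _), smul_smul,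
    prod_pairList fun a b => ((l f a : ℂ) - l f b), smul_eq_C_mul, mul_comm
    (∏ x : Fin H × Fin r, _) _]

end SchurSeries

end

/-! ### Expectations of random series, and conjugation of the operators. -/

section

open MvPowerSeries (X coeff coeff_mul pderiv smul_eq_C_mul)
open Finsupp (single)

section Mean

variable {σ Ω : Type} [Fintype σ] [DecidableEq σ]

/-- The expectation of a random power series, coefficient by coefficient. -/
def mean (E : (Ω → ℂ) →ₗ[ℂ] ℂ) (K : Ω → MvPowerSeries σ ℂ) : MvPowerSeries σ ℂ :=
  fun n => E fun ω => coeff n (K ω)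

variable (E : (Ω → ℂ) →ₗ[ℂ] ℂ)

theorem coeff_mean (K : Ω → MvPowerSeries σ ℂ) (n : σ →₀ ℕ) :
    coeff n (mean E K) = E fun ω => coeff n (K ω) := rfl

theorem mean_sub (K J : Ω → MvPowerSeries σ ℂ) :
    mean E (fun ω => K ω - J ω) = mean E K - mean E J := by
  ext n
  simp only [coeff_mean, map_sub]
  rw [← map_sub]
  rfl

/-- Every coefficient of a product is a finite linear combination, so an arbitrary linear functional
will do and no convergence is involved. -/
theorem mean_mul (J : MvPowerSeries σ ℂ) (K : Ω → MvPowerSeries σ ℂ) :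
    mean E (fun ω => J * K ω) = J * mean E K := by
  ext n
  simp only [coeff_mean, coeff_mul]
  have : (fun ω => ∑ p ∈ antidiagonal n, coeff p.1 J * coeff p.2 (K ω)) = ∑ p ∈ antidiagonal n,
        coeff p.1 J • fun ω => coeff p.2 (K ω) := by
    funext ω
    simp
  rw [this, map_sum]
  refine sum_congr rfl fun p _ => ?_
  rw [map_smul, smul_eq_mul]

theorem mean_pderiv (i : σ) (K : Ω → MvPowerSeries σ ℂ) :
    mean E (fun ω => pderiv ℂ i (K ω)) = pderiv ℂ i (mean E K) := by
  ext n
  simp only [coeff_mean, MvPowerSeries.coeff_pderiv]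
  have : (fun ω => coeff (n + single i 1) (K ω) * ((n i : ℂ) + 1)) =
      ((n i : ℂ) + 1) • fun ω => coeff (n + single i 1) (K ω) := by
    funext ω
    simp [mul_comm]
  rw [this, map_smul, smul_eq_mul, mul_comm]

theorem mean_opD (i : σ) (K : Ω → MvPowerSeries σ ℂ) :
    mean E (fun ω => opD i (K ω)) = opD i (mean E K) := by
  simp only [opD_apply]
  rw [mean_mul, mean_pderiv]

theorem mean_bigD (P : List (σ × σ)) (K : Ω → MvPowerSeries σ ℂ) :
    mean E (fun ω => bigD P (K ω)) = bigD P (mean E K) := by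
  induction P with
  | nil => rfl
  | cons p P ih =>
    simp only [bigD, LinearMap.comp_apply, LinearMap.sub_apply]
    rw [mean_sub, mean_opD, mean_opD, ih]

end Mean

section Chain

variable {σ : Type} [Fintype σ] [DecidableEq σ]

/-- The composition of the operators `opB` over a list of pairs. -/
def chain (ν : σ → ℂ) (s : σ → PowerSeries ℂ) :
    List (σ × σ) → (σ → ℕ) → MvPowerSeries σ ℂ → MvPowerSeries σ ℂ
  | [], _, K => K
  | p :: P, a, K => opB p.1 p.2 ((a p.1 + 1) / ν p.1) ((a p.2 + 1) / ν p.1) (1 / ν p.1) (s p.1)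
      (chain ν s P (fun x => a x + ((if p.1 = x then 1 else 0) + if p.2 = x then 1 else 0)) K)

/-- The monomial with the exponents `a`. -/
def monX (a : σ → ℕ) : MvPowerSeries σ ℂ := ∏ x, X x ^ a x

theorem X_mul_pderiv_monX (a : σ → ℕ) (i : σ) : X i * pderiv ℂ i (monX a) =
      MvPowerSeries.C (a i : ℂ) * monX a := by
  have h0 : pderiv ℂ i
      (∏ x ∈ univ.erase i, (X x : MvPowerSeries σ ℂ) ^ a x) = 0 := by
    have h1 : ∀ s : Finset σ, i ∉ s → pderiv ℂ i
        (∏ x ∈ s, (X x : MvPowerSeries σ ℂ) ^ a x) = 0 := by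
      intro s
      induction s using Finset.induction_on with
      | empty => simp
      | insert x s hx ih =>
        intro hi
        rw [mem_insert, not_or] at hi
        rw [prod_insert hx, leibniz, ih hi.2, leibniz_pow, pderiv_X_of_ne (Ne.symm hi.1)]
        simp
    exact h1 _ (Finset.notMem_erase i _)
  rw [monX, ← mul_prod_erase univ _ (mem_univ i), leibniz, h0, leibniz_pow, pderiv_X_self]
  simp only [smul_eq_mul, mul_zero, zero_add, mul_one, nsmul_eq_mul, map_natCast]
  rcases Nat.eq_zero_or_pos (a i) with h | h
  · rw [h]; simp
  · obtain ⟨k, hk⟩ : ∃ k, a i = k + 1 := ⟨a i - 1, by omega⟩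
    rw [hk, Nat.add_sub_cancel]
    ring

theorem monX_add (a b : σ → ℕ) : monX (fun x => a x + b x) = monX a * monX b := by
  simp only [monX, pow_add, prod_mul_distrib]

theorem monX_single (i : σ) : monX (fun x => if i = x then 1 else 0) = X i := by
  rw [monX, prod_eq_single i]
  · simp
  · intro x _ hx; simp [Ne.symm hx]
  · simp

theorem monX_ne_zero (a : σ → ℕ) : monX a ≠ 0 :=
  prod_ne_zero_iff.mpr fun x _ => pow_ne_zero _ (fun h => by
    have := congrArg (coeff (single x 1)) h
    simp at this)

/-- By Leibniz' rule the operator acts on K, behind the monomial and T, as (1+u_i)((a_i+1)/u_i + τ_i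
+ ∂_i). The denominator uses up the factor u_i, which leaves u_j, and extracting ν keeps all the
coefficients bounded. -/
theorem opD_monX_mul {ν : ℂ} (hν : ν ≠ 0) (T τ : σ → PowerSeries ℂ)
    (hT : ∀ i, derivative ℂ (T i) = τ i * T i) {i j : σ} (hij : i ≠ j)
    (a : σ → ℕ) (K : MvPowerSeries σ ℂ) : opD i (monX a * (X i * X j) * tens T * K) =
      MvPowerSeries.C ν * (monX a * tens T * (X j *
        opP i ((a i + 1) / ν) (1 / ν) (PowerSeries.C (1 / ν) * (PowerSeries.X * τ i)) K)) := by
  have h1 := X_mul_pderiv_monX a i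
  have h2 := pderiv_tens T τ hT i
  have hC : (MvPowerSeries.C ν * MvPowerSeries.C (1 / ν) : MvPowerSeries σ ℂ) = 1 := by
    rw [← map_mul, mul_one_div_cancel hν, map_one]
  have hCa : (MvPowerSeries.C ν * MvPowerSeries.C (((a i : ℂ) + 1) / ν) : MvPowerSeries σ ℂ) =
      MvPowerSeries.C (a i : ℂ) + 1 := by
    rw [← map_mul, mul_div_cancel₀ _ hν, map_add, map_one]
  have h3 : emb i (PowerSeries.C (1 / ν)) = (MvPowerSeries.C (1 / ν) : MvPowerSeries σ ℂ) :=
    commutes (emb i) (1 / ν)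
  rw [opD_apply, leibniz, leibniz, leibniz, leibniz,
    pderiv_X_self, pderiv_X_of_ne hij.symm, h2, opP, map_mul, map_mul, emb_X, h3]
  simp only [smul_eq_mul, mul_zero, mul_one, zero_add]
  linear_combination (1 + X i) * X j * tens T * K * h1
    - (1 + X i) * monX a * tens T * X j * K * hCa
    - (1 + X i) * monX a * tens T * X j * (X i * emb i (τ i) * K + X i * pderiv ℂ i K) * hC

/-- Every factor D_i - D_j consumes one factor u_i u_j of the monomial. The equalities for ν and τ
within each pair are what makes the two terms combine into one `opB`. -/
theorem bigD_monX_mul {ν : σ → ℂ} (hν : ∀ x, ν x ≠ 0) (T τ : σ → PowerSeries ℂ)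
    (hT : ∀ i, derivative ℂ (T i) = τ i * T i) (P : List (σ × σ))
    (hP : ∀ p ∈ P, p.1 ≠ p.2 ∧ ν p.1 = ν p.2 ∧ τ p.1 = τ p.2) (a : σ → ℕ)
    (K : MvPowerSeries σ ℂ) : bigD P (monX (fun x => a x + incidence P x) * tens T * K) =
      MvPowerSeries.C (P.map fun p => ν p.1).prod * (monX a * tens T *
        chain ν (fun x => PowerSeries.C (1 / ν x) * (PowerSeries.X * τ x)) P a K) := by
  induction P generalizing a with
  | nil => simp [bigD, chain, incidence]
  | cons p P ih =>
    obtain ⟨h1, h2, h3⟩ := hP p (by simp)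
    have h4 := ih (fun q hq => hP q (by simp [hq]))
      (fun x => a x + ((if p.1 = x then 1 else 0) + if p.2 = x then 1 else 0))
    have h5 : (fun x => a x + incidence (p :: P) x) = fun x =>
        (a x + ((if p.1 = x then 1 else 0) + if p.2 = x then 1 else 0)) + incidence P x := by
      funext x
      simp only [incidence, List.map_cons, List.sum_cons]
      ring
    rw [h5, bigD, LinearMap.comp_apply, h4, ← smul_eq_C_mul, map_smul,
      monX_add a, monX_add (fun x => if p.1 = x then 1 else 0), monX_single, monX_single,
      LinearMap.sub_apply, opD_monX_mul (hν p.1) T τ hT h1]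
    rw [mul_comm (X p.1) (X p.2),
      opD_monX_mul (hν p.2) T τ hT h1.symm, ← h2, ← h3, chain, opB, List.map_cons,
      List.prod_cons, smul_eq_C_mul, map_mul]
    ring

/-- The exponents change only by bounded amounts along the list, so after division by ν → ∞ they
keep the limit 1 and `CT.opB` applies at each step. -/
theorem chain_CT {ν : ℕ → σ → ℂ} {s : ℕ → σ → PowerSeries ℂ} {t : σ → PowerSeries ℂ}
    (hν : ∀ x, Tendsto (fun L => 1 / ν L x) atTop (𝓝 0)) (hs : ∀ x, CT (fun L => s L x) (t x))
    (P : List (σ × σ)) (hP : ∀ p ∈ P, ∀ L, ν L p.1 = ν L p.2) {a : ℕ → σ → ℕ}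
    (ha : ∀ x, Tendsto (fun L => (a L x : ℂ) / ν L x) atTop (𝓝 1))
    {K : ℕ → MvPowerSeries σ ℂ} {k : MvPowerSeries σ ℂ} (hK : CT K k) :
    CT (fun L => chain (ν L) (s L) P (a L) (K L))
      ((P.map fun p => mulB p.1 p.2 ((1 + PowerSeries.X) * (1 + t p.1))).prod * k) := by
  induction P generalizing a with
  | nil => simpa [chain] using hK
  | cons p P ih =>
    have hadd : ∀ (x : σ) (m : ℕ → ℕ) (B : ℕ), (∀ L, m L = a L x + B) →
        Tendsto (fun L => (m L : ℂ) / ν L x) atTop (𝓝 1) := by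
      intro x m B hm
      have := (ha x).add ((hν x).const_mul (B : ℂ))
      simp only [mul_zero, add_zero] at this
      refine this.congr fun L => ?_
      rw [hm]; push_cast; ring
    have h1 := ih (fun q hq => hP q (by simp [hq]))
      (a := fun L x => a L x + ((if p.1 = x then 1 else 0) + if p.2 = x then 1 else 0))
      (fun x => hadd x _ _ fun L => rfl)
    have h2 : Tendsto (fun L => ((a L p.1 : ℂ) + 1) / ν L p.1) atTop (𝓝 1) := by
      simpa using hadd p.1 (fun L => a L p.1 + 1) 1 fun L => rfl
    have h3 : Tendsto (fun L => ((a L p.2 : ℂ) + 1) / ν L p.1) atTop (𝓝 1) := by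
      have := hadd p.2 (fun L => a L p.2 + 1) 1 fun L => rfl
      simp only [hP p (by simp)]
      simpa using this
    have h4 := CT.opB (i := p.1) (j := p.2) h2 h3 (hν p.1) (hs p.1) h1
    rw [List.map_cons, List.prod_cons, mul_assoc]
    exact h4

/-- The operators are removed one at a time by `CT.of_opB`. -/
theorem CT_of_chain {ν : ℕ → σ → ℂ} {s : ℕ → σ → PowerSeries ℂ} {t : σ → PowerSeries ℂ}
    (hν : ∀ x, Tendsto (fun L => 1 / ν L x) atTop (𝓝 0)) (hs : ∀ x, CT (fun L => s L x) (t x))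
    (hs0 : ∀ L x, PowerSeries.constantCoeff (s L x) = 0)
    (P : List (σ × σ)) (hP : ∀ p ∈ P, p.1 ≠ p.2 ∧ ∀ L, ν L p.1 = ν L p.2) {a : ℕ → σ → ℕ}
    (ha : ∀ x, Tendsto (fun L => (a L x : ℂ) / ν L x) atTop (𝓝 1))
    {K : ℕ → MvPowerSeries σ ℂ} {k : MvPowerSeries σ ℂ}
    (hK : CT (fun L => chain (ν L) (s L) P (a L) (K L)) k) : ∃ j, CT K j ∧
      (P.map fun p => mulB p.1 p.2 ((1 + PowerSeries.X) * (1 + t p.1))).prod * j = k := by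
  induction P generalizing a k with
  | nil => exact ⟨k, by simpa [chain] using hK, by simp⟩
  | cons p P ih =>
    have hadd : ∀ (x : σ) (m : ℕ → ℕ) (B : ℕ), (∀ L, m L = a L x + B) →
        Tendsto (fun L => (m L : ℂ) / ν L x) atTop (𝓝 1) := by
      intro x m B hm
      have := (ha x).add ((hν x).const_mul (B : ℂ))
      simp only [mul_zero, add_zero] at this
      refine this.congr fun L => ?_
      rw [hm]; push_cast; ring
    have h2 : Tendsto (fun L => ((a L p.1 : ℂ) + 1) / ν L p.1) atTop (𝓝 1) := by
      simpa using hadd p.1 (fun L => a L p.1 + 1) 1 fun L => rfl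
    have h3 : Tendsto (fun L => ((a L p.2 : ℂ) + 1) / ν L p.1) atTop (𝓝 1) := by
      have := hadd p.2 (fun L => a L p.2 + 1) 1 fun L => rfl
      simp only [(hP p (by simp)).2]
      simpa using this
    obtain ⟨k', hk', hk''⟩ := CT.of_opB (hP p (by simp)).1 h2 h3 (hν p.1) (hs p.1)
      (fun L => hs0 L p.1) hK
    obtain ⟨j, hj, hj'⟩ := ih (fun q hq => hP q (by simp [hq]))
      (a := fun L x => a L x + ((if p.1 = x then 1 else 0) + if p.2 = x then 1 else 0))
      (fun x => hadd x _ _ fun L => rfl) hk'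
    refine ⟨j, hj, ?_⟩
    rw [List.map_cons, List.prod_cons, mul_assoc, hj', hk'']

end Chain

section Kappa

variable {H : ℕ} {N : Fin H → ℕ}

/-- The power series of the normalized Schur polynomial of one colour in one variable. -/
def phiSeries (h : Fin H) (lam : ∀ h, GT (N h)) : PowerSeries ℂ := phi (shiftedC (lam h))

/-- The normalization of the products of the series `wtSeries`. -/
theorem tens_wtSeries (r : ℕ) (lam : ∀ h, GT (N h)) :
    (tens fun x : Fin H × Fin r => wtSeries (shiftedC (lam x.1))) =
      MvPowerSeries.C (∏ x : Fin H × Fin r, ((N x.1 - 1).factorial : ℂ)⁻¹) *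
        monX (fun x => N x.1 - 1) * tens fun x : Fin H × Fin r => phiSeries x.1 lam := by
  simp only [tens, monX, map_prod, ← prod_mul_distrib]
  refine prod_congr rfl fun x _ => ?_
  rw [wtSeries_eq_mul_phi (shiftedC_injective _), map_mul, map_mul, map_pow, emb_X, mul_assoc]
  congr 1
  exact commutes (emb x) _

/-- The quantifier order matters: κ serves all functionals E and all factorizations, so it can later
be computed from one convenient choice. -/
theorem exists_kappa (r : ℕ) (hr : ∀ h, r ≤ N h) (hN : ∀ h, 0 < N h) : ∃ κ : ℂ,
    ∀ (E : ((∀ h, GT (N h)) → ℂ) →ₗ[ℂ] ℂ) (T τ : Fin H → PowerSeries ℂ)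
      (G : MvPowerSeries (Fin H × Fin r) ℂ), (∀ h, derivative ℂ (T h) = τ h * T h) →
    (tens fun x : Fin H × Fin r => T x.1) * G =
      mean E (fun lam => tens fun x : Fin H × Fin r => phiSeries x.1 lam) →
    MvPowerSeries.C κ * ((pairList H r).map fun p =>
        (X p.2 - X p.1 : MvPowerSeries (Fin H × Fin r) ℂ)).prod * mean E (schurSeries r) =
    (tens fun x : Fin H × Fin r => T x.1) * chain (fun x => (N x.1 : ℂ))
        (fun x => PowerSeries.C (1 / (N x.1 : ℂ)) * (PowerSeries.X * τ x.1)) (pairList H r)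
        (fun x => N x.1 - r) G := by
  obtain ⟨C, hC⟩ := exists_schurSeries_eq r hr
  set ν : Fin H × Fin r → ℂ := fun x => (N x.1 : ℂ) with hνdef
  have hν : ∀ x, ν x ≠ 0 := fun x => by
    have := hN x.1
    simp only [hνdef]
    exact_mod_cast this.ne'
  set f : ℂ := ∏ x : Fin H × Fin r, ((N x.1 - 1).factorial : ℂ)⁻¹ with hfdef
  have hf : f ≠ 0 := prod_ne_zero_iff.mpr fun x _ =>
    inv_ne_zero (by exact_mod_cast factorial_ne_zero _)
  set n : ℂ := ((pairList H r).map fun p => ν p.1).prod with hndef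
  have hn : n ≠ 0 := by
    rw [hndef]
    apply List.prod_ne_zero
    simp [hν]
  set sg : ℂ := ((pairList H r).map fun _ => (-1 : ℂ)).prod with hsg
  have hV : ((pairList H r).map fun p =>
      (X p.1 - X p.2 : MvPowerSeries (Fin H × Fin r) ℂ)).prod =
      MvPowerSeries.C sg * ((pairList H r).map fun p =>
      (X p.2 - X p.1 : MvPowerSeries (Fin H × Fin r) ℂ)).prod := by
    rw [hsg, map_list_prod, List.map_map, ← List.prod_map_mul]
    congr 1
    refine List.map_congr_left fun p _ => ?_
    simp
  refine ⟨C * sg / (f * n), fun E T τ G hT hG => ?_⟩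
  have h1 := tens_wtSeries (N := N) r
  rw [← hfdef] at h1
  have h2 := congrArg (mean E) (funext hC)
  rw [mean_mul, mean_bigD] at h2
  simp only [h1] at h2
  rw [mean_mul, ← hG] at h2
  -- The exponent N - 1 splits as (N - r) + (r - 1), where the second part is consumed by the
  -- operators. The hypothesis r ≤ N makes the truncated subtraction harmless.
  have h3 : (fun x : Fin H × Fin r => N x.1 - 1) =
      fun x => (N x.1 - r) + incidence (pairList H r) x := by
    funext x
    rw [incidence_pairList]
    have := hr x.1
    have := x.2.2
    omega
  have h4 := bigD_monX_mul hν (fun x : Fin H × Fin r => T x.1) (fun x => τ x.1)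
    (fun x => hT x.1) (pairList H r) (fun p hp => by
      obtain ⟨ha, hb⟩ := mem_pairList hp
      refine ⟨fun h => ?_, by simp only [hνdef, ha], by rw [ha]⟩
      rw [h] at hb
      exact lt_irrefl _ hb) (fun x => N x.1 - r) G
  have hlin : ∀ K : MvPowerSeries (Fin H × Fin r) ℂ, bigD (pairList H r)
      (MvPowerSeries.C f * K) = MvPowerSeries.C f * bigD (pairList H r) K := by
    intro K
    rw [← smul_eq_C_mul, map_smul, smul_eq_C_mul]
  rw [mul_assoc (MvPowerSeries.C f), ← mul_assoc (monX _), h3, hlin, h4, hV] at h2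
  apply mul_left_cancel₀ (monX_ne_zero fun x : Fin H × Fin r => N x.1 - r)
  have h5 : MvPowerSeries.C (C * sg / (f * n)) * (MvPowerSeries.C f * MvPowerSeries.C n) =
      (MvPowerSeries.C C * MvPowerSeries.C sg : MvPowerSeries (Fin H × Fin r) ℂ) := by
    rw [← map_mul, ← map_mul, ← map_mul, div_mul_cancel₀ _ (mul_ne_zero hf hn)]
  have h6 : (MvPowerSeries.C f * MvPowerSeries.C n : MvPowerSeries (Fin H × Fin r) ℂ) ≠ 0 := by
    rw [← map_mul]
    intro h
    have := congrArg MvPowerSeries.constantCoeff h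
    rw [MvPowerSeries.constantCoeff_C, map_zero] at this
    exact mul_ne_zero hf hn this
  apply mul_left_cancel₀ h6
  have h7 : (∏ x : Fin H × Fin r, (X x : MvPowerSeries (Fin H × Fin r) ℂ) ^
    (N x.1 - r)) = monX fun x => N x.1 - r := rfl
  rw [h7] at h2
  linear_combination h2 + monX (fun x => N x.1 - r) * ((pairList H r).map fun p =>
      (X p.2 - X p.1 : MvPowerSeries (Fin H × Fin r) ℂ)).prod * mean E (schurSeries r) * h5

end Kappa

end

/-! ### One-variable restrictions, and equivalence of convergence of the two quotients. -/

section

open MvPowerSeries (X coeff coeff_one constantCoeff constantCoeff_C pderiv)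
open Finsupp (single)

section OneVariable

variable {σ : Type} [Fintype σ] [DecidableEq σ]

theorem iterate_pd_line (f : (σ → ℂ) → ℂ) (i : σ) (n : ℕ) (t : ℂ) :
    (pd i)^[n] f (t • Pi.single i 1) = deriv^[n] (fun s : ℂ => f (s • Pi.single i 1)) t := by
  induction n generalizing f t with
  | zero => rfl
  | succ n ih =>
    rw [iterate_succ_apply, iterate_succ_apply, ih]
    refine congrFun (congrArg deriv^[n] (funext fun s => ?_)) t
    rw [pd, lineDeriv]
    have : (fun t : ℂ => f (s • (Pi.single i 1 : σ → ℂ) + t • Pi.single i 1)) =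
        fun t : ℂ => (fun s : ℂ => f (s • Pi.single i 1)) (s + t) := by
      funext t
      simp only [add_smul]
    rw [this]
    have := deriv_comp_const_add (fun s : ℂ => f (s • Pi.single i 1)) s 0
    rw [add_zero] at this
    exact this

theorem IsTaylor.coeff_single {f : (σ → ℂ) → ℂ} {K : MvPowerSeries σ ℂ} (h : IsTaylor f K)
    (i : σ) (n : ℕ) : coeff (single i n) K * (n.factorial : ℂ) = (pd i)^[n] f 0 := by
  induction n generalizing f K with
  | zero =>
    have := (h 0).zero
    simp only [single_zero, Nat.factorial_zero, Nat.cast_one, mul_one, Function.iterate_zero, id_eq]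
    exact this.symm
  | succ n ih =>
    have h1 := ih (f := pd i f) (K := pderiv ℂ i K) fun m => (h (m + 1)).2 i
    rw [iterate_succ_apply, ← h1, MvPowerSeries.coeff_pderiv, ← single_add, factorial_succ]
    simp only [Finsupp.single_eq_same]
    push_cast
    ring

/-- Coefficients of pure powers of one variable depend only on the restriction of the function to a
coordinate line. -/
theorem IsTaylor.coeff_single_eq {τ : Type} [Fintype τ] [DecidableEq τ]
    {f : (σ → ℂ) → ℂ} {K : MvPowerSeries σ ℂ} (h : IsTaylor f K)
    {g : (τ → ℂ) → ℂ} {J : MvPowerSeries τ ℂ} (h' : IsTaylor g J) (i : σ) (j : τ)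
    (hfg : ∀ t : ℂ, 1 + t ≠ 0 → f (t • Pi.single i 1) = g (t • Pi.single j 1)) (n : ℕ) :
    coeff (single i n) K = coeff (single j n) J := by
  have hn : (n.factorial : ℂ) ≠ 0 := by exact_mod_cast factorial_ne_zero n
  apply mul_right_cancel₀ hn
  rw [h.coeff_single, h'.coeff_single]
  have h1 := iterate_pd_line f i n 0
  have h2 := iterate_pd_line g j n 0
  rw [zero_smul] at h1 h2
  rw [h1, h2]
  have hev : (fun s : ℂ => f (s • Pi.single i 1)) =ᶠ[𝓝 0] fun s : ℂ => g (s • Pi.single j 1) := by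
    have : {t : ℂ | 1 + t ≠ 0} ∈ 𝓝 (0 : ℂ) :=
      (isOpen_ne_fun (continuous_const.add continuous_id) continuous_const).mem_nhds (by simp)
    filter_upwards [this] with t ht
    exact hfg t ht
  rw [← iteratedDeriv_eq_iterate, ← iteratedDeriv_eq_iterate]
  exact hev.iteratedDeriv_eq n

end OneVariable

section SchurOne

variable {H : ℕ} {N : Fin H → ℕ}

theorem schurSlice_zero (r : ℕ) (lam : ∀ h, GT (N h)) : schurSlice r lam 0 = 1 := by
  rw [schurSlice]
  refine Finset.prod_eq_one fun h _ => ?_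
  have : (pad (N h) fun i : Fin r => 1 + (0 : Fin H × Fin r → ℂ) (h, i)) = 1 := by
    funext i
    simp [pad]
  rw [this, div_self (schur_one_ne_zero (lam h).2)]

theorem constantCoeff_schurSeries (r : ℕ) (lam : ∀ h, GT (N h)) :
    constantCoeff (schurSeries r lam) = 1 := by
  rw [← ((reg_schurSlice r lam).taylor 0).zero, schurSlice_zero]

theorem constantCoeff_phiSeries (hN : ∀ h, 0 < N h) (h : Fin H) (lam : ∀ h, GT (N h)) :
    PowerSeries.constantCoeff (phiSeries h lam) = 1 := by
  have : NeZero (N h) := ⟨(hN h).ne'⟩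
  exact constantCoeff_phi (shiftedC_injective _)

/-- With one variable per colour there are no pairs, so the operator is the identity. The remaining
constant is fixed by the values at the origin. -/
theorem schurSeries_one (hN : ∀ h, 0 < N h) (lam : ∀ h, GT (N h)) :
    schurSeries 1 lam = tens fun x : Fin H × Fin 1 => phiSeries x.1 lam := by
  have hp : pairList H 1 = [] := by
    rw [List.eq_nil_iff_forall_not_mem]
    intro p hp
    have h1 : (p.1.2 : ℕ) < p.2.2 := (mem_pairList hp).2
    have h2 : (p.1.2 : ℕ) < 1 := p.1.2.2
    have h3 : (p.2.2 : ℕ) < 1 := p.2.2.2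
    omega
  obtain ⟨C, hC⟩ := exists_schurSeries_eq (N := N) 1 fun h => hN h
  have h1 := hC lam
  rw [hp] at h1
  simp only [List.map_nil, List.prod_nil, one_mul, bigD, LinearMap.id_apply] at h1
  have h2 := tens_wtSeries (N := N) 1 lam
  set f : ℂ := ∏ x : Fin H × Fin 1, ((N x.1 - 1).factorial : ℂ)⁻¹ with hfdef
  have hf : f ≠ 0 := prod_ne_zero_iff.mpr fun x _ =>
    inv_ne_zero (by exact_mod_cast factorial_ne_zero _)
  clear_value f
  rw [h2] at h1
  have h7 : (∏ x : Fin H × Fin 1, (X x : MvPowerSeries (Fin H × Fin 1) ℂ) ^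
    (N x.1 - 1)) = monX fun x => N x.1 - 1 := rfl
  rw [h7] at h1
  have h3 : MvPowerSeries.C C * schurSeries 1 lam =
      MvPowerSeries.C f * tens fun x : Fin H × Fin 1 => phiSeries x.1 lam := by
    apply mul_left_cancel₀ (monX_ne_zero fun x : Fin H × Fin 1 => N x.1 - 1)
    linear_combination h1
  have hc : constantCoeff
      (tens fun x : Fin H × Fin 1 => phiSeries x.1 lam) = 1 :=
    constantCoeff_tens (fun x : Fin H × Fin 1 => phiSeries x.1 lam)
      fun x => constantCoeff_phiSeries hN x.1 lam
  have h4 := congrArg constantCoeff h3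
  rw [map_mul, map_mul, constantCoeff_schurSeries, hc, constantCoeff_C,
    constantCoeff_C, mul_one, mul_one] at h4
  rw [h4] at h3
  have h5 : (MvPowerSeries.C f : MvPowerSeries (Fin H × Fin 1) ℂ) ≠ 0 := by
    intro h
    have := congrArg constantCoeff h
    rw [constantCoeff_C, map_zero] at this
    exact hf this
  exact mul_left_cancel₀ h5 h3

/-- By symmetry of the Schur polynomials the only variable different from 1 may be moved to the
first place, where the case r = 1 applies. -/
theorem coeff_single_schurSeries (hN : ∀ h, 0 < N h) {r : ℕ} (hr : ∀ h, r ≤ N h)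
    (lam : ∀ h, GT (N h)) (x : Fin H × Fin r) (n : ℕ) : coeff (single x n) (schurSeries r lam) =
      PowerSeries.coeff n (phiSeries x.1 lam) := by
  have h1 : PowerSeries.coeff n (phiSeries x.1 lam) =
      coeff (single (x.1, (0 : Fin 1)) n) (schurSeries 1 lam) := by
    rw [schurSeries_one hN, coeff_tens, prod_eq_single (x.1, (0 : Fin 1))]
    · simp
    · intro y _ hy
      rw [Finsupp.single_eq_of_ne hy, coeff_zero_ps, constantCoeff_phiSeries hN]
    · simp
  rw [h1]
  apply (reg_schurSlice r lam).taylor.coeff_single_eq (reg_schurSlice 1 lam).taylor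
  intro t ht
  rw [schurSlice, schurSlice]
  refine prod_congr rfl fun h _ => ?_
  congr 1
  obtain ⟨g, k⟩ := x
  by_cases hg : h = g
  · subst hg
    have hpos : 0 < N h := hN h
    set y : Fin (N h) → ℂ := pad (N h) fun i : Fin 1 =>
      1 + (t • (Pi.single (h, (0 : Fin 1)) 1 : Fin H × Fin 1 → ℂ)) (h, i) with hy
    have hk : (k : ℕ) < N h := k.2.trans_le (hr h)
    -- The transposition moves the nontrivial coordinate from place 0 to place k.
    rw [← schur_comp_perm (lam h).2 (Equiv.swap ⟨0, hpos⟩ ⟨k, hk⟩) y]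
    · congr 1
      have hy' : ∀ i : Fin (N h), y i = if (i : ℕ) = 0 then 1 + t else 1 := by
        intro i
        rw [hy, pad]
        by_cases hi : (i : ℕ) = 0
        · rw [dif_pos (by omega), if_pos hi]
          have : (⟨(i : ℕ), by omega⟩ : Fin 1) = 0 := Subsingleton.elim _ _
          rw [this]
          simp
        · rw [dif_neg (by omega), if_neg hi]
      funext i
      rw [Function.comp_apply, hy', pad]
      have hswap : ((Equiv.swap (⟨0, hpos⟩ : Fin (N h)) ⟨k, hk⟩ i : Fin (N h)) : ℕ) = 0 ↔
          (i : ℕ) = k := by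
        rw [show ((Equiv.swap (⟨0, hpos⟩ : Fin (N h)) ⟨k, hk⟩ i : Fin (N h)) : ℕ) = 0 ↔
          Equiv.swap (⟨0, hpos⟩ : Fin (N h)) ⟨k, hk⟩ i = ⟨0, hpos⟩ from by rw [Fin.ext_iff],
          Equiv.swap_apply_eq_iff, Equiv.swap_apply_left, Fin.ext_iff]
      simp only [hswap]
      by_cases hi : (i : ℕ) < r
      · rw [dif_pos hi]
        by_cases hik : (i : ℕ) = k
        · have : (⟨(i : ℕ), hi⟩ : Fin r) = k := Fin.ext hik
          rw [if_pos hik, this]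
          simp
        · have : (⟨(i : ℕ), hi⟩ : Fin r) ≠ k := fun h => hik (Fin.ext_iff.mp h)
          rw [if_neg hik]
          simp [this]
      · rw [dif_neg hi, if_neg (by have := k.2; omega)]
    · intro i
      rw [hy]
      apply pad_ne_zero
      intro j
      have : j = 0 := Subsingleton.elim _ _
      subst this
      simpa using ht
  · congr 1
    funext i
    simp only [pad]
    split_ifs <;> simp_all

theorem schur_zero (M : ℕ) (x : Fin M → ℂ) : schur M (fun _ => 0) x = 1 := by
  induction M with
  | zero => rfl
  | succ M ih =>
    rw [schur, Finset.Icc_self, sum_singleton, ih]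
    simp

/-- The zero signatures. -/
def zeroGT (N : Fin H → ℕ) : ∀ h, GT (N h) := fun _ => ⟨fun _ => 0, fun _ _ _ => le_rfl⟩

theorem schurSeries_zeroGT (r : ℕ) : schurSeries r (zeroGT N) = 1 := by
  refine (reg_schurSlice r (zeroGT N)).eq (by simpa using Reg.const (1 : ℂ)) fun u _ => ?_
  rw [schurSlice]
  exact Finset.prod_eq_one fun h _ => by simp [zeroGT, schur_zero]

theorem phiSeries_zeroGT (hN : ∀ h, 0 < N h) (h : Fin H) : phiSeries h (zeroGT N) = 1 := by
  ext n
  have h1 := coeff_single_schurSeries hN (r := 1) hN (zeroGT N) (h, 0) n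
  rw [← h1, schurSeries_zeroGT, coeff_one, PowerSeries.coeff_one]
  simp

end SchurOne

section Limit

variable {σ : Type} [Fintype σ] [DecidableEq σ]

theorem mulB_one_add_X (i j : σ) : mulB i j (1 + PowerSeries.X) = X j - X i := by
  rw [mulB, map_add, map_add, map_one, map_one, emb_X, emb_X]
  ring

/-- Multiplication by u_j - u_i is the operator `opB` with α = β = 1, ε = 0 and s = 0, since u_j
(1+u_i) - u_i (1+u_j) = u_j - u_i. -/
theorem CT.of_sub_prod (P : List (σ × σ)) (hP : ∀ p ∈ P, p.1 ≠ p.2) {K : ℕ → MvPowerSeries σ ℂ}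
    {k : MvPowerSeries σ ℂ}
    (hK : CT (fun L => (P.map fun p => (X p.2 - X p.1 : MvPowerSeries σ ℂ)).prod * K L) k) :
    ∃ j, CT K j ∧ (P.map fun p => (X p.2 - X p.1 : MvPowerSeries σ ℂ)).prod * j = k := by
  induction P generalizing k with
  | nil => exact ⟨k, by simpa using hK, by simp⟩
  | cons p P ih =>
    have h1 := CT.of_opB (hP p (by simp)) (α := fun _ => 1) (β := fun _ => 1) (ε := fun _ => 0)
      (s := fun _ => 0) (t := 0) (K := fun L => (P.map fun p => (X p.2 -
        X p.1 : MvPowerSeries σ ℂ)).prod * K L) (r := k) tendsto_const_nhds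
      tendsto_const_nhds tendsto_const_nhds (CT.const _) (fun _ => map_zero _) (by
        refine hK.congr' (Eventually.of_forall fun L => ?_)
        simp only [SchurCLT.opB, SchurCLT.opP, List.map_cons, List.prod_cons, map_one, map_zero]
        ring)
    obtain ⟨k', hk', hk''⟩ := h1
    obtain ⟨j, hj, hj'⟩ := ih (fun q hq => hP q (by simp [hq])) hk'
    refine ⟨j, hj, ?_⟩
    rw [add_zero, mul_one, mulB_one_add_X] at hk''
    rw [List.map_cons, List.prod_cons, mul_assoc, hj', hk'']

variable {H : ℕ} {N : ℕ → Fin H → ℕ}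

/-- The product of the differences of the variables of the same colour. -/
def diffProd (H r : ℕ) : MvPowerSeries (Fin H × Fin r) ℂ :=
  ((pairList H r).map fun p => (X p.2 - X p.1 : MvPowerSeries (Fin H × Fin r) ℂ)).prod

/-- The product of the series `u_j g_h(u_i) - u_i g_h(u_j)` over the pairs of variables of the
same colour. -/
def mulProd (r : ℕ) (g : Fin H → PowerSeries ℂ) : MvPowerSeries (Fin H × Fin r) ℂ :=
  ((pairList H r).map fun p => mulB p.1 p.2 (g p.1.1)).prod

theorem ne_of_mem_pairList {r : ℕ} {p : (Fin H × Fin r) × (Fin H × Fin r)}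
    (hp : p ∈ pairList H r) : p.1 ≠ p.2 := fun h => by
  have := (mem_pairList hp).2
  rw [h] at this
  exact lt_irrefl _ this

theorem tendsto_sub_div (hN0 : ∀ L h, 0 < N L h)
    (hN : ∀ h, Tendsto (fun L => 1 / (N L h : ℂ)) atTop (𝓝 0)) (r : ℕ)
    (hr : ∀ᶠ L in atTop, ∀ h, r ≤ N L h) (h : Fin H) :
    Tendsto (fun L => ((N L h - r : ℕ) : ℂ) / (N L h : ℂ)) atTop (𝓝 1) := by
  have h1 := ((hN h).const_mul (r : ℂ)).const_sub 1
  rw [mul_zero, sub_zero] at h1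
  refine h1.congr' ?_
  filter_upwards [hr] with L hL
  have h2 : (N L h : ℂ) ≠ 0 := by exact_mod_cast (hN0 L h).ne'
  rw [Nat.cast_sub (hL h)]
  field_simp

/-- Evaluation at the zero signature is a functional for which all the series equal 1. The identity
then reads κ ∏ (u_j - u_i) = chain(1), and the right side tends to ∏ (u_j - u_i). -/
theorem exists_kappa_tendsto (hN0 : ∀ L h, 0 < N L h)
    (hN : ∀ h, Tendsto (fun L => 1 / (N L h : ℂ)) atTop (𝓝 0)) (r : ℕ)
    (hr : ∀ᶠ L in atTop, ∀ h, r ≤ N L h) : ∃ κ : ℕ → ℂ, Tendsto κ atTop (𝓝 1) ∧ ∀ᶠ L in atTop,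
      ∀ (E : ((∀ h, GT (N L h)) → ℂ) →ₗ[ℂ] ℂ) (T τ : Fin H → PowerSeries ℂ)
        (G : MvPowerSeries (Fin H × Fin r) ℂ), (∀ h, derivative ℂ (T h) = τ h * T h) →
      (tens fun x : Fin H × Fin r => T x.1) * G =
        mean E (fun lam => tens fun x : Fin H × Fin r => phiSeries x.1 lam) →
      MvPowerSeries.C (κ L) * diffProd H r * mean E (schurSeries r) =
      (tens fun x : Fin H × Fin r => T x.1) * chain (fun x => (N L x.1 : ℂ))
          (fun x => PowerSeries.C (1 / (N L x.1 : ℂ)) * (PowerSeries.X * τ x.1)) (pairList H r)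
          (fun x => N L x.1 - r) G := by
  have h1 : ∀ L, ∃ κ : ℂ, (∀ h, r ≤ N L h) →
      ∀ (E : ((∀ h, GT (N L h)) → ℂ) →ₗ[ℂ] ℂ) (T τ : Fin H → PowerSeries ℂ)
        (G : MvPowerSeries (Fin H × Fin r) ℂ), (∀ h, derivative ℂ (T h) = τ h * T h) →
      (tens fun x : Fin H × Fin r => T x.1) * G =
        mean E (fun lam => tens fun x : Fin H × Fin r => phiSeries x.1 lam) →
      MvPowerSeries.C κ * diffProd H r * mean E (schurSeries r) =
      (tens fun x : Fin H × Fin r => T x.1) * chain (fun x => (N L x.1 : ℂ))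
          (fun x => PowerSeries.C (1 / (N L x.1 : ℂ)) * (PowerSeries.X * τ x.1)) (pairList H r)
          (fun x => N L x.1 - r) G := by
    intro L
    by_cases h : ∀ h, r ≤ N L h
    · obtain ⟨κ, hκ⟩ := exists_kappa r h (hN0 L)
      exact ⟨κ, fun _ => hκ⟩
    · exact ⟨0, fun h' => absurd h' h⟩
  choose κ hκ using h1
  refine ⟨κ, ?_, hr.mono fun L hL => hκ L hL⟩
  have h2 : ∀ᶠ L in atTop, MvPowerSeries.C (κ L) * diffProd H r =
      chain (fun x => (N L x.1 : ℂ)) (fun _ => 0) (pairList H r) (fun x => N L x.1 - r) 1 := by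
    filter_upwards [hr] with L hL
    -- The trivial measure that determines κ, with T = 1, τ = 0 and G = 1.
    set E : ((∀ h, GT (N L h)) → ℂ) →ₗ[ℂ] ℂ := proj (zeroGT (N L)) with hE
    have hmean : ∀ K : (∀ h, GT (N L h)) → MvPowerSeries (Fin H × Fin r) ℂ,
        mean E K = K (zeroGT (N L)) := fun K => rfl
    have h3 := hκ L hL E (fun _ => 1) (fun _ => 0) 1 (by simp) (by
      rw [hmean]
      simp only [phiSeries_zeroGT (hN0 L), mul_one])
    rw [hmean, schurSeries_zeroGT, mul_one] at h3
    rw [h3]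
    simp [tens]
  have h3 := chain_CT (σ := Fin H × Fin r) (ν := fun L x => (N L x.1 : ℂ)) (s := fun _ _ => 0)
    (t := fun _ => 0)
    (fun x => hN x.1) (fun x => CT.const _) (pairList H r)
    (fun p hp L => by rw [(mem_pairList hp).1]) (a := fun L x => N L x.1 - r)
    (fun x => tendsto_sub_div hN0 hN r hr x.1) (CT.const 1)
  simp only [add_zero, mul_one, mulB_one_add_X] at h3
  have hV : diffProd H r ≠ 0 := by
    rw [diffProd]
    apply List.prod_ne_zero
    simp only [List.mem_map, not_exists, not_and]
    intro p hp h
    have := congrArg (coeff (single p.1 1)) h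
    rw [map_sub, coeff_index_single_X, coeff_index_single_X,
      if_neg (ne_of_mem_pairList hp), if_pos rfl] at this
    simp at this
  -- One nonzero coefficient of the fixed series `diffProd` is enough to read off the limit of κ.
  obtain ⟨n, hn⟩ : ∃ n, coeff n (diffProd H r) ≠ 0 := by
    by_contra! h
    exact hV (MvPowerSeries.ext fun n => by rw [h n, map_zero])
  have h4 := h3 n
  simp only at h4
  have h5 := (h4.congr' (h2.mono fun L hL => by rw [← hL, MvPowerSeries.coeff_C_mul])).div_const
    (coeff n (diffProd H r))
  have h6 : coeff n ((pairList H r).map fun p => (X p.2 -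
      X p.1 : MvPowerSeries (Fin H × Fin r) ℂ)).prod /
        coeff n (diffProd H r) = 1 := div_self hn
  rw [h6] at h5
  refine h5.congr fun L => ?_
  rw [mul_div_cancel_right₀ _ hn]

section Equivalence

variable (hN0 : ∀ L h, 0 < N L h) (hN : ∀ h, Tendsto (fun L => 1 / (N L h : ℂ)) atTop (𝓝 0))
  {r : ℕ} (hr : ∀ᶠ L in atTop, ∀ h, r ≤ N L h)
  (E : ∀ L, ((∀ h, GT (N L h)) → ℂ) →ₗ[ℂ] ℂ)
  {T Λ : ℕ → Fin H → PowerSeries ℂ} {c : Fin H → PowerSeries ℂ}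
  (hT : ∀ L h, IsLog (Λ L h) (T L h))
  (hΛ : ∀ h, CT (fun L => PowerSeries.C (1 / (N L h : ℂ)) * Λ L h) (c h))
  {G A : ℕ → MvPowerSeries (Fin H × Fin r) ℂ}
  (hG : ∀ L, (tens fun x : Fin H × Fin r => T L x.1) * G L =
    mean (E L) (fun lam => tens fun x : Fin H × Fin r => phiSeries x.1 lam))
  (hA : ∀ L, (tens fun x : Fin H × Fin r => T L x.1) * A L = mean (E L) (schurSeries r))

/-- The limit `(1+u)(1+u c'(u))`. -/
def gSeries (c : PowerSeries ℂ) : PowerSeries ℂ :=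
  (1 + PowerSeries.X) * (1 + PowerSeries.X * derivative ℂ c)

include hN0 hN hr hT hΛ hG hA in
-- The common factor T is cancelled from the identity. The series s is u times the derivative of
-- (1/N) log T, which converges by `hΛ`.
theorem exists_chain_eq : ∃ (κ : ℕ → ℂ) (s : ℕ → Fin H × Fin r → PowerSeries ℂ),
    Tendsto κ atTop (𝓝 1) ∧ (∀ L x, PowerSeries.constantCoeff (s L x) = 0) ∧
    (∀ x, CT (fun L => s L x) (PowerSeries.X * derivative ℂ (c x.1))) ∧
    ∀ᶠ L in atTop, MvPowerSeries.C (κ L) * (diffProd H r * A L) =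
      chain (fun x => (N L x.1 : ℂ)) (s L) (pairList H r) (fun x => N L x.1 - r) (G L) := by
  obtain ⟨κ, hκ, hk⟩ := exists_kappa_tendsto hN0 hN r hr
  refine ⟨κ, fun L x => PowerSeries.C (1 / (N L x.1 : ℂ)) *
    (PowerSeries.X * derivative ℂ (Λ L x.1)), hκ, fun L x => by simp, fun x => ?_, ?_⟩
  · have h1 := (CT.const PowerSeries.X).mul ((hΛ x.1).pderiv ())
    refine h1.congr' (Eventually.of_forall fun L => ?_)
    have h2 : pderiv ℂ () (PowerSeries.C (1 / (N L x.1 : ℂ)) * Λ L x.1) =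
        PowerSeries.C (1 / (N L x.1 : ℂ)) * derivative ℂ (Λ L x.1) := by
      change derivative ℂ (PowerSeries.C (1 / (N L x.1 : ℂ)) * Λ L x.1) = _
      rw [leibniz]
      simp
    rw [h2]
    ring
  · filter_upwards [hk] with L hL
    have h1 := hL (E L) (T L) (fun h => derivative ℂ (Λ L h)) (G L)
      (fun h => (hT L h).deriv ()) (hG L)
    rw [← hA] at h1
    have h2 : (tens fun x : Fin H × Fin r => T L x.1) ≠ 0 := by
      intro h
      have := congrArg constantCoeff h
      have hc : ∀ x : Fin H × Fin r, PowerSeries.constantCoeff (T L x.1) = 1 :=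
        fun x => (hT L x.1).right
      rw [constantCoeff_tens _ hc] at this
      simp at this
    apply mul_left_cancel₀ h2
    linear_combination h1

include hN0 hN hr hT hΛ hG hA in
-- The chain of operators converges to multiplication by `mulProd`; afterwards the factors u_j - u_i
-- are divided out.
theorem CT_schur_of_CT_phi {g : MvPowerSeries (Fin H × Fin r) ℂ} (hg : CT G g) :
    ∃ a, CT A a ∧ diffProd H r * a = mulProd r (fun h => gSeries (c h)) * g := by
  obtain ⟨κ, s, hκ, hs0, hs, hk⟩ := exists_chain_eq hN0 hN hr E hT hΛ hG hA
  have h1 := chain_CT (fun x : Fin H × Fin r => hN x.1) hs (pairList H r)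
    (fun p hp L => by rw [(mem_pairList hp).1]) (a := fun L x => N L x.1 - r)
    (fun x => tendsto_sub_div hN0 hN r hr x.1) hg
  have h2 := (CT.C (σ := Fin H × Fin r) (hκ.inv₀ one_ne_zero)).mul h1
  rw [inv_one, map_one, one_mul] at h2
  apply CT.of_sub_prod _ (fun p hp => ne_of_mem_pairList hp)
  refine h2.congr' ?_
  filter_upwards [hk, hκ.eventually_ne one_ne_zero] with L hL hL'
  rw [← hL, ← mul_assoc, ← map_mul, inv_mul_cancel₀ hL', map_one, one_mul]
  rfl

include hN0 hN hr hT hΛ hG hA in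
-- The converse rests on the coefficientwise inversion of the chain, not only on its limit.
theorem CT_phi_of_CT_schur {a : MvPowerSeries (Fin H × Fin r) ℂ} (ha : CT A a) :
    ∃ g, CT G g ∧ diffProd H r * a = mulProd r (fun h => gSeries (c h)) * g := by
  obtain ⟨κ, s, hκ, hs0, hs, hk⟩ := exists_chain_eq hN0 hN hr E hT hΛ hG hA
  have h1 := (CT.C (σ := Fin H × Fin r) hκ).mul ((CT.const (diffProd H r)).mul ha)
  rw [map_one, one_mul] at h1
  obtain ⟨g, hg, hg'⟩ := CT_of_chain (fun x : Fin H × Fin r => hN x.1) hs hs0 (pairList H r)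
    (fun p hp => ⟨ne_of_mem_pairList hp, fun L => by rw [(mem_pairList hp).1]⟩)
    (a := fun L x => N L x.1 - r)
    (fun x => tendsto_sub_div hN0 hN r hr x.1) (h1.congr' hk)
  exact ⟨g, hg, hg'.symm⟩

end Equivalence

end Limit

end

/-! ### Expectations under smooth measures, and the analytic Schur generating function. -/

section

open MvPowerSeries (coeff coeff_C_mul pderiv)

open scoped ContDiff




section Expectation

variable {H : ℕ} {N : Fin H → ℕ}

theorem weight_nonneg (τ : PMF (∀ h, GT (N h))) (lam : ∀ h, GT (N h)) : 0 ≤ weight τ lam :=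
  ENNReal.toReal_nonneg

theorem hasSum_weight (τ : PMF (∀ h, GT (N h))) : HasSum (weight τ) 1 := by
  have h := τ.tsum_coe
  have h1 : Summable (weight τ) := ENNReal.summable_toReal (by rw [h]; exact ENNReal.one_ne_top)
  have h2 : ∑' lam, weight τ lam = 1 := by
    have := ENNReal.tsum_toReal_eq (f := fun lam => τ lam) fun lam => τ.apply_ne_top lam
    rw [h, ENNReal.toReal_one] at this
    exact this.symm
  rw [← h2]
  exact h1.hasSum

/-- A linear functional on all functions that is the expectation whenever the latter converges. -/
theorem exists_expectation (τ : PMF (∀ h, GT (N h))) :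
    ∃ E : ((∀ h, GT (N h)) → ℂ) →ₗ[ℂ] ℂ, ∀ f : (∀ h, GT (N h)) → ℂ,
      Summable (fun lam => (weight τ lam : ℂ) * f lam) →
      E f = ∑' lam, (weight τ lam : ℂ) * f lam := by
  let S : Submodule ℂ ((∀ h, GT (N h)) → ℂ) :=
    { carrier := {f | Summable fun lam => (weight τ lam : ℂ) * f lam}
      add_mem' := fun {f g} hf hg => by
        have := Summable.add hf hg
        simpa only [Set.mem_ofPred_eq, Pi.add_apply, mul_add] using this
      zero_mem' := by simp
      smul_mem' := fun c f hf => by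
        have := Summable.mul_left c hf
        simp only [Set.mem_ofPred_eq, Pi.smul_apply, smul_eq_mul] at this ⊢
        exact this.congr fun lam => by ring }
  let E0 : S →ₗ[ℂ] ℂ :=
    { toFun := fun f => ∑' lam, (weight τ lam : ℂ) * f.1 lam
      map_add' := fun f g => by
        rw [← Summable.tsum_add f.2 g.2]
        exact tsum_congr fun lam => by simp [mul_add]
      map_smul' := fun c f => by
        simp only [RingHom.id_apply, smul_eq_mul]
        rw [← tsum_mul_left]
        exact tsum_congr fun lam => by simp; ring }
  -- The sum defines E on the subspace of functions with a summable series. Its values elsewhere are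
  -- arbitrary and never matter.
  obtain ⟨E, hE⟩ := LinearMap.exists_extend E0
  refine ⟨E, fun f hf => ?_⟩
  have := LinearMap.congr_fun hE ⟨f, hf⟩
  exact this

/-- The size of a tuple of signatures. -/
def size (lam : ∀ h, GT (N h)) : ℕ := ∑ h, ∑ i, ((lam h).1 i).natAbs

/-- Functions of polynomial growth. -/
def PolyBdd (f : (∀ h, GT (N h)) → ℂ) : Prop :=
  ∃ (C : ℝ) (k : ℕ), 0 ≤ C ∧ ∀ lam, ‖f lam‖ ≤ C * (1 + size lam : ℝ) ^ k

theorem PolyBdd.mul {f g : (∀ h, GT (N h)) → ℂ} (hf : PolyBdd f) (hg : PolyBdd g) :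
    PolyBdd fun lam => f lam * g lam := by
  obtain ⟨C, k, hC, h⟩ := hf
  obtain ⟨D, m, hD, h'⟩ := hg
  refine ⟨C * D, k + m, mul_nonneg hC hD, fun lam => ?_⟩
  rw [norm_mul, pow_add]
  calc ‖f lam‖ * ‖g lam‖ ≤ (C * (1 + size lam : ℝ) ^ k) * (D * (1 + size lam : ℝ) ^ m) :=
        mul_le_mul (h lam) (h' lam) (norm_nonneg _) (by positivity)
    _ = _ := by ring

theorem PolyBdd.const (c : ℂ) : PolyBdd fun _ : ∀ h, GT (N h) => c :=
  ⟨‖c‖, 0, norm_nonneg _, fun lam => by simp⟩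

theorem PolyBdd.add {f g : (∀ h, GT (N h)) → ℂ} (hf : PolyBdd f) (hg : PolyBdd g) :
    PolyBdd fun lam => f lam + g lam := by
  obtain ⟨C, k, hC, h⟩ := hf
  obtain ⟨D, m, hD, h'⟩ := hg
  refine ⟨C + D, k + m, add_nonneg hC hD, fun lam => ?_⟩
  have h1 : (1 : ℝ) ≤ 1 + size lam := by
    have : (0 : ℝ) ≤ size lam := Nat.cast_nonneg _
    linarith
  calc ‖f lam + g lam‖ ≤ C * (1 + size lam : ℝ) ^ k + D * (1 + size lam : ℝ) ^ m :=
        (norm_add_le _ _).trans (add_le_add (h lam) (h' lam))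
    _ ≤ C * (1 + size lam : ℝ) ^ (k + m) + D * (1 + size lam : ℝ) ^ (k + m) := by
        gcongr <;> first | exact h1 | omega
    _ = _ := by ring

theorem PolyBdd.prod {ι : Type} (s : Finset ι) {f : ι → (∀ h, GT (N h)) → ℂ}
    (h : ∀ i ∈ s, PolyBdd (f i)) : PolyBdd fun lam => ∏ i ∈ s, f i lam := by
  classical
  induction s using Finset.induction_on with
  | empty => simpa using PolyBdd.const (1 : ℂ)
  | insert i s hi ih =>
    simp only [prod_insert hi]
    exact (h i (by simp)).mul (ih fun j hj => h j (by simp [hj]))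

theorem PolyBdd.sum {ι : Type} (s : Finset ι) {f : ι → (∀ h, GT (N h)) → ℂ}
    (h : ∀ i ∈ s, PolyBdd (f i)) : PolyBdd fun lam => ∑ i ∈ s, f i lam := by
  classical
  induction s using Finset.induction_on with
  | empty => simpa using PolyBdd.const (0 : ℂ)
  | insert i s hi ih =>
    simp only [sum_insert hi]
    exact (h i (by simp)).add (ih fun j hj => h j (by simp [hj]))

theorem PolyBdd.coord (h : Fin H) (i : Fin (N h)) :
    PolyBdd fun lam : ∀ h, GT (N h) => (((lam h).1 i : ℤ) : ℂ) := by
  refine ⟨1, 1, zero_le_one, fun lam => ?_⟩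
  rw [Complex.norm_intCast, one_mul, pow_one, ← Int.cast_abs, Int.abs_eq_natAbs]
  have h1 : ((lam h).1 i).natAbs ≤ size lam :=
    (single_le_sum (f := fun i => ((lam h).1 i).natAbs) (fun _ _ => Nat.zero_le _)
      (mem_univ i)).trans
      (single_le_sum (f := fun h => ∑ i, ((lam h).1 i).natAbs) (fun _ _ => Nat.zero_le _)
        (mem_univ h))
  have h2 : ((((lam h).1 i).natAbs : ℤ) : ℝ) ≤ size lam := by exact_mod_cast h1
  linarith

theorem PolyBdd.powerSum (k : ℕ+) (h : Fin H) :
    PolyBdd fun lam : ∀ h, GT (N h) => (SchurCLT.powerSum k h lam : ℂ) := by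
  have h1 : PolyBdd fun lam : ∀ h, GT (N h) => ∑ i : Fin (N h), ∏ _j ∈ range (k : ℕ),
      ((((lam h).1 i : ℤ) : ℂ) + ((N h : ℂ) - ((i : ℕ) + 1))) * (N h : ℂ)⁻¹ :=
    PolyBdd.sum _ fun i _ => PolyBdd.prod _ fun j _ =>
      ((PolyBdd.coord h i).add (PolyBdd.const _)).mul (PolyBdd.const _)
  convert h1 using 2 with lam
  rw [SchurCLT.powerSum]
  push_cast
  refine sum_congr rfl fun i _ => ?_
  rw [prod_const, Finset.card_range, div_eq_mul_inv, add_sub_assoc]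

theorem exists_pow_le {r : ℝ} (hr : 1 < r) (k : ℕ) :
    ∃ C : ℝ, 0 ≤ C ∧ ∀ n : ℕ, (1 + n : ℝ) ^ k ≤ C * r ^ n := by
  have h1 := (isLittleO_pow_const_const_pow_of_one_lt (R := ℝ) k hr).isBigO
  obtain ⟨C, hC⟩ := h1.bound
  rw [eventually_atTop] at hC
  obtain ⟨n0, hn0⟩ := hC
  have hr0 : 0 < r := by linarith
  refine ⟨|C| * r + ∑ n ∈ range (n0 + 1), (1 + n : ℝ) ^ k, by positivity, fun n => ?_⟩
  have hrn : 1 ≤ r ^ n := one_le_pow₀ hr.le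
  by_cases h : n < n0 + 1
  · have h2 : (1 + n : ℝ) ^ k ≤ ∑ n ∈ range (n0 + 1), (1 + n : ℝ) ^ k :=
      single_le_sum (f := fun n : ℕ => (1 + n : ℝ) ^ k) (fun _ _ => by positivity)
        (mem_range.mpr h)
    have h3 : 0 ≤ ∑ n ∈ range (n0 + 1), (1 + n : ℝ) ^ k :=
      Finset.sum_nonneg fun _ _ => by positivity
    have h4 : 0 ≤ |C| * r := by positivity
    nlinarith
  · have h2 := hn0 (n + 1) (by omega)
    simp only [norm_pow, Real.norm_eq_abs, Nat.abs_cast, abs_of_pos hr0] at h2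
    have h3 : (1 + n : ℝ) ^ k ≤ C * r ^ (n + 1) := by
      have : (1 + n : ℝ) = ((n + 1 : ℕ) : ℝ) := by push_cast; ring
      rw [this]; exact h2
    have h4 : C * r ^ (n + 1) ≤ |C| * r * r ^ n := by
      rw [pow_succ, mul_assoc, mul_comm r]
      exact mul_le_mul_of_nonneg_right (le_abs_self C) (by positivity)
    have h5 : 0 ≤ (∑ n ∈ range (n0 + 1), (1 + n : ℝ) ^ k) * r ^ n := by positivity
    nlinarith

/-- Smoothness supplies an exponential moment of the size, and an exponential dominates every
polynomial. -/
theorem PolyBdd.summable {τ : PMF (∀ h, GT (N h))} (hτ : IsSmooth τ)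
    {f : (∀ h, GT (N h)) → ℂ} (hf : PolyBdd f) :
    Summable fun lam => (weight τ lam : ℂ) * f lam := by
  obtain ⟨r, hr, hs⟩ := hτ
  obtain ⟨C, k, hC, h⟩ := hf
  obtain ⟨D, hD, h'⟩ := exists_pow_le hr k
  refine Summable.of_norm_bounded (hs.mul_left (C * D)) fun lam => ?_
  rw [norm_mul, norm_real, Real.norm_eq_abs, abs_of_nonneg (weight_nonneg τ lam)]
  have h1 : ‖f lam‖ ≤ C * D * r ^ size lam := by
    refine (h lam).trans ?_
    rw [mul_assoc]
    exact mul_le_mul_of_nonneg_left (h' (size lam)) hC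
  calc weight τ lam * ‖f lam‖ ≤ weight τ lam * (C * D * r ^ size lam) :=
        mul_le_mul_of_nonneg_left h1 (weight_nonneg τ lam)
    _ = _ := by rw [size]; ring

/-- The expectations of real random variables of polynomial growth. -/
theorem expectation_eq {τ : PMF (∀ h, GT (N h))} (hτ : IsSmooth τ)
    {E : ((∀ h, GT (N h)) → ℂ) →ₗ[ℂ] ℂ}
    (hE : ∀ f : (∀ h, GT (N h)) → ℂ, Summable (fun lam => (weight τ lam : ℂ) * f lam) →
      E f = ∑' lam, (weight τ lam : ℂ) * f lam)
    {ξ : (∀ h, GT (N h)) → ℝ} (hξ : PolyBdd fun lam => (ξ lam : ℂ)) :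
    E (fun lam => (ξ lam : ℂ)) = (expect τ ξ : ℂ) := by
  rw [hE _ (hξ.summable hτ), expect, Complex.ofReal_tsum]
  exact tsum_congr fun lam => by push_cast; rfl

theorem expectation_one {τ : PMF (∀ h, GT (N h))}
    {E : ((∀ h, GT (N h)) → ℂ) →ₗ[ℂ] ℂ}
    (hE : ∀ f : (∀ h, GT (N h)) → ℂ, Summable (fun lam => (weight τ lam : ℂ) * f lam) →
      E f = ∑' lam, (weight τ lam : ℂ) * f lam) : E (fun _ => 1) = 1 := by
  have h1 : HasSum (fun lam => (weight τ lam : ℂ) * 1) 1 := by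
    simp only [mul_one]
    have := Complex.hasSum_ofReal.mpr (hasSum_weight τ)
    rwa [Complex.ofReal_one] at this
  rw [hE _ h1.summable, h1.tsum_eq]

end Expectation

section Slice

variable {H : ℕ} {N : Fin H → ℕ}

theorem exists_one_lt_pow_le {r : ℝ} (hr : 1 < r) (M : ℕ) : ∃ R : ℝ, 1 < R ∧ R ^ M ≤ r := by
  have h1 : ContinuousAt (fun x : ℝ => x ^ M) 1 := (continuous_pow M).continuousAt
  have h2 : ∀ᶠ x in 𝓝 (1 : ℝ), x ^ M < r := h1.eventually_lt continuousAt_const (by simpa using hr)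
  have h3 : ∀ᶠ x in 𝓝[>] (1 : ℝ), x ^ M < r := h2.filter_mono nhdsWithin_le_nhds
  obtain ⟨R, hR, hR'⟩ := (h3.and self_mem_nhdsWithin).exists
  exact ⟨R, hR', hR.le⟩

theorem norm_schurSlice_le (r : ℕ) (lam : ∀ h, GT (N h)) {R : ℝ} (hR : 1 ≤ R)
    {u : Fin H × Fin r → ℂ} (hu : ∀ x, ‖1 + u x‖ ≤ R) (hu' : ∀ x, ‖(1 + u x)⁻¹‖ ≤ R) :
    ‖schurSlice r lam u‖ ≤ (R ^ (∑ h, N h ^ 2)) ^ size lam := by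
  have h1 : ∀ h, ‖schur (N h) (lam h).1 (pad (N h) fun i => 1 + u (h, i)) /
      schur (N h) (lam h).1 1‖ ≤ R ^ ((∑ h, N h ^ 2) * ∑ i, ((lam h).1 i).natAbs) := by
    intro h
    obtain ⟨n, hn, hb⟩ := exists_norm_schur_le (N h) (lam h).1
    have hn0 : (n : ℝ) ≠ 0 := by
      have := schur_one_ne_zero (lam h).2
      rw [hn] at this
      exact_mod_cast this
    have hn1 : 0 < (n : ℝ) := lt_of_le_of_ne (Nat.cast_nonneg n) hn0.symm
    have h2 := hb R (∑ i, ((lam h).1 i).natAbs) (pad (N h) fun i => 1 + u (h, i)) hR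
      (fun i => single_le_sum (f := fun i => ((lam h).1 i).natAbs)
        (fun _ _ => Nat.zero_le _) (mem_univ i))
      (fun i => by rw [pad]; split_ifs <;> simp [hu, hR])
      (fun i => by
        rw [pad]; split_ifs
        · exact hu' _
        · simpa using hR)
    rw [norm_div, hn, Complex.norm_natCast, div_le_iff₀ hn1, mul_comm _ (n : ℝ)]
    refine h2.trans (mul_le_mul_of_nonneg_left ?_ hn1.le)
    apply pow_le_pow_right₀ hR
    exact Nat.mul_le_mul_right _ (single_le_sum (f := fun h => N h ^ 2)
      (fun _ _ => Nat.zero_le _) (mem_univ h))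
  rw [schurSlice, norm_prod]
  refine (Finset.prod_le_prod (fun _ _ => norm_nonneg _) fun h _ => h1 h).trans (le_of_eq ?_)
  rw [Finset.prod_pow_eq_pow_sum, ← mul_sum, pow_mul, size]

variable (τ : PMF (∀ h, GT (N h)))

/-- The point at which the variables `x_i^h`, `i < r`, are `1 + u_{h,i}`. -/
def slicePoint (N : Fin H → ℕ) (r : ℕ) (u : Fin H × Fin r → ℂ) : ∀ h, Fin (N h) → ℂ :=
  fun h => pad (N h) fun i => 1 + u (h, i)

theorem exists_normalOn_slice (hτ : IsSmooth τ) (r : ℕ) : ∃ δ > 0,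
    ball (0 : Fin H × Fin r → ℂ) δ ⊆ invSet _ ∧
    NormalOn (fun lam u => (weight τ lam : ℂ) * schurSlice r lam u)
      (ball (0 : Fin H × Fin r → ℂ) δ) := by
  obtain ⟨q, hq, hs⟩ := hτ
  -- A normalized Schur product is at most R^{size · ∑ N_h²} where all |1+u| and |1+u|⁻¹ are at most
  -- R. On the ball of radius 1 - 1/R both bounds hold, since 2 - 1/R ≤ R.
  obtain ⟨R, hR, hRq⟩ := exists_one_lt_pow_le hq (∑ h, N h ^ 2)
  have hR0 : 0 < R := by linarith
  have hδ : 0 < 1 - R⁻¹ := by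
    have := inv_lt_one_of_one_lt₀ hR
    linarith
  have hlow : ∀ u ∈ ball (0 : Fin H × Fin r → ℂ) (1 - R⁻¹), ∀ x, R⁻¹ ≤ ‖1 + u x‖ := by
    intro u hu x
    rw [mem_ball_zero_iff] at hu
    have h1 := (norm_le_pi_norm u x).trans hu.le
    have h2 := norm_sub_le (1 + u x) (u x)
    rw [add_sub_cancel_right, norm_one] at h2
    linarith
  have hup : ∀ u ∈ ball (0 : Fin H × Fin r → ℂ) (1 - R⁻¹), ∀ x, ‖1 + u x‖ ≤ R := by
    intro u hu x
    rw [mem_ball_zero_iff] at hu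
    have h1 := (norm_le_pi_norm u x).trans hu.le
    have h2 := norm_add_le 1 (u x)
    rw [norm_one] at h2
    have h3 : R + R⁻¹ ≥ 2 := by
      have : 0 ≤ (R - 1) ^ 2 / R := by positivity
      have h4 : (R - 1) ^ 2 / R = R + R⁻¹ - 2 := by field_simp; ring
      linarith
    linarith
  have hRi : 0 < R⁻¹ := by positivity
  refine ⟨1 - R⁻¹, hδ, fun u hu x h => ?_, fun x hx => ?_⟩
  · have := hlow u hu x
    rw [h, norm_zero] at this
    linarith
  · rw [mem_ball] at hx
    refine ⟨1 - R⁻¹ - dist x 0, by linarith, fun lam => weight τ lam * q ^ size lam, hs,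
      Metric.ball_subset_ball' (by linarith), fun lam y hy => ?_⟩
    have hy' : y ∈ ball (0 : Fin H × Fin r → ℂ) (1 - R⁻¹) :=
      Metric.ball_subset_ball' (by linarith) hy
    rw [norm_mul, norm_real, Real.norm_eq_abs, abs_of_nonneg (weight_nonneg τ lam)]
    refine mul_le_mul_of_nonneg_left ?_ (weight_nonneg τ lam)
    refine (norm_schurSlice_le r lam hR.le (hup y hy') fun z => ?_).trans
      (pow_le_pow_left₀ (by positivity) hRq _)
    rw [norm_inv]
    exact inv_le_of_inv_le₀ hR0 (hlow y hy' z)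

theorem NormalOn.summable_foldr {ι σ : Type} [Fintype σ] [DecidableEq σ]
    {f : ι → (σ → ℂ) → ℂ} {K : ι → MvPowerSeries σ ℂ} {U : Set (σ → ℂ)} (hU : IsOpen U)
    (h0 : (0 : σ → ℂ) ∈ U) (h : NormalOn f U) (hf : ∀ i, ContDiffOn ℂ ∞ (f i) U)
    (hK : ∀ i, IsTaylor (f i) (K i)) (n : σ →₀ ℕ) :
    Summable fun i => coeff n (K i) := by
  obtain ⟨d, hd⟩ : ∃ d, n.degree = d := ⟨_, rfl⟩
  induction d generalizing f K n with
  | zero =>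
    rw [degree_eq_zero_iff] at hd
    subst hd
    exact (h.summable h0).congr fun i => (hK i 0).zero
  | succ d ih =>
    obtain ⟨j, m, rfl⟩ := exists_pos_of_ne_zero (n := n) (by
      rintro rfl
      simp at hd)
    have h1 := ih (h.pd hU hf j) (fun i => contDiffOn_pd hU (hf i) j)
      (K := fun i => pderiv ℂ j (K i)) (fun i k => (hK i (k + 1)).2 j) m (by
        rw [map_add, degree_single] at hd; omega)
    have h2 := h1.mul_right ((m j : ℂ) + 1)⁻¹
    refine h2.congr fun i => ?_
    have : (m j : ℂ) + 1 ≠ 0 := by exact_mod_cast succ_ne_zero (m j)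
    rw [MvPowerSeries.coeff_pderiv, mul_assoc, mul_inv_cancel₀ this, mul_one]

variable {τ}

/-- Near the point 1 the series over the signatures converges normally, so the Taylor coefficients
are summed term by term. -/
theorem isTaylor_sgf (hτ : IsSmooth τ) {E : ((∀ h, GT (N h)) → ℂ) →ₗ[ℂ] ℂ}
    (hE : ∀ f : (∀ h, GT (N h)) → ℂ, Summable (fun lam => (weight τ lam : ℂ) * f lam) →
      E f = ∑' lam, (weight τ lam : ℂ) * f lam) (r : ℕ) :
    ∃ U : Set (Fin H × Fin r → ℂ), IsOpen U ∧ 0 ∈ U ∧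
      ContDiffOn ℂ ∞ (fun u => sgf τ (slicePoint N r u)) U ∧
      IsTaylor (fun u => sgf τ (slicePoint N r u)) (mean E (schurSeries r)) := by
  obtain ⟨δ, hδ, hsub, hn⟩ := exists_normalOn_slice τ hτ r
  have h0 : (0 : Fin H × Fin r → ℂ) ∈ ball (0 : Fin H × Fin r → ℂ) δ := mem_ball_self hδ
  have hreg : ∀ lam, Reg (fun u => (weight τ lam : ℂ) * schurSlice r lam u)
      (MvPowerSeries.C (weight τ lam : ℂ) * schurSeries r lam) :=
    fun lam => (Reg.const _).mul (reg_schurSlice r lam)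
  have hsm : ∀ lam, ContDiffOn ℂ ∞ (fun u => (weight τ lam : ℂ) * schurSlice r lam u)
      (ball 0 δ) := fun lam => (hreg lam).smooth.mono hsub
  refine ⟨ball 0 δ, isOpen_ball, h0, contDiffOn_infty_tsum isOpen_ball hn hsm, fun n => ?_⟩
  have h1 := TaylorTo.tsum (n := n) isOpen_ball h0 hn hsm
    (K := fun lam => MvPowerSeries.C (weight τ lam : ℂ) * schurSeries r lam)
    fun lam => (hreg lam).taylor n
  have h2 : mean E (schurSeries r) =
      tsumCoeff fun lam => MvPowerSeries.C (weight τ lam : ℂ) * schurSeries r lam := by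
    ext m
    have h3 := NormalOn.summable_foldr isOpen_ball h0 hn hsm
      (fun lam => (hreg lam).taylor) m
    simp only [coeff_C_mul] at h3
    rw [coeff_mean, hE _ h3, coeff_tsumCoeff]
    simp only [coeff_C_mul]
  rw [h2]
  exact h1

theorem slicePoint_add {r : ℕ} (u : Fin H × Fin r → ℂ) (x : Fin H × Fin r)
    (t : ℂ) : slicePoint N r (u + t • Pi.single x 1) =
      slicePoint N r u + t • unitVec N (x.1, (x.2 : ℕ)) := by
  obtain ⟨g, k⟩ := x
  funext h i
  simp only [slicePoint, pad, Pi.add_apply, Pi.smul_apply, smul_eq_mul, unitVec]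
  by_cases hi : (i : ℕ) < r
  · rw [dif_pos hi, dif_pos hi]
    by_cases hx : h = g ∧ (i : ℕ) = k
    · obtain ⟨rfl, hk⟩ := hx
      have : (⟨(i : ℕ), hi⟩ : Fin r) = k := Fin.ext hk
      rw [this, if_pos ⟨rfl, hk⟩, Pi.single_eq_same]
      ring
    · rw [if_neg hx, Pi.single_eq_of_ne]
      · ring
      · intro heq
        rw [Prod.mk.injEq] at heq
        exact hx ⟨heq.1, congrArg Fin.val heq.2⟩
  · rw [dif_neg hi, dif_neg hi, if_neg, mul_zero, add_zero]
    rintro ⟨-, hk⟩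
    have := k.2
    omega

theorem foldr_partialDeriv_slicePoint {r : ℕ}
    (F : (∀ h, Fin (N h) → ℂ) → ℂ) (l : List (Fin H × Fin r)) (u : Fin H × Fin r → ℂ) :
    (l.map fun x => (x.1, (x.2 : ℕ))).foldr partialDeriv F (slicePoint N r u) =
      l.foldr pd (fun u => F (slicePoint N r u)) u := by
  induction l generalizing u with
  | nil => rfl
  | cons x l ih =>
    rw [List.map_cons, List.foldr_cons, List.foldr_cons, partialDeriv, pd, lineDeriv, lineDeriv]
    congr 1
    funext t
    rw [← slicePoint_add, ih]

/-- This is the bridge from the analytic derivatives in the definition of CLT-appropriateness to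
formal power series. Only the variables with index below r occur, so the others may be frozen at 1.
-/
theorem logSGFDeriv_eq (hτ : IsSmooth τ) {E : ((∀ h, GT (N h)) → ℂ) →ₗ[ℂ] ℂ}
    (hE : ∀ f : (∀ h, GT (N h)) → ℂ, Summable (fun lam => (weight τ lam : ℂ) * f lam) →
      E f = ∑' lam, (weight τ lam : ℂ) * f lam) {r : ℕ}
    {Λ : MvPowerSeries (Fin H × Fin r) ℂ} (hΛ : IsLog Λ (mean E (schurSeries r)))
    (l : List (Fin H × Fin r)) :
    logSGFDeriv τ (l.map fun x => (x.1, (x.2 : ℕ))) = MvPowerSeries.constantCoeff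
      (l.foldr (fun x J => pderiv ℂ x J) Λ) := by
  obtain ⟨U, hU, h0, hsm, ht⟩ := isTaylor_sgf hτ hE r
  have hone : (fun _ _ => 1 : ∀ h, Fin (N h) → ℂ) = slicePoint N r 0 := by
    funext h i
    simp [slicePoint, pad]
  have hs0 : sgf τ (slicePoint N r 0) = 1 := by
    rw [(ht 0).zero, hΛ.right]
  -- The generating function equals 1 at the base point, hence stays in the domain of the principal
  -- logarithm nearby.
  have hV : IsOpen (U ∩ (fun u => sgf τ (slicePoint N r u)) ⁻¹' slitPlane) :=
    hsm.continuousOn.isOpen_inter_preimage hU Complex.isOpen_slitPlane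
  have h1 := IsTaylor.log hV ⟨h0, by
    change sgf τ (slicePoint N r 0) ∈ slitPlane
    rw [hs0]; exact Complex.one_mem_slitPlane⟩ (hsm.mono Set.inter_subset_left)
    (fun u hu => hu.2) ht hΛ
  rw [logSGFDeriv, hone, foldr_partialDeriv_slicePoint]
  exact (h1 l.length).foldr l

end Slice

end

/-! ### Series in pairs of variables, and the normalized quotients. -/

section

open MvPowerSeries (coeff coeff_pderiv constantCoeff mul_inv_cancel pderiv)
open Finsupp (single single_apply)

section Restriction

variable {σ : Type} [Fintype σ] [DecidableEq σ]

/-- The logarithm of a power series with constant term `1`. -/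
def lg (K : MvPowerSeries σ ℂ) : MvPowerSeries σ ℂ :=
  open Classical in if h : constantCoeff K = 1 then (IsLog.exists_left h).choose else 0

theorem isLog_lg {K : MvPowerSeries σ ℂ} (h : constantCoeff K = 1) : IsLog (lg K) K := by
  rw [lg, dif_pos h]
  exact (IsLog.exists_left h).choose_spec

/-- The restriction of a power series to a subset of the variables. -/
theorem coeff_killCompl {τ R : Type*} [CommRing R] (e : σ ↪ τ) (K : MvPowerSeries τ R)
    (n : σ →₀ ℕ) : coeff n (killCompl e K) = coeff (n.embDomain e) K := rfl

theorem pderiv_killCompl {τ R : Type*} [CommRing R] (e : σ ↪ τ) (K : MvPowerSeries τ R) (i : σ) :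
    pderiv R i (killCompl e K) = killCompl e (pderiv R (e i) K) := by
  ext n
  rw [coeff_pderiv, coeff_killCompl, coeff_killCompl, coeff_pderiv,
    Finsupp.embDomain_apply_self, ← embDomain_single e i 1, embDomain_add]

theorem IsLog.killCompl {τ R : Type*} [CommRing R] (e : σ ↪ τ) {Λ K : MvPowerSeries τ R}
    (h : IsLog Λ K) : IsLog (MvPowerSeries.killCompl e Λ) (MvPowerSeries.killCompl e K) := by
  have hc : ∀ J : MvPowerSeries τ R, constantCoeff (MvPowerSeries.killCompl e J) =
      constantCoeff J := by
    intro J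
    rw [← coeff_zero_mv, coeff_killCompl, Finsupp.embDomain_zero, coeff_zero_mv]
  refine ⟨by rw [hc, h.left], by rw [hc, h.right], fun i => ?_⟩
  rw [pderiv_killCompl, pderiv_killCompl, h.deriv, map_mul]

theorem coeff_killCompl_pt {τ R : Type*} [CommRing R] (x : τ) (K : MvPowerSeries τ R) (n : ℕ) :
    PowerSeries.coeff n (killCompl (pt x) K) = coeff (single x n) K := by
  rw [PowerSeries.coeff, coeff_killCompl, embDomain_single]
  rfl

/-- The iterated derivatives of a power series at the origin. -/
theorem coeff_foldr_pderiv (Λ : MvPowerSeries σ ℂ) (l : List σ) (m : σ →₀ ℕ) :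
    (∏ x, ((m x).factorial : ℂ)) * coeff m
        (l.foldr (fun x J => pderiv ℂ x J) Λ) =
      (∏ x, (((m + toFinsupp (l : Multiset σ)) x).factorial : ℂ)) *
        coeff (m + toFinsupp (l : Multiset σ)) Λ := by
  induction l generalizing m with
  | nil => simp
  | cons y l ih =>
    have h1 := ih (m + single y 1)
    have h2 : m + toFinsupp ((y :: l : List σ) : Multiset σ) =
        m + single y 1 + toFinsupp (l : Multiset σ) := by
      rw [← Multiset.cons_coe, ← singleton_add, map_add, Multiset.toFinsupp_singleton, add_assoc]
    rw [List.foldr_cons, h2, ← h1, coeff_pderiv]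
    have h3 : (∏ x, (((m + single y 1 : σ →₀ ℕ) x).factorial : ℂ)) =
        ((m y : ℂ) + 1) * ∏ x, ((m x).factorial : ℂ) := by
      rw [← mul_prod_erase univ _ (mem_univ y),
        ← mul_prod_erase univ (fun x => ((m x).factorial : ℂ)) (mem_univ y)]
      rw [Finsupp.add_apply, Finsupp.single_eq_same, factorial_succ, prod_congr rfl
        (g := fun x => ((m x).factorial : ℂ))]
      · push_cast; ring
      · intro x hx
        rw [Finsupp.add_apply, Finsupp.single_eq_of_ne (ne_of_mem_erase hx), add_zero]
    rw [h3]
    ring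

theorem constantCoeff_foldr_pderiv (Λ : MvPowerSeries σ ℂ) (l : List σ) :
    constantCoeff (l.foldr (fun x J => pderiv ℂ x J) Λ) =
      (∏ x, ((toFinsupp (l : Multiset σ) x).factorial : ℂ)) *
        coeff (toFinsupp (l : Multiset σ)) Λ := by
  have := coeff_foldr_pderiv Λ l 0
  simpa using this

end Restriction

section Pair

variable {H r : ℕ}

/-- A power series of the form `∑ e_{h,f}(u_{h,i}, u_{f,j})`, where the sum is over the unordered
pairs of variables. -/
structure IsPair (e : Fin H → ℕ → Fin H → ℕ → ℂ) (Λ : MvPowerSeries (Fin H × Fin r) ℂ) : Prop where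
  pair : ∀ x y : Fin H × Fin r, x ≠ y → ∀ k m : ℕ, 0 < k → 0 < m →
    coeff (single x k + single y m) Λ = e x.1 k y.1 m
  other : ∀ n : Fin H × Fin r →₀ ℕ, n.support.card ≠ 2 → coeff n Λ = 0

theorem IsPair.add {e e' : Fin H → ℕ → Fin H → ℕ → ℂ} {Λ Λ' : MvPowerSeries (Fin H × Fin r) ℂ}
    (h : IsPair e Λ) (h' : IsPair e' Λ') :
    IsPair (fun a k b m => e a k b m + e' a k b m) (Λ + Λ') :=
  ⟨fun x y hxy k m hk hm => by rw [map_add, h.pair x y hxy k m hk hm, h'.pair x y hxy k m hk hm],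
    fun n hn => by rw [map_add, h.other n hn, h'.other n hn, add_zero]⟩

theorem IsPair.sub {e e' : Fin H → ℕ → Fin H → ℕ → ℂ} {Λ Λ' : MvPowerSeries (Fin H × Fin r) ℂ}
    (h : IsPair e Λ) (h' : IsPair e' Λ') :
    IsPair (fun a k b m => e a k b m - e' a k b m) (Λ - Λ') :=
  ⟨fun x y hxy k m hk hm => by rw [map_sub, h.pair x y hxy k m hk hm, h'.pair x y hxy k m hk hm],
    fun n hn => by rw [map_sub, h.other n hn, h'.other n hn, sub_zero]⟩

theorem eq_single_add_single {σ : Type} [DecidableEq σ] {n : σ →₀ ℕ} (h : n.support.card = 2) :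
    ∃ x y, x ≠ y ∧ 0 < n x ∧ 0 < n y ∧ n = single x (n x) + single y (n y) := by
  obtain ⟨x, y, hxy, hs⟩ := Finset.card_eq_two.mp h
  refine ⟨x, y, hxy, Nat.pos_of_ne_zero (mem_support_iff.mp (by simp [hs])),
    Nat.pos_of_ne_zero (mem_support_iff.mp (by simp [hs])), ?_⟩
  ext z
  rw [Finsupp.add_apply, single_apply, single_apply]
  by_cases hz : z ∈ n.support
  · rw [hs] at hz
    rcases mem_insert.mp hz with rfl | hz
    · simp [Ne.symm hxy]
    · rw [mem_singleton] at hz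
      subst hz
      simp [hxy]
  · have h1 := Finsupp.notMem_support_iff.mp hz
    rw [hs] at hz
    simp only [mem_insert, mem_singleton, not_or] at hz
    rw [h1, if_neg (Ne.symm hz.1), if_neg (Ne.symm hz.2), add_zero]

theorem support_single_add_single {σ : Type} [DecidableEq σ] {x y : σ} (hxy : x ≠ y) {k m : ℕ}
    (hk : 0 < k) (hm : 0 < m) : (single x k + single y m : σ →₀ ℕ).support = {x, y} := by
  ext z
  rw [mem_support_iff, Finsupp.add_apply, single_apply, single_apply, mem_insert, mem_singleton]
  by_cases h1 : x = z <;> by_cases h2 : y = z <;> simp_all [eq_comm] <;> omega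

end Pair

section Appropriate

variable {H : ℕ}

section Fixed

variable {N : Fin H → ℕ} (E : ((∀ h, GT (N h)) → ℂ) →ₗ[ℂ] ℂ)

/-- The expectation of the one-variable series. -/
def oneSeries (h : Fin H) : PowerSeries ℂ := mean E (phiSeries h)

/-- The series of the Schur generating function, divided by the one-variable factors. -/
def quotSchur (r : ℕ) : MvPowerSeries (Fin H × Fin r) ℂ :=
  (tens fun x : Fin H × Fin r => oneSeries E x.1)⁻¹ * mean E (schurSeries r)

/-- The expectation of the products of the one-variable series, divided by the one-variable
factors. -/
def quotPhi (r : ℕ) : MvPowerSeries (Fin H × Fin r) ℂ :=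
  (tens fun x : Fin H × Fin r => oneSeries E x.1)⁻¹ *
    mean E (fun lam => tens fun x : Fin H × Fin r => phiSeries x.1 lam)

variable {E} (hN0 : ∀ h, 0 < N h) (hE : E (fun _ => 1) = 1)

include hN0 hE

theorem constantCoeff_oneSeries (h : Fin H) : PowerSeries.constantCoeff (oneSeries E h) = 1 := by
  rw [← hE, ← coeff_zero_ps]
  change E (fun lam => PowerSeries.coeff 0 (phiSeries h lam)) = _
  congr 1
  funext lam
  rw [coeff_zero_ps, constantCoeff_phiSeries hN0]

theorem constantCoeff_tens_oneSeries (r : ℕ) :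
    constantCoeff (tens fun x : Fin H × Fin r => oneSeries E x.1) = 1 :=
  constantCoeff_tens (fun x : Fin H × Fin r => oneSeries E x.1)
    fun x => constantCoeff_oneSeries hN0 hE x.1

theorem tens_mul_quotSchur (r : ℕ) :
    (tens fun x : Fin H × Fin r => oneSeries E x.1) * quotSchur E r = mean E (schurSeries r) := by
  rw [quotSchur, ← mul_assoc, mul_inv_cancel _
    (by rw [constantCoeff_tens_oneSeries hN0 hE]; exact one_ne_zero), one_mul]

theorem tens_mul_quotPhi (r : ℕ) : (tens fun x : Fin H × Fin r => oneSeries E x.1) * quotPhi E r =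
      mean E (fun lam => tens fun x : Fin H × Fin r => phiSeries x.1 lam) := by
  rw [quotPhi, ← mul_assoc, mul_inv_cancel _
    (by rw [constantCoeff_tens_oneSeries hN0 hE]; exact one_ne_zero), one_mul]

theorem isLog_oneSeries (h : Fin H) : IsLog (lg (oneSeries E h)) (oneSeries E h) :=
  isLog_lg (constantCoeff_oneSeries hN0 hE h)

theorem constantCoeff_mean_schurSeries (r : ℕ) : constantCoeff (mean E (schurSeries r)) = 1 := by
  rw [← hE, ← coeff_zero_mv, coeff_mean]
  congr 1
  funext lam
  rw [coeff_zero_mv, constantCoeff_schurSeries]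

theorem constantCoeff_mean_tens (r : ℕ) : constantCoeff
      (mean E (fun lam => tens fun x : Fin H × Fin r => phiSeries x.1 lam)) = 1 := by
  rw [← hE, ← coeff_zero_mv, coeff_mean]
  congr 1
  funext lam
  rw [coeff_zero_mv]
  exact constantCoeff_tens (fun x : Fin H × Fin r => phiSeries x.1 lam)
    fun x => constantCoeff_phiSeries hN0 x.1 lam

theorem isLog_tens_oneSeries (r : ℕ) : IsLog (∑ x : Fin H × Fin r, emb x (lg (oneSeries E x.1)))
      (tens fun x : Fin H × Fin r => oneSeries E x.1) :=
  IsLog.sum_prod _ fun x _ => (isLog_oneSeries hN0 hE x.1).emb x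

theorem isLog_quotSchur (r : ℕ) :
    IsLog (lg (mean E (schurSeries r)) - ∑ x : Fin H × Fin r, emb x (lg (oneSeries E x.1)))
      (quotSchur E r) :=
  (isLog_lg (constantCoeff_mean_schurSeries hN0 hE r)).sub_div (isLog_tens_oneSeries hN0 hE r)
    (tens_mul_quotSchur hN0 hE r)

theorem constantCoeff_quotPhi (r : ℕ) : constantCoeff (quotPhi E r) = 1 :=
  ((isLog_lg (constantCoeff_mean_tens hN0 hE r)).sub_div (isLog_tens_oneSeries hN0 hE r)
    (tens_mul_quotPhi hN0 hE r)).right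

theorem lg_quotSchur (r : ℕ) : lg (quotSchur E r) =
      lg (mean E (schurSeries r)) - ∑ x : Fin H × Fin r, emb x (lg (oneSeries E x.1)) :=
  (isLog_lg (isLog_quotSchur hN0 hE r).right).unique_left (isLog_quotSchur hN0 hE r)

/-- Setting all other variables to 0 is a ring homomorphism compatible with logarithms, and it sends
the Schur series to the one-variable expectation. -/
theorem coeff_single_lg {r : ℕ} (hr : ∀ h, r ≤ N h) (x : Fin H × Fin r) (n : ℕ) :
    coeff (single x n) (lg (mean E (schurSeries r))) =
      PowerSeries.coeff n (lg (oneSeries E x.1)) := by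
  have h1 := (isLog_lg (constantCoeff_mean_schurSeries hN0 hE r)).killCompl (pt x)
  have h2 : killCompl (pt x) (mean E (schurSeries r)) = oneSeries E x.1 := by
    apply PowerSeries.ext
    intro m
    rw [coeff_killCompl_pt, coeff_mean]
    change _ = E (fun lam => PowerSeries.coeff m (phiSeries x.1 lam))
    congr 1
    funext lam
    rw [coeff_single_schurSeries hN0 hr]
  rw [h2] at h1
  rw [← coeff_killCompl_pt, h1.unique_left (isLog_oneSeries hN0 hE x.1)]

/-- Division by the one-variable factors removes from the logarithm exactly the terms that involve
at most one variable. -/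
theorem coeff_lg_quotSchur {r : ℕ} (hr : ∀ h, r ≤ N h) (n : Fin H × Fin r →₀ ℕ) :
    coeff n (lg (quotSchur E r)) = if n.support.card < 2 then 0 else
        coeff n (lg (mean E (schurSeries r))) := by
  rw [lg_quotSchur hN0 hE, map_sub, map_sum]
  split_ifs with h
  · rcases Nat.lt_or_ge n.support.card 1 with h0 | h1
    · have : n = 0 := by
        rw [← Finsupp.card_support_eq_zero]; omega
      subst this
      rw [coeff_zero_mv,
        (isLog_lg (constantCoeff_mean_schurSeries hN0 hE r)).left, zero_sub, neg_eq_zero]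
      refine sum_eq_zero fun x _ => ?_
      rw [coeff_zero_mv, constantCoeff_emb]
      exact (isLog_oneSeries hN0 hE x.1).left
    · obtain ⟨x, k, hk, rfl⟩ := Finsupp.card_support_eq_one'.mp (show n.support.card = 1 by omega)
      rw [coeff_single_lg hN0 hE hr, sum_eq_single x, coeff_emb_single, sub_self]
      · intro y _ hy
        rw [coeff_emb, if_neg]
        intro h
        have := congrArg (fun n => n x) h
        simp [hy] at this
        exact hk this
      · simp
  · rw [sub_eq_self]
    refine sum_eq_zero fun x _ => ?_
    rw [coeff_emb, if_neg]
    intro hn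
    rw [hn] at h
    exact h (lt_of_le_of_lt (Finsupp.support_single_subset.trans_eq rfl |> Finset.card_le_card)
      (by simp))

end Fixed

end Appropriate

end

/-! ### CLT-appropriateness in terms of formal series. -/

section

open PowerSeries (C coeff_C_mul)
open MvPowerSeries (coeff)
open Finsupp (single)

section AppropriateIff

/-- The generating series of the limits of the derivatives in one variable. -/
def cSeries (c : ℕ+ → ℂ) : PowerSeries ℂ :=
  PowerSeries.mk fun n => if h : 0 < n then c ⟨n, h⟩ / (n.factorial : ℂ) else 0

/-- The Taylor coefficients given by the limits of the derivatives in two variables. -/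
def dCoeff {H : ℕ} (d : ℕ+ → Fin H → ℕ+ → Fin H → ℂ) (h : Fin H) (k : ℕ) (f : Fin H) (m : ℕ) : ℂ :=
  if hkm : 0 < k ∧ 0 < m then
    d ⟨k, hkm.1⟩ h ⟨m, hkm.2⟩ f / ((k.factorial : ℂ) * (m.factorial : ℂ)) else 0

variable {H : ℕ} {N : ℕ → Fin H → ℕ} {ρ : ∀ L, PMF (∀ h, GT (N L h))}
  {E : ∀ L, ((∀ h, GT (N L h)) → ℂ) →ₗ[ℂ] ℂ}

theorem toFinsupp_replicate {σ : Type} [DecidableEq σ] (k : ℕ) (x : σ) :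
    toFinsupp ((List.replicate k x : List σ) : Multiset σ) = single x k := by
  ext y
  rw [Multiset.toFinsupp_apply, Multiset.coe_count, List.count_replicate, Finsupp.single_apply]
  by_cases h : x = y <;> simp [h]

theorem card_toFinset_map {α β : Type} [DecidableEq α] [DecidableEq β] {f : α → β}
    (hf : Function.Injective f) (l : List α) : (l.map f).toFinset.card = l.toFinset.card := by
  rw [← Finset.card_image_of_injective _ hf]
  congr 1
  ext x
  simp

theorem prod_factorial_single {σ : Type} [Fintype σ] [DecidableEq σ] (x : σ) (k : ℕ) :
    (∏ z, (((single x k : σ →₀ ℕ) z).factorial : ℂ)) = k.factorial := by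
  rw [prod_eq_single x]
  · simp
  · intro y _ hy; simp [hy]
  · simp

theorem prod_factorial_single_add_single {σ : Type} [Fintype σ] [DecidableEq σ] {x y : σ}
    (hxy : x ≠ y) (k m : ℕ) : (∏ z, (((single x k + single y m : σ →₀ ℕ) z).factorial : ℂ)) =
      (k.factorial : ℂ) * m.factorial := by
  rw [← prod_factorial_single x k, ← prod_factorial_single y m, ← prod_mul_distrib]
  refine prod_congr rfl fun z _ => ?_
  by_cases h1 : x = z
  · subst h1
    simp [hxy]
  · simp [Ne.symm h1]

theorem tendsto_ge (hN0 : ∀ L h, 0 < N L h)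
    (hN : ∀ h, Tendsto (fun L => 1 / (N L h : ℂ)) atTop (𝓝 0)) (r : ℕ) :
    ∀ᶠ L in atTop, ∀ h, r ≤ N L h := by
  rw [eventually_all]
  intro h
  have h1 := (hN h).norm
  rw [norm_zero] at h1
  have h2 : ∀ᶠ L in atTop, ‖1 / (N L h : ℂ)‖ < 1 / (r + 1 : ℝ) :=
    h1.eventually_lt_const (by positivity)
  filter_upwards [h2] with L hL
  rw [norm_div, norm_one, Complex.norm_natCast] at hL
  have h3 : (0 : ℝ) < N L h := by exact_mod_cast hN0 L h
  have h4 := lt_of_one_div_lt_one_div h3 hL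
  have h5 : r + 1 < N L h := by exact_mod_cast h4
  omega

section

variable (hN0 : ∀ L h, 0 < N L h) (hN : ∀ h, Tendsto (fun L => 1 / (N L h : ℂ)) atTop (𝓝 0))
  (hρ : ∀ L, IsSmooth (ρ L))
  (hE : ∀ L, ∀ f : (∀ h, GT (N L h)) → ℂ, Summable (fun lam => (weight (ρ L) lam : ℂ) * f lam) →
      E L f = ∑' lam, (weight (ρ L) lam : ℂ) * f lam)

include hN0 hρ hE

theorem logSGFDeriv_eq_coeff (L : ℕ) {r : ℕ} (l : List (Fin H × Fin r)) :
    logSGFDeriv (ρ L) (l.map fun x => (x.1, (x.2 : ℕ))) =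
      (∏ x, ((toFinsupp (l : Multiset (Fin H × Fin r)) x).factorial : ℂ)) *
        coeff (toFinsupp (l : Multiset (Fin H × Fin r)))
          (lg (mean (E L) (schurSeries r))) := by
  rw [logSGFDeriv_eq (hρ L) (hE L) (isLog_lg (constantCoeff_mean_schurSeries (hN0 L)
    (expectation_one (hE L)) r)) l, constantCoeff_foldr_pderiv]

theorem logSGFDeriv_replicate (L : ℕ) (k : ℕ) (h : Fin H) (i : ℕ) (hi : ∀ h, i + 1 ≤ N L h) :
    logSGFDeriv (ρ L) (List.replicate k (h, i)) =
      (k.factorial : ℂ) * PowerSeries.coeff k (lg (oneSeries (E L) h)) := by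
  have h1 := logSGFDeriv_eq_coeff hN0 hρ hE L
    (List.replicate k ((h, ⟨i, Nat.lt_succ_self i⟩) : Fin H × Fin (i + 1)))
  rw [List.map_replicate] at h1
  rw [h1, toFinsupp_replicate, prod_factorial_single,
    coeff_single_lg (hN0 L) (expectation_one (hE L)) hi]

theorem logSGFDeriv_append (L : ℕ) {r : ℕ} (hr : ∀ h, r ≤ N L h) {x y : Fin H × Fin r}
    (hxy : x ≠ y) {k m : ℕ} (hk : 0 < k) (hm : 0 < m) :
    logSGFDeriv (ρ L) (List.replicate k (x.1, (x.2 : ℕ)) ++ List.replicate m (y.1, (y.2 : ℕ))) =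
      ((k.factorial : ℂ) * m.factorial) * coeff (single x k + single y m)
          (lg (quotSchur (E L) r)) := by
  have h1 := logSGFDeriv_eq_coeff hN0 hρ hE L (List.replicate k x ++ List.replicate m y)
  rw [List.map_append, List.map_replicate, List.map_replicate] at h1
  rw [h1, ← Multiset.coe_add, map_add, toFinsupp_replicate, toFinsupp_replicate,
    prod_factorial_single_add_single hxy,
    coeff_lg_quotSchur (hN0 L) (expectation_one (hE L)) hr, if_neg]
  rw [support_single_add_single hxy hk hm, card_pair hxy]
  omega

theorem logSGFDeriv_of_card (L : ℕ) {r : ℕ} (hr : ∀ h, r ≤ N L h) (l : List (Fin H × Fin r))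
    (hl : 2 ≤ l.toFinset.card) : logSGFDeriv (ρ L) (l.map fun x => (x.1, (x.2 : ℕ))) =
      (∏ x, ((toFinsupp (l : Multiset (Fin H × Fin r)) x).factorial : ℂ)) *
        coeff (toFinsupp (l : Multiset (Fin H × Fin r)))
          (lg (quotSchur (E L) r)) := by
  rw [logSGFDeriv_eq_coeff hN0 hρ hE L, coeff_lg_quotSchur (hN0 L) (expectation_one (hE L)) hr,
    if_neg]
  rw [toFinsupp_support]
  change ¬ l.toFinset.card < 2
  omega

include hN in
-- The derivatives at 1 are factorials times Taylor coefficients. Condition 1 concerns the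
-- one-variable logarithm divided by N; conditions 2 and 3 concern the coefficients with at least
-- two variables, and those are the coefficients of the logarithm of the quotient.
theorem appropriate_iff (c : ℕ+ → Fin H → ℂ) (d : ℕ+ → Fin H → ℕ+ → Fin H → ℂ) :
    HasAppropriateLimits ρ c d ↔ (∀ h, CT (fun L => C (1 / (N L h : ℂ)) * lg (oneSeries (E L) h))
        (cSeries fun k => c k h)) ∧
      ∀ r, ∃ a, CT (fun L => lg (quotSchur (E L) r)) a ∧ IsPair (dCoeff d) a := by
  have hfac : ∀ k : ℕ, (k.factorial : ℂ) ≠ 0 := fun k => by exact_mod_cast factorial_ne_zero k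
  have hone : ∀ (k : ℕ+) (h : Fin H) (i : ℕ), Tendsto (fun L => 1 / (N L h : ℂ) *
      logSGFDeriv (ρ L) (List.replicate k (h, i))) atTop (𝓝 (c k h)) ↔
      Tendsto (fun L => PowerSeries.coeff (k : ℕ) (C (1 / (N L h : ℂ)) *
        lg (oneSeries (E L) h))) atTop (𝓝 (c k h / ((k : ℕ).factorial : ℂ))) := by
    intro k h i
    have h1 : ∀ᶠ L in atTop, 1 / (N L h : ℂ) * logSGFDeriv (ρ L) (List.replicate k (h, i)) =
        ((k : ℕ).factorial : ℂ) * PowerSeries.coeff (k : ℕ) (C (1 / (N L h : ℂ)) *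
        lg (oneSeries (E L) h)) := by
      filter_upwards [tendsto_ge hN0 hN (i + 1)] with L hL
      rw [logSGFDeriv_replicate hN0 hρ hE L k h i hL, coeff_C_mul]
      ring
    rw [tendsto_congr' h1]
    constructor
    · intro h2
      refine (h2.div_const ((k : ℕ).factorial : ℂ)).congr fun L => ?_
      rw [mul_div_cancel_left₀ _ (hfac k)]
    · intro h2
      have h3 := h2.const_mul ((k : ℕ).factorial : ℂ)
      rwa [mul_div_cancel₀ _ (hfac k)] at h3
  constructor
  · intro hA
    refine ⟨fun h n => ?_, fun r => ?_⟩
    · rw [show n = single () (n ()) from by ext; simp]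
      obtain ⟨m, hm⟩ : ∃ m, n () = m := ⟨_, rfl⟩
      rw [hm]
      change Tendsto (fun L => PowerSeries.coeff m _) atTop (𝓝 (PowerSeries.coeff m _))
      rw [cSeries, coeff_mk]
      split_ifs with hpos
      · exact (hone ⟨m, hpos⟩ h 0).mp (hA.one_variable _ h 0)
      · have : m = 0 := by omega
        subst this
        refine tendsto_const_nhds.congr fun L => ?_
        rw [coeff_C_mul, coeff_zero_ps]
        have := (isLog_oneSeries (hN0 L) (expectation_one (hE L)) h).left
        rw [PowerSeries.constantCoeff, this, mul_zero]
    · have h2 : ∀ x y : Fin H × Fin r, x ≠ y → ∀ k m : ℕ, 0 < k → 0 < m →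
          Tendsto (fun L => coeff (single x k + single y m)
            (lg (quotSchur (E L) r))) atTop (𝓝 (dCoeff d x.1 k y.1 m)) := by
        intro x y hxy k m hk hm
        have h3 := hA.two_variables ⟨k, hk⟩ x.1 ⟨m, hm⟩ y.1 x.2 y.2 (fun h => hxy (by
          rw [Prod.mk.injEq] at h
          exact Prod.ext h.1 (Fin.ext h.2)))
        rw [dCoeff, dif_pos ⟨hk, hm⟩]
        refine (h3.div_const ((k.factorial : ℂ) * m.factorial)).congr' ?_
        filter_upwards [tendsto_ge hN0 hN r] with L hL
        simp only [PNat.mk_coe]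
        rw [logSGFDeriv_append hN0 hρ hE L hL hxy hk hm,
          mul_div_cancel_left₀ _ (mul_ne_zero (hfac k) (hfac m))]
      have h3 : ∀ n : Fin H × Fin r →₀ ℕ, n.support.card ≠ 2 →
          Tendsto (fun L => coeff n (lg (quotSchur (E L) r))) atTop (𝓝 0) := by
        intro n hn
        rcases lt_or_gt_of_ne hn with h | h
        · refine tendsto_const_nhds.congr' ?_
          filter_upwards [tendsto_ge hN0 hN r] with L hL
          rw [coeff_lg_quotSchur (hN0 L) (expectation_one (hE L)) hL, if_pos h]
        -- The list of variables that realizes the exponent n as an iterated derivative.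
        · set l := (toMultiset n).toList with hl
          have hl' : toFinsupp (l : Multiset (Fin H × Fin r)) = n := by
            rw [hl, Multiset.coe_toList, Finsupp.toMultiset_toFinsupp]
          have hcard : l.toFinset.card = n.support.card := by
            rw [← hl', toFinsupp_support]
            rfl
          have hinj : Function.Injective fun x : Fin H × Fin r => (x.1, (x.2 : ℕ)) := by
            intro x y hxy
            simp only [Prod.mk.injEq] at hxy
            exact Prod.ext hxy.1 (Fin.ext hxy.2)
          have h4 := hA.more_variables (l.map fun x => (x.1, (x.2 : ℕ))) (by
            rw [card_toFinset_map hinj, hcard]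
            omega)
          have h5 := h4.div_const
            (∏ x, ((toFinsupp (l : Multiset (Fin H × Fin r)) x).factorial : ℂ))
          rw [zero_div] at h5
          refine h5.congr' ?_
          filter_upwards [tendsto_ge hN0 hN r] with L hL
          rw [logSGFDeriv_of_card hN0 hρ hE L hL l (by omega), mul_div_cancel_left₀, hl']
          exact prod_ne_zero_iff.mpr fun x _ => hfac _
      obtain ⟨a, ha⟩ := CT.of_coeff (K := fun L => lg (quotSchur (E L) r)) (fun n => by
        by_cases hn : n.support.card = 2
        · obtain ⟨x, y, hxy, hx, hy, hn'⟩ := eq_single_add_single hn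
          rw [hn']
          exact ⟨_, h2 x y hxy _ _ hx hy⟩
        · exact ⟨0, h3 n hn⟩)
      exact ⟨a, ha, fun x y hxy k m hk hm => tendsto_nhds_unique (ha _) (h2 x y hxy k m hk hm),
        fun n hn => tendsto_nhds_unique (ha _) (h3 n hn)⟩
  · rintro ⟨h1, h2⟩
    refine ⟨fun k h i => (hone k h i).mpr ?_, fun k h m f i j hij => ?_, fun l hl => ?_⟩
    · have h3 := h1 h (single () (k : ℕ))
      have h4 : coeff (single () (k : ℕ)) (cSeries fun k => c k h) =
          c k h / ((k : ℕ).factorial : ℂ) := by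
        change PowerSeries.coeff (k : ℕ) _ = _
        rw [cSeries, coeff_mk, dif_pos k.pos]
        rfl
      rw [h4] at h3
      exact h3
    -- The number of variables per colour is taken large enough to contain the indices i and j.
    · obtain ⟨a, ha, hp⟩ := h2 (max i j + 1)
      set x : Fin H × Fin (max i j + 1) := (h, ⟨i, by omega⟩) with hx
      set y : Fin H × Fin (max i j + 1) := (f, ⟨j, by omega⟩) with hy
      have hxy : x ≠ y := by
        intro h
        have h1 := congrArg Prod.fst h
        have h2 := congrArg (fun z => (z.2 : ℕ)) h
        exact hij (Prod.ext h1 h2)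
      have h3 := (ha (single x (k : ℕ) + single y (m : ℕ))).const_mul
        (((k : ℕ).factorial : ℂ) * (m : ℕ).factorial)
      rw [hp.pair x y hxy k m k.pos m.pos, dCoeff, dif_pos ⟨k.pos, m.pos⟩,
        mul_div_cancel₀ _ (mul_ne_zero (hfac k) (hfac m))] at h3
      refine h3.congr' ?_
      filter_upwards [tendsto_ge hN0 hN (max i j + 1)] with L hL
      rw [← logSGFDeriv_append hN0 hρ hE L hL hxy k.pos m.pos]
    -- A finite list involves finitely many variables, so it comes from some slice of r variables
    -- per colour.
    · obtain ⟨r, hr⟩ : ∃ r : ℕ, ∀ a ∈ l, a.2 < r := by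
        refine ⟨(l.map Prod.snd).sum + 1, fun a ha => Nat.lt_succ_of_le ?_⟩
        exact List.le_sum_of_mem (List.mem_map_of_mem ha)
      obtain ⟨l', hl'⟩ : ∃ l' : List (Fin H × Fin r), l'.map (fun x => (x.1, (x.2 : ℕ))) = l := by
        refine ⟨l.attach.map fun a => (a.1.1, ⟨a.1.2, hr a.1 a.2⟩), ?_⟩
        rw [List.map_map]
        conv_rhs => rw [← List.attach_map_subtype_val l]
        rfl
      obtain ⟨a, ha, hp⟩ := h2 r
      have hinj : Function.Injective fun x : Fin H × Fin r => (x.1, (x.2 : ℕ)) := by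
        intro x y hxy
        simp only [Prod.mk.injEq] at hxy
        exact Prod.ext hxy.1 (Fin.ext hxy.2)
      have hc : l'.toFinset.card = l.toFinset.card := by
        rw [← hl', card_toFinset_map hinj]
      have h3 := (ha (toFinsupp (l' : Multiset (Fin H × Fin r)))).const_mul
        (∏ x, ((toFinsupp (l' : Multiset (Fin H × Fin r)) x).factorial : ℂ))
      rw [hp.other _ (by
        rw [toFinsupp_support]
        change l'.toFinset.card ≠ 2
        omega), mul_zero] at h3
      refine h3.congr' ?_
      filter_upwards [tendsto_ge hN0 hN r] with L hL
      rw [← logSGFDeriv_of_card hN0 hρ hE L hL l' (by omega), hl']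

end

end AppropriateIff

end

/-! ### The factor (w g(z) - z g(w)) / (w - z), and the transfer between the quotients. -/

section

open PowerSeries (C constantCoeff)
open MvPowerSeries (X coeff rename)
open Finsupp (single single_apply)

section Quotient

/-- The power series `(w g(z) - z g(w)) / (w - z)`. -/
def q2 (g : PowerSeries ℂ) : MvPowerSeries (Fin 2) ℂ := fun n =>
  if n 0 = 0 then (if n 1 = 0 then PowerSeries.coeff 0 g else 0)
  else if n 1 = 0 then 0 else -PowerSeries.coeff (n 0 + n 1) g

theorem coeff_q2 (g : PowerSeries ℂ) (n : Fin 2 →₀ ℕ) : coeff n (q2 g) =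
    if n 0 = 0 then (if n 1 = 0 then PowerSeries.coeff 0 g else 0)
    else if n 1 = 0 then 0 else -PowerSeries.coeff (n 0 + n 1) g := rfl

theorem coeff_X_mul_eq {σ : Type} [DecidableEq σ] (i : σ) (J : MvPowerSeries σ ℂ) (n : σ →₀ ℕ) :
    coeff n (X i * J) = if n i = 0 then 0 else coeff (n - single i 1) J := by
  split_ifs with h
  · exact coeff_X_mul_of_eq_zero J h
  · have : n = single i 1 + (n - single i 1) := by
      ext j
      rw [Finsupp.add_apply, tsub_apply, single_apply]
      split_ifs with hj
      · subst hj; omega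
      · omega
    conv_lhs => rw [this]
    rw [coeff_single_add_X_mul]

/-- By linearity this is a statement about monomials: (w zⁿ - z wⁿ) / (w - z) equals 1 for n = 0,
vanishes for n = 1, and is minus the sum of all z^a w^b with a + b = n and a, b ≥ 1 for n ≥ 2. -/
theorem mulB_eq_mul_q2 (g : PowerSeries ℂ) : mulB (0 : Fin 2) 1 g = (X 1 - X 0) * q2 g := by
  ext n
  rw [mulB, sub_mul, map_sub, map_sub, coeff_X_mul_eq, coeff_X_mul_eq, coeff_X_mul_eq,
    coeff_X_mul_eq, coeff_emb, coeff_emb, coeff_q2, coeff_q2]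
  have e0 : ∀ m : Fin 2 →₀ ℕ, m = single 0 (m 0) ↔ m 1 = 0 := by
    intro m
    constructor
    · intro h; rw [h]; simp
    · intro h; ext j; fin_cases j <;> simp [h]
  have e1 : ∀ m : Fin 2 →₀ ℕ, m = single 1 (m 1) ↔ m 0 = 0 := by
    intro m
    constructor
    · intro h; rw [h]; simp
    · intro h; ext j; fin_cases j <;> simp [h]
  simp only [e0, e1]
  simp only [tsub_apply, single_apply]
  generalize n 0 = a
  generalize n 1 = b
  rcases a with _ | _ | a <;> rcases b with _ | _ | b <;> simp <;> ring_nf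

theorem constantCoeff_q2 (g : PowerSeries ℂ) (hg : constantCoeff g = 1) :
    MvPowerSeries.constantCoeff (q2 g) = 1 := by
  rw [← coeff_zero_mv, coeff_q2]
  simpa using hg

/-- The coefficients of the logarithm of `q2 g`. -/
def ell (g : PowerSeries ℂ) (k m : ℕ) : ℂ := coeff (single 0 k + single 1 m) (lg (q2 g))

variable {g : PowerSeries ℂ} (hg : constantCoeff g = 1)

include hg

/-- If one of the variables is set to 0, the quotient becomes g(0) = 1, so its logarithm has only
terms in both variables. -/
theorem lg_q2_coeff_single (i : Fin 2) (n : ℕ) : coeff (single i n) (lg (q2 g)) = 0 := by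
  have h1 := (isLog_lg (constantCoeff_q2 g hg)).killCompl (pt i)
  have h2 : killCompl (pt i) (q2 g) = 1 := by
    apply PowerSeries.ext
    intro m
    rw [coeff_killCompl_pt, coeff_q2]
    have : PowerSeries.coeff m (1 : MvPowerSeries Unit ℂ) = if m = 0 then 1 else 0 :=
      PowerSeries.coeff_one m
    rw [this]
    have h0 : PowerSeries.coeff 0 g = 1 := by simpa using hg
    fin_cases i <;> simp [h0]
  rw [h2] at h1
  rw [← coeff_killCompl_pt, h1.unique_left IsLog.zero_one]
  exact map_zero _

theorem ell_zero_left (m : ℕ) : ell g 0 m = 0 := by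
  rw [ell, single_zero, zero_add, lg_q2_coeff_single hg]

theorem ell_zero_right (k : ℕ) : ell g k 0 = 0 := by
  rw [ell, single_zero, add_zero, lg_q2_coeff_single hg]

theorem ell_comm (k m : ℕ) : ell g k m = ell g m k := by
  set e : Fin 2 ↪ Fin 2 := (Equiv.swap 0 1).toEmbedding with he
  have h1 := (isLog_lg (constantCoeff_q2 g hg)).killCompl e
  have h2 : killCompl e (q2 g) = q2 g := by
    ext n
    have e1 : n.embDomain e 0 = n 1 := by
      have := Finsupp.embDomain_apply_self e n 1
      rwa [show e 1 = 0 from by simp [he]] at this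
    have e2 : n.embDomain e 1 = n 0 := by
      have := Finsupp.embDomain_apply_self e n 0
      rwa [show e 0 = 1 from by simp [he]] at this
    rw [coeff_killCompl, coeff_q2, coeff_q2, e1, e2, add_comm]
    split_ifs <;> rfl
  rw [h2] at h1
  have h3 := h1.unique_left (isLog_lg (constantCoeff_q2 g hg))
  rw [ell, ← h3, coeff_killCompl, embDomain_add, embDomain_single, embDomain_single, ell, add_comm]
  simp [he]

end Quotient

section PairEmb

variable {σ : Type} [DecidableEq σ]

/-- The embedding of two variables. -/
def pairEmb (x y : σ) (h : x ≠ y) : Fin 2 ↪ σ := ⟨![x, y], by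
    intro i j hij
    fin_cases i <;> fin_cases j <;> simp_all⟩

theorem rename_emb {R : Type*} [CommRing R] (e : Fin 2 ↪ σ) (i : Fin 2) (φ : PowerSeries R) :
    rename e (emb i φ) = emb (e i) φ := by
  rw [emb, emb, MvPowerSeries.rename_rename]
  congr 1

/-- The series `q2 g` in the variables `u_x`, `u_y`. -/
def qAt (g : PowerSeries ℂ) (x y : σ) : MvPowerSeries σ ℂ :=
  if h : x ≠ y then rename (pairEmb x y h) (q2 g) else 1

/-- The logarithm of `q2 g` in the variables `u_x`, `u_y`. -/
def lAt (g : PowerSeries ℂ) (x y : σ) : MvPowerSeries σ ℂ :=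
  if h : x ≠ y then rename (pairEmb x y h) (lg (q2 g)) else 0

theorem mulB_eq_mul_qAt (g : PowerSeries ℂ) {x y : σ} (h : x ≠ y) :
    mulB x y g = (X y - X x) * qAt g x y := by
  have h1 := congrArg (rename (pairEmb x y h)) (mulB_eq_mul_q2 g)
  rw [map_mul, map_sub, mulB, map_sub, map_mul, map_mul, rename_X,
    rename_X, rename_emb, rename_emb] at h1
  rw [qAt, dif_pos h]
  exact h1

theorem isLog_lAt {g : PowerSeries ℂ} (hg : constantCoeff g = 1) (x y : σ) :
    IsLog (lAt g x y) (qAt g x y) := by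
  rw [lAt, qAt]
  split_ifs with h
  · exact (isLog_lg (constantCoeff_q2 g hg)).rename _
  · exact IsLog.zero_one

theorem coeff_lAt (g : PowerSeries ℂ) {x y : σ} (h : x ≠ y) (k m : ℕ) :
    coeff (single x k + single y m) (lAt g x y) = ell g k m := by
  rw [lAt, dif_pos h, ell, ← MvPowerSeries.coeff_embDomain_rename (pairEmb x y h),
    embDomain_add, embDomain_single, embDomain_single]
  rfl

theorem coeff_lAt_of_ne {g : PowerSeries ℂ} (hg : constantCoeff g = 1) {x y : σ}
    {n : σ →₀ ℕ} (hn : n.support ≠ {x, y} ∨ x = y) : coeff n (lAt g x y) = 0 := by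
  by_cases h : x = y
  · rw [lAt, dif_neg (by simpa using h), map_zero]
  replace hn := hn.resolve_right h
  by_cases hr : n ∈ Set.range (mapDomain (pairEmb x y h) : (Fin 2 →₀ ℕ) → σ →₀ ℕ)
  · obtain ⟨m, rfl⟩ := hr
    have h1 : mapDomain (pairEmb x y h) m = single x (m 0) + single y (m 1) := by
      have : m = single 0 (m 0) + single 1 (m 1) := by
        ext j; fin_cases j <;> simp
      conv_lhs => rw [this]
      rw [Finsupp.mapDomain_add, Finsupp.mapDomain_single, Finsupp.mapDomain_single]
      rfl
    rw [h1] at hn ⊢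
    rw [coeff_lAt g h]
    by_cases h0 : m 0 = 0
    · rw [h0, ell_zero_left hg]
    · by_cases h1 : m 1 = 0
      · rw [h1, ell_zero_right hg]
      · exact absurd (support_single_add_single h (Nat.pos_of_ne_zero h0)
          (Nat.pos_of_ne_zero h1)) hn
  · rw [lAt, dif_pos h]
    exact MvPowerSeries.coeff_rename_eq_zero _ _ hr

end PairEmb

section Transfer

variable {H r : ℕ}

theorem mulProd_eq (g : Fin H → PowerSeries ℂ) :
    mulProd r g = diffProd H r * ((pairList H r).map fun p => qAt (g p.1.1) p.1 p.2).prod := by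
  rw [mulProd, diffProd, ← List.prod_map_mul]
  congr 1
  exact List.map_congr_left fun p hp => mulB_eq_mul_qAt _ (ne_of_mem_pairList hp)

theorem diffProd_ne_zero : diffProd H r ≠ 0 := by
  rw [diffProd]
  apply List.prod_ne_zero
  simp only [List.mem_map, not_exists, not_and]
  intro p hp h
  have := congrArg (coeff (single p.1 1)) h
  rw [map_sub, coeff_index_single_X, coeff_index_single_X,
    if_neg (ne_of_mem_pairList hp), if_pos rfl] at this
  simp at this

theorem isLog_list_sum {ι σ : Type} {Λ K : ι → MvPowerSeries σ ℂ} (h : ∀ i, IsLog (Λ i) (K i))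
    (l : List ι) : IsLog (l.map Λ).sum (l.map K).prod := by
  induction l with
  | nil => simpa using IsLog.zero_one
  | cons i l ih =>
    rw [List.map_cons, List.map_cons, List.sum_cons, List.prod_cons]
    exact (h i).add_mul ih

/-- The coefficients of the logarithm of the product of the series `q2`. -/
def ellCoeff (g : Fin H → PowerSeries ℂ) (a : Fin H) (k : ℕ) (b : Fin H) (m : ℕ) : ℂ :=
  if a = b then ell (g a) k m else 0

/-- A given pair of variables occurs exactly once in the list if the colours agree and never
otherwise, and each summand involves only its own two variables. Symmetry of the coefficients makes
the order within a pair irrelevant. -/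
theorem isPair_sum_lAt {g : Fin H → PowerSeries ℂ}
    (hg : ∀ h, constantCoeff (g h) = 1) :
    IsPair (ellCoeff g) ((pairList H r).map fun p => lAt (g p.1.1) p.1 p.2).sum := by
  have key : ∀ (x y : Fin H × Fin r), x.1 = y.1 → x.2 < y.2 → ∀ k m : ℕ, 0 < k → 0 < m →
      coeff (single x k + single y m)
        ((pairList H r).map fun p => lAt (g p.1.1) p.1 p.2).sum = ell (g x.1) k m := by
    rintro ⟨h, i⟩ ⟨h', j⟩ hh hij k m hk hm
    simp only at hh hij
    subst hh
    have hne : ((h, i) : Fin H × Fin r) ≠ (h, j) := fun h => hij.ne (congrArg Prod.snd h)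
    have hz : ∀ x y : Fin H × Fin r, (h, i) ≠ x ∨ (h, j) ≠ y → x.1 = y.1 → x.2 < y.2 →
        coeff (single (h, i) k + single (h, j) m)
        (lAt (g x.1) x y) = 0 := by
      intro x y hxy h1 h2
      apply coeff_lAt_of_ne (hg _)
      left
      rw [support_single_add_single hne hk hm]
      intro heq
      have m1 : x ∈ ({(h, i), (h, j)} : Finset (Fin H × Fin r)) := by rw [heq]; simp
      have m2 : y ∈ ({(h, i), (h, j)} : Finset (Fin H × Fin r)) := by rw [heq]; simp
      simp only [mem_insert, mem_singleton] at m1 m2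
      rcases m1 with rfl | rfl <;> rcases m2 with rfl | rfl
      · exact lt_irrefl _ h2
      · simp at hxy
      · exact lt_asymm hij h2
      · exact lt_irrefl _ h2
    rw [sum_pairList fun x y => lAt (g x.1) x y, map_sum, sum_eq_single h, map_sum,
      sum_eq_single i, map_sum, sum_eq_single j, coeff_lAt _ hne]
    · intro j' hj' hne'
      exact hz _ _ (Or.inr fun h => hne' (congrArg Prod.snd h).symm) rfl (mem_Ioi.mp hj')
    · intro hj'; exact absurd (mem_Ioi.mpr hij) hj'
    · intro i' _ hne'
      rw [map_sum]
      exact sum_eq_zero fun j' hj' => hz _ _ (Or.inl fun h => hne' (congrArg Prod.snd h).symm)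
        rfl (mem_Ioi.mp hj')
    · simp
    · intro h' _ hne'
      rw [map_sum]
      refine sum_eq_zero fun i' _ => ?_
      rw [map_sum]
      exact sum_eq_zero fun j' hj' => hz _ _ (Or.inl fun h => hne' (congrArg Prod.fst h).symm)
        rfl (mem_Ioi.mp hj')
    · simp
  have hzero : ∀ n : Fin H × Fin r →₀ ℕ, (∀ p ∈ pairList H r, n.support ≠ {p.1, p.2}) →
      coeff n ((pairList H r).map fun p => lAt (g p.1.1) p.1 p.2).sum = 0 := by
    intro n hn
    rw [map_list_sum, List.map_map]
    apply List.sum_eq_zero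
    intro z hz
    rw [List.mem_map] at hz
    obtain ⟨p, hp, rfl⟩ := hz
    exact coeff_lAt_of_ne (hg _) (Or.inl (hn p hp))
  constructor
  · intro x y hxy k m hk hm
    rw [ellCoeff]
    split_ifs with h
    · rcases lt_trichotomy x.2 y.2 with h1 | h1 | h1
      · exact key x y h h1 k m hk hm
      · exact absurd (Prod.ext h h1) hxy
      · rw [add_comm, key y x h.symm h1 m k hm hk, ell_comm (hg _), h]
    · apply hzero
      intro p hp heq
      rw [support_single_add_single hxy hk hm] at heq
      have m1 : x ∈ ({p.1, p.2} : Finset (Fin H × Fin r)) := by rw [← heq]; simp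
      have m2 : y ∈ ({p.1, p.2} : Finset (Fin H × Fin r)) := by rw [← heq]; simp
      have := (mem_pairList hp).1
      simp only [mem_insert, mem_singleton] at m1 m2
      rcases m1 with rfl | rfl <;> rcases m2 with rfl | rfl <;> simp_all
  · intro n hn
    apply hzero
    intro p hp heq
    rw [heq, card_pair (ne_of_mem_pairList hp)] at hn
    exact hn rfl

variable {N : ℕ → Fin H → ℕ}
  {E : ∀ L, ((∀ h, GT (N L h)) → ℂ) →ₗ[ℂ] ℂ}
  (hN0 : ∀ L h, 0 < N L h) (hN : ∀ h, Tendsto (fun L => 1 / (N L h : ℂ)) atTop (𝓝 0))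
  (hE : ∀ L, E L (fun _ => 1) = 1) {c : Fin H → PowerSeries ℂ}
  (hc : ∀ h, CT (fun L => C (1 / (N L h : ℂ)) * lg (oneSeries (E L) h)) (c h))

theorem constantCoeff_gSeries (c : PowerSeries ℂ) : constantCoeff (gSeries c) = 1 := by
  rw [gSeries]; simp

include hN0 hN hE hc

/-- The limits of the two quotients differ by the product of the series q2 over the pairs of one
colour. Its logarithm has two-variable terms only, so being a pair series is preserved and the
coefficients are shifted by `ellCoeff`. -/
theorem schur_pair_iff_phi_pair (d : Fin H → ℕ → Fin H → ℕ → ℂ) :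
    (∃ a, CT (fun L => lg (quotSchur (E L) r)) a ∧ IsPair d a) ↔
    ∃ b, CT (fun L => lg (quotPhi (E L) r)) b ∧
      IsPair (fun h k f m => d h k f m - ellCoeff (fun h => gSeries (c h)) h k f m) b := by
  have hr := tendsto_ge hN0 hN r
  have hT : ∀ L h, IsLog (lg (oneSeries (E L) h)) (oneSeries (E L) h) :=
    fun L h => isLog_oneSeries (hN0 L) (hE L) h
  have hG := fun L => tens_mul_quotPhi (hN0 L) (hE L) r
  have hA := fun L => tens_mul_quotSchur (hN0 L) (hE L) r
  have hlA : ∀ L, IsLog (lg (quotSchur (E L) r)) (quotSchur (E L) r) :=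
    fun L => isLog_lg (isLog_quotSchur (hN0 L) (hE L) r).right
  have hlG : ∀ L, IsLog (lg (quotPhi (E L) r)) (quotPhi (E L) r) :=
    fun L => isLog_lg (constantCoeff_quotPhi (hN0 L) (hE L) r)
  have hq := isLog_list_sum
    (fun p : (Fin H × Fin r) × (Fin H × Fin r) =>
      isLog_lAt (constantCoeff_gSeries (c p.1.1)) p.1 p.2) (pairList H r)
  have hp := isPair_sum_lAt (r := r) fun h => constantCoeff_gSeries (c h)
  constructor
  · rintro ⟨a, ha, hpa⟩
    obtain ⟨a', ha', hla⟩ := CT.of_log (Eventually.of_forall hlA) ha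
    obtain ⟨g, hg, hag⟩ := CT_phi_of_CT_schur hN0 hN hr E hT hc hG hA ha'
    obtain ⟨b, hb, hbg⟩ := CT.log (Eventually.of_forall hlG) hg
    refine ⟨b, hb, ?_⟩
    -- The nonzero factor ∏ (u_j - u_i) is common to both sides and is cancelled; no division of
    -- series is needed.
    rw [mulProd_eq, mul_assoc] at hag
    have h1 := hla.sub_div hq (mul_left_cancel₀ diffProd_ne_zero hag).symm
    rw [hbg.unique_left h1]
    exact hpa.sub hp
  · rintro ⟨b, hb, hpb⟩
    obtain ⟨g, hg, hlg⟩ := CT.of_log (Eventually.of_forall hlG) hb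
    obtain ⟨a', ha', hag⟩ := CT_schur_of_CT_phi hN0 hN hr E hT hc hG hA hg
    obtain ⟨a, ha, hla⟩ := CT.log (Eventually.of_forall hlA) ha'
    refine ⟨a, ha, ?_⟩
    rw [mulProd_eq, mul_assoc] at hag
    have h1 := hq.add_mul hlg
    rw [← mul_left_cancel₀ diffProd_ne_zero hag] at h1
    rw [hla.unique_left h1]
    have h2 := hp.add hpb
    simpa using h2

end Transfer

end

/-! ### Newton's identities and the algebraic system for the power sums. -/

section

open PowerSeries (C X coeff coeff_C coeff_C_mul coeff_map coeff_mul coeff_one)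

section Newton

/-- The power series `log(1+u) / u`. -/
def logQuot : PowerSeries ℂ := PowerSeries.mk fun n => (-1) ^ n / (n + 1)

theorem constantCoeff_logQuot : PowerSeries.constantCoeff logQuot = 1 := by
  rw [← coeff_zero_ps, logQuot, coeff_mk]
  simp

theorem one_add_X_mul_derivative_X_mul_logQuot : (1 + X) * derivative ℂ (X * logQuot) = 1 := by
  ext n
  rw [coeff_one_add_X_mul_derivative, coeff_succ_X_mul, logQuot, coeff_mk]
  cases n with
  | zero => simp
  | succ n =>
    rw [coeff_succ_X_mul, coeff_mk, coeff_one, if_neg (succ_ne_zero n)]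
    have h1 : (n + 1 : ℂ) ≠ 0 := by exact_mod_cast succ_ne_zero n
    have h2 : (n + 1 + 1 : ℂ) ≠ 0 := by exact_mod_cast succ_ne_zero (n + 1)
    push_cast
    field_simp
    ring

/-- Multiplication by log(1+u) sends log(1+u)^m / m! to (m+1) log(1+u)^{m+1} / (m+1)!. The proof
applies (1+u) d/du, under which log(1+u) becomes 1, and uses induction on the coefficient. -/
theorem coeff_X_mul_logQuot_mul_beta (n : ℕ) (b : ℕ → ℂ) : coeff n (X * logQuot * beta b) =
      betaCoeff n fun m => m * b (m - 1) := by
  induction n generalizing b with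
  | zero => rw [mul_assoc, coeff_zero_X_mul]; simp [betaCoeff]
  | succ n ih =>
    have h := congrArg (coeff n)
      (show (1 + X) * derivative ℂ (X * logQuot * beta b) =
        beta b + X * logQuot * beta fun m => b (m + 1) from by
        rw [leibniz, smul_eq_mul, smul_eq_mul, ← one_add_X_mul_derivative_beta]
        linear_combination beta b * one_add_X_mul_derivative_X_mul_logQuot)
    rw [coeff_one_add_X_mul_derivative, map_add, ih, ih,
      show coeff n (beta b) = betaCoeff n b from coeff_mk _ _] at h
    have h1 := betaCoeff_linear n 1 1 b fun m => m * b (m - 1 + 1)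
    have h2 : (fun m => 1 * b m + 1 * ((m : ℂ) * b (m - 1 + 1))) =
        fun m => ((m + 1 : ℕ) : ℂ) * b (m + 1 - 1) := by
      funext m
      cases m with
      | zero => simp
      | succ m => rw [Nat.add_sub_cancel, Nat.add_sub_cancel]; push_cast; ring
    rw [h2, one_mul, one_mul] at h1
    rw [betaCoeff, h1, eq_div_iff (by exact_mod_cast succ_ne_zero n)]
    linear_combination h

/-- The sequence `a` moved to the right by `k` places. -/
def shiftSeq (a : ℕ → ℂ) (k m : ℕ) : ℂ := if k ≤ m then a (m - k) else 0

theorem one_add_X_mul_derivative_beta_shiftSeq (a : ℕ → ℂ) (k : ℕ) :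
    (1 + X) * derivative ℂ (beta (shiftSeq a (k + 1))) = beta (shiftSeq a k) := by
  rw [one_add_X_mul_derivative_beta]
  congr 1
  funext m
  simp [shiftSeq]

variable {N : ℕ} [NeZero N] {a : Fin N → ℂ} (ha : Function.Injective a)

include ha

theorem wt_newton (m : ℕ) :
    (m : ℂ) * ∑ j, wt a j * a j ^ m - ((N - 1 : ℕ) : ℂ) * ∑ j, wt a j * a j ^ m =
      ∑ k ∈ range m, (∑ j, a j ^ (k + 1)) * ∑ j, wt a j * a j ^ (m - (k + 1)) := by
  have h := congrArg (coeff m) (momentSeries_newton ha)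
  have hc : ∀ n, coeff n (momentSeries a) = ∑ j, wt a j * a j ^ n :=
    fun n => coeff_mk n _
  have h0 : coeff m (X * derivative ℂ (momentSeries a)) = m * ∑ j, wt a j * a j ^ m := by
    cases m with
    | zero => simp
    | succ m =>
      rw [coeff_succ_X_mul, coeff_derivative, hc]
      push_cast
      ring
  rw [map_sub, coeff_C_mul, h0, coeff_mul,
    Finset.Nat.sum_antidiagonal_eq_sum_range_succ_mk, Finset.sum_range_succ'] at h
  simp only [map_sum, map_sub, coeff_mk, coeff_one, hc] at h
  simpa using h

/-- Newton's identities in terms of Y = ∑ w_j (1+u)^{a_j}: with D = (1+u) d/du, log(1+u) D Y - (N-1)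
Y is the sum over k of p_{k+1} times the (k+1)-fold antiderivative of Y under D. The k-fold
antiderivative is divisible by u^k, so any truncation with M ≥ n gives the right coefficient. -/
theorem coeff_newton (n M : ℕ) (hM : n ≤ M) : coeff n (X * logQuot *
        ((1 + X) * derivative ℂ (wtSeries a)) - C ((N - 1 : ℕ) : ℂ) * wtSeries a) =
      coeff n (∑ k ∈ range M, C (∑ j, a j ^ (k + 1)) *
        beta (shiftSeq (fun m => ∑ j, wt a j * a j ^ m) (k + 1))) := by
  rw [map_sub, wtSeries, one_add_X_mul_derivative_beta, coeff_X_mul_logQuot_mul_beta,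
    coeff_C_mul, map_sum]
  simp only [coeff_C_mul, beta, coeff_mk]
  have h1 := betaCoeff_linear n 1 (-((N - 1 : ℕ) : ℂ))
    (fun m => (m : ℂ) * ∑ j, wt a j * a j ^ (m - 1 + 1)) fun m => ∑ j, wt a j * a j ^ m
  have h2 : ∀ k, (∑ j, a j ^ (k + 1)) *
      betaCoeff n (shiftSeq (fun m => ∑ j, wt a j * a j ^ m) (k + 1)) =
      betaCoeff n fun m => (∑ j, a j ^ (k + 1)) *
        shiftSeq (fun m => ∑ j, wt a j * a j ^ m) (k + 1) m := by
    intro k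
    have := betaCoeff_linear n (∑ j, a j ^ (k + 1)) 0
      (shiftSeq (fun m => ∑ j, wt a j * a j ^ m) (k + 1)) fun _ => 0
    simpa using this.symm
  rw [sum_congr rfl fun k _ => h2 k, ← betaCoeff_sum]
  rw [one_mul, neg_mul, ← sub_eq_add_neg] at h1
  rw [← h1]
  apply betaCoeff_congr
  intro m hm
  have h3 : (m : ℂ) * ∑ j, wt a j * a j ^ (m - 1 + 1) = m * ∑ j, wt a j * a j ^ m := by
    cases m with
    | zero => simp
    | succ m => rfl
  rw [h3, one_mul, neg_mul, ← sub_eq_add_neg, wt_newton ha m]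
  rw [← sum_subset (Finset.range_mono (hm.trans hM))]
  · refine sum_congr rfl fun k hk => ?_
    rw [shiftSeq, if_pos (Nat.succ_le_of_lt (mem_range.mp hk))]
  · intro k _ hk
    rw [shiftSeq, if_neg (by simpa using hk), mul_zero]

end Newton

section System

variable {R : Type*} [CommRing R] [Algebra ℂ R]

/-- The relations between the logarithm `F` of the one-variable series and the power sums
`p 0, p 1, …` (of degrees `1, 2, …`) through the auxiliary series `K`. -/
structure PowerSumSystem (ν : R) (F : PowerSeries R) (K : ℕ → PowerSeries R) (p : ℕ → R) :
    Prop where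
  zero : K 0 = 1
  succ : ∀ k : ℕ, (1 + X) * ((C (1 + k * ν) + X * derivative R F) * K (k + 1) +
    C ν * (X * derivative R (K (k + 1)))) = K k
  main : ∀ n : ℕ, coeff (n + 1) (PowerSeries.map (algebraMap ℂ R)
    ((1 + X) * logQuot) * (C (1 - ν) + X * derivative R F)) =
    ∑ k ∈ range (n + 1), p k * coeff (n - k) (K (k + 1))

variable {N : ℕ} [NeZero N] {a : Fin N → ℂ} (ha : Function.Injective a)

include ha in
-- The series K_k are the k-fold antiderivatives of ∑ w_j (1+u)^{a_j} under (1+u) d/du, divided by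
-- their leading powers of u and by φ and rescaled by N^k. The relation `succ` says that
-- differentiation lowers k, and `main` is Newton's identity divided by u^{N-1} φ.
theorem exists_powerSumSystem {F : PowerSeries ℂ} (hF : C (N : ℂ) * F = lg (phi a)) :
    ∃ K, PowerSumSystem (1 / (N : ℂ)) F K fun k => 1 / (N : ℂ) * ∑ j, (a j / N) ^ (k + 1) := by
  have hN : (N : ℂ) ≠ 0 := by exact_mod_cast NeZero.ne N
  have hN1 : ((N - 1 : ℕ) : ℂ) = N - 1 := by
    rw [Nat.cast_sub (Nat.one_le_iff_ne_zero.mpr (NeZero.ne N)), Nat.cast_one]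
  set f : ℂ := ((N - 1).factorial : ℂ)⁻¹ with hf
  have hf0 : f ≠ 0 := inv_ne_zero (by exact_mod_cast factorial_ne_zero _)
  have hfν : ∀ k : ℕ, f * (1 / (N : ℂ)) ^ k ≠ 0 := fun k =>
    mul_ne_zero hf0 (pow_ne_zero _ (one_div_ne_zero hN))
  set y : ℕ → ℂ := fun m => ∑ j, wt a j * a j ^ m with hy
  have hP0 := constantCoeff_phi ha
  have hlog := isLog_lg hP0
  have hdP : derivative ℂ (phi a) = C (N : ℂ) * derivative ℂ F * phi a := by
    have := hlog.deriv ()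
    rw [← hF] at this
    refine this.trans ?_
    congr 1
    have h1 := leibniz (derivative ℂ) (C (N : ℂ)) F
    rw [derivative_C, smul_zero, add_zero, smul_eq_mul] at h1
    exact h1
  have hinv : phi a * (phi a)⁻¹ = 1 := PowerSeries.mul_inv_cancel _ (by rw [hP0]; exact one_ne_zero)
  -- The first N - 1 moments vanish and the shift adds k further zeros, so u^{N-1+k} divides the
  -- antiderivative.
  have hZ : ∀ k, ∃ J : PowerSeries ℂ, beta (shiftSeq y k) =
      C (f * (1 / (N : ℂ)) ^ k) * (X ^ (N - 1 + k) * (J * phi a)) := by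
    intro k
    have h0 : ∀ m < N - 1 + k, shiftSeq y k m = 0 := by
      intro m hm
      rw [shiftSeq]
      split_ifs with h
      · exact sum_wt_mul_pow_of_lt ha (by omega)
      · rfl
    obtain ⟨J, hJ⟩ : X ^ (N - 1 + k) ∣ beta (shiftSeq y k) := by
      rw [X_pow_dvd_iff]
      intro m hm
      rw [beta, coeff_mk]
      exact betaCoeff_of_lt h0 hm
    refine ⟨C (f * (1 / (N : ℂ)) ^ k)⁻¹ * J * (phi a)⁻¹, ?_⟩
    have hc : C (f * (1 / (N : ℂ)) ^ k) * C (f * (1 / (N : ℂ)) ^ k)⁻¹ = 1 := by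
      rw [← map_mul, mul_inv_cancel₀ (hfν k), map_one]
    rw [hJ]
    linear_combination (-X ^ (N - 1 + k) * J) * hc -
      X ^ (N - 1 + k) * J * C (f * (1 / (N : ℂ)) ^ k) * C (f * (1 / (N : ℂ)) ^ k)⁻¹ * hinv
  choose K' hK' using hZ
  -- The chosen quotient for k = 0 is replaced by 1, as the relation `zero` requires.
  set K : ℕ → PowerSeries ℂ := fun k => if k = 0 then 1 else K' k with hKdef
  have hY : wtSeries a = C f * (X ^ (N - 1) * phi a) := wtSeries_eq_mul_phi ha
  have hK : ∀ k, beta (shiftSeq y k) =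
      C (f * (1 / (N : ℂ)) ^ k) * (X ^ (N - 1 + k) * (K k * phi a)) := by
    intro k
    cases k with
    | zero =>
      rw [show beta (shiftSeq y 0) = wtSeries a from rfl, hY]
      simp [hKdef]
    | succ k => rw [hK' (k + 1)]; simp [hKdef]
  have hCC : C (N : ℂ) * C (1 / (N : ℂ)) = 1 := by
    rw [← map_mul, mul_one_div_cancel hN, map_one]
  have hD : ∀ (m : ℕ) (G : PowerSeries ℂ), X * derivative ℂ (X ^ m * (G * phi a)) =
      C (N : ℂ) * (X ^ m * (((C (m * (1 / (N : ℂ))) + X * derivative ℂ F) * G + C (1 / (N : ℂ)) *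
          (X * derivative ℂ G)) * phi a)) := by
    intro m G
    have h1 : X * derivative ℂ (X ^ m : PowerSeries ℂ) = C (m : ℂ) * X ^ m := by
      rw [leibniz_pow, derivative_X]
      cases m with
      | zero => simp
      | succ m => simp [pow_succ]; ring
    rw [leibniz, leibniz, hdP, map_mul]
    simp only [smul_eq_mul]
    linear_combination G * phi a * h1 - (C (m : ℂ) * G + X * derivative ℂ G) * phi a * X ^ m * hCC
  refine ⟨K, by simp [hKdef], fun k => ?_, fun n => ?_⟩
  · have h := one_add_X_mul_derivative_beta_shiftSeq y k
    have h1 : derivative ℂ (beta (shiftSeq y (k + 1))) = C (f *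
        (1 / (N : ℂ)) ^ (k + 1)) * derivative ℂ
          (X ^ (N - 1 + (k + 1)) * (K (k + 1) * phi a)) := by
      rw [hK, leibniz, derivative_C, smul_zero, add_zero, smul_eq_mul]
    have h2 := hD (N - 1 + (k + 1)) (K (k + 1))
    have h3 : ((N - 1 + (k + 1) : ℕ) : ℂ) * (1 / (N : ℂ)) = 1 + k * (1 / (N : ℂ)) := by
      push_cast
      rw [hN1]
      field_simp
      ring
    rw [h3] at h2
    rw [h1, hK k] at h
    have hne : C (f * (1 / (N : ℂ)) ^ k) * X ^ (N - 1 + (k + 1)) * phi a ≠ 0 := by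
      refine mul_ne_zero (mul_ne_zero ?_ (pow_ne_zero _ X_ne_zero)) ?_
      · rw [Ne, map_eq_zero]
        exact hfν k
      · intro h0
        rw [h0, map_zero] at hP0
        exact zero_ne_one hP0
    apply mul_left_cancel₀ hne
    rw [pow_succ, ← mul_assoc f, map_mul C (f * (1 / (N : ℂ)) ^ k)] at h
    have hpow : (X : PowerSeries ℂ) ^ (N - 1 + (k + 1)) =
      X ^ (N - 1 + k) * X := by rw [← add_assoc, pow_succ]
    rw [hpow] at h h2 ⊢
    linear_combination X * h - (1 + X) * C (f * (1 / (N : ℂ)) ^ k) *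
      C (1 / (N : ℂ)) * h2 - (1 + X) * C (f * (1 / (N : ℂ)) ^ k) *
      (X ^ (N - 1 + k) * X) * ((C (1 + k * (1 / (N : ℂ))) +
        X * derivative ℂ F) * K (k + 1) + C (1 / (N : ℂ)) *
          (X * derivative ℂ (K (k + 1)))) * phi a * hCC
  · set P : ℕ → ℂ := fun k => 1 / (N : ℂ) * ∑ j, (a j / N) ^ (k + 1) with hP
    set A : PowerSeries ℂ := (1 + X) * logQuot * (C (1 - 1 / (N : ℂ)) + X * derivative ℂ F) with hA
    have hterm : ∀ k, C (∑ j, a j ^ (k + 1)) * beta (shiftSeq y (k + 1)) =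
        C (f * N) * (X ^ (N - 1) * (C (P k) * (X ^ (k + 1) * K (k + 1)) * phi a)) := by
      intro k
      have h1 : (∑ j, a j ^ (k + 1)) * (f * (1 / (N : ℂ)) ^ (k + 1)) = f * N * P k := by
        rw [hP]
        simp only [div_pow, ← Finset.sum_div]
        field_simp
        rw [one_pow, mul_one]
      rw [hK, ← mul_assoc, ← map_mul, h1, map_mul, pow_add]
      ring
    have hmain : X * logQuot * ((1 + X) *
        derivative ℂ (wtSeries a)) - C ((N - 1 : ℕ) : ℂ) * wtSeries a = C (f * N) * (X ^ (N - 1) *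
          ((A - C (1 - 1 / (N : ℂ))) * phi a)) := by
      have h1 := hD (N - 1) 1
      have h2 : ((N - 1 : ℕ) : ℂ) * (1 / (N : ℂ)) = 1 - 1 / N := by
        rw [hN1]
        field_simp
      have h3 : C ((N - 1 : ℕ) : ℂ) = C (N : ℂ) * C (1 - 1 / (N : ℂ)) := by
        rw [← h2, ← map_mul]
        congr 1
        field_simp
      have h4 : derivative ℂ (wtSeries a) = C f * derivative ℂ (X ^ (N - 1) * phi a) := by
        rw [hY, leibniz, derivative_C, smul_zero, add_zero, smul_eq_mul]
      rw [h2, one_mul, mul_one] at h1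
      simp only [Derivation.map_one_eq_zero, mul_zero, add_zero] at h1
      rw [h4, h3, hY, hA, map_mul C f]
      linear_combination logQuot * (1 + X) * C f * h1
    -- The identity up to the order n + 1 is expressed as divisibility, so that u^{N-1} and the unit
    -- φ can be cancelled.
    have hdvd : X ^ (N - 1 + (n + 2)) ∣ C (f * N) * (X ^ (N - 1) *
        ((A - C (1 - 1 / (N : ℂ)) - ∑ k ∈ range (n + 1),
          C (P k) * (X ^ (k + 1) * K (k + 1))) * phi a)) := by
      have hsplit : C (f * N) * (X ^ (N - 1) * ((A - C (1 - 1 / (N : ℂ)) - ∑ k ∈ range (n + 1),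
          C (P k) * (X ^ (k + 1) * K (k + 1))) * phi a)) = C (f * N) * (X ^ (N - 1) *
          ((A - C (1 - 1 / (N : ℂ))) * phi a)) - ∑ k ∈ range (n + 1),
            C (∑ j, a j ^ (k + 1)) * beta (shiftSeq y (k + 1)) := by
        rw [sum_congr rfl fun k _ => hterm k, ← mul_sum, ← mul_sum, ← sum_mul]
        ring
      rw [hsplit, X_pow_dvd_iff]
      intro m hm
      rw [← hmain, map_sub, coeff_newton ha m (max m (n + 1)) (le_max_left _ _), sub_eq_zero,
        map_sum, map_sum]
      symm
      apply sum_subset (Finset.range_mono (le_max_right _ _))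
      intro k _ hk
      rw [hK, coeff_C_mul, coeff_C_mul, coeff_X_pow_mul', if_neg, mul_zero, mul_zero]
      rw [mem_range] at hk
      omega
    have hdvd2 : X ^ (n + 2) ∣ A - C (1 - 1 / (N : ℂ)) -
        ∑ k ∈ range (n + 1), C (P k) * (X ^ (k + 1) * K (k + 1)) := by
      have hu : IsUnit (C (f * N)) := (IsUnit.mk0 _ (mul_ne_zero hf0 hN)).map C
      have hu2 : IsUnit (phi a) := IsUnit.of_mul_eq_one _ hinv
      rw [hu.dvd_mul_left, pow_add, mul_dvd_mul_iff_left (pow_ne_zero _ X_ne_zero),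
        hu2.dvd_mul_right] at hdvd
      exact hdvd
    have hfin := X_pow_dvd_iff.mp hdvd2 (n + 1) (by omega)
    rw [map_sub, map_sub, coeff_C, if_neg (succ_ne_zero n), sub_zero, sub_eq_zero, map_sum] at hfin
    have hid : PowerSeries.map (algebraMap ℂ ℂ) ((1 + X) * logQuot) =
      (1 + X) * logQuot := PowerSeries.ext fun n => rfl
    rw [hid, ← hA, hfin]
    refine sum_congr rfl fun k hk => ?_
    rw [coeff_C_mul, coeff_X_pow_mul', if_pos (by
      rw [mem_range] at hk; omega), Nat.add_sub_add_right]

theorem coeff_X_mul_derivative {R : Type*} [CommRing R] (F : PowerSeries R) (n : ℕ) :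
    coeff n (X * derivative R F) = n * coeff n F := by
  cases n with
  | zero => simp
  | succ n =>
    rw [coeff_succ_X_mul, coeff_derivative]
    push_cast
    ring

variable {ν : R} {F : PowerSeries R} {K : ℕ → PowerSeries R} {p : ℕ → R} {S : Subalgebra ℂ R}
  (hs : PowerSumSystem ν F K p) (hν : ν ∈ S) (hS : ∀ m : ℕ, ∃ i ∈ S, i * (1 + m * ν) = 1)

include hs hν hS

namespace PowerSumSystem

/-- After division by 1 + u, the j-th coefficient of the relation `succ` is (1 + (k+j)ν) times the
j-th coefficient of K_{k+1}, plus terms with its earlier coefficients and those of F. The factors 1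
+ mν are inverted in S. -/
theorem coeff_K_mem {n : ℕ} (hF : ∀ j ≤ n, coeff j F ∈ S) (k : ℕ) : ∀ j ≤ n, coeff j (K k) ∈ S := by
  induction k with
  | zero =>
    intro j _
    rw [hs.zero, coeff_one]
    split_ifs
    · exact one_mem S
    · exact zero_mem S
  | succ k ih =>
    set A := (C (1 + k * ν) + X * derivative R F) * K (k + 1) +
      C ν * (X * derivative R (K (k + 1))) with hA
    have hA1 : (1 + X) * A = K k := hs.succ k
    have hAS : ∀ j ≤ n, coeff j A ∈ S := by
      intro j
      induction j with
      | zero =>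
        intro _
        have := ih 0 (Nat.zero_le _)
        rw [← hA1, add_mul, one_mul, map_add, coeff_zero_X_mul, add_zero] at this
        exact this
      | succ j ihj =>
        intro hj
        have := sub_mem (ih (j + 1) hj) (ihj (by omega))
        rw [← hA1, add_mul, one_mul, map_add, coeff_succ_X_mul, add_sub_cancel_right] at this
        exact this
    intro j
    induction j using Nat.strong_induction_on with
    | _ j ihj =>
      intro hj
      obtain ⟨i, hi, hi1⟩ := hS (k + j)
      have h1 : coeff j A = (1 + ((k + j : ℕ) : R) * ν) * coeff j (K (k + 1)) +
          ∑ q ∈ (antidiagonal j).erase (0, j), (q.1 * coeff q.1 F) * coeff q.2 (K (k + 1)) := by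
        rw [hA, add_mul, map_add, map_add, coeff_C_mul, coeff_C_mul,
          coeff_X_mul_derivative, coeff_mul]
        simp only [coeff_X_mul_derivative]
        rw [← add_sum_erase _ _ (show (0, j) ∈ antidiagonal j by simp)]
        push_cast
        ring
      have h2 : (1 + ((k + j : ℕ) : R) * ν) * coeff j (K (k + 1)) ∈ S := by
        rw [← sub_eq_iff_eq_add] at h1
        rw [← h1]
        refine sub_mem (hAS j hj) (sum_mem fun q hq => ?_)
        rw [mem_erase, mem_antidiagonal] at hq
        have hq2 : q.2 < j := by
          rcases Nat.eq_zero_or_pos q.1 with h0 | h0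
          · exact absurd (Prod.ext h0 (by simp; omega)) hq.1
          · omega
        exact mul_mem (mul_mem (natCast_mem S _) (hF _ (by omega))) (ihj _ hq2 (by omega))
      have := mul_mem hi h2
      rwa [← mul_assoc, hi1, one_mul] at this

/-- At u = 0 the relation `succ` reads (1 + kν) K_{k+1}(0) = K_k(0). -/
theorem exists_inv_coeff_zero (k : ℕ) : ∃ i ∈ S, i * coeff 0 (K k) = 1 := by
  induction k with
  | zero => exact ⟨1, one_mem S, by rw [hs.zero]; simp⟩
  | succ k ih =>
    obtain ⟨i, hi, hi1⟩ := ih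
    refine ⟨i * (1 + k * ν), mul_mem hi (add_mem (one_mem S) (mul_mem (natCast_mem S _) hν)), ?_⟩
    rw [← hs.succ k] at hi1
    refine Eq.trans ?_ hi1
    simp only [PowerSeries.coeff_zero_eq_constantCoeff, map_mul, map_add, map_one,
      PowerSeries.constantCoeff_X, PowerSeries.constantCoeff_C]
    ring

/-- The n-th main relation contains p_n only in the term p_n K_{n+1}(0), whose second factor is
invertible in S. -/
theorem p_mem (hF : ∀ n, coeff n F ∈ S) (n : ℕ) : p n ∈ S := by
  induction n using Nat.strong_induction_on with
  | _ n ih =>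
    have hK := fun k j => hs.coeff_K_mem hν hS (n := j) (fun j _ => hF j) k j le_rfl
    obtain ⟨i, hi, hi1⟩ := hs.exists_inv_coeff_zero hν hS (n + 1)
    have h := hs.main n
    rw [sum_range_succ, Nat.sub_self, ← sub_eq_iff_eq_add'] at h
    have h1 : p n * coeff 0 (K (n + 1)) ∈ S := by
      rw [← h]
      refine sub_mem ?_ (sum_mem fun k hk => mul_mem (ih k (mem_range.mp hk)) (hK _ _))
      rw [coeff_mul]
      refine sum_mem fun q _ => mul_mem ?_ ?_
      · rw [coeff_map]
        exact S.algebraMap_mem _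
      · rw [map_add, coeff_X_mul_derivative, coeff_C]
        refine add_mem ?_ (mul_mem (natCast_mem S _) (hF _))
        split_ifs
        · exact sub_mem (one_mem S) hν
        · exact zero_mem S
    have := mul_mem hi h1
    rwa [mul_left_comm, hi1, mul_one] at this

/-- The n-th main relation contains the coefficient of order n + 1 of F only as (n+1) times it,
because log(1+u)/u has constant term 1. The series K enter it up to the order n only, hence through
earlier coefficients of F. -/
theorem coeff_F_mem (hF0 : coeff 0 F ∈ S) (hp : ∀ n, p n ∈ S) (n : ℕ) : coeff n F ∈ S := by
  induction n using Nat.strong_induction_on with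
  | _ n ih =>
    cases n with
    | zero => exact hF0
    | succ n =>
      have hK := fun k => hs.coeff_K_mem hν hS (n := n) (fun j hj => ih j (by omega)) k
      have h := hs.main n
      rw [coeff_mul, ← add_sum_erase _ _
        (show (0, n + 1) ∈ antidiagonal (n + 1) by simp), ← eq_sub_iff_add_eq] at h
      have h0 : coeff 0 (PowerSeries.map (algebraMap ℂ R)
          ((1 + X) * logQuot)) = 1 := by
        rw [coeff_map]
        simp [constantCoeff_logQuot]
      have h1 : ((n + 1 : ℕ) : R) * coeff (n + 1) F ∈ S := by
        rw [h0, one_mul, map_add, coeff_X_mul_derivative, coeff_C,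
          if_neg (succ_ne_zero n), zero_add] at h
        rw [h]
        refine sub_mem (sum_mem fun k hk => mul_mem (hp k) (hK _ _ (by omega)))
          (sum_mem fun q hq => mul_mem ?_ ?_)
        · rw [coeff_map]
          exact S.algebraMap_mem _
        · rw [mem_erase, mem_antidiagonal] at hq
          have hq2 : q.2 < n + 1 := by
            rcases Nat.eq_zero_or_pos q.1 with h0 | h0
            · exact absurd (Prod.ext h0 (by simp; omega)) hq.1
            · omega
          rw [map_add, coeff_X_mul_derivative, coeff_C]
          refine add_mem ?_ (mul_mem (natCast_mem S _) (ih _ hq2))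
          split_ifs
          · exact sub_mem (one_mem S) hν
          · exact zero_mem S
      have h2 := S.smul_mem h1 ((n + 1 : ℕ) : ℂ)⁻¹
      rwa [← map_natCast (algebraMap ℂ R), ← smul_def, smul_smul, inv_mul_cancel₀
        (by exact_mod_cast succ_ne_zero n), one_smul] at h2

end PowerSumSystem

end System

end

/-! ### Lagrange inversion, and the limiting system over the dual numbers. -/

section

open PowerSeries (C X coeff coeff_C_mul coeff_map coeff_mul constantCoeff)

section Lagrange

variable {R : Type*} [CommRing R] [Algebra ℂ R] {g gi : PowerSeries R} (hg : g * gi = 1)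
  (hg0 : constantCoeff g = 1)

theorem natCast_mul_cancel {n : ℕ} (hn : n ≠ 0) {x y : R} (h : (n : R) * x = n * y) : x = y := by
  have h1 := congrArg (fun z => algebraMap ℂ R ((n : ℂ)⁻¹) * z) h
  have h2 : algebraMap ℂ R ((n : ℂ)⁻¹) * (n : R) = 1 := by
    rw [← map_natCast (algebraMap ℂ R), ← map_mul, inv_mul_cancel₀ (by exact_mod_cast hn), map_one]
  simpa only [← mul_assoc, h2, one_mul] using h1

include hg hg0

theorem constantCoeff_inv_eq_one : constantCoeff gi = 1 := by
  have := congrArg constantCoeff hg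
  rwa [map_mul, hg0, one_mul, map_one] at this

/-- This is the expansion of A in powers of u/g; the matrix of coefficients is unitriangular since
g⁻¹ has constant term 1. -/
theorem exists_expansion (A : PowerSeries R) : ∃ Q : ℕ → R, ∀ n, coeff n A =
    ∑ k ∈ range (n + 1), Q k * coeff (n - k) (gi ^ k) := by
  have hgi := constantCoeff_inv_eq_one hg hg0
  have h : ∀ n, ∃ Q : ℕ → R, ∀ m < n, coeff m A =
      ∑ k ∈ range (m + 1), Q k * coeff (m - k) (gi ^ k) := by
    intro n
    induction n with
    | zero => exact ⟨0, fun m hm => absurd hm (Nat.not_lt_zero m)⟩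
    | succ n ih =>
      obtain ⟨Q, hQ⟩ := ih
      refine ⟨Function.update Q n (coeff n A -
        ∑ k ∈ range n, Q k * coeff (n - k) (gi ^ k)), fun m hm => ?_⟩
      rcases Nat.lt_succ_iff_lt_or_eq.mp hm with hm | rfl
      · rw [hQ m hm]
        refine sum_congr rfl fun k hk => ?_
        rw [update_of_ne (by rw [mem_range] at hk; omega)]
      · rw [sum_range_succ, Function.update_self, Nat.sub_self,
          coeff_zero_ps, map_pow, hgi, one_pow, mul_one,
          sum_congr rfl fun k hk => by
            rw [update_of_ne (mem_range.mp hk).ne], add_sub_cancel]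
  choose Q hQ using h
  -- Finite stages of the expansion are compatible, which allows the diagonal choice of the
  -- coefficients.
  have huniq : ∀ n m k, k < n → k < m → Q n k = Q m k := by
    intro n m k
    induction k using Nat.strong_induction_on with
    | _ k ih =>
      intro hn hm
      have h1 := (hQ n k hn).symm.trans (hQ m k hm)
      rw [sum_range_succ, sum_range_succ, sum_congr rfl fun j hj => by
        rw [ih j (mem_range.mp hj) ((mem_range.mp hj).trans hn)
          ((mem_range.mp hj).trans hm)], add_left_cancel_iff, Nat.sub_self,
          coeff_zero_ps, map_pow, hgi, one_pow, mul_one, mul_one] at h1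
      exact h1
  refine ⟨fun k => Q (k + 1) k, fun n => ?_⟩
  rw [hQ (n + 1) n (Nat.lt_succ_self n)]
  refine sum_congr rfl fun k hk => ?_
  rw [huniq (n + 1) (k + 1) k (mem_range.mp hk) (Nat.lt_succ_self k)]

/-- With v = u/g the left side is the residue of v^{-(k+j+1)} d(v^{k+1}). For j > 0 the form is
exact; for j = 0 it is (k+1) dv/v. -/
theorem coeff_pow_mul_derivative (k j : ℕ) : coeff (k + j) (g ^ (k + j + 1) *
      derivative R ((X * gi) ^ (k + 1))) = if j = 0 then (k + 1 : R) else 0 := by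
  have hd : g * derivative R gi = -(derivative R g * gi) := by
    have := congrArg (derivative R) hg
    rw [leibniz, Derivation.map_one_eq_zero, smul_eq_mul, smul_eq_mul] at this
    linear_combination this
  have hpow : g ^ (k + 1) * gi ^ (k + 1) = 1 := by rw [← mul_pow, hg, one_pow]
  have h1 : X * (g ^ (k + j + 1) * derivative R ((X * gi) ^ (k + 1))) = X ^ (k + 1) *
        (C (k + 1 : R) * (g ^ j - X * (g ^ j * gi * derivative R g))) := by
    have h2 : derivative R ((X * gi) ^ (k + 1)) = C (k + 1 : R) * ((X * gi) ^ k *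
          (gi + X * derivative R gi)) := by
      rw [leibniz_pow, leibniz, derivative_X]
      simp only [smul_eq_mul, nsmul_eq_mul, mul_one, Nat.add_sub_cancel, map_add, map_natCast,
        map_one]
      push_cast
      ring
    have h3 : g ^ (k + 1) * gi ^ k = g := by
      rw [pow_succ, mul_comm, ← mul_assoc, ← mul_pow, mul_comm gi g, hg, one_pow, one_mul]
    rw [h2, mul_pow, show k + j + 1 = (k + 1) + j by ring, pow_add g]
    linear_combination C (k + 1 : R) * X ^ (k + 1) * g ^ j * (gi + X * derivative R gi) * h3 +
      C (k + 1 : R) * X ^ (k + 1) * g ^ j * hg + C (k + 1 : R) * X ^ (k + 1) * g ^ j * X * hd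
  have h4 := congrArg (coeff (k + j + 1)) h1
  rw [coeff_succ_X_mul, show k + j + 1 = j + (k + 1) by ring,
    PowerSeries.coeff_X_pow_mul, coeff_C_mul, map_sub] at h4
  rw [show k + j + 1 = j + (k + 1) by ring, h4]
  cases j with
  | zero => simp
  | succ j =>
    rw [if_neg (succ_ne_zero j)]
    have h5 : coeff (j + 1) (g ^ (j + 1)) - coeff (j + 1)
        (X * (g ^ (j + 1) * gi * derivative R g)) = 0 := by
      apply natCast_mul_cancel (succ_ne_zero j)
      have h6 : derivative R (g ^ (j + 1)) =
          C ((j + 1 : ℕ) : R) * (g ^ (j + 1) * gi * derivative R g) := by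
        rw [leibniz_pow, Nat.add_sub_cancel, smul_eq_mul, nsmul_eq_mul, map_natCast]
        linear_combination (-((j + 1 : ℕ) : PowerSeries R)) * g ^ j * derivative R g * hg
      have h7 := coeff_X_mul_derivative (g ^ (j + 1)) (j + 1)
      rw [h6, mul_left_comm, coeff_C_mul] at h7
      rw [mul_sub, h7, sub_self, mul_zero]
    rw [h5, mul_zero]

/-- Lagrange inversion: u A / g = ∑ Q_k (u/g)^{k+1}, and the preceding residue isolates one term of
its derivative. -/
theorem expansion_coeff {A : PowerSeries R} {Q : ℕ → R} (hQ : ∀ n, coeff n A =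
    ∑ k ∈ range (n + 1), Q k * coeff (n - k) (gi ^ k)) (m : ℕ) :
    ((m + 1 : ℕ) : R) * Q m = coeff m (g ^ (m + 1) * derivative R (X * A * gi)) := by
  obtain ⟨B, hB⟩ : X ^ (m + 1) ∣ A - ∑ k ∈ range (m + 1), C (Q k) * (X * gi) ^ k := by
    rw [X_pow_dvd_iff]
    intro n hn
    rw [map_sub, map_sum, hQ n, sub_eq_zero]
    rw [← sum_subset (Finset.range_mono (Nat.succ_le_of_lt hn))]
    · refine sum_congr rfl fun k hk => ?_
      rw [coeff_C_mul, mul_pow, coeff_X_pow_mul', if_pos (Nat.lt_succ_iff.mp (mem_range.mp hk))]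
    · intro k _ hk
      rw [coeff_C_mul, mul_pow, coeff_X_pow_mul', if_neg, mul_zero]
      rw [mem_range] at hk
      omega
  have h1 : X * A * gi = ∑ k ∈ range (m + 1),
      C (Q k) * (X * gi) ^ (k + 1) + X ^ (m + 2) * (B * gi) := by
    simp only [pow_succ _ (_ : ℕ), ← mul_assoc, ← sum_mul]
    rw [pow_succ] at hB
    linear_combination X * gi * hB
  have h2 : derivative R (X ^ (m + 2) * (B * gi)) = X ^ (m + 1) *
      (X * derivative R (B * gi) + ((m + 2 : ℕ) : PowerSeries R) * (B * gi)) := by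
    rw [leibniz, leibniz_pow, derivative_X, smul_eq_mul,
      smul_eq_mul, smul_eq_mul, nsmul_eq_mul, mul_one, show m + 2 - 1 = m + 1 by omega]
    ring
  rw [h1, map_add, map_sum, h2, mul_add, mul_left_comm (g ^ (m + 1)), map_add,
    coeff_X_pow_mul', if_neg (by omega), add_zero, mul_sum, map_sum,
    Finset.sum_eq_single_of_mem m (Finset.self_mem_range_succ m)]
  · rw [leibniz, derivative_C, smul_zero, add_zero, smul_eq_mul, mul_left_comm, coeff_C_mul]
    have := coeff_pow_mul_derivative hg hg0 m 0
    rw [add_zero, if_pos rfl] at this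
    rw [this]
    push_cast
    ring
  · intro k hk hkm
    rw [leibniz, derivative_C, smul_zero, add_zero, smul_eq_mul, mul_left_comm, coeff_C_mul]
    have hkm' : k < m := lt_of_le_of_ne (Nat.lt_succ_iff.mp (mem_range.mp hk)) hkm
    have := coeff_pow_mul_derivative hg hg0 k (m - k)
    rw [if_neg (by omega), Nat.add_sub_cancel' hkm'.le] at this
    rw [this, mul_zero]

end Lagrange

section Zero

variable {R : Type*} [CommRing R] [Algebra ℂ R]

/-- The solution of the system for `ν = 0`, by Lagrange inversion. -/
theorem exists_powerSumSystem_zero (F oi : PowerSeries R) (ho : (1 + X) * oi = 1) :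
    ∃ K p, PowerSumSystem 0 F K p ∧ ∀ k : ℕ, ((k + 2 : ℕ) : R) * p k = coeff (k + 1) (((1 + X) *
        (1 + X * derivative R F)) ^ (k + 2) * oi) := by
  set g := (1 + X) * (1 + X * derivative R F) with hgdef
  have hg0 : constantCoeff g = 1 := by simp [hgdef]
  obtain ⟨gi, hg⟩ := (isUnit_of_constantCoeff_eq_one hg0).exists_right_inv
  set lq := PowerSeries.map (algebraMap ℂ R) logQuot with hlq
  obtain ⟨Q, hQ⟩ := exists_expansion hg hg0 (lq * g)
  have hX1 : PowerSeries.map (algebraMap ℂ R) (1 + X) = 1 + X := by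
    rw [map_add, map_one, PowerSeries.map_X]
  -- For ν = 0 no derivative of K remains, so K_k = g^{-k}, and the main relation is the expansion
  -- of g log(1+u)/u in powers of u/g. Its constant term Q_0 is not a power sum, hence the shift of
  -- the index.
  refine ⟨fun k => gi ^ k, fun k => Q (k + 1), ⟨pow_zero _, fun k => ?_, fun n => ?_⟩, fun k => ?_⟩
  · rw [mul_zero, add_zero, map_zero, zero_mul, add_zero, map_one, ← mul_assoc, ← hgdef, pow_succ',
      ← mul_assoc, hg, one_mul]
  · rw [map_mul (PowerSeries.map (algebraMap ℂ R)), hX1, sub_zero, map_one C]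
    have h := hQ (n + 1)
    rw [Finset.sum_range_succ', pow_zero, PowerSeries.coeff_one, if_neg (by omega), mul_zero,
      add_zero] at h
    rw [show (1 + X) * lq * (1 + X * derivative R F) = lq * g by
      rw [hgdef]; ring, h]
    refine sum_congr rfl fun k _ => ?_
    rw [Nat.add_sub_add_right]
  · have h := expansion_coeff hg hg0 hQ (k + 1)
    -- The series to be differentiated in Lagrange's formula is log(1+u), whose derivative is
    -- 1/(1+u).
    have h1 : X * (lq * g) * gi = PowerSeries.map (algebraMap ℂ R)
        (X * logQuot) := by
      rw [map_mul, PowerSeries.map_X]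
      linear_combination X * lq * hg
    have h2 : derivative R (X * (lq * g) * gi) = oi := by
      have h3 := congrArg (PowerSeries.map (algebraMap ℂ R)) one_add_X_mul_derivative_X_mul_logQuot
      have h4 : PowerSeries.map (algebraMap ℂ R) (derivative ℂ (X * logQuot)) =
          derivative R (PowerSeries.map (algebraMap ℂ R) (X * logQuot)) := by
        generalize X * logQuot = Z
        ext n
        simp only [coeff_map, coeff_derivative, map_mul, map_add, map_natCast, map_one]
      rw [map_mul, hX1, map_one, h4, ← h1] at h3
      linear_combination oi * h3 - derivative R (X * (lq * g) * gi) * ho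
    rw [h2] at h
    exact h

variable {A : Type*} [CommRing A] [Algebra ℂ A]

/-- The power series `c + ε w` over the dual numbers. -/
def dualSeries (c : PowerSeries ℂ) (w : PowerSeries A) : PowerSeries (DualNumber A) :=
  PowerSeries.mk fun n => inl (algebraMap ℂ A (coeff n c)) + inr (coeff n w)

/-- Over the dual numbers g becomes g + ε (1+u) u w'. In g^{k+2} / (1+u) the first order term is
(k+2) g^{k+1} u w', so both the factor k + 2 and the denominator disappear. -/
theorem exists_powerSumSystem_dual (c : PowerSeries ℂ) (w : PowerSeries A) (oi : PowerSeries ℂ)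
    (ho : (1 + X) * oi = 1) : ∃ K, PowerSumSystem 0 (dualSeries c w) K fun k =>
      inl (algebraMap ℂ A (1 / ((k + 2 : ℕ) : ℂ) * coeff (k + 1) (gSeries c ^ (k + 2) * oi))) +
      inr (coeff (k + 1) (PowerSeries.map (algebraMap ℂ A)
        (gSeries c ^ (k + 1)) * (X * derivative A w))) := by
  set ι : ℂ →+* DualNumber A := algebraMap ℂ (DualNumber A) with hι
  have hι' : ∀ z, ι z = inl (algebraMap ℂ A z) := fun z => rfl
  have hX1 : PowerSeries.map ι (1 + X) = 1 + X := by
    rw [map_add, map_one, PowerSeries.map_X]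
  have ho' : (1 + X) * PowerSeries.map ι oi = 1 := by
    rw [← hX1, ← map_mul, ho, map_one]
  obtain ⟨K, p, hs, hp⟩ := exists_powerSumSystem_zero (dualSeries c w) (PowerSeries.map ι oi) ho'
  set y : PowerSeries (DualNumber A) := PowerSeries.mk fun n =>
    inr (coeff n (X * derivative A w)) with hy
  have hinr : ∀ (B : PowerSeries ℂ) (n : ℕ), coeff n (PowerSeries.map ι B * y) =
      inr (coeff n (PowerSeries.map (algebraMap ℂ A) B * (X * derivative A w))) := by
    intro B n
    rw [coeff_mul, coeff_mul, inr_sum]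
    refine sum_congr rfl fun q _ => ?_
    rw [coeff_map, coeff_map, hy, coeff_mk, hι', TrivSqZeroExt.inl_mul_inr, smul_eq_mul]
  have hyy : y * y = 0 := by
    refine PowerSeries.ext fun n => ?_
    rw [coeff_mul, map_zero]
    refine sum_eq_zero fun q _ => ?_
    rw [hy, coeff_mk, coeff_mk]
    exact TrivSqZeroExt.inr_mul_inr A _ _
  have hθ : X * derivative _ (dualSeries c w) = PowerSeries.map ι (X * derivative ℂ c) + y := by
    refine PowerSeries.ext fun n => ?_
    rw [coeff_X_mul_derivative, map_add, coeff_map, coeff_X_mul_derivative, hy,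
      coeff_mk, coeff_X_mul_derivative, dualSeries, coeff_mk, map_mul,
      map_natCast, hι', mul_add, add_right_inj, ← nsmul_eq_mul, ← nsmul_eq_mul]
    exact (inr_smul _ n _).symm
  have hg : (1 + X) * (1 + X * derivative _ (dualSeries c w)) =
      PowerSeries.map ι (gSeries c) + (1 + X) * y := by
    rw [hθ, gSeries, map_mul _ (1 + X), hX1, map_add, map_one]
    ring
  have hpow : ∀ m : ℕ, (PowerSeries.map ι (gSeries c) + (1 + X) * y) ^ (m + 1) =
      PowerSeries.map ι (gSeries c) ^ (m + 1) +
        ((m + 1 : ℕ) : PowerSeries (DualNumber A)) * PowerSeries.map ι (gSeries c) ^ m *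
          ((1 + X) * y) := by
    intro m
    induction m with
    | zero => simp
    | succ m ih =>
      rw [pow_succ, ih]
      push_cast
      linear_combination (m + 1 : PowerSeries (DualNumber A)) *
        PowerSeries.map ι (gSeries c) ^ m * (1 + X) ^ 2 * hyy
  refine ⟨K, ?_⟩
  convert hs using 1
  funext k
  apply natCast_mul_cancel (n := k + 2) (by omega)
  rw [hp, hg, hpow (k + 1)]
  have h1 : (PowerSeries.map ι (gSeries c) ^ (k + 1 + 1) +
      ((k + 1 + 1 : ℕ) : PowerSeries (DualNumber A)) * PowerSeries.map ι (gSeries c) ^ (k + 1) *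
        ((1 + X) * y)) * PowerSeries.map ι oi =
      PowerSeries.map ι (gSeries c ^ (k + 2) * oi) + C ((k + 2 : ℕ) : DualNumber A) *
        (PowerSeries.map ι (gSeries c ^ (k + 1)) * y) := by
    rw [map_mul, map_pow, map_pow, map_natCast]
    linear_combination ((k + 2 : ℕ) : PowerSeries (DualNumber A)) *
      PowerSeries.map ι (gSeries c) ^ (k + 1) * y * ho'
  rw [h1, map_add, coeff_C_mul, hinr, mul_add, coeff_map, ← hι', map_mul ι,
    ← mul_assoc, ← map_natCast ι, ← map_mul ι, mul_one_div_cancel (Nat.cast_ne_zero.mpr (by omega)),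
    map_one, one_mul]

end Zero

end

/-! ### Gaussian functionals and exponentials of Gaussian series. -/

section

open MvPolynomial (X coeff_add smul_eq_C_mul)
open MvPowerSeries (coeff coeff_C_mul coeff_map coeff_mul coeff_pderiv constantCoeff pderiv)
open Finsupp (single)

section Gaussian

/-- A functional under which the elements of `𝓛` are jointly Gaussian, expressed through
integration by parts. -/
structure IsGaussian {A : Type*} [CommRing A] [Algebra ℂ A] (M : A →ₗ[ℂ] ℂ) (𝓛 : Submodule ℂ A) :
    Prop where
  one : M 1 = 1
  parts : ∀ w ∈ 𝓛, ∃ D : Derivation ℂ A A, (∀ P, M (w * P) = M w * M P + M (D P)) ∧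
    ∀ w' ∈ 𝓛, D w' = algebraMap ℂ A (M (w * w') - M w * M w')

variable {B : Type*}

/-- Gaussian functionals with given means and covariances. -/
theorem exists_gaussian (μ : B → ℂ) (c : B → B → ℂ) (hc : ∀ a b, c a b = c b a) :
    ∃ M : MvPolynomial B ℂ →ₗ[ℂ] ℂ, IsGaussian M (span ℂ (Set.range X)) ∧
      (∀ b, M (X b) = μ b) ∧ ∀ a b, M (X a * X b) - M (X a) * M (X b) = c a b := by
  set d : B → Derivation ℂ (MvPolynomial B ℂ) (MvPolynomial B ℂ) := fun a =>
    MvPolynomial.mkDerivation ℂ fun b => MvPolynomial.C (c a b) with hd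
  have hdX : ∀ a b, d a (X b) = MvPolynomial.C (c a b) := fun a b =>
    MvPolynomial.mkDerivation_X _ _ _
  have hcomm : ∀ a b P, d a (d b P) = d b (d a P) := by
    intro a b P
    have h : ⁅d a, d b⁆ = 0 := by
      apply MvPolynomial.derivation_ext
      intro i
      rw [commutator_apply, hdX, hdX, derivation_C, derivation_C, sub_zero, Derivation.zero_apply]
    have := congrArg (fun D => D P) h
    simpa [commutator_apply, sub_eq_zero] using this
  -- Multiplication plus mean plus derivation in the direction of the covariances. Replacing the
  -- variables of P by these operators, applying the result to 1 and taking the constant term yields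
  -- the Gaussian expectation of P.
  set T : B → MvPolynomial B ℂ →ₗ[ℂ] MvPolynomial B ℂ := fun a =>
    mulLeft ℂ (X a) + μ a • LinearMap.id + (d a).toLinearMap with hT
  have hTa : ∀ a P, T a P = X a * P + μ a • P + d a P := fun a P => rfl
  have hdT : ∀ a b P, d b (T a P) = T a (d b P) + c b a • P := by
    intro a b P
    rw [hTa, hTa, map_add, map_add, leibniz, hdX, Derivation.map_smul, hcomm b a,
      smul_eq_mul, smul_eq_mul, smul_eq_C_mul P (c b a)]
    ring
  -- The commutator is c(a,b) - c(b,a); symmetry of the covariance makes the substitution into a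
  -- monomial well defined.
  have hlc : ∀ a b P, T a (T b P) = T b (T a P) := by
    intro a b P
    rw [hTa a (T b P), hTa b (T a P), hdT, hdT, hc a b]
    simp only [hTa, smul_eq_C_mul, hcomm a b P]
    ring
  have : LeftCommutative (fun b (Q : MvPolynomial B ℂ) => T b Q) := ⟨hlc⟩
  set Θ : MvPolynomial B ℂ →ₗ[ℂ] MvPolynomial B ℂ := (basisMonomials B ℂ).constr ℂ
    fun s => (toMultiset s).foldr (fun b Q => T b Q) 1 with hΘ
  have hmon : ∀ s, Θ (monomial s 1) = (toMultiset s).foldr (fun b Q => T b Q) 1 := by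
    intro s
    have := (basisMonomials B ℂ).constr_basis ℂ
      (fun s => (toMultiset s).foldr (fun b Q => T b Q) 1) s
    rwa [coe_basisMonomials] at this
  have hΘX : ∀ b P, Θ (X b * P) = T b (Θ P) := by
    intro b P
    have h : Θ ∘ₗ mulLeft ℂ (X b) = T b ∘ₗ Θ := by
      apply (basisMonomials B ℂ).ext
      intro s
      rw [coe_basisMonomials, LinearMap.comp_apply, LinearMap.comp_apply,
        LinearMap.mulLeft_apply, hmon, X, MvPolynomial.monomial_mul, one_mul, hmon,
        map_add, Finsupp.toMultiset_single, one_nsmul, singleton_add, Multiset.foldr_cons]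
    exact congrArg (fun f => f P) h
  have hΘ1 : Θ 1 = 1 := by
    have := hmon 0
    rwa [map_zero, Multiset.foldr_zero] at this
  have hdΘ : ∀ b P, d b (Θ P) = Θ (d b P) := by
    intro b P
    induction P using MvPolynomial.induction_on with
    | C a =>
      rw [derivation_C, map_zero, ← mul_one (MvPolynomial.C a),
        ← smul_eq_C_mul, map_smul, hΘ1, Derivation.map_smul, Derivation.map_one_eq_zero, smul_zero]
    | add p q hp hq => simp only [map_add, hp, hq]
    | mul_X p a hp =>
      rw [mul_comm, hΘX, hdT, hp, leibniz, hdX, smul_eq_mul, smul_eq_mul, map_add, hΘX,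
        mul_comm p, ← smul_eq_C_mul, map_smul]
  -- Integration by parts follows because Θ commutes with the derivations and the summand X_b Θ(P)
  -- has no constant term.
  set M : MvPolynomial B ℂ →ₗ[ℂ] ℂ := lcoeff ℂ 0 ∘ₗ Θ with hM
  have hMa : ∀ P, M P = MvPolynomial.coeff 0 (Θ P) := fun P => rfl
  have hMX : ∀ b P, M (X b * P) = μ b * M P + M (d b P) := by
    intro b P
    rw [hMa, hΘX, hTa, coeff_add, coeff_add, MvPolynomial.coeff_smul,
      hdΘ, ← hMa, ← hMa, smul_eq_mul, ← MvPolynomial.constantCoeff_eq, map_mul,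
      MvPolynomial.constantCoeff_X, zero_mul, zero_add]
  have hM1 : M 1 = 1 := by rw [hMa, hΘ1, MvPolynomial.coeff_zero_one]
  have hμ : ∀ b, M (X b) = μ b := by
    intro b
    have := hMX b 1
    rwa [mul_one, hM1, mul_one, Derivation.map_one_eq_zero, map_zero, add_zero] at this
  refine ⟨M, ⟨hM1, fun w hw => ?_⟩, hμ, fun a b => ?_⟩
  · obtain ⟨D, hD, hDs⟩ : ∃ D : Derivation ℂ (MvPolynomial B ℂ) (MvPolynomial B ℂ),
        (∀ P, M (w * P) = M w * M P + M (D P)) ∧ ∀ b, ∃ z, D (X b) = MvPolynomial.C z := by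
      induction hw using span_induction with
      | mem x hx =>
        obtain ⟨b, rfl⟩ := hx
        exact ⟨d b, fun P => by rw [hMX, hμ], fun a => ⟨_, hdX b a⟩⟩
      | zero => exact ⟨0, fun P => by simp, fun b => ⟨0, by simp⟩⟩
      | add x y _ _ hx hy =>
        obtain ⟨D, h1, h2⟩ := hx
        obtain ⟨D', h1', h2'⟩ := hy
        refine ⟨D + D', fun P => ?_, fun b => ?_⟩
        · rw [add_mul, map_add, h1, h1', map_add, Derivation.add_apply, map_add]
          ring
        · obtain ⟨z, hz⟩ := h2 b
          obtain ⟨z', hz'⟩ := h2' b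
          exact ⟨z + z', by rw [Derivation.add_apply, hz, hz', map_add]⟩
      | smul t x _ hx =>
        obtain ⟨D, h1, h2⟩ := hx
        refine ⟨t • D, fun P => ?_, fun b => ?_⟩
        · rw [smul_mul_assoc, map_smul, h1, map_smul, Derivation.smul_apply, map_smul, smul_eq_mul,
            smul_eq_mul, smul_eq_mul]
          ring
        · obtain ⟨z, hz⟩ := h2 b
          exact ⟨t * z, by rw [Derivation.smul_apply, hz, smul_eq_C_mul, map_mul]⟩
    refine ⟨D, hD, fun w' hw' => ?_⟩
    obtain ⟨z, hz⟩ : ∃ z, D w' = algebraMap ℂ (MvPolynomial B ℂ) z := by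
      induction hw' using span_induction with
      | mem x hx =>
        obtain ⟨b, rfl⟩ := hx
        exact hDs b
      | zero => exact ⟨0, by simp⟩
      | add x y _ _ hx hy =>
        obtain ⟨z, hz⟩ := hx
        obtain ⟨z', hz'⟩ := hy
        exact ⟨z + z', by rw [map_add, hz, hz', map_add]⟩
      | smul t x _ hx =>
        obtain ⟨z, hz⟩ := hx
        exact ⟨t * z, by rw [Derivation.map_smul, hz, smul_def, map_mul]⟩
    have h := hD w'
    rw [hz, algebraMap_eq_smul_one, map_smul, hM1, smul_eq_mul, mul_one] at h
    rw [hz, h, add_sub_cancel_left]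
  · rw [hMX, hμ, hμ, hdX, ← mul_one (MvPolynomial.C (c a b)), ← smul_eq_C_mul,
      map_smul, hM1, smul_eq_mul, mul_one, add_sub_cancel_left]

end Gaussian

section Exponential

variable {σ : Type} {A V : Type*} [CommRing A] [Algebra ℂ A] [CommRing V] [Algebra ℂ V]

/-- A linear map applied to the coefficients of a power series. -/
def lc (f : A →ₗ[ℂ] V) (K : MvPowerSeries σ A) : MvPowerSeries σ V :=
  fun n => f (coeff n K)

theorem coeff_lc (f : A →ₗ[ℂ] V) (K : MvPowerSeries σ A) (n : σ →₀ ℕ) :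
    coeff n (lc f K) = f (coeff n K) := rfl

theorem lc_add (f : A →ₗ[ℂ] V) (K J : MvPowerSeries σ A) : lc f (K + J) = lc f K + lc f J := by
  ext n
  simp only [coeff_lc, map_add]

theorem lc_sum {ι : Type*} (f : A →ₗ[ℂ] V) (s : Finset ι) (K : ι → MvPowerSeries σ A) :
    lc f (∑ i ∈ s, K i) = ∑ i ∈ s, lc f (K i) := by
  ext n
  simp only [coeff_lc, map_sum]

theorem lc_pderiv (f : A →ₗ[ℂ] V) (i : σ) (K : MvPowerSeries σ A) :
    lc f (pderiv A i K) = pderiv V i (lc f K) := by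
  ext n
  rw [coeff_lc, coeff_pderiv, coeff_pderiv, coeff_lc, mul_comm,
    ← Nat.cast_succ, ← nsmul_eq_mul, map_nsmul, nsmul_eq_mul, mul_comm, Nat.cast_succ]

theorem lc_leibniz (D : Derivation ℂ A A) (K J : MvPowerSeries σ A) :
    lc D.toLinearMap (K * J) = lc D.toLinearMap K * J + K * lc D.toLinearMap J := by
  classical
  ext n
  rw [coeff_lc, map_add, coeff_mul, coeff_mul, coeff_mul, map_sum, ← sum_add_distrib]
  refine sum_congr rfl fun q _ => ?_
  rw [coeff_lc, coeff_lc, Derivation.coeFn_coe, leibniz, smul_eq_mul, smul_eq_mul]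
  ring

theorem lc_mul_map (M : A →ₗ[ℂ] ℂ) (K : MvPowerSeries σ A) (s : MvPowerSeries σ ℂ) :
    lc M (K * MvPowerSeries.map (algebraMap ℂ A) s) = lc M K * s := by
  classical
  ext n
  rw [coeff_lc, coeff_mul, coeff_mul, map_sum]
  refine sum_congr rfl fun q _ => ?_
  rw [coeff_lc, coeff_map, mul_comm, ← smul_def, map_smul, smul_eq_mul, mul_comm]

theorem coeff_lc_mul_mul [DecidableEq σ] (M : A →ₗ[ℂ] ℂ) (U K : MvPowerSeries σ A)
    (J : MvPowerSeries σ ℂ) (n : σ →₀ ℕ) : coeff n (lc M (U * K) * J) =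
      ∑ q ∈ antidiagonal n, coeff q.2
        (lc M (MvPowerSeries.C (coeff q.1 U) * K) * J) := by
  rw [← lc_mul_map, mul_assoc, coeff_lc, coeff_mul, map_sum]
  refine sum_congr rfl fun q _ => ?_
  rw [← lc_mul_map, mul_assoc, coeff_lc, coeff_C_mul]

/-- A derivation acts on an exponential as multiplication by the derivative of the logarithm. -/
theorem IsLog.lc_derivation [IsAddTorsionFree A] {W K : MvPowerSeries σ A} (h : IsLog W K)
    (D : Derivation ℂ A A) : lc D.toLinearMap K = lc D.toLinearMap W * K := by
  -- Adding the error D K - (D W) K to K does not change its logarithm, so uniqueness of the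
  -- exponential forces the error to vanish.
  have h1 : IsLog W (K + (lc D.toLinearMap K - lc D.toLinearMap W * K)) := by
    refine ⟨h.left, ?_, fun i => ?_⟩
    · have e1 : constantCoeff (lc D.toLinearMap K) = 0 := by
        rw [← coeff_zero_mv, coeff_lc, coeff_zero_mv, h.right]
        exact D.map_one_eq_zero
      have e2 : constantCoeff (lc D.toLinearMap W) = 0 := by
        rw [← coeff_zero_mv, coeff_lc, coeff_zero_mv, h.left, map_zero]
      rw [map_add, map_sub, map_mul, e1, e2, h.right]
      ring
    · rw [map_add, map_sub, ← lc_pderiv, h.deriv i, lc_leibniz, leibniz, ← lc_pderiv,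
        h.deriv i, smul_eq_mul, smul_eq_mul]
      ring
  have h2 := h.unique_right h1
  rw [left_eq_add, sub_eq_zero] at h2
  exact h2

variable {M : A →ₗ[ℂ] ℂ} {𝓛 : Submodule ℂ A} (hM : IsGaussian M 𝓛)

include hM

/-- Integration by parts for the exponential: E[w e^W] = (E w + Cov(w, W)) E[e^W], since the
derivation sends W to a deterministic series. -/
theorem IsGaussian.lc_C_mul [IsAddTorsionFree A] {W K : MvPowerSeries σ A} (h : IsLog W K)
    (hW : ∀ n, coeff n W ∈ 𝓛) {w : A} (hw : w ∈ 𝓛) :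
    lc M (MvPowerSeries.C w * K) = (MvPowerSeries.C (M w) + (lc M (MvPowerSeries.C w * W) -
      MvPowerSeries.C (M w) * lc M W)) * lc M K := by
  obtain ⟨D, hD, hD'⟩ := hM.parts w hw
  have h1 : lc D.toLinearMap W = MvPowerSeries.map (algebraMap ℂ A)
      (lc M (MvPowerSeries.C w * W) - MvPowerSeries.C (M w) * lc M W) := by
    ext n
    rw [coeff_lc, coeff_map, map_sub, coeff_lc, coeff_C_mul, coeff_C_mul, coeff_lc]
    exact hD' _ (hW n)
  rw [add_mul, mul_comm (_ - _), ← lc_mul_map, ← h1, mul_comm K, ← h.lc_derivation D]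
  ext n
  rw [coeff_lc, coeff_C_mul, hD, map_add, coeff_C_mul, coeff_lc, coeff_lc, coeff_lc]
  rfl

/-- The expectation of the exponential of a Gaussian series. -/
theorem IsGaussian.isLog_lc [IsAddTorsionFree A] {W K : MvPowerSeries σ A} (h : IsLog W K)
    (hW : ∀ n, coeff n W ∈ 𝓛) :
    IsLog (lc M W + MvPowerSeries.C (1 / 2) * (lc M (W * W) - lc M W * lc M W)) (lc M K) := by
  classical
  have hz : constantCoeff (lc M W) = 0 := by
    rw [← coeff_zero_mv, coeff_lc, coeff_zero_mv, h.left, map_zero]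
  refine ⟨?_, ?_, fun i => ?_⟩
  · have e2 : constantCoeff (lc M (W * W)) = 0 := by
      rw [← coeff_zero_mv, coeff_lc, coeff_zero_mv, map_mul, h.left, mul_zero, map_zero]
    simp only [map_add, map_mul, map_sub, hz, e2, mul_zero, sub_zero, add_zero]
  · rw [← coeff_zero_mv, coeff_lc, coeff_zero_mv, h.right, hM.one]
  · set U := pderiv A i W with hU
    have hUL : ∀ n, coeff n U ∈ 𝓛 := by
      intro n
      rw [hU, coeff_pderiv, mul_comm, ← Nat.cast_succ, ← nsmul_eq_mul]
      exact 𝓛.smul_of_tower_mem _ (hW _)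
    have hd : pderiv ℂ i (lc M W + MvPowerSeries.C (1 / 2) *
        (lc M (W * W) - lc M W * lc M W)) = lc M U + (lc M (U * W) - lc M U * lc M W) := by
      have hC : pderiv ℂ i (MvPowerSeries.C (1 / 2 : ℂ) : MvPowerSeries σ ℂ) = 0 :=
        Derivation.map_algebraMap _ _
      have h2 : (MvPowerSeries.C (1 / 2 : ℂ) : MvPowerSeries σ ℂ) * 2 = 1 := by
        rw [show (2 : MvPowerSeries σ ℂ) = MvPowerSeries.C (2 : ℂ) from (map_ofNat _ 2).symm,
          ← map_mul]
        norm_num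
      rw [map_add, leibniz, hC, smul_zero, add_zero, smul_eq_mul, map_sub,
        ← lc_pderiv, ← lc_pderiv, leibniz, leibniz, ← lc_pderiv, smul_eq_mul,
        smul_eq_mul, ← hU, lc_add, mul_comm W U]
      linear_combination (lc M (U * W) - lc M U * lc M W) * h2
    rw [hd, ← lc_pderiv, h.deriv i, ← hU]
    ext n
    have e1 := coeff_lc_mul_mul M U W (lc M K) n
    rw [add_mul, sub_mul, map_add, map_sub, e1, coeff_lc, coeff_mul, map_sum,
      mul_assoc, coeff_mul, coeff_mul, ← sum_sub_distrib, ← sum_add_distrib]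
    refine sum_congr rfl fun q _ => ?_
    have e2 := congrArg (coeff q.2) (hM.lc_C_mul h hW (hUL q.1))
    rw [coeff_lc, coeff_C_mul, add_mul, sub_mul, map_add, map_sub, mul_assoc,
      coeff_C_mul, coeff_C_mul] at e2
    rw [e2]
    rfl

end Exponential

section PairGaussian

theorem isAddTorsionFree_of_algebra (A : Type*) [CommRing A] [Algebra ℂ A] :
    IsAddTorsionFree A := by
  let : Module ℚ A := Module.compHom A (algebraMap ℚ ℂ)
  exact IsAddTorsionFree.of_module_rat A

theorem lc_emb {σ : Type} {A : Type*} [CommRing A] [Algebra ℂ A] (M : A →ₗ[ℂ] ℂ) (x : σ)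
    (a : PowerSeries A) : lc M (emb x a) = emb x (lc M a : PowerSeries ℂ) := by
  classical
  ext n
  rw [coeff_lc, coeff_emb, coeff_emb]
  split_ifs
  · rfl
  · exact map_zero _

theorem coeff_emb_mul_emb {σ : Type} [DecidableEq σ] {R : Type*} [CommRing R] {x y : σ}
    (hxy : x ≠ y) (a b : PowerSeries R) (n : σ →₀ ℕ) :
    coeff n (emb x a * emb y b) = if n.support ⊆ {x, y} then
      PowerSeries.coeff (n x) a * PowerSeries.coeff (n y) b else 0 := by
  have h := coeff_prod_emb (fun i => if i = x then a else b) {x, y} n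
  rw [prod_pair hxy, prod_pair hxy, if_pos rfl, if_neg hxy.symm] at h
  exact h

variable {H r : ℕ} {A : Type*} [CommRing A] [Algebra ℂ A] {M : A →ₗ[ℂ] ℂ} {𝓛 : Submodule ℂ A}
  (hM : IsGaussian M 𝓛) {w K : Fin H → PowerSeries A} (hw : ∀ h n, PowerSeries.coeff n (w h) ∈ 𝓛)
  (hK : ∀ h, IsLog (w h) (K h))

/-- The covariances of the coefficients of the series `w`. -/
def covCoeff (M : A →ₗ[ℂ] ℂ) (w : Fin H → PowerSeries A) (h : Fin H) (k : ℕ) (f : Fin H) (m : ℕ) :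
    ℂ := M (PowerSeries.coeff k (w h) * PowerSeries.coeff m (w f)) -
    M (PowerSeries.coeff k (w h)) * M (PowerSeries.coeff m (w f))

include hM hw hK in
theorem IsGaussian.isLog_lc_one (h : Fin H) : IsLog (lc M (w h) + PowerSeries.C (1 / 2) *
    (lc M (w h * w h) - lc M (w h) * lc M (w h)) : PowerSeries ℂ) (lc M (K h)) := by
  have := isAddTorsionFree_of_algebra A
  refine hM.isLog_lc (hK h) fun n => ?_
  have := hw h (n ())
  rwa [PowerSeries.coeff, show single () (n ()) = n from by ext; simp] at this

include hM hw hK in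
-- The product of the exponentials is the exponential of ∑ w(u_x), and half the variance of this sum
-- splits into one-variable terms and covariances of distinct variables.
theorem IsGaussian.exists_pair (r : ℕ) : ∃ Λ : MvPowerSeries (Fin H × Fin r) ℂ,
    IsPair (covCoeff M w) Λ ∧ IsLog (∑ x : Fin H × Fin r, emb x (lc M (w x.1) + PowerSeries.C (1 / 2) *
      (lc M (w x.1 * w x.1) - lc M (w x.1) * lc M (w x.1)) : PowerSeries ℂ) + Λ)
      (lc M (tens fun x : Fin H × Fin r => K x.1)) := by
  have := isAddTorsionFree_of_algebra A
  set W : MvPowerSeries (Fin H × Fin r) A := ∑ x : Fin H × Fin r, emb x (w x.1) with hW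
  have hlog : IsLog W (tens fun x : Fin H × Fin r => K x.1) :=
    IsLog.sum_prod univ fun x _ => (hK x.1).emb x
  have hWL : ∀ n, coeff n W ∈ 𝓛 := by
    intro n
    rw [hW, map_sum]
    refine sum_mem fun x _ => ?_
    rw [coeff_emb]
    split_ifs
    · exact hw _ _
    · exact zero_mem _
  have hw0 : ∀ h, PowerSeries.coeff 0 (w h) = 0 := fun h => by
    rw [coeff_zero_ps]
    exact (hK h).left
  set T : Fin H × Fin r → Fin H × Fin r → MvPowerSeries (Fin H × Fin r) ℂ := fun x y =>
    lc M (emb x (w x.1) * emb y (w y.1)) - lc M (emb x (w x.1)) * lc M (emb y (w y.1)) with hT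
  have hTc : ∀ x y, x ≠ y → ∀ n, coeff n (T x y) =
      if n.support = {x, y} then covCoeff M w x.1 (n x) y.1 (n y) else 0 := by
    intro x y hxy n
    rw [hT, map_sub, coeff_lc, lc_emb, lc_emb, coeff_emb_mul_emb hxy, coeff_emb_mul_emb hxy]
    by_cases h : n.support = {x, y}
    · rw [if_pos h.le, if_pos h.le, if_pos h]
      rfl
    · rw [if_neg h]
      split_ifs with h1
      · have h2 : n x = 0 ∨ n y = 0 := by
          by_contra! h2
          apply h
          refine Finset.Subset.antisymm h1 fun z hz => ?_
          rw [mem_insert, mem_singleton] at hz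
          rw [mem_support_iff]
          rcases hz with rfl | rfl
          · exact h2.1
          · exact h2.2
        have h3 : ∀ (z : Fin H) k, PowerSeries.coeff k (lc M (w z) : PowerSeries ℂ) =
          M (PowerSeries.coeff k (w z)) := fun z k => rfl
        rw [h3, h3]
        rcases h2 with h2 | h2 <;> simp [h2, hw0]
      · rw [map_zero, sub_zero]
  -- The sum over ordered pairs counts each unordered pair twice, which the factor 1/2 compensates.
  refine ⟨MvPowerSeries.C (1 / 2) * ∑ x, ∑ y ∈ univ.erase x, T x y, ⟨?_, ?_⟩, ?_⟩
  · intro x y hxy k m hk hm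
    have hs := support_single_add_single hxy hk hm
    have hsym : covCoeff M w y.1 m x.1 k = covCoeff M w x.1 k y.1 m := by
      rw [covCoeff, covCoeff, mul_comm (PowerSeries.coeff m _), mul_comm (M (PowerSeries.coeff m _))]
    have hx : (single x k + single y m : Fin H × Fin r →₀ ℕ) x = k := by
      simp [hxy]
    have hy : (single x k + single y m : Fin H × Fin r →₀ ℕ) y = m := by
      simp [hxy.symm]
    have hval : ∀ a b, a ≠ b → coeff (single x k + single y m)
        (T a b) = (if a = x ∧ b = y then covCoeff M w x.1 k y.1 m else 0) +
          if a = y ∧ b = x then covCoeff M w x.1 k y.1 m else 0 := by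
      intro a b hab
      rw [hTc a b hab, hs]
      by_cases h1 : a = x ∧ b = y
      · obtain ⟨rfl, rfl⟩ := h1
        simp only [and_self, if_true, hx, hy, hxy, false_and, if_false, add_zero]
      · by_cases h2 : a = y ∧ b = x
        · obtain ⟨rfl, rfl⟩ := h2
          rw [if_pos (Finset.pair_comm _ _), if_neg h1, if_pos ⟨rfl, rfl⟩, zero_add, hx, hy, hsym]
        · rw [if_neg h1, if_neg h2, add_zero, if_neg]
          intro h3
          have m1 : a ∈ ({x, y} : Finset (Fin H × Fin r)) := by rw [h3]; simp
          have m2 : b ∈ ({x, y} : Finset (Fin H × Fin r)) := by rw [h3]; simp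
          rw [mem_insert, mem_singleton] at m1 m2
          rcases m1 with rfl | rfl <;> rcases m2 with rfl | rfl <;> simp_all
    rw [coeff_C_mul, map_sum, sum_congr rfl fun a _ => by
      rw [map_sum, sum_congr rfl fun b hb => hval a b (ne_of_mem_erase hb).symm]]
    simp only [sum_add_distrib, ite_and]
    have e1 : ∀ u v : Fin H × Fin r, u ≠ v → ∀ z : ℂ, (∑ a, ∑ b ∈ univ.erase a,
        if a = u then if b = v then z else 0 else 0) = z := by
      intro u v huv z
      rw [sum_eq_single u]
      · simp [huv.symm]
      · intro a _ ha
        simp [ha]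
      · simp
    rw [e1 x y hxy, e1 y x hxy.symm]
    ring
  · intro n hn
    rw [coeff_C_mul, map_sum, sum_eq_zero, mul_zero]
    intro x _
    rw [map_sum]
    refine sum_eq_zero fun y hy => ?_
    have hxy := (ne_of_mem_erase hy).symm
    rw [hTc x y hxy, if_neg]
    intro h
    rw [h, card_pair hxy] at hn
    exact hn rfl
  · convert hM.isLog_lc hlog hWL using 1
    have e1 : lc M (W * W) - lc M W * lc M W = ∑ x, ∑ y, T x y := by
      rw [hW, sum_mul_sum, lc_sum, lc_sum, sum_mul_sum, ← sum_sub_distrib]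
      refine sum_congr rfl fun x _ => ?_
      rw [lc_sum, ← sum_sub_distrib]
    have e2 : ∀ x : Fin H × Fin r, T x x = emb x (lc M (w x.1 * w x.1) - lc M (w x.1) * lc M (w x.1) :
        PowerSeries ℂ) := by
      intro x
      rw [hT, map_sub, map_mul, ← lc_emb, ← lc_emb, map_mul]
    rw [e1, hW, lc_sum]
    simp only [map_add, map_mul, sum_add_distrib, ← lc_emb, ← e2]
    have e3 : ∀ x : Fin H × Fin r, emb x (PowerSeries.C (1 / 2 : ℂ)) =
        (MvPowerSeries.C (1 / 2 : ℂ) : MvPowerSeries (Fin H × Fin r) ℂ) :=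
      fun x => commutes (emb x) _
    simp only [e3]
    rw [← mul_sum, add_assoc, ← mul_add, ← sum_add_distrib]
    congr 2
    refine sum_congr rfl fun x _ => ?_
    rw [add_sum_erase _ _ (mem_univ x)]

end PairGaussian

end

/-! ### Algebras of sequences of random variables paired with their limits. -/

section

open PowerSeries (X coeff coeff_map constantCoeff)

/-- Sequences of complex random variables. -/
abbrev RV (Ω : ℕ → Type) : Type := ∀ L, Ω L → ℂ

section PairSeries

variable {Ω : ℕ → Type} {D : Type*} [CommRing D] [Algebra ℂ D]

/-- The evaluation of a sequence of random variables at an elementary event. -/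
def ev (D : Type*) [CommRing D] [Algebra ℂ D] (L : ℕ) (ω : Ω L) : RV Ω × D →ₐ[ℂ] ℂ :=
  ((Pi.evalAlgHom ℂ (fun _ : Ω L => ℂ) ω).comp (Pi.evalAlgHom ℂ (fun L => Ω L → ℂ) L)).comp
    (AlgHom.fst ℂ (RV Ω) D)

/-- A sequence of random power series, together with a power series over `D`. -/
def pairS (K : ∀ L, Ω L → PowerSeries ℂ) (k : PowerSeries D) : PowerSeries (RV Ω × D) :=
  PowerSeries.mk fun n => (fun L ω => coeff n (K L ω), coeff n k)

theorem coeff_pairS (K : ∀ L, Ω L → PowerSeries ℂ) (k : PowerSeries D) (n : ℕ) :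
    coeff n (pairS K k) = (fun L ω => coeff n (K L ω), coeff n k) := coeff_mk _ _

theorem map_ev_pairS (K : ∀ L, Ω L → PowerSeries ℂ) (k : PowerSeries D) (L : ℕ) (ω : Ω L) :
    PowerSeries.map (ev D L ω : RV Ω × D →+* ℂ) (pairS K k) = K L ω := by
  ext n
  rw [coeff_map, coeff_pairS]
  rfl

theorem map_snd_pairS (K : ∀ L, Ω L → PowerSeries ℂ) (k : PowerSeries D) :
    PowerSeries.map (AlgHom.snd ℂ (RV Ω) D : RV Ω × D →+* D) (pairS K k) = k := by
  refine PowerSeries.ext fun n => ?_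
  rw [coeff_map, coeff_pairS]
  rfl

/-- The evaluations at all elementary events together with the second projection are jointly
injective, so identities in the product algebra may be checked under each of these homomorphisms. -/
theorem pair_ext {x y : RV Ω × D} (h : ∀ L (ω : Ω L), ev D L ω x = ev D L ω y)
    (h' : AlgHom.snd ℂ (RV Ω) D x = AlgHom.snd ℂ (RV Ω) D y) : x = y :=
  Prod.ext (funext fun L => funext fun ω => h L ω) h'

theorem pairSeries_ext {K J : PowerSeries (RV Ω × D)}
    (h : ∀ L (ω : Ω L), PowerSeries.map (ev D L ω : RV Ω × D →+* ℂ) K =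
      PowerSeries.map (ev D L ω : RV Ω × D →+* ℂ) J)
    (h' : PowerSeries.map (AlgHom.snd ℂ (RV Ω) D : RV Ω × D →+* D) K =
      PowerSeries.map (AlgHom.snd ℂ (RV Ω) D : RV Ω × D →+* D) J) : K = J :=
  PowerSeries.ext fun n => pair_ext
    (fun L ω => by simpa using congrArg (coeff n) (h L ω))
    (by simpa using congrArg (coeff n) h')

theorem map_derivative {R S : Type*} [CommRing R] [CommRing S] (f : R →+* S) (K : PowerSeries R) :
    PowerSeries.map f (derivative R K) = derivative S (PowerSeries.map f K) := by
  refine PowerSeries.ext fun n => ?_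
  simp only [coeff_map, coeff_derivative, map_mul, map_add, map_natCast, map_one]

theorem isLog_iff_derivative {R : Type*} [CommRing R] {Λ K : PowerSeries R} :
    IsLog Λ K ↔ constantCoeff Λ = 0 ∧ constantCoeff K = 1 ∧ derivative R K = derivative R Λ * K :=
  ⟨fun h => ⟨h.left, h.right, h.deriv ()⟩, fun h => ⟨h.1, h.2.1, fun _ => h.2.2⟩⟩

theorem isLog_pairS {Λ K : ∀ L, Ω L → PowerSeries ℂ} {l k : PowerSeries D}
    (h : ∀ L ω, IsLog (Λ L ω) (K L ω)) (h' : IsLog l k) : IsLog (pairS Λ l) (pairS K k) := by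
  simp only [isLog_iff_derivative] at h h' ⊢
  refine ⟨?_, ?_, pairSeries_ext (fun L ω => ?_) ?_⟩
  · rw [← coeff_zero_ps, coeff_pairS]
    refine Prod.ext (funext fun L => funext fun ω => ?_) ?_
    · exact (coeff_zero_ps _).trans (h L ω).1
    · exact (coeff_zero_ps _).trans h'.1
  · rw [← coeff_zero_ps, coeff_pairS]
    refine Prod.ext (funext fun L => funext fun ω => ?_) ?_
    · exact (coeff_zero_ps _).trans (h L ω).2.1
    · exact (coeff_zero_ps _).trans h'.2.1
  · rw [map_derivative, map_mul, map_derivative, map_ev_pairS, map_ev_pairS]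
    exact (h L ω).2.2
  · rw [map_derivative, map_mul, map_derivative, map_snd_pairS, map_snd_pairS]
    exact h'.2.2

/-- The systems for all L and all signatures, together with the limiting system for ν = 0, form one
system over the product algebra. A single application of the membership theorems then covers the
sequence and its limit. -/
theorem PowerSumSystem.pairS {ν : ℕ → ℂ} {F : ∀ L, Ω L → PowerSeries ℂ}
    {K : ∀ L, Ω L → ℕ → PowerSeries ℂ} {p : ∀ L, Ω L → ℕ → ℂ}
    (h : ∀ L ω, PowerSumSystem (ν L) (F L ω) (K L ω) (p L ω)) {f : PowerSeries D}
    {k : ℕ → PowerSeries D} {q : ℕ → D} (h' : PowerSumSystem 0 f k q) :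
    PowerSumSystem ((fun L _ => ν L, 0) : RV Ω × D) (SchurCLT.pairS F f)
      (fun j => SchurCLT.pairS (fun L ω => K L ω j) (k j)) fun j => (fun L ω => p L ω j, q j) := by
  refine ⟨pairSeries_ext (fun L ω => ?_) ?_, fun j => pairSeries_ext (fun L ω => ?_) ?_,
    fun n => pair_ext (fun L ω => ?_) ?_⟩
  · rw [map_ev_pairS, map_one]
    exact (h L ω).zero
  · rw [map_snd_pairS, map_one]
    exact h'.zero
  · simp only [map_mul, map_add, map_one, map_derivative, PowerSeries.map_X, PowerSeries.map_C,
      map_ev_pairS, RingHom.coe_coe, map_natCast]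
    have := (h L ω).succ j
    simp only [map_add, map_mul, map_one, map_natCast] at this
    exact this
  · simp only [map_mul, map_add, map_one, map_derivative, PowerSeries.map_X, PowerSeries.map_C,
      map_snd_pairS, RingHom.coe_coe, map_natCast]
    have := h'.succ j
    simp only [map_add, map_mul, map_one, map_natCast] at this
    exact this
  · have e1 := (h L ω).main n
    have e2 : ∀ Z : PowerSeries (RV Ω × D), ev D L ω (coeff n.succ Z) =
      coeff n.succ (PowerSeries.map (ev D L ω : RV Ω × D →+* ℂ) Z) := fun Z => by
        rw [coeff_map]; rfl
    have e3 : PowerSeries.map (ev D L ω : RV Ω × D →+* ℂ) (PowerSeries.map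
        (algebraMap ℂ (RV Ω × D)) ((1 + X) * logQuot)) =
        PowerSeries.map (algebraMap ℂ ℂ) ((1 + X) * logQuot) :=
      PowerSeries.ext fun n => by simp only [coeff_map]; rfl
    rw [e2, map_mul (PowerSeries.map (ev D L ω : RV Ω × D →+* ℂ)), e3,
      map_add (PowerSeries.map (ev D L ω : RV Ω × D →+* ℂ)), PowerSeries.map_C,
      map_mul (PowerSeries.map (ev D L ω : RV Ω × D →+* ℂ)), PowerSeries.map_X, map_derivative,
      map_ev_pairS, map_sum]
    refine Eq.trans ?_ (e1.trans (sum_congr rfl fun j _ => ?_))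
    · rfl
    · rw [map_mul, coeff_pairS]
      rfl
  · have e1 := h'.main n
    have e2 : ∀ Z : PowerSeries (RV Ω × D), AlgHom.snd ℂ (RV Ω) D (coeff n.succ Z) =
      coeff n.succ (PowerSeries.map (AlgHom.snd ℂ (RV Ω) D : RV Ω × D →+* D) Z) :=
        fun Z => by rw [coeff_map]; rfl
    have e3 : PowerSeries.map (AlgHom.snd ℂ (RV Ω) D : RV Ω × D →+* D) (PowerSeries.map
        (algebraMap ℂ (RV Ω × D)) ((1 + X) * logQuot)) =
        PowerSeries.map (algebraMap ℂ D) ((1 + X) * logQuot) :=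
      PowerSeries.ext fun n => by simp only [coeff_map]; rfl
    rw [e2, map_mul (PowerSeries.map (AlgHom.snd ℂ (RV Ω) D : RV Ω × D →+* D)), e3,
      map_add (PowerSeries.map (AlgHom.snd ℂ (RV Ω) D : RV Ω × D →+* D)), PowerSeries.map_C,
      map_mul (PowerSeries.map (AlgHom.snd ℂ (RV Ω) D : RV Ω × D →+* D)), PowerSeries.map_X, map_derivative,
      map_snd_pairS, map_sum]
    refine Eq.trans ?_ (e1.trans (sum_congr rfl fun j _ => ?_))
    · rfl
    · rw [map_mul, coeff_pairS]
      rfl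

end PairSeries

section Membership

variable {R : Type*} [CommRing R] [Algebra ℂ R] {S : Subalgebra ℂ R} {Λ K : PowerSeries R}
  (h : IsLog Λ K)

theorem mem_of_natCast_mul_mem {n : ℕ} (hn : n ≠ 0) {x : R} (hx : (n : R) * x ∈ S) : x ∈ S := by
  have h2 := S.smul_mem hx (n : ℂ)⁻¹
  rwa [← map_natCast (algebraMap ℂ R), ← smul_def, smul_smul, inv_mul_cancel₀
    (by exact_mod_cast hn), one_smul] at h2

include h

theorem IsLog.coeff_succ_mul (n : ℕ) : ((n + 1 : ℕ) : R) * coeff (n + 1) K = ∑ q ∈ antidiagonal n,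
      ((q.1 + 1 : ℕ) : R) * coeff (q.1 + 1) Λ * coeff q.2 K := by
  have h1 := congrArg (coeff n) (isLog_iff_derivative.mp h).2.2
  rw [PowerSeries.coeff_mul, coeff_derivative] at h1
  push_cast
  rw [mul_comm, h1]
  refine sum_congr rfl fun q _ => ?_
  rw [coeff_derivative]
  ring

/-- The equation K' = Λ' K is triangular in the coefficients of K, with division by positive
integers only. -/
theorem IsLog.coeff_right_mem (hΛ : ∀ n, coeff n Λ ∈ S) (n : ℕ) : coeff n K ∈ S := by
  induction n using Nat.strong_induction_on with
  | _ n ih =>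
    cases n with
    | zero =>
      rw [coeff_zero_ps, (isLog_iff_derivative.mp h).2.1]
      exact one_mem S
    | succ n =>
      apply mem_of_natCast_mul_mem (succ_ne_zero n)
      rw [h.coeff_succ_mul]
      refine sum_mem fun q hq => mul_mem (mul_mem (natCast_mem S _) (hΛ _)) (ih _ ?_)
      rw [mem_antidiagonal] at hq
      omega

/-- The same relation is triangular in the coefficients of Λ, as K has constant term 1. -/
theorem IsLog.coeff_left_mem (hK : ∀ n, coeff n K ∈ S) (n : ℕ) : coeff n Λ ∈ S := by
  induction n using Nat.strong_induction_on with
  | _ n ih =>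
    cases n with
    | zero =>
      rw [coeff_zero_ps, (isLog_iff_derivative.mp h).1]
      exact zero_mem S
    | succ n =>
      apply mem_of_natCast_mul_mem (succ_ne_zero n)
      have h1 := h.coeff_succ_mul n
      rw [← add_sum_erase _ _ (show (n, 0) ∈ antidiagonal n by simp),
        coeff_zero_ps K, (isLog_iff_derivative.mp h).2.1, mul_one, ← sub_eq_iff_eq_add] at h1
      rw [← h1]
      refine sub_mem (mul_mem (natCast_mem S _) (hK _)) (sum_mem fun q hq => ?_)
      rw [mem_erase, mem_antidiagonal] at hq
      refine mul_mem (mul_mem (natCast_mem S _) (ih _ ?_)) (hK _)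
      rcases Nat.eq_zero_or_pos q.2 with h0 | h0
      · exact absurd (Prod.ext (by simp; omega) h0) hq.1
      · omega

end Membership

section Admissible

variable {Ω : ℕ → Type} {A : Type*} [CommRing A] [Algebra ℂ A]

/-- The convergence of the expectations against all elements of `S`. -/
def MeanTendsto (E : ∀ L, (Ω L → ℂ) →ₗ[ℂ] ℂ) (M : A →ₗ[ℂ] ℂ) (S : Submonoid (RV Ω × A))
    (y : RV Ω × A) : Prop := ∀ s ∈ S, Tendsto (fun L => E L ((y * s).1 L)) atTop (𝓝 (M (y * s).2))

/-- The algebra of pairs that preserve the convergence of expectations. -/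
def admissible (E : ∀ L, (Ω L → ℂ) →ₗ[ℂ] ℂ) (M : A →ₗ[ℂ] ℂ) (S : Submonoid (RV Ω × A)) :
    Subalgebra ℂ (RV Ω × A) where
  carrier := {x | ∀ y, MeanTendsto E M S y → MeanTendsto E M S (x * y)}
  mul_mem' := by
    intro a b ha hb y hy
    rw [mul_assoc]
    exact ha _ (hb _ hy)
  add_mem' := by
    intro a b ha hb y hy s hs
    have := (ha y hy s hs).add (hb y hy s hs)
    rw [← map_add] at this
    simp only [← map_add] at this
    rw [add_mul, add_mul]
    exact this
  algebraMap_mem' := by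
    intro z y hy s hs
    have := (hy s hs).const_mul z
    rw [← smul_def, smul_mul_assoc]
    rw [show M (z • (y * s)).2 = z * M (y * s).2 from M.map_smul z _]
    exact this.congr fun L => ((E L).map_smul z _).symm

variable {E : ∀ L, (Ω L → ℂ) →ₗ[ℂ] ℂ} {M : A →ₗ[ℂ] ℂ} {S : Submonoid (RV Ω × A)}

/-- Defining admissibility through multiplication on convergent elements makes the admissible pairs
an algebra at once; closure of S under products puts S inside it. -/
theorem mem_admissible_of_mem {x : RV Ω × A} (hx : x ∈ S) : x ∈ admissible E M S := by
  intro y hy s hs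
  rw [mul_comm x, mul_assoc]
  exact hy _ (mul_mem hx hs)

theorem const_mem_admissible {z : ℕ → ℂ} {z₀ : ℂ} (hz : Tendsto z atTop (𝓝 z₀)) :
    ((fun L _ => z L, algebraMap ℂ A z₀) : RV Ω × A) ∈ admissible E M S := by
  intro y hy s hs
  have := hz.mul (hy s hs)
  rw [mul_assoc]
  have h1 : M (((fun L _ => z L, algebraMap ℂ A z₀) : RV Ω × A) * (y * s)).2 =
      z₀ * M (y * s).2 := by
    have h2 := M.map_smul z₀ (y * s).2
    rw [smul_def] at h2
    exact h2
  rw [h1]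
  exact this.congr fun L => ((E L).map_smul (z L) _).symm

/-- The definition is tested on the unit, for which convergence against S is the hypothesis `hS`. -/
theorem tendsto_of_mem_admissible
    (hS : ∀ s ∈ S, Tendsto (fun L => E L (s.1 L)) atTop (𝓝 (M s.2))) {x : RV Ω × A}
    (hx : x ∈ admissible E M S) : Tendsto (fun L => E L (x.1 L)) atTop (𝓝 (M x.2)) := by
  have h := hx 1 (fun s hs => by rw [one_mul]; exact hS s hs) 1 (one_mem S)
  rwa [mul_one, mul_one] at h

end Admissible

section Fluctuation

variable {Ω : ℕ → Type} {A : Type*} [CommRing A] [Algebra ℂ A] (G : Subalgebra ℂ (RV Ω × A))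
  (𝓛 : Submodule ℂ A) (ν : ℕ → ℂ)

/-- Random variables `z_L + ν_L W_L` with `z_L → z` and `(W, w)` in `G`, together with the dual
number `z + ε w`. -/
def fluctuation (hν : Tendsto ν atTop (𝓝 0))
    (hG : ∀ (z : ℕ → ℂ) (z₀ : ℂ), Tendsto z atTop (𝓝 z₀) →
      ((fun L _ => z L, algebraMap ℂ A z₀) : RV Ω × A) ∈ G) :
    Subalgebra ℂ (RV Ω × DualNumber A) where
  carrier := {x | ∃ (z : ℕ → ℂ) (z₀ : ℂ) (y : RV Ω × A), Tendsto z atTop (𝓝 z₀) ∧ y ∈ G ∧ y.2 ∈ 𝓛 ∧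
    x = (fun L ω => z L + ν L * y.1 L ω, inl (algebraMap ℂ A z₀) + inr y.2)}
  mul_mem' := by
    rintro _ _ ⟨z, z₀, y, hz, hy, hyL, rfl⟩ ⟨z', z₀', y', hz', hy', hyL', rfl⟩
    -- (z + νW)(z' + νW') = zz' + ν (zW' + z'W + ν WW'). The quadratic term stays in G with limit 0
    -- because ν → 0, which matches ε² = 0 on the side of the limits.
    refine ⟨fun L => z L * z' L, z₀ * z₀', _, hz.mul hz', add_mem (add_mem
      (mul_mem (hG z z₀ hz) hy') (mul_mem (hG z' z₀' hz') hy)) (mul_mem (hG ν 0 hν)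
        (mul_mem hy hy')), ?_, Prod.ext ?_ ?_⟩
    · have h : algebraMap ℂ A z₀ * y'.2 + algebraMap ℂ A z₀' * y.2 +
          algebraMap ℂ A 0 * (y.2 * y'.2) ∈ 𝓛 := by
        rw [map_zero, zero_mul, add_zero, ← smul_def, ← smul_def]
        exact add_mem (𝓛.smul_mem _ hyL') (𝓛.smul_mem _ hyL)
      exact h
    · funext L ω
      simp only [Prod.fst_mul, Prod.fst_add, Pi.mul_apply, Pi.add_apply]
      ring
    · refine TrivSqZeroExt.ext ?_ ?_
      · simp
      · simp [mul_comm]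
  add_mem' := by
    rintro _ _ ⟨z, z₀, y, hz, hy, hyL, rfl⟩ ⟨z', z₀', y', hz', hy', hyL', rfl⟩
    refine ⟨fun L => z L + z' L, z₀ + z₀', _, hz.add hz', add_mem hy hy', add_mem hyL hyL',
      Prod.ext ?_ ?_⟩
    · funext L ω
      simp only [Prod.fst_add, Pi.add_apply]
      ring
    · refine TrivSqZeroExt.ext ?_ ?_ <;> simp
  algebraMap_mem' := by
    intro z
    refine ⟨fun _ => z, z, 0, tendsto_const_nhds, zero_mem _, zero_mem _, Prod.ext ?_ ?_⟩
    · funext L ω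
      simp
    · refine TrivSqZeroExt.ext ?_ ?_
      · simp [algebraMap_eq_inl']
      · simp [algebraMap_eq_inl']

variable {G 𝓛 ν} {hν : Tendsto ν atTop (𝓝 0)}
  {hG : ∀ (z : ℕ → ℂ) (z₀ : ℂ), Tendsto z atTop (𝓝 z₀) →
      ((fun L _ => z L, algebraMap ℂ A z₀) : RV Ω × A) ∈ G}

theorem mem_fluctuation {x : RV Ω × DualNumber A} : x ∈ fluctuation G 𝓛 ν hν hG ↔
    ∃ (z : ℕ → ℂ) (z₀ : ℂ) (y : RV Ω × A), Tendsto z atTop (𝓝 z₀) ∧ y ∈ G ∧ y.2 ∈ 𝓛 ∧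
    x = (fun L ω => z L + ν L * y.1 L ω, inl (algebraMap ℂ A z₀) + inr y.2) := Iff.rfl

theorem const_mem_fluctuation {z : ℕ → ℂ} {z₀ : ℂ} (hz : Tendsto z atTop (𝓝 z₀)) :
    ((fun L _ => z L, inl (algebraMap ℂ A z₀)) : RV Ω × DualNumber A) ∈
      fluctuation G 𝓛 ν hν hG :=
  mem_fluctuation.mpr ⟨z, z₀, 0, hz, zero_mem _, zero_mem _, Prod.ext (by funext L ω; simp)
    (by simp)⟩

/-- These inverses are deterministic and converge to 1, so the hypothesis on S in the membership
theorems is satisfied. -/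
theorem exists_inv_mem_fluctuation (h0 : ∀ L (m : ℕ), 1 + m * ν L ≠ 0) (m : ℕ) :
    ∃ i ∈ fluctuation G 𝓛 ν hν hG, i * (1 + m * ((fun L _ => ν L, 0) : RV Ω × DualNumber A)) = 1 := by
  refine ⟨_, const_mem_fluctuation (z := fun L => (1 + m * ν L)⁻¹) (z₀ := (1 + m * 0)⁻¹)
    ((tendsto_const_nhds.add (hν.const_mul _)).inv₀ (by simp)), Prod.ext ?_ ?_⟩
  · funext L ω
    exact inv_mul_cancel₀ (h0 L m)
  · simp

end Fluctuation

end

/-! ### From power sums to the one-variable series. -/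

section

open PowerSeries (C coeff coeff_C_mul constantCoeff)
open Finsupp (single)

section PowerSums

variable {H : ℕ}

/-- The tuples of signatures on which the measures live. -/
abbrev Sig (N : ℕ → Fin H → ℕ) (L : ℕ) : Type := ∀ h, GT (N L h)

/-- The power sum of degree `k + 1` in the colour `h`, `b = (k, h)`. -/
def psum (N : ℕ → Fin H → ℕ) (b : ℕ × Fin H) : RV (Sig N) :=
  fun _ lam => (powerSum b.1.succPNat b.2 lam : ℂ)

variable {N : ℕ → Fin H → ℕ} (hN0 : ∀ L h, 0 < N L h)

include hN0 in
theorem exists_powerSumSystem_psum (h : Fin H) (L : ℕ) (lam : Sig N L) :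
    ∃ K, PowerSumSystem (1 / (N L h : ℂ)) (C (1 / (N L h : ℂ)) * lg (phiSeries h lam)) K
      fun k => 1 / (N L h : ℂ) * psum N (k, h) L lam := by
  have : NeZero (N L h) := ⟨(hN0 L h).ne'⟩
  have hN : (N L h : ℂ) ≠ 0 := by exact_mod_cast NeZero.ne (N L h)
  obtain ⟨K, hK⟩ := exists_powerSumSystem (shiftedC_injective (lam h))
    (F := C (1 / (N L h : ℂ)) * lg (phiSeries h lam)) (by
      rw [← mul_assoc, ← map_mul, mul_one_div_cancel hN, map_one, one_mul]; rfl)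
  refine ⟨K, ?_⟩
  convert hK using 4 with k
  rw [psum, powerSum, ofReal_sum]
  refine sum_congr rfl fun i _ => ?_
  simp only [shiftedC, shifted]
  push_cast
  rfl

include hN0 in
theorem one_add_mul_inv_ne_zero (h : Fin H) (L m : ℕ) : 1 + (m : ℂ) * (1 / (N L h : ℂ)) ≠ 0 := by
  have hN : (N L h : ℂ) ≠ 0 := by exact_mod_cast (hN0 L h).ne'
  intro h0
  have h1 : ((N L h + m : ℕ) : ℂ) = N L h * (1 + m * (1 / N L h)) := by
    push_cast
    field_simp
  rw [h0, mul_zero, Nat.cast_eq_zero] at h1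
  have := hN0 L h
  omega

end PowerSums

section Forward

variable {H : ℕ} {N : ℕ → Fin H → ℕ} (hN0 : ∀ L h, 0 < N L h)
  (hN : ∀ h, Tendsto (fun L => 1 / (N L h : ℂ)) atTop (𝓝 0))
  {E : ∀ L, (Sig N L → ℂ) →ₗ[ℂ] ℂ} (hE : ∀ L, E L (fun _ => 1) = 1)
  {A : Type*} [CommRing A] [Algebra ℂ A] {M : A →ₗ[ℂ] ℂ} {𝓛 : Submodule ℂ A}
  {S : Submonoid (RV (Sig N) × A)}

include hN0 in
-- `coeff_F_mem` applied to the fluctuation algebra: each p_k / N is a convergent sequence plus 1/N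
-- times an admissible variable, so each coefficient of (1/N) log φ has the same form.
theorem coeff_lg_phiSeries_of_psum {p : ℕ → ℂ} {y : ℕ → A} (h : Fin H)
    (hp : ∀ k, Tendsto (fun L => 1 / (N L h : ℂ) * E L (psum N (k, h) L)) atTop (𝓝 (p k)))
    (hy : ∀ k, y k ∈ 𝓛)
    (hW : ∀ k, ((fun L lam => psum N (k, h) L lam - E L (psum N (k, h) L), y k) : RV (Sig N) × A) ∈
      admissible E M S) (hN : Tendsto (fun L => 1 / (N L h : ℂ)) atTop (𝓝 0)) (n : ℕ) :
    ∃ (z : ℕ → ℂ) (z₀ : ℂ) (x : RV (Sig N) × A), Tendsto z atTop (𝓝 z₀) ∧ x ∈ admissible E M S ∧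
      x.2 ∈ 𝓛 ∧ (∀ L lam, coeff n (C (1 / (N L h : ℂ)) *
        lg (phiSeries h lam)) = z L + 1 / (N L h : ℂ) * x.1 L lam) ∧ (n = 0 → z = 0 ∧ x = 0) := by
  have h0 : ∀ L (lam : Sig N L), coeff 0 (C (1 / (N L h : ℂ)) *
      lg (phiSeries h lam)) = 0 := fun L lam => by
    rw [coeff_C_mul, coeff_zero_ps]
    exact mul_eq_zero_of_right _ (isLog_lg (constantCoeff_phiSeries (hN0 L) h lam)).left
  rcases Nat.eq_zero_or_pos n with rfl | hn
  · refine ⟨0, 0, 0, tendsto_const_nhds, zero_mem _, zero_mem _, fun L lam => ?_,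
      fun _ => ⟨rfl, rfl⟩⟩
    rw [h0]
    simp
  choose K hK using exists_powerSumSystem_psum hN0 h
  -- In this direction only the sequences have to satisfy the system, so the limit component is
  -- replaced by the trivial ring, and T asks merely for some completion to an element of the
  -- fluctuation algebra.
  have htriv : PowerSumSystem (0 : Unit) (0 : PowerSeries Unit) (fun _ => 0) (fun _ => 0) :=
    ⟨Subsingleton.elim _ _, fun _ => Subsingleton.elim _ _, fun _ => Subsingleton.elim _ _⟩
  set Fl := fluctuation (admissible E M S) 𝓛 (fun L => 1 / (N L h : ℂ)) hN
    (fun z z₀ hz => const_mem_admissible hz)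
  set T : Subalgebra ℂ (RV (Sig N) × Unit) :=
    (Fl.map (AlgHom.fst ℂ (RV (Sig N)) (DualNumber A))).comap (AlgHom.fst ℂ (RV (Sig N)) Unit)
  have hT : ∀ x : RV (Sig N) × DualNumber A, x ∈ Fl → ∀ u, (x.1, u) ∈ T := fun x hx u =>
    ⟨x, hx, rfl⟩
  have hmem := (PowerSumSystem.pairS hK htriv).coeff_F_mem (S := T)
    (hT _ (const_mem_fluctuation hN) _) (fun m => by
      obtain ⟨i, hi, hi1⟩ := exists_inv_mem_fluctuation (G := admissible E M S) (𝓛 := 𝓛)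
        (hν := hN) (hG := fun z z₀ hz => const_mem_admissible hz)
        (one_add_mul_inv_ne_zero hN0 h) m
      have h1 := congrArg Prod.fst hi1
      exact ⟨_, hT i hi 0, Prod.ext h1 (Subsingleton.elim _ _)⟩)
    (by
      have h1 := hT 0 (zero_mem _) 0
      rw [coeff_pairS]
      convert h1 using 2
      exact funext fun L => funext fun lam => h0 L lam)
    (fun k => by
      have h1 := hT _ (mem_fluctuation.mpr ⟨_, _, _, hp k, hW k, hy k, rfl⟩) 0
      convert h1 using 2
      funext L lam
      ring) n
  rw [coeff_pairS] at hmem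
  obtain ⟨x, ⟨z, z₀, w, hz, hw, hwL, rfl⟩, hx⟩ := hmem
  exact ⟨z, z₀, w, hz, hw, hwL, fun L lam => (congrFun (congrFun hx L) lam).symm, by omega⟩

include hN0 hN hE in
/-- Gaussian fluctuations of the power sums imply the convergence of the logarithms of the
one-variable series and of their products. -/
theorem exists_phi_limits (hM : IsGaussian M 𝓛)
    (hS : ∀ s ∈ S, Tendsto (fun L => E L (s.1 L)) atTop (𝓝 (M s.2)))
    {p : ℕ × Fin H → ℂ} {y : ℕ × Fin H → A}
    (hp : ∀ b, Tendsto (fun L => 1 / (N L b.2 : ℂ) * E L (psum N b L)) atTop (𝓝 (p b)))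
    (hy : ∀ b, y b ∈ 𝓛)
    (hW : ∀ b, ((fun L lam => psum N b L lam - E L (psum N b L), y b) : RV (Sig N) × A) ∈ S) :
    ∃ (c : Fin H → PowerSeries ℂ) (e : Fin H → ℕ → Fin H → ℕ → ℂ),
      (∀ h, CT (fun L => C (1 / (N L h : ℂ)) * lg (oneSeries (E L) h)) (c h)) ∧
      ∀ r, ∃ b, CT (fun L => lg (quotPhi (E L) r)) b ∧ IsPair e b := by
  choose z z₀ x hz hx hxL hzx hzero using fun h => coeff_lg_phiSeries_of_psum (M := M) (𝓛 := 𝓛)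
    (S := S) hN0 h (fun k => hp (k, h)) (fun k => hy (k, h))
    (fun k => mem_admissible_of_mem (hW (k, h))) (hN h)
  let : Algebra ℚ A := ((algebraMap ℂ A).comp (algebraMap ℚ ℂ)).toAlgebra
  set w : Fin H → PowerSeries A := fun h => PowerSeries.mk fun n => (x h n).2
  set W : Fin H → ∀ L, Sig N L → PowerSeries ℂ := fun h L lam =>
    PowerSeries.mk fun n => (x h n).1 L lam
  -- The deterministic part of log φ, of order N, is separated from the fluctuation W; then φ is the
  -- product of their exponentials.
  set Z : Fin H → ℕ → PowerSeries ℂ := fun h L => PowerSeries.mk fun n => N L h * z h n L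
  have hw0 : ∀ h, constantCoeff (w h) = 0 := fun h => by
    rw [← coeff_zero_ps, coeff_mk, (hzero h 0 rfl).2]
    rfl
  have hW0 : ∀ h L lam, constantCoeff (W h L lam) = 0 := fun h L lam => by
    rw [← coeff_zero_ps, coeff_mk, (hzero h 0 rfl).2]
    rfl
  have hZ0 : ∀ h L, constantCoeff (Z h L) = 0 := fun h L => by
    rw [← coeff_zero_ps, coeff_mk, (hzero h 0 rfl).1]
    exact mul_zero _
  choose K hK using fun h => IsLog.exists_right (hw0 h)
  choose Ψ hΨ using fun h L lam => IsLog.exists_right (hW0 h L lam)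
  choose X hX using fun h L => IsLog.exists_right (hZ0 h L)
  have hlg : ∀ h L (lam : Sig N L), lg (phiSeries h lam) = Z h L + W h L lam := by
    intro h L lam
    refine PowerSeries.ext fun n => ?_
    have h1 := hzx h n L lam
    have hN' : (N L h : ℂ) ≠ 0 := by exact_mod_cast (hN0 L h).ne'
    rw [coeff_C_mul] at h1
    rw [map_add, coeff_mk, coeff_mk]
    field_simp at h1
    linear_combination h1
  have hphi : ∀ h L (lam : Sig N L), phiSeries h lam = X h L * Ψ h L lam := by
    intro h L lam
    have h1 := isLog_lg (constantCoeff_phiSeries (hN0 L) h lam)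
    rw [hlg] at h1
    exact h1.unique_right ((hX h L).add_mul (hΨ h L lam))
  have hΨG : ∀ h n, ((fun L lam => coeff n (Ψ h L lam), coeff n (K h)) :
      RV (Sig N) × A) ∈ admissible E M S := by
    intro h n
    have h1 := (isLog_pairS (hΨ h) (hK h)).coeff_right_mem (S := admissible E M S) (fun n => by
      rw [coeff_pairS]
      simp only [w, W, coeff_mk]
      exact hx h n) n
    rwa [coeff_pairS] at h1
  set Ψ₁ : Fin H → ℕ → PowerSeries ℂ := fun h L => mean (E L) (Ψ h L)
  have hone : ∀ h L, oneSeries (E L) h = X h L * Ψ₁ h L := by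
    intro h L
    rw [oneSeries, show phiSeries h = fun lam : Sig N L => X h L * Ψ h L lam from
      funext fun lam => hphi h L lam]
    exact mean_mul _ _ _
  have hX1 := fun h L => (hX h L).right
  have hlΨ₁ : ∀ h L, IsLog (lg (oneSeries (E L) h) - Z h L) (Ψ₁ h L) := fun h L =>
    (isLog_oneSeries (hN0 L) (hE L) h).sub_div (hX h L) (hone h L).symm
  have hCT₁ : ∀ h, CT (Ψ₁ h) (lc M (K h)) := fun h n => by
    have h1 := tendsto_of_mem_admissible hS (hΨG h (n ()))
    simp only [coeff, show single () (n ()) = n from by ext; simp] at h1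
    exact h1
  have hwL : ∀ h n, coeff n (w h) ∈ 𝓛 := fun h n => by
    rw [coeff_mk]; exact hxL h n
  -- Hence log E φ = Z + O(1), with the Gaussian correction mean plus half variance. After division
  -- by N only the limit of Z / N remains.
  have hC : ∀ h, CT (fun L => lg (oneSeries (E L) h) - Z h L) (lc M (w h) + C (1 / 2) *
      (lc M (w h * w h) - lc M (w h) * lc M (w h)) : PowerSeries ℂ) := by
    intro h
    obtain ⟨l, hl, hl'⟩ := CT.log (Eventually.of_forall (hlΨ₁ h)) (hCT₁ h)
    rwa [hl'.unique_left (hM.isLog_lc_one hwL hK h)] at hl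
  refine ⟨fun h => PowerSeries.mk fun n => z₀ h n, covCoeff M w, fun h n => ?_, fun r => ?_⟩
  · have h1 := ((CT.C (hN h)).mul (hC h)) n
    have h2 := (hz h (n ())).add h1
    rw [map_zero MvPowerSeries.C, zero_mul, map_zero (MvPowerSeries.coeff n), add_zero] at h2
    have e1 : ∀ J : PowerSeries ℂ, MvPowerSeries.coeff n J = coeff (n ()) J := fun J => by
      rw [coeff, show single () (n ()) = n from by ext; simp]
    rw [e1, coeff_mk]
    refine h2.congr fun L => ?_
    have hN' : (N L h : ℂ) ≠ 0 := by exact_mod_cast (hN0 L h).ne'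
    change _ + MvPowerSeries.coeff n (C (1 / (N L h : ℂ)) * (lg (oneSeries (E L) h) - Z h L)) = _
    rw [e1, e1, coeff_C_mul, coeff_C_mul, map_sub (coeff (n ())), coeff_mk]
    field_simp
    ring
  · obtain ⟨Λ, hΛ, hlog⟩ := hM.exists_pair hwL hK r
    refine ⟨Λ, ?_, hΛ⟩
    set J : ℕ → MvPowerSeries (Fin H × Fin r) ℂ := fun L =>
      mean (E L) fun lam => tens fun x : Fin H × Fin r => Ψ x.1 L lam
    -- The deterministic exponentials occur equally in E ∏ φ and in ∏ E φ, so they cancel in the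
    -- quotient.
    have hJ : ∀ L, (tens fun x : Fin H × Fin r => Ψ₁ x.1 L) * quotPhi (E L) r = J L := by
      intro L
      have h1 := tens_mul_quotPhi (hN0 L) (hE L) r
      have hXt : MvPowerSeries.constantCoeff (tens fun x : Fin H × Fin r => X x.1 L) = 1 :=
        constantCoeff_tens (fun x : Fin H × Fin r => X x.1 L) fun x => hX1 x.1 L
      apply (isUnit_of_constantCoeff_eq_one hXt).mul_left_cancel
      rw [← mul_assoc, ← tens_mul, ← mean_mul]
      simp only [← hone, ← tens_mul, ← hphi]
      exact h1
    have hJT : CT J (lc M (tens fun x : Fin H × Fin r => K x.1)) := fun n => by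
      have h1 := tendsto_of_mem_admissible hS (prod_mem (S := admissible E M S)
        (t := univ) fun (x : Fin H × Fin r) _ => hΨG x.1 (n x))
      rw [coeff_lc, coeff_tens]
      rw [Prod.snd_prod] at h1
      refine h1.congr fun L => ?_
      rw [coeff_mean]
      congr 1
      funext lam
      rw [coeff_tens, Prod.fst_prod, Finset.prod_apply, Finset.prod_apply]
    have hlt : ∀ L, IsLog (∑ x : Fin H × Fin r, emb x (lg (oneSeries (E L) x.1) - Z x.1 L))
        (tens fun x : Fin H × Fin r => Ψ₁ x.1 L) := fun L =>
      IsLog.sum_prod univ fun x _ => (hlΨ₁ x.1 L).emb x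
    have hlq : ∀ L, IsLog (lg (quotPhi (E L) r)) (quotPhi (E L) r) :=
      fun L => isLog_lg (constantCoeff_quotPhi (hN0 L) (hE L) r)
    have hlJ : ∀ L, IsLog (∑ x : Fin H × Fin r, emb x (lg (oneSeries (E L) x.1) - Z x.1 L) +
        lg (quotPhi (E L) r)) (J L) := fun L => hJ L ▸ (hlt L).add_mul (hlq L)
    obtain ⟨l, hl, hl'⟩ := CT.log (Eventually.of_forall hlJ) hJT
    rw [hl'.unique_left hlog] at hl
    have h2 := hl.sub (CT.sum univ fun (x : Fin H × Fin r) _ => (hC x.1).emb x)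
    simp only [add_sub_cancel_left] at h2
    exact h2

end Forward

end

/-! ### From the one-variable series to power sums. -/

section

open PowerSeries (C coeff coeff_C_mul coeff_mul)
open MvPolynomial (X)

section Backward

theorem IsPair.ext {H r : ℕ} {e e' : Fin H → ℕ → Fin H → ℕ → ℂ}
    {Λ Λ' : MvPowerSeries (Fin H × Fin r) ℂ} (h : IsPair e Λ) (h' : IsPair e' Λ')
    (he : ∀ a k b m, 0 < k → 0 < m → e a k b m = e' a k b m) : Λ = Λ' := by
  classical
  ext n
  by_cases hn : n.support.card = 2
  · obtain ⟨x, y, hxy, hx, hy, hn'⟩ := eq_single_add_single hn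
    rw [hn', h.pair x y hxy _ _ hx hy, h'.pair x y hxy _ _ hx hy, he _ _ _ _ hx hy]
  · rw [h.other n hn, h'.other n hn]

/-- The means of the coefficients are free, and they are chosen so that the mean of w(u) is minus
half its variance. Then E e^{w(u)} = 1 and the expectations of products have pair terms only, as for
the quotients. -/
theorem exists_gaussian_series {H : ℕ} {e : Fin H → ℕ → Fin H → ℕ → ℂ}
    (he : ∀ h k f m, 0 < k → 0 < m → e h k f m = e f m h k) :
    ∃ (M : MvPolynomial (ℕ × Fin H) ℂ →ₗ[ℂ] ℂ)
      (w : Fin H → PowerSeries (MvPolynomial (ℕ × Fin H) ℂ)), IsGaussian M (span ℂ (Set.range X)) ∧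
      (∀ h, PowerSeries.constantCoeff (w h) = 0) ∧ (∀ h n, coeff n (w h) ∈ span ℂ (Set.range X)) ∧
      (∀ h k f m, 0 < k → 0 < m → covCoeff M w h k f m = e h k f m) ∧ ∀ h, (lc M (w h) + C (1 / 2) *
        (lc M (w h * w h) - lc M (w h) * lc M (w h)) : PowerSeries ℂ) = 0 := by
  set e₀ : ℕ × Fin H → ℕ × Fin H → ℂ := fun a b =>
    if 0 < a.1 ∧ 0 < b.1 then e a.2 a.1 b.2 b.1 else 0 with he₀
  -- The n-th coefficient of the variance of w(u) is the sum of the covariances over all ways to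
  -- write n as an ordered sum.
  obtain ⟨M, hM, hμ, hcov⟩ := exists_gaussian (fun a : ℕ × Fin H => -(1 / 2) *
    ∑ q ∈ antidiagonal a.1, e₀ (q.1, a.2) (q.2, a.2)) e₀ (fun a b => by
      simp only [he₀]
      by_cases h : 0 < a.1 ∧ 0 < b.1
      · rw [if_pos h, if_pos h.symm, he _ _ _ _ h.1 h.2]
      · rw [if_neg h, if_neg fun h' => h h'.symm])
  set w : Fin H → PowerSeries (MvPolynomial (ℕ × Fin H) ℂ) := fun h => PowerSeries.mk fun n =>
    if n = 0 then 0 else X (n, h)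
  have hcov' : ∀ h k f m, covCoeff M w h k f m = e₀ (k, h) (m, f) := by
    intro h k f m
    rw [covCoeff, coeff_mk, coeff_mk]
    by_cases hk : k = 0
    · simp [hk, he₀]
    · by_cases hm : m = 0
      · simp [hm, he₀]
      · rw [if_neg hk, if_neg hm, hcov]
  refine ⟨M, w, hM, fun h => ?_, fun h n => ?_, fun h k f m hk hm => ?_, fun h => ?_⟩
  · rw [← coeff_zero_ps, coeff_mk, if_pos rfl]
  · rw [coeff_mk]
    split_ifs
    · exact zero_mem _
    · exact subset_span ⟨_, rfl⟩
  · rw [hcov', he₀]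
    exact if_pos ⟨hk, hm⟩
  · have hlc : ∀ (n : ℕ) J, coeff n (lc M J : PowerSeries ℂ) = M (coeff n J) :=
      fun n J => rfl
    refine PowerSeries.ext fun n => ?_
    rw [map_add, coeff_C_mul, map_sub, hlc, hlc, coeff_mul, coeff_mul, map_sum, ← sum_sub_distrib]
    simp only [hlc]
    rw [sum_congr rfl fun q _ => hcov' h q.1 h q.2, coeff_mk, map_zero]
    split_ifs with hn
    · subst hn
      simp [he₀]
    · rw [hμ]
      ring

variable {H : ℕ} {N : ℕ → Fin H → ℕ} (hN0 : ∀ L h, 0 < N L h)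
  (hN : ∀ h, Tendsto (fun L => 1 / (N L h : ℂ)) atTop (𝓝 0))
  {E : ∀ L, (Sig N L → ℂ) →ₗ[ℂ] ℂ} (hE : ∀ L, E L (fun _ => 1) = 1)

/-- Any monomial in the coefficients is a single coefficient of a product over many variables: the
i-th factor gets the i-th variable of its colour, and the unused variables contribute constant terms
1. -/
theorem prod_coeff_list {H : ℕ} {R : Type*} [CommRing R] {V : Fin H → PowerSeries R}
    (hV : ∀ h, coeff 0 (V h) = 1) (l : List (ℕ × Fin H)) : ∏ x : Fin H × Fin l.length,
      coeff (if (l.get x.2).2 = x.1 then (l.get x.2).1 else 0) (V x.1) =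
    (l.map fun b => coeff b.1 (V b.2)).prod := by
  rw [Fintype.prod_prod_type_right, ← Fin.prod_univ_fun_getElem]
  refine prod_congr rfl fun i _ => ?_
  rw [prod_eq_single (l.get i).2 (fun h _ hh => by rw [if_neg hh.symm, hV]) (by simp), if_pos rfl]
  rfl

include hN0 hN hE in
/-- The convergence of the logarithms of the one-variable series and of their products implies
Gaussian fluctuations of the power sums. -/
theorem exists_gaussian_limits {c : Fin H → PowerSeries ℂ} {e : Fin H → ℕ → Fin H → ℕ → ℂ}
    (hc : ∀ h, CT (fun L => C (1 / (N L h : ℂ)) * lg (oneSeries (E L) h)) (c h))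
    (he : ∀ r, ∃ b, CT (fun L => lg (quotPhi (E L) r)) b ∧ IsPair e b)
    {oi : PowerSeries ℂ} (ho : (1 + PowerSeries.X) * oi = 1) :
    ∃ (M : MvPolynomial (ℕ × Fin H) ℂ →ₗ[ℂ] ℂ)
      (w : Fin H → PowerSeries (MvPolynomial (ℕ × Fin H) ℂ))
      (S : Submonoid (RV (Sig N) × MvPolynomial (ℕ × Fin H) ℂ)),
      IsGaussian M (span ℂ (Set.range X)) ∧ (∀ h n, coeff n (w h) ∈ span ℂ (Set.range X)) ∧
      (∀ h k f m, 0 < k → 0 < m → covCoeff M w h k f m = e h k f m) ∧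
      (∀ s ∈ S, Tendsto (fun L => E L (s.1 L)) atTop (𝓝 (M s.2))) ∧
      ∀ k h, ∃ z, Tendsto z atTop (𝓝 (1 / ((k + 2 : ℕ) : ℂ) *
          coeff (k + 1) (gSeries (c h) ^ (k + 2) * oi))) ∧
        ((fun L lam => psum N (k, h) L lam - N L h * z L, coeff (k + 1)
          (PowerSeries.map (algebraMap ℂ _) (gSeries (c h) ^ (k + 1)) *
            (PowerSeries.X * derivative _ (w h)))) :
          RV (Sig N) × MvPolynomial (ℕ × Fin H) ℂ) ∈ admissible E M S := by
  -- With two variables per colour, the same coefficient of the limit is read in both orders.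
  have hsymm : ∀ h k f m, 0 < k → 0 < m → e h k f m = e f m h k := by
    intro h k f m hk hm
    obtain ⟨b, -, hb⟩ := he 2
    have hxy : ((h, 0) : Fin H × Fin 2) ≠ (f, 1) := by simp
    have h1 := hb.pair _ _ hxy k m hk hm
    rw [add_comm, hb.pair _ _ hxy.symm m k hm hk] at h1
    exact h1.symm
  obtain ⟨M, w, hM, hw0, hwL, hcov, hone⟩ := exists_gaussian_series hsymm
  let : Algebra ℚ (MvPolynomial (ℕ × Fin H) ℂ) := ((algebraMap ℂ _).comp (algebraMap ℚ ℂ)).toAlgebra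
  choose K hK using fun h => IsLog.exists_right (hw0 h)
  have hT1 := fun L h => constantCoeff_oneSeries (E := E L) (hN0 L) (hE L) h
  set Ψ : Fin H → ∀ L, Sig N L → PowerSeries ℂ := fun h L lam =>
    (oneSeries (E L) h)⁻¹ * phiSeries h lam
  have hΨ : ∀ h L lam, oneSeries (E L) h * Ψ h L lam = phiSeries h lam := fun h L lam => by
    rw [← mul_assoc, PowerSeries.mul_inv_cancel _ (by rw [hT1]; exact one_ne_zero), one_mul]
  have hlΨ : ∀ h L lam, IsLog (lg (phiSeries h lam) - lg (oneSeries (E L) h)) (Ψ h L lam) :=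
    fun h L lam => (isLog_lg (constantCoeff_phiSeries (hN0 L) h lam)).sub_div
      (isLog_oneSeries (hN0 L) (hE L) h) (hΨ h L lam)
  set V : Fin H → PowerSeries (RV (Sig N) × MvPolynomial (ℕ × Fin H) ℂ) := fun h =>
    pairS (Ψ h) (K h)
  have hV := fun h => isLog_pairS (hlΨ h) (hK h)
  -- The expectation of products of Ψ = φ / E φ is the quotient itself. Its logarithm tends to the
  -- pair series of covariances, which is also the logarithm of the Gaussian expectation.
  have hlim : ∀ r, CT (fun L => mean (E L) fun lam => tens fun x : Fin H × Fin r => Ψ x.1 L lam)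
      (lc M (tens fun x : Fin H × Fin r => K x.1)) := by
    intro r
    obtain ⟨b, hb, hbe⟩ := he r
    obtain ⟨Λ, hΛ, hΛ'⟩ := hM.exists_pair hwL hK r
    simp only [hone, map_zero, Finset.sum_const_zero, zero_add] at hΛ'
    obtain ⟨k, hk, hk'⟩ := CT.of_log (Eventually.of_forall fun L =>
      isLog_lg (constantCoeff_quotPhi (hN0 L) (hE L) r)) hb
    rw [hbe.ext hΛ fun h k f m hk hm => (hcov h k f m hk hm).symm] at hk'
    rw [← hk'.unique_right hΛ']
    convert hk using 2 with L
    apply (isUnit_of_constantCoeff_eq_one (constantCoeff_tens_oneSeries (hN0 L) (hE L) r)).mul_left_cancel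
    rw [tens_mul_quotPhi (hN0 L) (hE L), ← mean_mul]
    simp only [← tens_mul, hΨ]
  -- All monomials in the coefficients of φ / E φ, each paired with the corresponding monomial in
  -- the coefficients of e^w.
  set S : Submonoid (RV (Sig N) × MvPolynomial (ℕ × Fin H) ℂ) := Submonoid.closure
    (Set.range fun b : ℕ × Fin H => coeff b.1 (V b.2))
  refine ⟨M, w, S, hM, hwL, hcov, fun s hs => ?_, fun k h => ?_⟩
  · obtain ⟨l, hl, rfl⟩ := Submonoid.exists_list_of_mem_closure hs
    obtain ⟨l, rfl⟩ : ∃ l' : List (ℕ × Fin H), l = l'.map fun b => coeff b.1 (V b.2) := by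
      clear hs
      induction l with
      | nil => exact ⟨[], rfl⟩
      | cons x l ih =>
        obtain ⟨l', rfl⟩ := ih fun y hy => hl y (List.mem_cons_of_mem _ hy)
        obtain ⟨b, rfl⟩ := hl x List.mem_cons_self
        exact ⟨b :: l', rfl⟩
    rw [← prod_coeff_list (fun h => (coeff_zero_ps _).trans
      (hV h).right)]
    have h1 := hlim l.length (Finsupp.equivFunOnFinite.symm fun x : Fin H × Fin l.length =>
      if (l.get x.2).2 = x.1 then (l.get x.2).1 else 0)
    rw [coeff_lc, coeff_tens] at h1
    simp only [Finsupp.equivFunOnFinite_symm_apply_apply] at h1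
    rw [Prod.snd_prod]
    simp only [coeff_pairS]
    refine h1.congr fun L => ?_
    rw [coeff_mean]
    congr 1
    funext lam
    rw [coeff_tens, Prod.fst_prod, Finset.prod_apply, Finset.prod_apply]
    rfl
  · have hζ : ∀ n, ((fun L lam => coeff n (lg (phiSeries h lam) - lg (oneSeries (E L) h)),
        coeff n (w h)) : RV (Sig N) × MvPolynomial (ℕ × Fin H) ℂ) ∈ admissible E M S := by
      intro n
      have h1 := (hV h).coeff_left_mem (S := admissible E M S)
        (fun n => mem_admissible_of_mem (Submonoid.subset_closure ⟨(n, h), rfl⟩)) n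
      rwa [coeff_pairS] at h1
    choose J hJ using exists_powerSumSystem_psum hN0 h
    obtain ⟨j, hj⟩ := exists_powerSumSystem_dual (c h) (w h) oi ho
    -- The system is fed with (1/N) log φ = (1/N) log E φ + (1/N)(log φ - log E φ), paired with the
    -- dual series c + ε w.
    have hmem := (PowerSumSystem.pairS hJ hj).p_mem (S := fluctuation (admissible E M S)
        (span ℂ (Set.range X)) (fun L => 1 / (N L h : ℂ)) (hN h)
        (fun z z₀ hz => const_mem_admissible hz))
      (by
        have h1 := const_mem_fluctuation (G := admissible E M S)
          (𝓛 := span ℂ (Set.range X)) (hν := hN h)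
          (hG := fun z z₀ hz => const_mem_admissible hz) (hN h)
        rwa [map_zero, inl_zero] at h1)
      (exists_inv_mem_fluctuation (one_add_mul_inv_ne_zero hN0 h))
      (fun n => mem_fluctuation.mpr ⟨fun L => coeff n (C (1 / (N L h : ℂ)) *
        lg (oneSeries (E L) h)), coeff n (c h), _, hc h _, hζ n, hwL h n, by
          rw [coeff_pairS]
          refine Prod.ext ?_ (coeff_mk _ _)
          funext L lam
          simp only [coeff_C_mul, map_sub]
          ring⟩) k
    obtain ⟨z, z₀, y, hz, hy, -, hzy⟩ := mem_fluctuation.mp hmem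
    -- Comparison of the dual numbers: the part without ε identifies the limit of the deterministic
    -- sequence, where M with M(1) = 1 undoes the embedding of the scalars, and the ε-part
    -- identifies the limit of the fluctuation.
    have h1 := congrArg (fun x => M (TrivSqZeroExt.fst x.2)) hzy
    have hMz : ∀ z, M (algebraMap ℂ _ z) = z := fun z => by
      rw [algebraMap_eq_smul_one, map_smul, hM.one, smul_eq_mul, mul_one]
    simp only [fst_add, fst_inl, fst_inr, add_zero, hMz] at h1
    have h2 := congrArg (fun x => TrivSqZeroExt.snd x.2) hzy
    simp only [snd_add, snd_inl, snd_inr, zero_add] at h2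
    rw [← h1] at hz
    refine ⟨z, hz, ?_⟩
    convert hy using 1
    refine Prod.ext (funext fun L => funext fun lam => ?_) h2
    have h3 := congrFun (congrFun (congrArg Prod.fst hzy) L) lam
    have hN' : (N L h : ℂ) ≠ 0 := by exact_mod_cast (hN0 L h).ne'
    simp only at h3 ⊢
    field_simp at h3
    linear_combination h3

end Backward

end

/-! ### Moments and cumulants. -/

section Cumulants

variable {ι : Type} [DecidableEq ι]

/-- The joint cumulant of a set of random variables, in terms of their mixed moments `m`. -/
def kap (m : Finset ι → ℂ) (S : Finset ι) : ℂ :=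
  ∑ π : Finpartition S, (-1) ^ (π.parts.card - 1) * ((π.parts.card - 1).factorial : ℂ) *
    ∏ U ∈ π.parts, m U

/-- The set partitions of a finite set, as sets of blocks. -/
def parts (S : Finset ι) : Finset (Finset (Finset ι)) :=
  univ.image fun π : Finpartition S => π.parts

theorem mem_parts {S : Finset ι} {P : Finset (Finset ι)} :
    P ∈ parts S ↔ ∃ π : Finpartition S, π.parts = P := by simp [parts]

theorem kap_eq (m : Finset ι → ℂ) (S : Finset ι) : kap m S = ∑ P ∈ parts S,
    (-1) ^ (P.card - 1) * ((P.card - 1).factorial : ℂ) * ∏ U ∈ P, m U := by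
  rw [parts, Finset.sum_image fun _ _ _ _ h => Finpartition.ext h]
  rfl

/-- The recursion between moments and cumulants. -/
theorem moment_eq_sum_kap {m : Finset ι → ℂ} (h0 : m ∅ = 1) {i : ι} {T : Finset ι} (hi : i ∉ T) :
    m (insert i T) = ∑ C ∈ T.powerset, kap m (insert i C) * m (T \ C) := by
  set S := insert i T with hS
  set a : ℕ → ℂ := fun n => (-1) ^ (n - 1) * ((n - 1).factorial : ℂ)
  have hiS : i ∈ S := mem_insert_self i T
  have h1 : ∑ C ∈ T.powerset, kap m (insert i C) * m (T \ C) =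
      kap m S + ∑ U ∈ T.powerset.erase ∅, kap m (S \ U) * m U := by
    have e : ∑ C ∈ T.powerset, kap m (insert i C) * m (T \ C) =
        ∑ U ∈ T.powerset, kap m (S \ U) * m U := by
      refine sum_nbij' (T \ ·) (T \ ·) ?_ ?_ ?_ ?_ ?_
      · intro C _; simp
      · intro C _; simp
      · intro C hC; exact Finset.sdiff_sdiff_eq_self (mem_powerset.mp hC)
      · intro C hC; exact Finset.sdiff_sdiff_eq_self (mem_powerset.mp hC)
      · intro C hC
        rw [hS, Finset.insert_sdiff_of_notMem _ (by simp [hi]),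
          Finset.sdiff_sdiff_eq_self (mem_powerset.mp hC)]
    rw [e, ← add_sum_erase _ _ (Finset.empty_mem_powerset T), h0, mul_one, Finset.sdiff_empty]
  -- A nonempty U avoiding i together with a partition of S \ U is the same as a partition of S with
  -- a marked block that avoids i.
  have h2 : ∑ U ∈ T.powerset.erase ∅, kap m (S \ U) * m U =
      ∑ P ∈ parts S, ∑ U ∈ P.filter (i ∉ ·), a (P.card - 1) * ∏ V ∈ P, m V := by
    simp only [kap_eq, sum_mul]
    rw [Finset.sum_sigma', Finset.sum_sigma']
    refine sum_nbij' (fun x => ⟨insert x.1 x.2, x.1⟩) (fun x => ⟨x.2, x.1.erase x.2⟩)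
      ?_ ?_ ?_ ?_ ?_
    · rintro ⟨U, P⟩ hx
      simp only [mem_sigma, mem_erase, mem_powerset, mem_parts] at hx
      obtain ⟨⟨hU, hUT⟩, π, rfl⟩ := hx
      simp only [mem_sigma, mem_parts, mem_filter]
      exact ⟨⟨π.extend hU Finset.sdiff_disjoint (Finset.sdiff_union_of_subset
        (hUT.trans (Finset.subset_insert i T))), rfl⟩, mem_insert_self _ _,
        fun h => hi (hUT h)⟩
    · rintro ⟨P, U⟩ hx
      simp only [mem_sigma, mem_parts, mem_filter] at hx
      obtain ⟨⟨π, rfl⟩, hU, hiU⟩ := hx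
      simp only [mem_sigma, mem_erase, mem_powerset, mem_parts]
      refine ⟨⟨π.ne_bot hU, fun x hx => ?_⟩, π.ofSubset (Finset.erase_subset U _) ?_, rfl⟩
      · exact Finset.mem_of_mem_insert_of_ne (π.le hU hx) fun h => hiU (h ▸ hx)
      · ext x
        simp only [Finset.mem_sup, mem_erase, id, Finset.mem_sdiff]
        constructor
        · rintro ⟨V, ⟨hVU, hV⟩, hx⟩
          exact ⟨π.le hV hx, fun hxU => hVU (π.eq_of_mem_parts hV hU hx hxU)⟩
        · rintro ⟨hx, hxU⟩
          obtain ⟨V, hV, hxV⟩ := π.exists_mem hx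
          exact ⟨V, ⟨fun h => hxU (h ▸ hxV), hV⟩, hxV⟩
    · rintro ⟨U, P⟩ hx
      simp only [mem_sigma, mem_erase, mem_powerset, mem_parts] at hx
      obtain ⟨⟨hU, hUT⟩, π, rfl⟩ := hx
      have : U ∉ π.parts := fun h => hU (Finset.sdiff_disjoint.eq_bot_of_ge (π.le h))
      simp [Finset.erase_insert this]
    · rintro ⟨P, U⟩ hx
      simp only [mem_sigma, mem_filter] at hx
      simp [insert_erase hx.2.1]
    · rintro ⟨U, P⟩ hx
      simp only [mem_sigma, mem_erase, mem_powerset, mem_parts] at hx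
      obtain ⟨⟨hU, hUT⟩, π, rfl⟩ := hx
      have : U ∉ π.parts := fun h => hU (Finset.sdiff_disjoint.eq_bot_of_ge (π.le h))
      simp only [prod_insert this, card_insert_of_notMem this, Nat.add_sub_cancel, a]
      ring
  rw [h1, h2, kap_eq, ← sum_add_distrib, sum_eq_single {S}]
  · rw [sum_const, Finset.filter_singleton, if_neg (not_not.mpr hiS)]
    simp
  · intro P hP hPS
    obtain ⟨π, rfl⟩ := mem_parts.mp hP
    -- A partition with n + 2 blocks has n + 1 blocks that avoid i, and (-1)^n n! (n+1) cancels its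
    -- own coefficient (-1)^{n+1} (n+1)!. Only the partition with one block survives.
    obtain ⟨V, ⟨hV, hiV⟩, hu⟩ := π.existsUnique_mem hiS
    have hf : π.parts.filter (i ∉ ·) = π.parts.erase V := by
      ext U
      simp only [mem_filter, mem_erase]
      exact ⟨fun h => ⟨fun e => h.2 (e ▸ hiV), h.1⟩, fun h => ⟨h.2, fun e => h.1 (hu U ⟨h.2, e⟩)⟩⟩
    rw [sum_const, hf, Finset.card_erase_of_mem hV]
    obtain ⟨n, hn⟩ : ∃ n, π.parts.card = n + 2 := by
      have hc : 0 < π.parts.card := Finset.card_pos.mpr ⟨V, hV⟩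
      rcases Nat.lt_or_ge 1 π.parts.card with h | h
      · exact ⟨π.parts.card - 2, by omega⟩
      · obtain ⟨U, hU⟩ := card_eq_one.mp (by omega : π.parts.card = 1)
        have := π.sup_parts
        rw [hU, Finset.sup_singleton] at this
        exact absurd (hU.trans (congrArg _ this)) hPS
    simp only [hn, a, Nat.add_sub_cancel, nsmul_eq_mul, show n + 2 - 1 = n + 1 from rfl,
      factorial_succ]
    push_cast
    ring
  · intro h
    exact absurd (mem_parts.mpr ⟨Finpartition.indiscrete (Finset.ne_empty_of_mem hiS), rfl⟩) h

/-- The recursion between moments and cumulants determines the latter. -/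
theorem eq_kap {m K : Finset ι → ℂ} (h0 : m ∅ = 1) (hK : ∀ (i : ι) (T : Finset ι), i ∉ T →
    m (insert i T) = ∑ C ∈ T.powerset, K (insert i C) * m (T \ C)) {S : Finset ι}
    (hS : S.Nonempty) : K S = kap m S := by
  induction hn : S.card using Nat.strong_induction_on generalizing S with
  | _ n ih =>
    obtain ⟨i, hi⟩ := hS
    obtain ⟨T, hT, rfl⟩ : ∃ T, i ∉ T ∧ insert i T = S := ⟨S.erase i, by simp, insert_erase hi⟩
    have h1 := (hK i T hT).symm.trans (moment_eq_sum_kap h0 hT)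
    rw [← Finset.sum_erase_add _ _ (Finset.mem_powerset_self T),
      ← Finset.sum_erase_add _ _ (Finset.mem_powerset_self T), Finset.sdiff_self, h0, mul_one,
      mul_one, sum_congr rfl fun C hC => ?_] at h1
    · exact add_left_cancel h1
    · rw [mem_erase, mem_powerset] at hC
      have : C.card < T.card := Finset.card_lt_card (hC.2.ssubset_of_ne hC.1)
      rw [ih (insert i C).card _ ⟨i, by simp⟩ rfl]
      rw [← hn, card_insert_of_notMem hT, card_insert_of_notMem fun h => hT (hC.2 h)]
      omega

/-- Both sides satisfy the moment recursion, which determines the cumulants of nonempty sets. -/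
theorem kap_map {κ : Type} [DecidableEq κ] (f : κ ↪ ι) {m : Finset ι → ℂ} (h0 : m ∅ = 1)
    {S : Finset κ} (hS : S.Nonempty) : kap m (S.map f) = kap (fun U => m (U.map f)) S := by
  refine eq_kap (K := fun S => kap m (S.map f)) (by simpa using h0) (fun i T hi => ?_) hS
  rw [Finset.map_insert, moment_eq_sum_kap h0 (by simpa using hi)]
  refine (Finset.sum_nbij (fun C : Finset κ => C.map f) ?_ ?_ ?_ ?_).symm
  · intro C hC
    simpa using hC
  · intro C _ C' _ h
    exact Finset.map_injective f h
  · intro C hC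
    obtain ⟨C', hC', rfl⟩ := Finset.subset_map_iff.mp (mem_powerset.mp hC)
    exact ⟨C', by simpa using hC', rfl⟩
  · intro C _
    rw [Finset.map_insert, Finset.map_sdiff]

variable {Ω : Type} (E : (Ω → ℂ) →ₗ[ℂ] ℂ) (ξ : ι → Ω → ℂ)

/-- The mixed moments of a set of random variables. -/
def mom (S : Finset ι) : ℂ := E fun ω => ∏ j ∈ S, ξ j ω

variable {E}

theorem mom_empty (hE : E (fun _ => 1) = 1) : mom E ξ ∅ = 1 := by simpa [mom] using hE

/-- The recursion between moments and cumulants after a shift of all variables but one. -/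
theorem expectation_mul_prod_sub (hE : E (fun _ => 1) = 1) (a : ι → ℂ) {i : ι} {T : Finset ι}
    (hi : i ∉ T) : E (fun ω => ξ i ω * ∏ j ∈ T, (ξ j ω - a j)) =
      ∑ C ∈ T.powerset, kap (mom E ξ) (insert i C) * mom E (fun j ω => ξ j ω - a j) (T \ C) := by
  have hexp : ∀ (T : Finset ι) (η : Ω → ℂ), E (fun ω => η ω * ∏ j ∈ T, (ξ j ω - a j)) =
      ∑ R ∈ T.powerset, (∏ j ∈ T \ R, -a j) * E fun ω => η ω * ∏ j ∈ R, ξ j ω := by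
    intro T η
    have : (fun ω => η ω * ∏ j ∈ T, (ξ j ω - a j)) = ∑ R ∈ T.powerset,
        (∏ j ∈ T \ R, -a j) • fun ω => η ω * ∏ j ∈ R, ξ j ω := by
      funext ω
      simp only [sub_eq_add_neg, Finset.prod_add, Finset.sum_apply, Pi.smul_apply, smul_eq_mul,
        mul_sum]
      exact sum_congr rfl fun R _ => by ring
    rw [this, map_sum]
    exact sum_congr rfl fun R _ => E.map_smul _ _
  have h1 : ∀ R ∈ T.powerset, E (fun ω => ξ i ω * ∏ j ∈ R, ξ j ω) =
      ∑ C ∈ R.powerset, kap (mom E ξ) (insert i C) * mom E ξ (R \ C) := by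
    intro R hR
    have hiR : i ∉ R := fun h => hi (mem_powerset.mp hR h)
    rw [← moment_eq_sum_kap (mom_empty ξ hE) hiR, mom]
    simp only [prod_insert hiR]
  rw [hexp T (ξ i), sum_congr rfl fun R hR => by rw [h1 R hR, mul_sum]]
  rw [Finset.sum_comm' (t' := T.powerset) (s' := fun C => T.powerset.filter (C ⊆ ·)) (by
    intro R C
    simp only [mem_powerset, mem_filter]
    exact ⟨fun h => ⟨h, h.2.trans h.1⟩, fun h => h.1⟩)]
  refine sum_congr rfl fun C hC => ?_
  have h2 := hexp (T \ C) 1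
  simp only [Pi.one_apply, one_mul] at h2
  rw [mom, h2, mul_sum]
  refine sum_nbij' (· \ C) (· ∪ C) ?_ ?_ ?_ ?_ ?_
  · intro R hR
    simp only [mem_filter, mem_powerset] at hR ⊢
    exact Finset.sdiff_subset_sdiff hR.1 le_rfl
  · intro R hR
    simp only [mem_filter, mem_powerset] at hR hC ⊢
    exact ⟨Finset.union_subset (hR.trans Finset.sdiff_subset) hC, Finset.subset_union_right⟩
  · intro R hR
    exact Finset.sdiff_union_of_subset (mem_filter.mp hR).2
  · intro R hR
    refine Finset.union_sdiff_cancel_right (Finset.disjoint_of_subset_left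
      (mem_powerset.mp hR) Finset.sdiff_disjoint)
  · intro R hR
    rw [mom, sdiff_sdiff_left, sup_sdiff_cancel_right (mem_filter.mp hR).2]
    ring

/-- Cumulants of order at least two do not change when the variables are centered. -/
theorem kap_center (hE : E (fun _ => 1) = 1) {S : Finset ι} (hS : 2 ≤ S.card) :
    kap (mom E ξ) S = kap (mom E fun j ω => ξ j ω - E (ξ j)) S := by
  have h := eq_kap (m := mom E fun j ω => ξ j ω - E (ξ j)) (S := S)
    (K := fun S => if 2 ≤ S.card then kap (mom E ξ) S else 0) (mom_empty _ hE) (fun i T hi => ?_)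
    (Finset.card_pos.mp (by omega))
  · simpa [hS] using h
  · have h1 : kap (mom E ξ) {i} = E (ξ i) := by
      have := moment_eq_sum_kap (mom_empty ξ hE) (notMem_empty i)
      simp only [Finset.powerset_empty, sum_singleton, Finset.sdiff_self, insert_empty_eq,
        mom_empty ξ hE, mul_one] at this
      rw [← this, mom]
      simp
    have h2 : mom E (fun j ω => ξ j ω - E (ξ j)) (insert i T) = E (fun ω => ξ i ω *
        ∏ j ∈ T, (ξ j ω - E (ξ j))) - E (ξ i) * mom E (fun j ω => ξ j ω - E (ξ j)) T := by
      have h3 := E.map_smul (E (ξ i)) fun ω => ∏ j ∈ T, (ξ j ω - E (ξ j))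
      rw [mom, mom, ← smul_eq_mul (E (ξ i)), ← h3, ← map_sub]
      congr 1
      funext ω
      simp only [prod_insert hi, Pi.sub_apply, Pi.smul_apply, smul_eq_mul]
      ring
    rw [h2, expectation_mul_prod_sub ξ hE _ hi, ← add_sum_erase _ _
      (Finset.empty_mem_powerset T), ← add_sum_erase T.powerset _
      (Finset.empty_mem_powerset T), Finset.sdiff_empty, insert_empty_eq, h1, add_sub_cancel_left]
    simp only [Finset.card_singleton, Nat.not_ofNat_le_one, if_false, zero_mul, zero_add]
    refine sum_congr rfl fun C hC => ?_
    rw [mem_erase, mem_powerset] at hC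
    rw [if_pos]
    rw [card_insert_of_notMem fun h => hi (hC.2 h)]
    have := Finset.card_pos.mpr (Finset.nonempty_iff_ne_empty.mpr hC.1)
    omega

/-- Cumulants of centered Gaussian variables. -/
theorem kap_gaussian {A : Type*} [CommRing A] [Algebra ℂ A] {M : A →ₗ[ℂ] ℂ} {𝓛 : Submodule ℂ A}
    (hM : IsGaussian M 𝓛) {y : ι → A} (hy : ∀ j, y j ∈ 𝓛) {S : Finset ι} (hS : S.Nonempty) :
    kap (fun U => M (∏ j ∈ U, (y j - algebraMap ℂ A (M (y j))))) S =
      if S.card = 2 then M (∏ j ∈ S, (y j - algebraMap ℂ A (M (y j)))) else 0 := by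
  symm
  refine eq_kap (K := fun S => if S.card = 2 then M (∏ j ∈ S, (y j - algebraMap ℂ A (M (y j))))
    else 0) (by simpa using hM.one) (fun i T hi => ?_) hS
  obtain ⟨D, hD, hDw⟩ := hM.parts (y i) (hy i)
  set v : ι → A := fun j => y j - algebraMap ℂ A (M (y j)) with hv
  have hv' : ∀ P, M (v i * P) = M (D P) := fun P => by
    rw [hv, sub_mul, map_sub, hD, ← smul_def, map_smul, smul_eq_mul]
    ring
  have hDv : ∀ j, D (v j) = algebraMap ℂ A (M (v i * v j)) := fun j => by
    have h1 : D (v j) = D (y j) := by rw [hv]; simp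
    rw [hv', h1, hDw _ (hy j), algebraMap_eq_smul_one (_ - _), map_smul, hM.one,
      smul_eq_mul, mul_one, algebraMap_eq_smul_one]
  -- Wick's rule: integration by parts pairs v_i with one other factor and leaves the rest of the
  -- product.
  have hDP : ∀ T : Finset ι, D (∏ j ∈ T, v j) = ∑ j ∈ T, M (v i * v j) • ∏ l ∈ T \ {j}, v l := by
    intro T
    induction T using Finset.induction_on with
    | empty => simp
    | insert a T ha ih =>
      rw [prod_insert ha, leibniz, ih, hDv, sum_insert ha, add_comm,
        Finset.insert_sdiff_of_mem _ (Finset.mem_singleton_self a),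
        Finset.sdiff_singleton_eq_erase, Finset.erase_eq_of_notMem ha, smul_eq_mul, mul_comm, ← smul_def, Finset.smul_sum]
      congr 1
      refine sum_congr rfl fun j hj => ?_
      have haj : a ∉ ({j} : Finset ι) := by
        rw [mem_singleton]
        exact fun h => ha (h ▸ hj)
      rw [Finset.insert_sdiff_of_notMem _ haj, prod_insert (by simp [ha]), smul_eq_mul,
        mul_smul_comm]
  rw [prod_insert hi, hv', hDP, map_sum]
  symm
  -- The candidate cumulants live on two-element sets, so only the singletons C contribute to the
  -- recursion.
  rw [← sum_subset (s₁ := T.map ⟨singleton, Finset.singleton_injective⟩)]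
  · rw [sum_map]
    refine sum_congr rfl fun j hj => ?_
    have hij : i ∉ ({j} : Finset ι) := by
      rw [mem_singleton]
      exact fun h => hi (h ▸ hj)
    simp only [Function.Embedding.coeFn_mk]
    rw [card_insert_of_notMem hij, Finset.card_singleton, if_pos rfl,
      prod_insert hij, Finset.prod_singleton, map_smul, smul_eq_mul]
  · intro C hC
    obtain ⟨j, hj, rfl⟩ := Finset.mem_map.mp hC
    simpa using hj
  · intro C hC hC'
    rw [if_neg, zero_mul]
    rw [card_insert_of_notMem fun h => hi (mem_powerset.mp hC h)]
    intro h
    obtain ⟨j, rfl⟩ := card_eq_one.mp (by omega : C.card = 1)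
    exact hC' (Finset.mem_map.mpr ⟨j, by simpa using hC, rfl⟩)

end Cumulants

/-! ### Gaussian limits in terms of centered moments and of cumulants. -/

section Convergence

variable {I : Type} {Ω : ℕ → Type} {E : ∀ L, (Ω L → ℂ) →ₗ[ℂ] ℂ} (hE : ∀ L, E L (fun _ => 1) = 1)
  (ξ : I → RV Ω) {A : Type*} [CommRing A] [Algebra ℂ A] {M : A →ₗ[ℂ] ℂ} {𝓛 : Submodule ℂ A}
  (hM : IsGaussian M 𝓛) {y : I → A} (hy : ∀ a, y a ∈ 𝓛)

/-- The mixed moments of the centered variables. -/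
def cmom (E : ∀ L, (Ω L → ℂ) →ₗ[ℂ] ℂ) (ξ : I → RV Ω) {r : ℕ} (b : Fin r → I) (L : ℕ)
    (S : Finset (Fin r)) : ℂ := mom (E L) (fun j ω => ξ (b j) L ω - E L (ξ (b j) L)) S

/-- The limits of these moments. -/
def limMom (M : A →ₗ[ℂ] ℂ) (y : I → A) {r : ℕ} (b : Fin r → I) (S : Finset (Fin r)) : ℂ :=
  M (∏ j ∈ S, (y (b j) - algebraMap ℂ A (M (y (b j)))))

include hE

theorem cmom_singleton {r : ℕ} (b : Fin r → I) (L : ℕ) (i : Fin r) : cmom E ξ b L {i} = 0 := by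
  have h1 := (E L).map_smul (E L (ξ (b i) L)) fun _ => 1
  have h2 := (E L).map_sub (ξ (b i) L) (E L (ξ (b i) L) • fun _ => 1)
  rw [h1, hE, smul_eq_mul, mul_one, sub_self] at h2
  rw [cmom, mom, ← h2]
  congr 1
  funext ω
  simp

theorem cmom_pair {r : ℕ} (b : Fin r → I) (L : ℕ) {i j : Fin r} (hij : i ≠ j) :
    cmom E ξ b L {i, j} = E L (fun ω => ξ (b i) L ω * ξ (b j) L ω) -
      E L (ξ (b i) L) * E L (ξ (b j) L) := by
  set x := E L (ξ (b i) L)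
  set z := E L (ξ (b j) L)
  have h1 := (E L).map_smul x (ξ (b j) L)
  have h2 := (E L).map_smul z (ξ (b i) L)
  have h3 := (E L).map_smul (x * z) fun _ => 1
  have h4 : cmom E ξ b L {i, j} = E L ((fun ω => ξ (b i) L ω * ξ (b j) L ω) - x • ξ (b j) L -
      z • ξ (b i) L + (x * z) • fun _ => 1) := by
    rw [cmom, mom]
    congr 1
    funext ω
    simp only [prod_pair hij, Pi.add_apply, Pi.sub_apply, Pi.smul_apply, smul_eq_mul]
    ring
  rw [h4, map_add, map_sub, map_sub, h1, h2, h3, hE]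
  simp only [smul_eq_mul]
  ring

theorem kap_cmom_pair {r : ℕ} (b : Fin r → I) (L : ℕ) {i j : Fin r} (hij : i ≠ j) :
    kap (cmom E ξ b L) {i, j} = cmom E ξ b L {i, j} := by
  have h0 : cmom E ξ b L ∅ = 1 := mom_empty _ (hE L)
  rw [moment_eq_sum_kap h0 (by simpa using hij), ← insert_empty_eq j,
    Finset.sum_powerset_insert (notMem_empty j)]
  simp [cmom_singleton hE, h0]

include hM hy

/-- First cumulants vanish by centering and second ones are the covariances. Higher ones are not
affected by centering, so they tend to 0 by `h3` after the set is numbered by its order embedding.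
-/
theorem tendsto_kap_cmom
    (h2 : ∀ a b, Tendsto (fun L => E L (fun ω => ξ a L ω * ξ b L ω) - E L (ξ a L) * E L (ξ b L))
      atTop (𝓝 (M ((y a - algebraMap ℂ A (M (y a))) * (y b - algebraMap ℂ A (M (y b)))))))
    (h3 : ∀ r, 2 < r → ∀ b : Fin r → I,
      Tendsto (fun L => kap (mom (E L) fun j => ξ (b j) L) univ) atTop (𝓝 0))
    {r : ℕ} (b : Fin r → I) {S : Finset (Fin r)} (hS : S.Nonempty) :
    Tendsto (fun L => kap (cmom E ξ b L) S) atTop (𝓝 (kap (limMom M y b) S)) := by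
  have hk : kap (limMom M y b) S = if S.card = 2 then limMom M y b S else 0 :=
    kap_gaussian hM (y := fun j => y (b j)) (fun j => hy _) hS
  rw [hk]
  rcases Nat.lt_trichotomy S.card 2 with h | h | h
  · obtain ⟨i, rfl⟩ := card_eq_one.mp
      (le_antisymm (Nat.le_of_lt_succ h) (Finset.card_pos.mpr hS))
    rw [if_neg h.ne]
    refine tendsto_const_nhds.congr fun L => ?_
    have h4 := moment_eq_sum_kap (m := cmom E ξ b L) (mom_empty _ (hE L)) (notMem_empty i)
    rw [Finset.powerset_empty, sum_singleton, Finset.sdiff_self, insert_empty_eq,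
      cmom_singleton hE, show cmom E ξ b L ∅ = 1 from mom_empty _ (hE L), mul_one] at h4
    exact h4
  · obtain ⟨i, j, hij, rfl⟩ := Finset.card_eq_two.mp h
    rw [if_pos h, limMom, prod_pair hij]
    exact (h2 (b i) (b j)).congr fun L => by rw [kap_cmom_pair hE ξ b L hij, cmom_pair hE ξ b L hij]
  · rw [if_neg h.ne']
    refine (h3 S.card h fun j => b (S.orderEmbOfFin rfl j)).congr fun L => ?_
    have h4 := kap_map (S.orderEmbOfFin rfl).toEmbedding (mom_empty (fun j => ξ (b j) L) (hE L))
      (S := univ) (by rw [← Finset.card_pos, card_univ, card_fin]; omega)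
    have h5 : univ.map (S.orderEmbOfFin rfl).toEmbedding = S := by
      rw [Finset.map_eq_image]
      exact Finset.image_orderEmbOfFin_univ S rfl
    rw [h5, kap_center _ (hE L) h.le] at h4
    refine Eq.trans (congrArg (kap · univ) ?_) h4.symm
    funext U
    simp only [mom, prod_map]
    rfl

/-- Moments are recovered from cumulants by the recursion, with induction on the number of factors.
-/
theorem tendsto_cmom
    (h2 : ∀ a b, Tendsto (fun L => E L (fun ω => ξ a L ω * ξ b L ω) - E L (ξ a L) * E L (ξ b L))
      atTop (𝓝 (M ((y a - algebraMap ℂ A (M (y a))) * (y b - algebraMap ℂ A (M (y b)))))))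
    (h3 : ∀ r, 2 < r → ∀ b : Fin r → I,
      Tendsto (fun L => kap (mom (E L) fun j => ξ (b j) L) univ) atTop (𝓝 0))
    {r : ℕ} (b : Fin r → I) (S : Finset (Fin r)) :
    Tendsto (fun L => cmom E ξ b L S) atTop (𝓝 (limMom M y b S)) := by
  have h0 : ∀ L, cmom E ξ b L ∅ = 1 := fun L => mom_empty _ (hE L)
  have h0' : limMom M y b ∅ = 1 := by simpa [limMom] using hM.one
  induction hn : S.card using Nat.strong_induction_on generalizing S with
  | _ n ih =>
    rcases S.eq_empty_or_nonempty with rfl | ⟨i, hi⟩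
    · rw [h0']
      exact tendsto_const_nhds.congr fun L => (h0 L).symm
    · obtain ⟨T, hT, rfl⟩ : ∃ T, i ∉ T ∧ insert i T = S := ⟨S.erase i, by simp, insert_erase hi⟩
      rw [moment_eq_sum_kap h0' hT]
      refine Tendsto.congr (fun L => (moment_eq_sum_kap (h0 L) hT).symm) ?_
      refine tendsto_finsetSum _ fun C _ => (tendsto_kap_cmom hE ξ hM hy h2 h3 b ⟨i, by simp⟩).mul
        (ih _ ?_ _ rfl)
      rw [← hn, card_insert_of_notMem hT]
      exact Nat.lt_succ_of_le (Finset.card_le_card Finset.sdiff_subset)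

/-- Cumulants are polynomials in the centered moments, and Gaussian cumulants of order above two
vanish. -/
theorem tendsto_kap_of_cmom
    (h : ∀ {r : ℕ} (b : Fin r → I) (S : Finset (Fin r)),
      Tendsto (fun L => cmom E ξ b L S) atTop (𝓝 (limMom M y b S))) {r : ℕ} (hr : 2 < r)
    (b : Fin r → I) : Tendsto (fun L => kap (mom (E L) fun j => ξ (b j) L) univ) atTop (𝓝 0) := by
  have hk := kap_gaussian hM (y := fun j => y (b j)) (fun j => hy _) (S := univ)
    ⟨⟨0, by omega⟩, mem_univ _⟩
  rw [if_neg (by rw [card_univ, card_fin]; omega)] at hk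
  rw [← hk]
  simp only [fun L => kap_center (E := E L) (fun j => ξ (b j) L) (hE L) (S := univ)
    (by rw [card_univ, card_fin]; omega)]
  exact tendsto_finsetSum _ fun π _ => (tendsto_finsetProd _ fun U _ => h b U).const_mul _

end Convergence

/-! ### Coefficients of log ((w g(z) - z g(w)) / (w - z)) against powers of g. -/

section

open PowerSeries (C X coeff coeff_C coeff_C_mul coeff_map coeff_mul)
open MvPowerSeries (pderiv)
open Finsupp (single)

section Slices

variable {g : PowerSeries ℂ} (hg : PowerSeries.constantCoeff g = 1)

/-- The power series of power series with the coefficients of a power series in two variables. -/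
def nest (F : MvPowerSeries (Fin 2) ℂ) : PowerSeries (PowerSeries ℂ) :=
  PowerSeries.mk fun n => PowerSeries.mk fun j =>
    MvPowerSeries.coeff (single 0 n + single 1 j) F

theorem nest_mul (F G : MvPowerSeries (Fin 2) ℂ) : nest (F * G) = nest F * nest G := by
  refine PowerSeries.ext fun n => PowerSeries.ext fun j => ?_
  rw [coeff_mul, map_sum]
  simp only [nest, coeff_mk, coeff_mul, MvPowerSeries.coeff_mul]
  rw [← Finset.sum_product']
  have e : ∀ f : Fin 2 →₀ ℕ, single 0 (f 0) + single 1 (f 1) = f := fun f => by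
    ext i
    fin_cases i <;> simp
  refine sum_nbij' (fun p => ((p.1 0, p.2 0), (p.1 1, p.2 1)))
    (fun q => (single 0 q.1.1 + single 1 q.2.1, single 0 q.1.2 + single 1 q.2.2)) ?_ ?_ ?_ ?_ ?_
  · intro p hp
    rw [mem_antidiagonal] at hp
    have h0 := DFunLike.congr_fun hp 0
    have h1 := DFunLike.congr_fun hp 1
    simp at h0 h1
    simpa using ⟨h0, h1⟩
  · intro q hq
    simp only [Finset.mem_product, mem_antidiagonal] at hq ⊢
    rw [← hq.1, ← hq.2, single_add, single_add]
    abel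
  · intro p _
    simp only [e]
  · intro q _
    simp
  · intro p _
    simp only [e]

/-- The defining identity (w - z) q2 = w g(z) - z g(w), with z as the outer and w as the inner
variable. -/
theorem sub_mul_nest_q2 : (C X - X) * nest (q2 g) = C X * PowerSeries.map C g - X * C g := by
  have hq : ∀ n j, coeff j (coeff n (nest (q2 g))) = if n = 0 then (if j = 0 then coeff 0 g else 0)
      else if j = 0 then 0 else -coeff (n + j) g := fun n j => by
    simp [nest, coeff_q2]
  refine PowerSeries.ext fun n => PowerSeries.ext fun j => ?_
  have hs : ∀ (m : ℕ) (F : PowerSeries (PowerSeries ℂ)), coeff (m + 1)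
      (X * F) = coeff m F := fun m F => coeff_succ_X_mul m F
  have hs' : ∀ (m : ℕ) (F : PowerSeries ℂ), coeff (m + 1)
      (X * F) = coeff m F := fun m F => coeff_succ_X_mul m F
  rw [sub_mul, map_sub, map_sub, coeff_C_mul, map_sub, map_sub, coeff_C_mul, coeff_map]
  rcases n with _ | _ | n <;> rcases j with _ | _ | j <;>
    simp only [hs, hs', coeff_zero_X_mul, hq, coeff_C, succ_ne_zero,
      if_true, if_false, zero_add, map_zero] <;> ring_nf

/-- The coefficients, as power series in `w`, of the derivative in `w` of the logarithm of
`q2 g`. -/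
def ellSeries (g : PowerSeries ℂ) (n : ℕ) : PowerSeries ℂ :=
  PowerSeries.mk fun j => (j + 1 : ℕ) * ell g n (j + 1)

include hg

/-- Multiplying ∂_w q2 = (∂_w log q2) q2 by w - z gives a relation that is linear in ∂_w log q2 with
the coefficient w g(z) - z g(w). This is its part of degree n + 1 in z. -/
theorem ellSeries_relation (n : ℕ) (hn : 0 < n) : X * ∑ x ∈ antidiagonal (n + 1),
      C (coeff x.1 g) * ellSeries g x.2 - g * ellSeries g n =
    PowerSeries.mk fun j => coeff (n + 1 + j) g := by
  have hD : ∀ (F : MvPowerSeries (Fin 2) ℂ) m, coeff m (nest (pderiv ℂ 1 F)) =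
      derivative ℂ (coeff m (nest F)) := by
    intro F m
    refine PowerSeries.ext fun j => ?_
    rw [coeff_derivative]
    simp only [nest, coeff_mk, MvPowerSeries.coeff_pderiv]
    rw [add_assoc, ← single_add]
    simp
  have hT : ∀ m, coeff m (nest (pderiv ℂ 1 (lg (q2 g)))) =
      ellSeries g m := by
    intro m
    rw [hD]
    refine PowerSeries.ext fun j => ?_
    rw [coeff_derivative, ellSeries, nest]
    simp only [coeff_mk, ell]
    push_cast
    ring
  set Q := nest (q2 g)
  set T := nest (pderiv ℂ 1 (lg (q2 g)))
  have h1 : nest (pderiv ℂ 1 (q2 g)) = T * Q := by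
    rw [(isLog_lg (constantCoeff_q2 g hg)).deriv 1, nest_mul]
  have h2 : (C X - X) * nest (pderiv ℂ 1 (q2 g)) = (C X * PowerSeries.map C g - X * C g) * T := by
    rw [h1, ← sub_mul_nest_q2]
    ring
  obtain ⟨n, rfl⟩ : ∃ m, n = m + 1 := ⟨n - 1, by omega⟩
  have h3 := congrArg (coeff (n + 1 + 1)) h2
  have h4 := congrArg (fun F => derivative ℂ (coeff (n + 1 + 1) F))
    (sub_mul_nest_q2 (g := g))
  have hs : ∀ (m : ℕ) (F : PowerSeries (PowerSeries ℂ)), coeff (m + 1)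
      (X * F) = coeff m F := fun m F => coeff_succ_X_mul m F
  simp only [sub_mul, mul_assoc, map_sub, coeff_C_mul, hs, hD,
    coeff_map, leibniz, derivative_X, coeff_C,
    derivative_C, smul_eq_mul, hT, mul_one, mul_zero, succ_ne_zero,
    if_false, zero_add, sub_zero] at h3 h4
  rw [coeff_mul] at h3
  simp only [coeff_map, hT] at h3
  rw [← h3]
  have h5 : X * derivative ℂ (coeff (n + 1 + 1) (nest (q2 g))) -
      derivative ℂ (coeff (n + 1) (nest (q2 g))) = C (coeff (n + 1 + 1) g) -
        coeff (n + 1 + 1) (nest (q2 g)) := by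
    linear_combination h4
  rw [h5]
  refine PowerSeries.ext fun j => ?_
  rw [map_sub, coeff_C, nest, coeff_mk, coeff_mk, coeff_mk, coeff_q2]
  rcases j with _ | j <;> simp

/-- By induction on K: multiply the preceding relation by g^{K+1} and take the coefficient of
w^{K+1}. The left part is known by induction, and together with the right side it completes the
convolution for g · g^{K+1}. This identity is the origin of the δ-term in the covariance. -/
theorem coeff_ellSeries_mul_pow (K n : ℕ) (hn : 0 < n) :
    coeff K (ellSeries g n * g ^ (K + 1)) = -coeff (K + 1 + n) (g ^ (K + 1)) := by
  have h0 : ellSeries g 0 = 0 := by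
    ext j
    rw [ellSeries, coeff_mk, ell_zero_left hg, mul_zero, map_zero]
  induction K generalizing n with
  | zero =>
    have h := congrArg (coeff 0) (ellSeries_relation hg n hn)
    simp only [map_sub, coeff_zero_X_mul, zero_sub, coeff_mk] at h
    rw [zero_add, pow_one, mul_comm, add_comm 1, ← h, neg_neg]
  | succ K ih =>
    have h := congrArg (fun F => coeff (K + 1) (F * g ^ (K + 1)))
      (ellSeries_relation hg n hn)
    simp only [sub_mul, map_sub] at h
    rw [mul_assoc, coeff_succ_X_mul, sum_mul, map_sum,
      Finset.Nat.sum_antidiagonal_eq_sum_range_succ_mk, sum_range_succ] at h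
    simp only [Nat.sub_self, h0, mul_zero, zero_mul, map_zero, add_zero] at h
    rw [sum_congr rfl fun i hi => by
      rw [mul_assoc, coeff_C_mul, ih (n + 1 - i) (by
        rw [mem_range] at hi; omega)], coeff_mul _ (PowerSeries.mk _),
      Finset.Nat.sum_antidiagonal_eq_sum_range_succ_mk] at h
    have e1 : ellSeries g n * g ^ (K + 1 + 1) = g * ellSeries g n * g ^ (K + 1) := by ring
    rw [e1, ← sub_eq_iff_eq_add.mpr (sub_eq_iff_eq_add'.mp h), pow_succ' g (K + 1),
      coeff_mul _ g, Finset.Nat.sum_antidiagonal_eq_sum_range_succ_mk,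
      show (K + 1 + 1 + n).succ = (n + 1) + (K + 1).succ from by omega,
      Finset.sum_range_add _ (n + 1) (K + 1).succ, neg_add, ← Finset.sum_neg_distrib, sub_eq_add_neg]
    simp only [coeff_mk]
    congr 1
    · refine sum_congr rfl fun i hi => ?_
      rw [mem_range] at hi
      rw [show K + 1 + (n + 1 - i) = K + 1 + 1 + n - i from by omega]
      ring
    · congr 1
      refine sum_congr rfl fun i hi => ?_
      rw [show K + 1 + 1 + n - (n + 1 + i) = K + 1 - i from by omega]

end Slices

end

/-! ### Closed forms: finite sums, Laurent series, universal polynomials. -/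

section

open HahnSeries (C)
open PowerSeries (X coeff coeff_C_mul coeff_map coeff_mul)

section ClosedForms

variable {R : Type*} [CommRing R]

/-- The series `(1 + X) (1 + ∑ c_a X^{a+1})`. -/
def gOf (c : ℕ → R) : PowerSeries R := (1 + X) * (1 + X * PowerSeries.mk c)

/-- The series `1 / (1 + X)`. -/
def altSeries (R : Type*) [CommRing R] : PowerSeries R := PowerSeries.mk fun n => (-1) ^ n

/-- The closed form of the limits of the means. -/
def meanSum [Algebra ℚ R] (g : PowerSeries R) (k : ℕ) : R :=
  algebraMap ℚ R (1 / ((k + 2 : ℕ) : ℚ)) * coeff (k + 1) (g ^ (k + 2) * altSeries R)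

/-- The closed form of the limits of the covariances. -/
def covSum (δ : Prop) [Decidable δ] (g₁ g₂ : PowerSeries R) (d : ℕ → ℕ → R) (k₁ k₂ : ℕ) : R :=
  ∑ x ∈ antidiagonal k₁, coeff x.1 (g₁ ^ (k₁ + 1)) *
    ((if δ then ((x.2 + 1 : ℕ) : R) * coeff (k₂ + 2 + x.2) (g₂ ^ (k₂ + 1)) else 0) +
      ∑ y ∈ antidiagonal k₂, coeff y.1 (g₂ ^ (k₂ + 1)) * d x.2 y.2)

theorem one_add_X_mul_altSeries : (1 + X) * altSeries R = 1 := by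
  refine PowerSeries.ext fun n => ?_
  rw [add_mul, one_mul, map_add, altSeries, coeff_mk, PowerSeries.coeff_one]
  rcases n with _ | n
  · simp
  · rw [coeff_succ_X_mul, coeff_mk, pow_succ, if_neg (succ_ne_zero n)]
    ring

variable {S : Type*} [CommRing S]

theorem map_gOf (f : R →+* S) (c : ℕ → R) : PowerSeries.map f (gOf c) = gOf fun a => f (c a) := by
  have h : PowerSeries.map f (PowerSeries.mk c) = PowerSeries.mk fun a => f (c a) :=
    PowerSeries.ext fun n => by simp
  rw [gOf, map_mul, map_add, map_add, map_mul, map_one, PowerSeries.map_X, h, gOf]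

theorem map_meanSum [Algebra ℚ R] [Algebra ℚ S] (f : R →ₐ[ℚ] S) (g : PowerSeries R) (k : ℕ) :
    f (meanSum g k) = meanSum (PowerSeries.map (f : R →+* S) g) k := by
  have h : altSeries S = PowerSeries.map (f : R →+* S) (altSeries R) :=
    PowerSeries.ext fun n => by simp [altSeries]
  rw [meanSum, meanSum, h, ← map_pow, ← map_mul, coeff_map, map_mul, commutes]
  rfl

theorem map_covSum (f : R →+* S) (δ : Prop) [Decidable δ] (g₁ g₂ : PowerSeries R) (d : ℕ → ℕ → R)
    (k₁ k₂ : ℕ) : f (covSum δ g₁ g₂ d k₁ k₂) =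
      covSum δ (PowerSeries.map f g₁) (PowerSeries.map f g₂) (fun a b => f (d a b)) k₁ k₂ := by
  simp only [covSum, map_sum, map_mul, map_add, apply_ite f, map_zero, map_natCast, ← map_pow,
    coeff_map]

end ClosedForms

section Covariance

theorem gSeries_cSeries (c : ℕ+ → ℂ) :
    gSeries (cSeries c) = gOf fun a => c a.succPNat / (a.factorial : ℂ) := by
  rw [gSeries, gOf]
  congr 3
  refine PowerSeries.ext fun n => ?_
  rw [coeff_derivative, cSeries, coeff_mk, coeff_mk, dif_pos n.succ_pos, factorial_succ]
  have h1 : (n.factorial : ℂ) ≠ 0 := by exact_mod_cast n.factorial_ne_zero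
  have h2 : (n + 1 : ℂ) ≠ 0 := by exact_mod_cast n.succ_ne_zero
  push_cast
  field_simp
  rfl

variable {H : ℕ} {A : Type*} [CommRing A] [Algebra ℂ A] {M : A →ₗ[ℂ] ℂ} {w : Fin H → PowerSeries A}
  {g : Fin H → PowerSeries ℂ} (hg : ∀ h, PowerSeries.constantCoeff (g h) = 1)
  {d : ℕ+ → Fin H → ℕ+ → Fin H → ℂ}

/-- The fluctuation of the power sum of degree `k + 1`. -/
def fluctP (g : Fin H → PowerSeries ℂ) (w : Fin H → PowerSeries A) (b : ℕ × Fin H) : A :=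
  coeff (b.1 + 1) (PowerSeries.map (algebraMap ℂ A) (g b.2 ^ (b.1 + 1)) *
    (X * derivative A (w b.2)))

theorem fluctP_eq (b : ℕ × Fin H) : fluctP g w b = ∑ x ∈ antidiagonal b.1,
    (coeff x.1 (g b.2 ^ (b.1 + 1)) * (x.2 + 1 : ℕ)) •
      coeff (x.2 + 1) (w b.2) := by
  rw [fluctP, mul_left_comm, coeff_succ_X_mul, coeff_mul]
  refine sum_congr rfl fun x _ => ?_
  rw [coeff_derivative, coeff_map, smul_def, map_mul, map_natCast]
  push_cast
  ring

include hg

/-- The limiting fluctuations are linear in the coefficients of w, so the covariance is a double sum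
of d - ell. The weights k and m from u w' lower the factorials in d by one, and the sum with ell is
evaluated by `coeff_ellSeries_mul_pow`. -/
theorem covariance_fluctP (hcov : ∀ h k f m, 0 < k → 0 < m →
      covCoeff M w h k f m = dCoeff d h k f m - ellCoeff g h k f m) (a b : ℕ × Fin H) :
    M (fluctP g w a * fluctP g w b) - M (fluctP g w a) * M (fluctP g w b) =
      covSum (a.2 = b.2) (g a.2) (g b.2) (fun i j => d i.succPNat a.2 j.succPNat b.2 /
        ((i.factorial : ℂ) * (j.factorial : ℂ))) a.1 b.1 := by
  have h1 : M (fluctP g w a * fluctP g w b) - M (fluctP g w a) * M (fluctP g w b) =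
      ∑ x ∈ antidiagonal a.1, ∑ y ∈ antidiagonal b.1,
        coeff x.1 (g a.2 ^ (a.1 + 1)) * (x.2 + 1 : ℕ) *
        (coeff y.1 (g b.2 ^ (b.1 + 1)) * (y.2 + 1 : ℕ)) *
          covCoeff M w a.2 (x.2 + 1) b.2 (y.2 + 1) := by
    simp only [fluctP_eq, sum_mul_sum, map_sum, smul_mul_smul_comm, map_smul, smul_eq_mul,
      ← sum_sub_distrib, covCoeff]
    exact sum_congr rfl fun x _ => sum_congr rfl fun y _ => by ring
  rw [h1, covSum]
  refine sum_congr rfl fun x _ => ?_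
  have h2 : (if a.2 = b.2 then ((x.2 + 1 : ℕ) : ℂ) *
      coeff (b.1 + 2 + x.2) (g b.2 ^ (b.1 + 1)) else 0) =
      -∑ y ∈ antidiagonal b.1, ((x.2 + 1 : ℕ) : ℂ) *
        (coeff y.1 (g b.2 ^ (b.1 + 1)) * (y.2 + 1 : ℕ)) *
          ellCoeff g a.2 (x.2 + 1) b.2 (y.2 + 1) := by
    split_ifs with h
    · have h3 := coeff_ellSeries_mul_pow (hg b.2) b.1 (x.2 + 1) x.2.succ_pos
      rw [mul_comm, coeff_mul, show b.1 + 1 + (x.2 + 1) = b.1 + 2 + x.2 from by omega] at h3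
      rw [← neg_eq_iff_eq_neg.mpr h3, mul_neg, mul_sum]
      congr 1
      refine sum_congr rfl fun y _ => ?_
      rw [ellSeries, coeff_mk, ellCoeff, if_pos h, h]
      ring
    · simp [ellCoeff, h]
  rw [h2, ← Finset.sum_neg_distrib, ← sum_add_distrib, mul_sum]
  refine sum_congr rfl fun y _ => ?_
  rw [hcov _ _ _ _ x.2.succ_pos y.2.succ_pos, dCoeff, dif_pos ⟨x.2.succ_pos, y.2.succ_pos⟩]
  have h4 : ∀ n : ℕ, (n.factorial : ℂ) ≠ 0 := fun n => by exact_mod_cast n.factorial_ne_zero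
  have h5 : ∀ n : ℕ, (n + 1 : ℂ) ≠ 0 := fun n => by exact_mod_cast n.succ_ne_zero
  have h6 : ∀ D : ℂ, D / (((x.2 + 1).factorial : ℂ) * ((y.2 + 1).factorial : ℂ)) *
      ((x.2 + 1 : ℕ) * (y.2 + 1 : ℕ)) = D / ((x.2.factorial : ℂ) * (y.2.factorial : ℂ)) := by
    intro D
    have := h4 x.2
    have := h4 y.2
    have := h5 x.2
    have := h5 y.2
    rw [factorial_succ, factorial_succ]
    push_cast
    field_simp
  change _ = _ * (_ + _ * (d ⟨x.2 + 1, _⟩ a.2 ⟨y.2 + 1, _⟩ b.2 / _))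
  rw [← h6]
  ring

end Covariance

section Laurent

variable {K : Type} [Field K]

/-- f(z) = g(z)/z, so extracting residues of powers of f amounts to taking ordinary coefficients of
powers of g. -/
theorem fSeries_eq (ι : ℂ →+* K) (c : ℕ+ → ℂ) : fSeries ι c = (lvar K)⁻¹ *
    ofPowerSeries ℤ K (PowerSeries.map ι (gSeries (cSeries c))) := by
  have hl : lvar K = ofPowerSeries ℤ K X := ofPowerSeries_X.symm
  have h0 : lvar K ≠ 0 := HahnSeries.single_ne_zero one_ne_zero
  rw [gSeries_cSeries, map_gOf, gOf, map_mul, map_add, map_add, map_mul, map_one, ← hl, fSeries]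
  field_simp

theorem coeff_inv_lvar_pow (n : ℕ) (P : PowerSeries K) :
    ((lvar K)⁻¹ ^ (n + 1) * ofPowerSeries ℤ K P).coeff (-1) = coeff n P := by
  rw [lvar, HahnSeries.inv_single, HahnSeries.single_pow, inv_one, one_pow,
    HahnSeries.coeff_single_mul, one_mul, ← LaurentSeries.coeff_coe_powerSeries]
  congr 1
  simp

theorem meanFormula_eq (c : ℕ+ → ℂ) (k : ℕ) :
    meanFormula c k.succPNat = meanSum (gSeries (cSeries c)) k := by
  have hl : (lvar ℂ) = ofPowerSeries ℤ ℂ X := ofPowerSeries_X.symm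
  have h1 : (((k.succPNat : ℕ) + 1 : LaurentSeries ℂ) * (1 + lvar ℂ))⁻¹ =
      ofPowerSeries ℤ ℂ (PowerSeries.C (1 / ((k + 2 : ℕ) : ℂ)) * altSeries ℂ) := by
    apply inv_eq_of_mul_eq_one_right
    have e : ((k.succPNat : ℕ) + 1 : LaurentSeries ℂ) =
        ofPowerSeries ℤ ℂ (PowerSeries.C ((k + 2 : ℕ) : ℂ)) := by
      rw [map_natCast, map_natCast, Nat.succPNat_coe]
      push_cast
      ring
    rw [e, hl, ← map_one (ofPowerSeries ℤ ℂ), ← map_add, ← map_mul, ← map_mul,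
      mul_mul_mul_comm, one_add_X_mul_altSeries, ← map_mul, mul_one_div_cancel (by
        exact_mod_cast (k + 1).succ_ne_zero), map_one, mul_one]
  rw [meanFormula, h1, fSeries_eq, mul_pow, mul_left_comm, ← map_pow, ← map_mul, Nat.succPNat_coe,
    coeff_inv_lvar_pow, mul_assoc, coeff_C_mul, meanSum, PowerSeries.map_id, mul_comm
    (altSeries ℂ)]
  congr 1
  push_cast
  simp

theorem coeff_geomSeries_sq (a : ℕ) : coeff a
    ((PowerSeries.mk fun a : ℕ => ((lvar ℂ) ^ (1 + a))⁻¹) ^ 2 : PowerSeries (LaurentSeries ℂ)) =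
      C ((a + 1 : ℕ) : ℂ) * (lvar ℂ)⁻¹ ^ (a + 2) := by
  rw [pow_two, coeff_mul, sum_congr rfl fun x hx => by
    rw [coeff_mk, coeff_mk, ← inv_pow, ← inv_pow, ← pow_add,
      show 1 + x.1 + (1 + x.2) = a + 2 from by
        rw [mem_antidiagonal] at hx; omega], sum_const,
    Finset.Nat.card_antidiagonal, nsmul_eq_mul, map_natCast]

/-- The residue in z is a convolution of coefficients. The square of the geometric series has the
coefficient (a+1) / w^{a+2} at z^a, which moves the residue in w to the coefficient of order k₂ + 2
+ a of g₂^{k₂+1}; here k₁ and k₂ are one less than the degrees. -/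
theorem covFormula_eq (δ : Prop) [Decidable δ] (c₁ c₂ : ℕ+ → ℂ) (d : ℕ+ → ℕ+ → ℂ) (k₁ k₂ : ℕ) :
    covFormula δ c₁ c₂ d k₁.succPNat k₂.succPNat =
      covSum δ (gSeries (cSeries c₁)) (gSeries (cSeries c₂)) (fun a b =>
        d a.succPNat b.succPNat / ((a.factorial : ℂ) * (b.factorial : ℂ))) k₁ k₂ := by
  set g₁ := gSeries (cSeries c₁)
  set g₂ := gSeries (cSeries c₂)
  have hC : ∀ (r : ℂ) (x : LaurentSeries ℂ) (i : ℤ), (C r * x).coeff i = r * x.coeff i :=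
    fun r x i => by rw [HahnSeries.C_mul_eq_smul]; rfl
  have h2 : fSeries (RingHom.id ℂ) c₂ ^ (k₂ + 1) =
      (lvar ℂ)⁻¹ ^ (k₂ + 1) * ofPowerSeries ℤ ℂ (g₂ ^ (k₂ + 1)) := by
    rw [fSeries_eq, mul_pow, PowerSeries.map_id, ← map_pow]
    rfl
  have h1 : fSeries (C : ℂ →+* LaurentSeries ℂ) c₁ ^ (k₁ + 1) *
      C (fSeries (RingHom.id ℂ) c₂ ^ (k₂ + 1)) *
      ((if δ then geomSeries ^ 2 else 0) + dSeries d) = (lvar (LaurentSeries ℂ))⁻¹ ^ (k₁ + 1) *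
      ofPowerSeries ℤ _ (PowerSeries.map C (g₁ ^ (k₁ + 1)) *
        (PowerSeries.C (fSeries (RingHom.id ℂ) c₂ ^ (k₂ + 1)) *
        ((if δ then (PowerSeries.mk fun a : ℕ => ((lvar ℂ) ^ (1 + a))⁻¹) ^ 2 else 0) +
        PowerSeries.mk fun a : ℕ => ofPowerSeries ℤ ℂ (PowerSeries.mk fun b : ℕ =>
          d a.succPNat b.succPNat / ((a.factorial : ℂ) * (b.factorial : ℂ)))))) := by
    rw [fSeries_eq (C : ℂ →+* LaurentSeries ℂ), mul_pow, ← map_pow, ← map_pow, map_mul, map_mul, map_add,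
      apply_ite (ofPowerSeries ℤ (LaurentSeries ℂ)), map_pow _ (PowerSeries.mk _),
      map_zero, HahnSeries.ofPowerSeries_C, geomSeries, dSeries, mul_assoc, mul_assoc]
  rw [covFormula, Nat.succPNat_coe, Nat.succPNat_coe, Nat.succ_eq_add_one, Nat.succ_eq_add_one, h1,
    coeff_inv_lvar_pow, coeff_mul, HahnSeries.coeff_sum, covSum]
  refine sum_congr rfl fun x _ => ?_
  rw [coeff_map, hC, coeff_C_mul, map_add, mul_add, HahnSeries.coeff_add,
    coeff_mk, h2, mul_assoc, mul_assoc, ← map_mul, coeff_inv_lvar_pow, coeff_mul]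
  congr 2
  · split_ifs
    · rw [coeff_geomSeries_sq, mul_left_comm (ofPowerSeries ℤ ℂ _), mul_left_comm, hC,
        mul_comm (ofPowerSeries ℤ ℂ _), ← mul_assoc (_ ^ _), ← pow_add,
        show k₂ + 1 + (x.2 + 2) = k₂ + 2 + x.2 + 1 from by omega, coeff_inv_lvar_pow]
    · simp
  · simp only [coeff_mk]

end Laurent

section Polynomials

variable {H : ℕ}

/-- The series `gSeries` with indeterminate coefficients. -/
def gPoly (h : Fin H) : PowerSeries (MvPolynomial (LimitVar H) ℚ) :=
  gOf fun a => MvPolynomial.C (1 / (a.factorial : ℚ)) * MvPolynomial.X (Sum.inl (a.succPNat, h))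

/-- The polynomial that expresses the limit of the means. -/
def meanPoly (k : ℕ) (h : Fin H) : MvPolynomial (LimitVar H) ℚ := meanSum (gPoly h) k

/-- The polynomial that expresses the limit of the covariances. -/
def covPoly (k₁ : ℕ) (h₁ : Fin H) (k₂ : ℕ) (h₂ : Fin H) : MvPolynomial (LimitVar H) ℚ :=
  covSum (h₁ = h₂) (gPoly h₁) (gPoly h₂) (fun a b => MvPolynomial.C (1 / ((a.factorial : ℚ) * (b.factorial : ℚ))) *
      MvPolynomial.X (Sum.inr ((a.succPNat, h₁), (b.succPNat, h₂)))) k₁ k₂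

variable (c : ℕ+ → Fin H → ℂ) (d : ℕ+ → Fin H → ℕ+ → Fin H → ℂ)

theorem map_aeval_gPoly (h : Fin H) :
    PowerSeries.map ((aeval (limitVal c d) : MvPolynomial (LimitVar H) ℚ →ₐ[ℚ] ℂ) :
      MvPolynomial (LimitVar H) ℚ →+* ℂ) (gPoly h) = gSeries (cSeries fun k => c k h) := by
  rw [gPoly, map_gOf, gSeries_cSeries]
  congr 1
  funext a
  simp [limitVal, div_eq_inv_mul]

theorem aeval_meanPoly (k : ℕ) (h : Fin H) : aeval (limitVal c d) (meanPoly k h) =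
    meanSum (gSeries (cSeries fun k => c k h)) k := by
  rw [meanPoly, map_meanSum, map_aeval_gPoly]

theorem aeval_covPoly (k₁ : ℕ) (h₁ : Fin H) (k₂ : ℕ) (h₂ : Fin H) :
    aeval (limitVal c d) (covPoly k₁ h₁ k₂ h₂) = covSum (h₁ = h₂)
      (gSeries (cSeries fun k => c k h₁)) (gSeries (cSeries fun k => c k h₂))
      (fun a b => d a.succPNat h₁ b.succPNat h₂ / ((a.factorial : ℂ) * (b.factorial : ℂ))) k₁ k₂ := by
  have h := map_covSum ((aeval (limitVal c d) : MvPolynomial (LimitVar H) ℚ →ₐ[ℚ] ℂ) :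
    MvPolynomial (LimitVar H) ℚ →+* ℂ) (h₁ = h₂)
  rw [covPoly]
  refine (h _ _ _ _ _).trans ?_
  rw [map_aeval_gPoly, map_aeval_gPoly]
  congr 1
  funext a b
  simp [limitVal, div_eq_inv_mul]

end Polynomials

end

/-! ### The equivalence and the main theorem. -/

section

open MvPolynomial (X)
open PowerSeries (coeff)

section Equivalence

theorem exists_eq_succPNat (k : ℕ+) : ∃ j : ℕ, k = j.succPNat := ⟨k.natPred, by simp⟩

theorem IsGaussian.centered {A : Type*} [CommRing A] [Algebra ℂ A] {M : A →ₗ[ℂ] ℂ}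
    {𝓛 : Submodule ℂ A} (hM : IsGaussian M 𝓛) (u v : A) :
    M ((u - algebraMap ℂ A (M u)) * (v - algebraMap ℂ A (M v))) = M (u * v) - M u * M v := by
  have h : (u - algebraMap ℂ A (M u)) * (v - algebraMap ℂ A (M v)) =
      u * v - M u • v - M v • u + (M u * M v) • 1 := by
    simp only [smul_def, map_mul]
    ring
  rw [h, map_add, map_sub, map_sub, map_smul, map_smul, map_smul, hM.one]
  simp only [smul_eq_mul]
  ring

theorem IsPair.congr {H r : ℕ} {e e' : Fin H → ℕ → Fin H → ℕ → ℂ}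
    {Λ : MvPowerSeries (Fin H × Fin r) ℂ} (h : IsPair e Λ)
    (he : ∀ a k b m, 0 < k → 0 < m → e a k b m = e' a k b m) : IsPair e' Λ :=
  ⟨fun x y hxy k m hk hm => (h.pair x y hxy k m hk hm).trans (he _ _ _ _ hk hm), h.other⟩

variable {H : ℕ} {N : ℕ → Fin H → ℕ} {ρ : ∀ L, PMF (∀ h, GT (N L h))}
  {E : ∀ L, (Sig N L → ℂ) →ₗ[ℂ] ℂ} (hN0 : ∀ L h, 0 < N L h)
  (hN : ∀ h, Tendsto (fun L => 1 / (N L h : ℂ)) atTop (𝓝 0)) (hρ : ∀ L, IsSmooth (ρ L))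
  (hE : ∀ L, ∀ f : (∀ h, GT (N L h)) → ℂ, Summable (fun lam => (weight (ρ L) lam : ℂ) * f lam) →
      E L f = ∑' lam, (weight (ρ L) lam : ℂ) * f lam)

include hρ hE

theorem expect_powerSum (b : ℕ × Fin H) (L : ℕ) :
    (expect (ρ L) (powerSum b.1.succPNat b.2) : ℂ) = E L (psum N b L) :=
  (expectation_eq (hρ L) (hE L) (PolyBdd.powerSum _ _)).symm

theorem covariance_powerSum (a b : ℕ × Fin H) (L : ℕ) :
    ((expect (ρ L) (fun lam => powerSum a.1.succPNat a.2 lam * powerSum b.1.succPNat b.2 lam) -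
      expect (ρ L) (powerSum a.1.succPNat a.2) * expect (ρ L) (powerSum b.1.succPNat b.2) : ℝ) : ℂ) =
    E L (fun lam => psum N a L lam * psum N b L lam) - E L (psum N a L) * E L (psum N b L) := by
  rw [Complex.ofReal_sub, ofReal_mul, expect_powerSum hρ hE, expect_powerSum hρ hE,
    ← expectation_eq (hρ L) (hE L)]
  · simp only [ofReal_mul]
    rfl
  · simp only [ofReal_mul]
    exact (PolyBdd.powerSum _ _).mul (PolyBdd.powerSum _ _)

theorem cumulant_powerSum {r : ℕ} (b : Fin r → ℕ × Fin H) (L : ℕ) :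
    (cumulant (ρ L) (fun j => powerSum (b j).1.succPNat (b j).2) : ℂ) =
      kap (mom (E L) fun j => psum N (b j) L) univ := by
  have h : ∀ U : Finset (Fin r), ((expect (ρ L) fun lam => ∏ j ∈ U, powerSum (b j).1.succPNat
      (b j).2 lam : ℝ) : ℂ) = mom (E L) (fun j => psum N (b j) L) U := by
    intro U
    rw [← expectation_eq (hρ L) (hE L), mom]
    · simp only [ofReal_prod]
      rfl
    · simp only [ofReal_prod]
      exact PolyBdd.prod _ fun j _ => PolyBdd.powerSum _ _
  rw [cumulant, kap, ofReal_sum]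
  refine sum_congr (by ext; simp) fun π _ => ?_
  simp only [ofReal_mul, ofReal_prod, h]
  push_cast
  rfl

include hN0 hN

/-- A Gaussian functional is built from the given covariances, the centered power sums converge to
it in moments, and the chain power sums, log φ, Schur quotient is followed. -/
theorem HasCLTLimits.isCLTAppropriate {p : ℕ+ → Fin H → ℝ} {cov : ℕ+ → Fin H → ℕ+ → Fin H → ℝ}
    (hclt : HasCLTLimits ρ p cov) : IsCLTAppropriate ρ := by
  have hE1 : ∀ L, E L (fun _ => 1) = 1 := fun L => expectation_one (hE L)
  -- Centered variables, one for each power sum; the symmetry of the covariance comes from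
  -- uniqueness of limits.
  obtain ⟨M, hM, hμ, hc⟩ := exists_gaussian (fun _ : ℕ × Fin H => (0 : ℂ))
    (fun a b => (cov a.1.succPNat a.2 b.1.succPNat b.2 : ℂ)) (fun a b => by
      have h1 := hclt.covariance a.1.succPNat a.2 b.1.succPNat b.2
      have h2 := hclt.covariance b.1.succPNat b.2 a.1.succPNat a.2
      simp only [mul_comm (powerSum b.1.succPNat b.2 _),
        mul_comm (expect _ (powerSum b.1.succPNat b.2))] at h2
      rw [tendsto_nhds_unique h1 h2])
  have hcm : ∀ {r : ℕ} (b : Fin r → ℕ × Fin H) (S : Finset (Fin r)),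
      Tendsto (fun L => cmom E (psum N) b L S) atTop (𝓝 (limMom M X b S)) :=
    fun b S => tendsto_cmom hE1 (psum N) hM (fun a => subset_span ⟨a, rfl⟩)
    (fun a b => by
      rw [hM.centered, hc]
      exact ((continuous_ofReal.tendsto _).comp (hclt.covariance _ _ _ _)).congr fun L =>
        covariance_powerSum hρ hE a b L)
    (fun r hr b => by
      have h1 := (continuous_ofReal.tendsto _).comp
        (hclt.higher r hr (fun j => (b j).1.succPNat) fun j => (b j).2)
      rw [Complex.ofReal_zero] at h1
      exact h1.congr fun L => cumulant_powerSum hρ hE b L) b S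
  set v : ℕ × Fin H → RV (Sig N) × MvPolynomial (ℕ × Fin H) ℂ := fun b =>
    (fun L lam => psum N b L lam - E L (psum N b L), X b)
  obtain ⟨c, e, hc1, he⟩ := exists_phi_limits hN0 hN hE1 (S := Submonoid.closure (Set.range v)) hM
    (fun s hs => by
      obtain ⟨l, hl, rfl⟩ := Submonoid.exists_list_of_mem_closure hs
      obtain ⟨l, rfl⟩ := (Set.range_list_map v).ge hl
      rw [← Fin.prod_univ_fun_getElem, Prod.snd_prod]
      have h1 := hcm (fun j : Fin l.length => l[j]) univ
      simp only [limMom, hμ, map_zero, sub_zero] at h1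
      refine h1.congr fun L => ?_
      rw [cmom, mom]
      congr 1
      funext lam
      rw [Prod.fst_prod, Finset.prod_apply, Finset.prod_apply]
      rfl)
    (p := fun b => (p b.1.succPNat b.2 : ℂ)) (fun b =>
      ((continuous_ofReal.tendsto _).comp (hclt.mean _ _)).congr fun L => by
        rw [Function.comp_apply, ofReal_mul, expect_powerSum hρ hE]
        push_cast
        rfl)
    (fun b => subset_span ⟨b, rfl⟩) fun b => Submonoid.subset_closure ⟨b, rfl⟩
  have hfac : ∀ k : ℕ, (k.factorial : ℂ) ≠ 0 := fun k => by exact_mod_cast k.factorial_ne_zero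
  -- `cSeries` has no constant term by definition, and neither has c, as a limit of logarithms.
  have hcs : ∀ h, cSeries (fun k => ((k : ℕ).factorial : ℂ) * coeff k (c h)) = c h := by
    intro h
    refine PowerSeries.ext fun n => ?_
    rw [cSeries, coeff_mk]
    split_ifs with hn
    · exact mul_div_cancel_left₀ _ (hfac n)
    · obtain rfl : n = 0 := by omega
      refine Eq.trans (tendsto_nhds_unique (tendsto_const_nhds.congr fun L => ?_) (hc1 h 0))
        (coeff_zero_ps _).symm
      rw [coeff_zero_mv, map_mul, (isLog_oneSeries (hN0 L) (hE1 L) h).left, mul_zero]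
  refine ⟨fun k h => ((k : ℕ).factorial : ℂ) * coeff k (c h),
    fun k h m f => ((k : ℕ).factorial : ℂ) * ((m : ℕ).factorial : ℂ) *
      (e h k f m + ellCoeff (fun h => gSeries (c h)) h k f m),
    (appropriate_iff hN0 hN hρ hE _ _).mpr ⟨fun h => by rw [hcs]; exact hc1 h, fun r => ?_⟩⟩
  obtain ⟨b, hb, hb'⟩ := he r
  obtain ⟨a, ha, ha'⟩ := (schur_pair_iff_phi_pair hN0 hN hE1 hc1
    (fun h k f m => e h k f m + ellCoeff (fun h => gSeries (c h)) h k f m)).mpr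
    ⟨b, hb, hb'.congr fun _ _ _ _ _ _ => (add_sub_cancel_right _ _).symm⟩
  refine ⟨a, ha, ha'.congr fun h k f m hk hm => ?_⟩
  rw [dCoeff, dif_pos ⟨hk, hm⟩]
  exact (mul_div_cancel_left₀ _ (mul_ne_zero (hfac k) (hfac m))).symm

/-- The power sums minus their deterministic parts N z are admissible. Hence E p / N has the same
limit as z, the centered power sums have Gaussian limits, and the covariances are those of `fluctP`.
-/
theorem HasAppropriateLimits.tendsto {c : ℕ+ → Fin H → ℂ} {d : ℕ+ → Fin H → ℕ+ → Fin H → ℂ}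
    (hap : HasAppropriateLimits ρ c d) :
    (∀ b : ℕ × Fin H, Tendsto (fun L => 1 / (N L b.2 : ℂ) * E L (psum N b L)) atTop
      (𝓝 (meanSum (gSeries (cSeries fun k => c k b.2)) b.1))) ∧
    (∀ a b : ℕ × Fin H, Tendsto (fun L => E L (fun lam => psum N a L lam * psum N b L lam) -
        E L (psum N a L) * E L (psum N b L)) atTop
      (𝓝 (covSum (a.2 = b.2) (gSeries (cSeries fun k => c k a.2)) (gSeries (cSeries fun k => c k b.2))
        (fun i j => d i.succPNat a.2 j.succPNat b.2 / ((i.factorial : ℂ) * (j.factorial : ℂ)))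
        a.1 b.1))) ∧ ∀ {r : ℕ}, 2 < r → ∀ b : Fin r → ℕ × Fin H,
      Tendsto (fun L => kap (mom (E L) fun j => psum N (b j) L) univ) atTop (𝓝 0) := by
  have hE1 : ∀ L, E L (fun _ => 1) = 1 := fun L => expectation_one (hE L)
  obtain ⟨hc, hd⟩ := (appropriate_iff hN0 hN hρ hE c d).mp hap
  set g : Fin H → PowerSeries ℂ := fun h => gSeries (cSeries fun k => c k h)
  obtain ⟨M, w, S, hM, hwL, hcov, hS, hz⟩ := exists_gaussian_limits hN0 hN hE1 hc
    -- The Gaussian covariances of log φ are d - ell, not d; the correction reappears as the δ-term.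
    (fun r => (schur_pair_iff_phi_pair hN0 hN hE1 hc _).mp (hd r)) one_add_X_mul_altSeries
  choose z hz hW using hz
  have hEz : ∀ (L : ℕ) (x : ℂ), E L (fun _ => x) = x := fun L x => by
    have h1 := (E L).map_smul x fun _ => 1
    rw [hE1, smul_eq_mul, mul_one] at h1
    refine Eq.trans ?_ h1
    congr 1
    funext lam
    simp
  have hEW : ∀ (b : ℕ × Fin H) L, E L (fun lam => psum N b L lam - N L b.2 * z b.1 b.2 L) =
      E L (psum N b L) - N L b.2 * z b.1 b.2 L := fun b L => by
    have h1 := (E L).map_sub (psum N b L) fun _ => N L b.2 * z b.1 b.2 L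
    rwa [hEz] at h1
  have hlim : ∀ b : ℕ × Fin H, Tendsto (fun L => E L (psum N b L) - N L b.2 * z b.1 b.2 L) atTop
      (𝓝 (M (fluctP g w b))) := fun b =>
    (tendsto_of_mem_admissible hS (hW b.1 b.2)).congr fun L => hEW b L
  have hy : ∀ b, fluctP g w b ∈ span ℂ (Set.range X) := fun b => by
    rw [fluctP_eq]
    exact sum_mem fun x _ => Submodule.smul_mem _ _ (hwL _ _)
  have hG : ∀ b : ℕ × Fin H, ((fun L lam => psum N b L lam - E L (psum N b L),
      fluctP g w b - algebraMap ℂ _ (M (fluctP g w b))) : RV (Sig N) × MvPolynomial (ℕ × Fin H) ℂ) ∈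
      admissible E M S := by
    intro b
    convert sub_mem (hW b.1 b.2) (const_mem_admissible (hlim b)) using 1
    refine Prod.ext (funext fun L => funext fun lam => ?_) rfl
    exact (sub_sub_sub_cancel_right _ _ _).symm
  have hcm : ∀ {r : ℕ} (b : Fin r → ℕ × Fin H) (U : Finset (Fin r)),
      Tendsto (fun L => cmom E (psum N) b L U) atTop (𝓝 (limMom M (fluctP g w) b U)) := by
    intro r b U
    have h1 := tendsto_of_mem_admissible hS (prod_mem (S := admissible E M S) (t := U)
      fun j _ => hG (b j))
    rw [Prod.snd_prod] at h1
    refine h1.congr fun L => ?_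
    rw [cmom, mom]
    congr 1
    funext lam
    rw [Prod.fst_prod, Finset.prod_apply, Finset.prod_apply]
  refine ⟨fun b => ?_, fun a b => ?_, fun hr b => tendsto_kap_of_cmom hE1 (psum N) hM hy hcm hr b⟩
  · have h1 := (hz b.1 b.2).add ((hN b.2).mul (hlim b))
    rw [zero_mul, add_zero] at h1
    rw [meanSum, map_div₀, map_one, map_natCast]
    refine h1.congr fun L => ?_
    have hN' : (N L b.2 : ℂ) ≠ 0 := by exact_mod_cast (hN0 L b.2).ne'
    field_simp
    ring
  · have h1 := hcm ![a, b] {0, 1}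
    have h2 := covariance_fluctP (g := g) (fun h => constantCoeff_gSeries _) hcov a b
    rw [limMom, prod_pair Fin.zero_ne_one, hM.centered] at h1
    have h3 := fun L => cmom_pair hE1 (psum N) ![a, b] L Fin.zero_ne_one
    simp only [Matrix.cons_val_zero, Matrix.cons_val_one] at h1 h3
    rw [h2] at h1
    exact h1.congr h3

end Equivalence

section Main

variable {H : ℕ} {N : ℕ → Fin H → ℕ} {ρ : ∀ L, PMF (∀ h, GT (N L h))} (L₀ : ℕ)

theorem hasCLTLimits_shift {p : ℕ+ → Fin H → ℝ} {cov : ℕ+ → Fin H → ℕ+ → Fin H → ℝ} :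
    HasCLTLimits (N := fun L => N (L + L₀)) (fun L => ρ (L + L₀)) p cov ↔ HasCLTLimits ρ p cov := by
  have h1 := fun k h => tendsto_add_atTop_iff_nat (l := 𝓝 (p k h))
    (f := fun L => 1 / (N L h : ℝ) * expect (ρ L) (powerSum k h)) L₀
  have h2 := fun k h m f => tendsto_add_atTop_iff_nat (l := 𝓝 (cov k h m f))
    (f := fun L => expect (ρ L) (fun lam => powerSum k h lam * powerSum m f lam) -
      expect (ρ L) (powerSum k h) * expect (ρ L) (powerSum m f)) L₀
  have h3 := fun (r : ℕ) (k : Fin r → ℕ+) (h : Fin r → Fin H) =>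
    tendsto_add_atTop_iff_nat (l := 𝓝 0)
      (f := fun L => cumulant (ρ L) (fun j => powerSum (k j) (h j))) L₀
  constructor
  · rintro ⟨a, b, c⟩
    exact ⟨fun k h => (h1 k h).mp (a k h), fun k h m f => (h2 k h m f).mp (b k h m f),
      fun r hr k h => (h3 r k h).mp (c r hr k h)⟩
  · rintro ⟨a, b, c⟩
    exact ⟨fun k h => (h1 k h).mpr (a k h), fun k h m f => (h2 k h m f).mpr (b k h m f),
      fun r hr k h => (h3 r k h).mpr (c r hr k h)⟩

theorem hasAppropriateLimits_shift {c : ℕ+ → Fin H → ℂ} {d : ℕ+ → Fin H → ℕ+ → Fin H → ℂ} :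
    HasAppropriateLimits (N := fun L => N (L + L₀)) (fun L => ρ (L + L₀)) c d ↔
      HasAppropriateLimits ρ c d := by
  have h1 := fun (k : ℕ+) h i => tendsto_add_atTop_iff_nat (l := 𝓝 (c k h))
    (f := fun L => 1 / (N L h : ℂ) * logSGFDeriv (ρ L) (List.replicate k (h, i))) L₀
  have h2 := fun (x : ℂ) (l : List (Fin H × ℕ)) => tendsto_add_atTop_iff_nat (l := 𝓝 x)
    (f := fun L => logSGFDeriv (ρ L) l) L₀
  constructor
  · rintro ⟨a, b, c⟩
    exact ⟨fun k h i => (h1 k h i).mp (a k h i),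
      fun k h m f i j hij => (h2 _ _).mp (b k h m f i j hij), fun l hl => (h2 _ _).mp (c l hl)⟩
  · rintro ⟨a, b, c⟩
    exact ⟨fun k h i => (h1 k h i).mpr (a k h i),
      fun k h m f i j hij => (h2 _ _).mpr (b k h m f i j hij), fun l hl => (h2 _ _).mpr (c l hl)⟩

/-- Limits of real sequences are compared with complex ones: taking real parts gives existence, and
uniqueness of limits after the embedding into ℂ gives the formulas. -/
theorem clt_of_pos (hN0 : ∀ L h, 0 < N L h)
    (hN : ∀ h, Tendsto (fun L => 1 / (N L h : ℂ)) atTop (𝓝 0)) (hρ : ∀ L, IsSmooth (ρ L)) :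
    (SatisfiesCLT ρ ↔ IsCLTAppropriate ρ) ∧
    ∀ (p : ℕ+ → Fin H → ℝ) (cov : ℕ+ → Fin H → ℕ+ → Fin H → ℝ) (c : ℕ+ → Fin H → ℂ)
      (d : ℕ+ → Fin H → ℕ+ → Fin H → ℂ), HasCLTLimits ρ p cov → HasAppropriateLimits ρ c d →
      (∀ b : ℕ × Fin H, (p b.1.succPNat b.2 : ℂ) =
        meanSum (gSeries (cSeries fun k => c k b.2)) b.1) ∧
      ∀ a b : ℕ × Fin H, (cov a.1.succPNat a.2 b.1.succPNat b.2 : ℂ) = covSum (a.2 = b.2)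
        (gSeries (cSeries fun k => c k a.2)) (gSeries (cSeries fun k => c k b.2))
        (fun i j => d i.succPNat a.2 j.succPNat b.2 / ((i.factorial : ℂ) * (j.factorial : ℂ)))
        a.1 b.1 := by
  choose E hE using fun L => exists_expectation (ρ L)
  have hmean : ∀ (b : ℕ × Fin H) L, ((1 / (N L b.2 : ℝ) * expect (ρ L) (powerSum b.1.succPNat b.2) :
      ℝ) : ℂ) = 1 / (N L b.2 : ℂ) * E L (psum N b L) := fun b L => by
    rw [ofReal_mul, expect_powerSum hρ hE]
    push_cast
    rfl
  have hre : ∀ {u : ℕ → ℝ} {v : ℕ → ℂ} {x : ℂ}, (∀ L, (u L : ℂ) = v L) → Tendsto v atTop (𝓝 x) →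
      Tendsto u atTop (𝓝 x.re) := fun huv hv =>
    ((Complex.continuous_re.tendsto _).comp hv).congr fun L => by
      rw [Function.comp_apply, ← huv, Complex.ofReal_re]
  have huniq : ∀ {u : ℕ → ℝ} {v : ℕ → ℂ} {y : ℝ} {x : ℂ}, (∀ L, (u L : ℂ) = v L) →
      Tendsto v atTop (𝓝 x) → Tendsto u atTop (𝓝 y) → (y : ℂ) = x := fun huv hv hu =>
    tendsto_nhds_unique (((continuous_ofReal.tendsto _).comp hu).congr huv) hv
  refine ⟨⟨fun ⟨p, cov, h⟩ => h.isCLTAppropriate hN0 hN hρ hE, fun ⟨c, d, h⟩ => ?_⟩,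
    fun p cov c d hclt hap => ?_⟩
  · obtain ⟨h1, h2, h3⟩ := h.tendsto hN0 hN hρ hE
    refine ⟨fun k h => (meanSum (gSeries (cSeries fun j => c j h)) k.natPred).re,
      fun k h m f => (covSum (h = f) (gSeries (cSeries fun j => c j h))
        (gSeries (cSeries fun j => c j f)) (fun i j => d i.succPNat h j.succPNat f /
          ((i.factorial : ℂ) * (j.factorial : ℂ))) k.natPred m.natPred).re, fun k h => ?_, fun k h m f => ?_, fun r hr k h => ?_⟩
    · have := hre (hmean (k.natPred, h)) (h1 (k.natPred, h))
      simpa only [PNat.succPNat_natPred] using this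
    · have := hre (covariance_powerSum hρ hE (k.natPred, h) (m.natPred, f))
        (h2 (k.natPred, h) (m.natPred, f))
      simpa only [PNat.succPNat_natPred] using this
    · have := hre (cumulant_powerSum hρ hE fun j => ((k j).natPred, h j)) (h3 hr _)
      simpa only [PNat.succPNat_natPred, Complex.zero_re] using this
  · obtain ⟨h1, h2, -⟩ := hap.tendsto hN0 hN hρ hE
    exact ⟨fun b => huniq (hmean b) (h1 b) (hclt.mean _ _), fun a b =>
      huniq (covariance_powerSum hρ hE a b) (h2 a b) (hclt.covariance _ _ _ _)⟩

end Main

end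

end SchurCLT

end

theorem theorem3p4 (H : ℕ) :
    -- the limits are universal polynomials in the `c_{k,h}`, `d_{k,h;m,f}`
    ∃ (P : ℕ+ → Fin H → MvPolynomial (SchurCLT.LimitVar H) ℚ)
      (Q : ℕ+ → Fin H → ℕ+ → Fin H → MvPolynomial (SchurCLT.LimitVar H) ℚ),
    ∀ (N : ℕ → Fin H → ℕ) (nu : Fin H → ℝ), (∀ h, 0 < nu h) →
      (∀ h, Tendsto (fun L => (N L h : ℝ) / (L : ℝ)) atTop (𝓝 (nu h))) →
    ∀ (ρ : ∀ L, PMF (∀ h, SchurCLT.GT (N L h))), (∀ L, SchurCLT.IsSmooth (ρ L)) →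
      (SchurCLT.SatisfiesCLT ρ ↔ SchurCLT.IsCLTAppropriate ρ) ∧
      ∀ (p : ℕ+ → Fin H → ℝ) (cov : ℕ+ → Fin H → ℕ+ → Fin H → ℝ)
        (c : ℕ+ → Fin H → ℂ) (d : ℕ+ → Fin H → ℕ+ → Fin H → ℂ),
        SchurCLT.HasCLTLimits ρ p cov → SchurCLT.HasAppropriateLimits ρ c d →
        (∀ (k : ℕ+) (h : Fin H),
          (p k h : ℂ) = SchurCLT.meanFormula (fun a => c a h) k ∧
          (p k h : ℂ) = MvPolynomial.aeval (SchurCLT.limitVal c d) (P k h)) ∧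
        (∀ (k₁ : ℕ+) (h₁ : Fin H) (k₂ : ℕ+) (h₂ : Fin H),
          (cov k₁ h₁ k₂ h₂ : ℂ) =
            SchurCLT.covFormula (h₁ = h₂) (fun a => c a h₁) (fun a => c a h₂)
              (fun a b => d a h₁ b h₂) k₁ k₂ ∧
          (cov k₁ h₁ k₂ h₂ : ℂ) =
            MvPolynomial.aeval (SchurCLT.limitVal c d) (Q k₁ h₁ k₂ h₂)) := by
  refine ⟨fun k h => SchurCLT.meanPoly k.natPred h,
    fun k₁ h₁ k₂ h₂ => SchurCLT.covPoly k₁.natPred h₁ k₂.natPred h₂, fun N nu hnu hN ρ hρ => ?_⟩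
  have hNtop : ∀ h, Tendsto (fun L => (N L h : ℝ)) atTop atTop := fun h =>
    ((hN h).pos_mul_atTop (hnu h) tendsto_natCast_atTop_atTop).congr' (by
      filter_upwards [eventually_gt_atTop 0] with L hL
      exact div_mul_cancel₀ _ (by exact_mod_cast hL.ne'))
  -- Some N_h(L) may vanish for small L. As both properties depend only on the tail of the sequence,
  -- it is shifted past these values.
  obtain ⟨L₀, hL₀⟩ := eventually_atTop.mp (eventually_all.mpr fun h =>
    (hNtop h).eventually_gt_atTop 0)
  obtain ⟨h1, h2⟩ := SchurCLT.clt_of_pos (N := fun L => N (L + L₀)) (ρ := fun L => ρ (L + L₀))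
    (fun L h => by exact_mod_cast hL₀ (L + L₀) (Nat.le_add_left _ _) h)
    (fun h => by
      have h3 := (Complex.continuous_ofReal.tendsto _).comp
        ((tendsto_add_atTop_iff_nat L₀).mpr (hNtop h).inv_tendsto_atTop)
      rw [Complex.ofReal_zero] at h3
      exact h3.congr fun L => by simp)
    fun L => hρ (L + L₀)
  constructor
  · simpa only [SchurCLT.SatisfiesCLT, SchurCLT.IsCLTAppropriate, SchurCLT.hasCLTLimits_shift,
      SchurCLT.hasAppropriateLimits_shift] using h1
  · intro p cov c d hclt hap
    obtain ⟨h3, h4⟩ := h2 p cov c d ((SchurCLT.hasCLTLimits_shift L₀).mpr hclt)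
      ((SchurCLT.hasAppropriateLimits_shift L₀).mpr hap)
    refine ⟨fun k h => ?_, fun k₁ h₁ k₂ h₂ => ?_⟩
    · obtain ⟨j, rfl⟩ := SchurCLT.exists_eq_succPNat k
      rw [SchurCLT.meanFormula_eq, SchurCLT.aeval_meanPoly, Nat.natPred_succPNat]
      exact ⟨h3 (j, h), h3 (j, h)⟩
    · obtain ⟨i, rfl⟩ := SchurCLT.exists_eq_succPNat k₁
      obtain ⟨j, rfl⟩ := SchurCLT.exists_eq_succPNat k₂
      rw [SchurCLT.covFormula_eq, SchurCLT.aeval_covPoly, Nat.natPred_succPNat,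
        Nat.natPred_succPNat]
      exact ⟨h4 (i, h₁) (j, h₂), h4 (i, h₁) (j, h₂)⟩
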